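/- **Setting.** Let $M=\{t\in\mathbb C^\times:\ |\mathrm{Re}\,t|<\tfrac12,\ 2\,\mathrm{Re}(e^{2\pi i t})\neq 1\}$. Let $\Gamma\to M$ be the local system of lattices with local frame $(\beta^\vee,\beta,\delta)$, where $\beta,\delta$ are global and $\beta^\vee\mapsto\beta^\vee+\beta$ as $t$ crosses the ray $i\mathbb R_{\le 0}$ anti-clockwise, with skew pairing $\langle\beta^\vee,\beta\rangle=1$ and $\delta$ in its kernel. The central charge is $Z_\delta=1$, $Z_\beta=t$, $Z_{\beta^\vee}=-\frac{1}{(2\pi i)^2}\big(\tfrac12(\log e^{2\pi i t})^2+\mathrm{Li}_2(e^{2\pi i t})\big)$ (principal branches away from $i\mathbb R_{\le 0}$, continued with $Z_{\beta^\vee}\mapsto Z_{\beta^\vee}+Z_\beta$), and the BPS indices are $\Omega(\pm\beta+n\delta)=1$ $(n\in\mathbb Z)$, $\Omega(k\delta)=-2$ $(k\ne0)$, and $0$ otherwise. For $\varepsilon\in\{0,1\}$ let $\mathcal N_\varepsilon\to M$ be the torus bundle whose fibre over $t$ is the set of $\theta:\Gamma_t\to\mathbb R/2\pi\mathbb Z$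 with $\theta_{\gamma+\gamma'}=\theta_\gamma+\theta_{\gamma'}+\varepsilon\pi\langle\gamma,\gamma'\rangle$ and $\theta_\delta=0$ (unitary characters for $\varepsilon=0$, twisted unitary characters for $\varepsilon=1$). With $K_\nu$ the modified Bessel functions of the second kind put $$V_\gamma=\frac1{2\pi}\sum_{n>0}e^{in\theta_\gamma}K_0(2\pi n|Z_\gamma|),\qquad A_\gamma=-\frac1{4\pi}\sum_{n>0}e^{in\theta_\gamma}|Z_\gamma|K_1(2\pi n|Z_\gamma|)\Big(\frac{dZ_\gamma}{Z_\gamma}-\frac{d\overline Z_\gamma}{\overline Z_\gamma}\Big),$$ $$\omega_1+i\omega_2=-\frac1{2\pi}\langle dZ\wedge d\theta\rangle+\sum_\gamma\Omega(\gamma)\Big(dZ_\gamma\wedge A_\gamma+\frac{i}{2\pi}V_\gamma\,d\theta_\gamma\wedge dZ_\gamma\Big),$$ $$\omega_3=\frac14\langle dZ\wedge d\overline Z\rangle-\frac1{8\pi^2}\langle d\theta\wedge d\theta\rangle+\sum_\gamma\Omega(\gamma)\Big(\frac i2V_\gamma\,dZ_\gamma\wedge d\overline Z_\gamma+\frac1{2\pi}d\theta_\gamma\wedge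 A_\gamma\Big),$$ where $\langle\alpha\wedge\alpha'\rangle=\alpha_{\beta^\vee}\wedge\alpha'_\beta-\alpha_\beta\wedge\alpha'_{\beta^\vee}$. Let $\tau=dZ_{\beta^\vee}/dZ_\beta$, let $N_\varepsilon\subset\mathcal N_\varepsilon$ be the open set where $T=\mathrm{Im}(\tau)|dt|^2+\sum_\gamma\Omega(\gamma)V_\gamma|dZ_\gamma|^2$ is non-degenerate on the normal spaces of the fibres of $\mathcal N_\varepsilon\to M$, and on $N_\varepsilon$ let $$g_N=\rho\,|dt|^2+\frac{1}{4\pi^2\rho}|\Theta|^2,\quad \rho=\mathrm{Im}\,\tau+\sum_\gamma\Omega(\gamma)n_\gamma^2V_\gamma,\quad \Theta=d\theta_{\beta^\vee}-\tau\,d\theta_\beta+\sum_\gamma\Omega(\gamma)n_\gamma\big(2\pi A_\gamma-iV_\gamma d\theta_\gamma\big),$$ $n_\gamma$ being the coefficient of $\beta$ in $\gamma$. The Ooguri–Vafa forms $\omega^{\rm ov}_\alpha$ with cutoff $\Lambda\in\mathbb C^\times$ are given by the same formulas for the lattice spanned by $\beta^\vee,\beta$, with $Z^{\rm ov}_\beta=t$,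 $Z^{\rm ov}_{\beta^\vee}=\frac1{2\pi i}(t\log(t/\Lambda)-t)$, $\Omega^{\rm ov}(\pm\beta)=1$ and $\Omega^{\rm ov}=0$ otherwise. Take $\Lambda=\frac{i}{2\pi}$; then $\log(t/\Lambda)$ is principal away from $i\mathbb R_{\le0}$ and is continued compatibly with $\beta^\vee\mapsto\beta^\vee+\beta$. Finally put $V_n=V_{\beta-n\delta}+V_{-\beta+n\delta}=\frac1{2\pi}\sum_{m\ne0}e^{im\theta_\beta}K_0(2\pi|m||t-n|)$. **Theorem.** (i) All the series above converge absolutely at every point, $\omega_3$ and $\omega_3^{\rm ov}$ are real, and for $\varepsilon=0,1$ the forms $\omega_\alpha,\omega_\alpha^{\rm ov}$ are well defined on $\mathcal N_\varepsilon$. (ii) There are smooth real two-forms $\eta_1,\eta_2,\eta_3$ in the variables $(t,\theta_\beta)\in(M\cup\{0\})\times\mathbb R/2\pi\mathbb Z$ such that on $\mathcal N_\varepsilon$, $\varepsilon=0,1$ (in particular near $t=0$), $$\omega_\alpha=\omega_\alpha^{\rm ov}+\eta_\alpha,\qquad \alpha=1,2,3,$$ and, with the absolutely convergent real sum $S(\theta_\beta)=\sum_{n\neq0}V_n|_{t=0}$,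 $$(\eta_1+i\eta_2)|_{t=0}=-\frac{i}{2\pi}S\,dt\wedge d\theta_\beta,\qquad \eta_3|_{t=0}=\frac i2 S\,dt\wedge d\bar t,$$ that is, $\eta_1|_{t=0}=\frac1{2\pi}S\,d(\mathrm{Im}\,t)\wedge d\theta_\beta$ and $\eta_2|_{t=0}=-\frac1{2\pi}S\,d(\mathrm{Re}\,t)\wedge d\theta_\beta$. (iii) There is a smooth (Hausdorff, second countable) 4-manifold $X$ that contains the torus bundle $\mathcal N_1$ of twisted characters as the open submanifold $t\neq0$, on which $t$ and $e^{i\theta_\beta}$ extend smoothly, with $t:X\to M\cup\{0\}$ proper and with the fibre over $t=0$ a pinched torus (Kodaira type $I_1$) pinched at $\theta_\beta=0$, such that $\omega_\alpha$ and $\omega^{\rm ov}_\alpha$ extend to smooth two-forms on $X$ whose difference is the pull-back of $\eta_\alpha$. Let $\bar N\subset X$ be the set of points at which the three extended forms $\omega_\alpha$ are non-degenerate. Then $\bar N\cap\{t\ne0\}=N_1$, and there is a smooth (possibly indefinite) hyperkähler structure on $\bar N$ with Kähler forms $\omega_1,\omega_2,\omega_3$, whose metric is $g_N$ on $N_1$;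 that is, the hyperkähler structure extends smoothly over the points of the locus $t=0$ where the forms are non-degenerate. -/

import Mathlib

open Set
open scoped ContDiff Manifold

noncomputable section

namespace ConifoldHK

/-! ### Special functions -/

/-- The modified Bessel function of the second kind, for `x > 0`:
`K_ν(x) = ∫_0^∞ exp (- x cosh s) cosh (ν s) ds`. -/
def besselK (ν x : ℝ) : ℝ :=
  ∫ s in Ioi (0 : ℝ), Real.exp (-(x * Real.cosh s)) * Real.cosh (ν * s)

/-- The principal branch of the dilogarithm on `ℂ ∖ [1, ∞)`; it equals `∑_{n ≥ 1} zⁿ / n²` for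
`|z| < 1`. On the cut the value is the limit from below. -/
def dilog (z : ℂ) : ℂ :=
  -∫ u in (0 : ℝ)..1, Complex.log (1 - (u : ℂ) * z) / (u : ℂ)

/-! ### Exterior algebra of one-forms with complex values -/

section Wedge

variable {F : Type} [NormedAddCommGroup F] [NormedSpace ℝ F]

/-- The wedge product of two complex valued one-forms (covectors),
`(α ∧ β)(u, v) = α u * β v - α v * β u`. -/
def wedge (α β : F →L[ℝ] ℂ) : F [⋀^Fin 2]→L[ℝ] ℂ :=
  ContinuousMultilinearMap.alternatization
    ((ContinuousMultilinearMap.mkPiAlgebra ℝ (Fin 2) ℂ).compContinuousLinearMap ![α, β])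

theorem wedge_apply (α β : F →L[ℝ] ℂ) (v : Fin 2 → F) :
    wedge α β v = α (v 0) * β (v 1) - α (v 1) * β (v 0) := by
  rw [wedge, ContinuousMultilinearMap.alternatization_apply_apply,
    Fintype.sum_equiv (Equiv.refl _) _ (fun σ : Equiv.Perm (Fin 2) =>
      Equiv.Perm.sign σ • (α (v (σ 0)) * β (v (σ 1)))) (fun σ => by simp)]
  rw [show (Finset.univ : Finset (Equiv.Perm (Fin 2))) = {1, Equiv.swap 0 1} by decide,
    Finset.sum_pair (by decide)]
  simp [sub_eq_add_neg]

/-- The complex conjugate of a one-form. -/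
def conjForm (α : F →L[ℝ] ℂ) : F →L[ℝ] ℂ :=
  (Complex.conjCLE : ℂ →L[ℝ] ℂ) ∘L α

/-- A real one-form seen as a complex valued one. -/
def realForm (α : F →L[ℝ] ℝ) : F →L[ℝ] ℂ := Complex.ofRealCLM ∘L α

/-- The symmetric bilinear form `|α|²`, that is `(u, v) ↦ Re (α u * conj (α v))`. -/
def absSq (α : F →L[ℝ] ℂ) (u v : F) : ℝ := (α u * (starRingEnd ℂ) (α v)).re

/-- Non-degeneracy of a two-form at a point. -/
def Nondegenerate (Φ : F [⋀^Fin 2]→L[ℝ] ℝ) : Prop :=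
  ∀ u : F, (∀ v : F, Φ ![u, v] = 0) → u = 0

end Wedge

/-! ### Hyperkähler structures -/

/-- `(g, I₁, I₂, I₃)` is a smooth, possibly indefinite, hyperkähler structure on the open subset `U`
of a real vector space, with Kähler forms `ω₁, ω₂, ω₃`. -/
structure IsHyperkahlerOn {F : Type} [NormedAddCommGroup F] [NormedSpace ℝ F] (U : Set F)
    (g : F → F →L[ℝ] F →L[ℝ] ℝ) (I : Fin 3 → F → F →L[ℝ] F)
    (Φ : Fin 3 → F → F [⋀^Fin 2]→L[ℝ] ℝ) : Prop where
  smooth_metric : ContDiffOn ℝ ∞ g U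
  smooth_complex : ∀ α, ContDiffOn ℝ ∞ (I α) U
  smooth_form : ∀ α, ContDiffOn ℝ ∞ (Φ α) U
  symm : ∀ y ∈ U, ∀ u v, g y u v = g y v u
  nondegenerate : ∀ y ∈ U, ∀ u, (∀ v, g y u v = 0) → u = 0
  square : ∀ y ∈ U, ∀ α u, I α y (I α y u) = -u
  quaternion : ∀ y ∈ U, ∀ u, I 0 y (I 1 y u) = I 2 y u
  kahler : ∀ y ∈ U, ∀ α u v, Φ α y ![u, v] = g y (I α y u) v
  closed : ∀ y ∈ U, ∀ α, extDeriv (Φ α) y = 0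
  /-- The Nijenhuis tensor
  `[I u, I v] - I [I u, v] - I [u, I v] - [u, v]` vanishes on constant vector fields. -/
  integrable : ∀ y ∈ U, ∀ α u v,
    fderiv ℝ (I α) y (I α y u) v - fderiv ℝ (I α) y (I α y v) u
      + I α y (fderiv ℝ (I α) y v u) - I α y (fderiv ℝ (I α) y u v) = 0

/-! ### Coordinates

The base curve is a punctured neighbourhood of `t = 0`, and the lattice local system on it has
monodromy around `t = 0` only. All objects are described on the covering on which it becomes
trivial: a point of `Coord` is `(s, a, b)` with `t = exp s`, `a = θ_β`, `b = θ_{β^∨}`. -/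

/-- The real four-dimensional vector space with coordinates `(s, θ_β, θ_{β^∨})`. -/
abbrev Coord : Type := ℂ × ℝ × ℝ

/-! ### Kähler forms of a mutually local variation of BPS structures over a curve -/

/-- A central charge, angles and BPS indices for charges in the lattice `G`, written in a
trivialisation of the lattice on a covering of the base curve with coordinate `s`. The sections
`magnetic`, `electric` project to a Darboux frame (`⟨magnetic, electric⟩ = 1`) of the lattice of
gauge charges, and `coeff γ` is the coefficient of `electric` in `γ`. -/
structure BPSData (G : Type) where
  Z : G → ℂ → ℂ
  θ : G → Coord → ℝ
  Ω : G → ℤ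
  magnetic : G
  electric : G
  coeff : G → ℤ

/-- The function `(z, θ) ↦ (1 / 2π) ∑_{n > 0} exp (i n θ) K_0(2 π n |z|)`. -/
def instV (z : ℂ) (θ : ℝ) : ℂ :=
  (1 / (2 * Real.pi) : ℂ) * ∑' n : ℕ, Complex.exp (Complex.I * ((n : ℂ) + 1) * θ) *
    (besselK 0 (2 * Real.pi * ((n : ℝ) + 1) * ‖z‖) : ℂ)

/-- The function `(z, θ) ↦ - (1 / 4π) ∑_{n > 0} exp (i n θ) |z| K_1(2 π n |z|)`. -/
def instA (z : ℂ) (θ : ℝ) : ℂ :=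
  -(1 / (4 * Real.pi) : ℂ) * ∑' n : ℕ, Complex.exp (Complex.I * ((n : ℂ) + 1) * θ) *
    ((‖z‖ * besselK 1 (2 * Real.pi * ((n : ℝ) + 1) * ‖z‖) : ℝ) : ℂ)

namespace BPSData

variable {G : Type} (D : BPSData G)

/-- The one-form `dZ_γ`. -/
def dZ (γ : G) (x : Coord) : Coord →L[ℝ] ℂ := fderiv ℝ (fun y : Coord => D.Z γ y.1) x

/-- The one-form `dθ_γ`. -/
def dθ (γ : G) (x : Coord) : Coord →L[ℝ] ℂ := realForm (fderiv ℝ (D.θ γ) x)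

/-- The pairing `⟨α ∧ α'⟩` of two one-forms with values in the dual of the lattice of gauge
charges, computed in the Darboux frame. -/
def pair (α α' : G → Coord →L[ℝ] ℂ) : Coord [⋀^Fin 2]→L[ℝ] ℂ :=
  wedge (α D.magnetic) (α' D.electric) - wedge (α D.electric) (α' D.magnetic)

/-- `V_γ^inst`. -/
def V (γ : G) (x : Coord) : ℂ := instV (D.Z γ x.1) (D.θ γ x)

/-- `A_γ^inst = -(1/4π) ∑_{n>0} e^{inθ_γ} |Z_γ| K_1(2πn|Z_γ|) (dZ_γ / Z_γ - conj (dZ_γ / Z_γ))`. -/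
def A (γ : G) (x : Coord) : Coord →L[ℝ] ℂ :=
  instA (D.Z γ x.1) (D.θ γ x) •
    ((D.Z γ x.1)⁻¹ • D.dZ γ x - conjForm ((D.Z γ x.1)⁻¹ • D.dZ γ x))

/-- The summand of `γ` in `ω₁ + i ω₂`. -/
def holTerm (γ : G) (x : Coord) : Coord [⋀^Fin 2]→L[ℝ] ℂ :=
  (D.Ω γ : ℂ) • wedge (D.dZ γ x) (D.A γ x)
    + (Complex.I * D.Ω γ / (2 * Real.pi) * D.V γ x) • wedge (D.dθ γ x) (D.dZ γ x)

/-- `ω₁ + i ω₂`. -/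
def omegaHol (x : Coord) : Coord [⋀^Fin 2]→L[ℝ] ℂ :=
  -(1 / (2 * Real.pi) : ℂ) • D.pair (fun γ => D.dZ γ x) (fun γ => D.dθ γ x)
    + ∑' γ : G, D.holTerm γ x

/-- The summand of `γ` in `ω₃`. -/
def realTerm (γ : G) (x : Coord) : Coord [⋀^Fin 2]→L[ℝ] ℂ :=
  (Complex.I * D.Ω γ / 2 * D.V γ x) • wedge (D.dZ γ x) (conjForm (D.dZ γ x))
    + (D.Ω γ / (2 * Real.pi) : ℂ) • wedge (D.dθ γ x) (D.A γ x)

/-- `ω₃`, as a form that is real but written with complex values. -/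
def omegaThree (x : Coord) : Coord [⋀^Fin 2]→L[ℝ] ℂ :=
  (1 / 4 : ℂ) • D.pair (fun γ => D.dZ γ x) (fun γ => conjForm (D.dZ γ x))
    - (1 / (8 * Real.pi ^ 2) : ℂ) • D.pair (fun γ => D.dθ γ x) (fun γ => D.dθ γ x)
    + ∑' γ : G, D.realTerm γ x

/-- The three real two-forms `ω₁, ω₂, ω₃`. -/
def omega (α : Fin 3) (x : Coord) : Coord [⋀^Fin 2]→L[ℝ] ℝ :=
  ![Complex.reCLM.compContinuousAlternatingMap (D.omegaHol x),
    Complex.imCLM.compContinuousAlternatingMap (D.omegaHol x),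
    Complex.reCLM.compContinuousAlternatingMap (D.omegaThree x)] α

/-- `τ = dZ_magnetic / dZ_electric`. -/
def tau (s : ℂ) : ℂ := deriv (D.Z D.magnetic) s / deriv (D.Z D.electric) s

/-- The tensor `T = g_sK + ∑_γ Ω(γ) V_γ^inst |dZ_γ|²`, where `g_sK = Im τ |dZ_electric|²` is the
affine special Kähler metric of the base. -/
def tensorT (x u v : Coord) : ℝ :=
  (D.tau x.1).im * absSq (D.dZ D.electric x) u v
    + (∑' γ : G, (D.Ω γ : ℂ) * D.V γ x * (absSq (D.dZ γ x) u v : ℂ)).re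

/-- Non-degeneracy of `T` on the normal space of the fibre `s = const` through `x`. -/
def HorizontallyNondegenerate (x : Coord) : Prop :=
  ∀ u : Coord, (∀ v : Coord, D.tensorT x u v = 0) → u.1 = 0

/-- `N + N^inst`, where `N = Im τ`. -/
def potential (x : Coord) : ℝ :=
  (D.tau x.1).im + (∑' γ : G, (D.Ω γ : ℂ) * D.V γ x * (D.coeff γ : ℂ) ^ 2).re

/-- The summand of `γ` in `W^inst`. -/
def connTerm (γ : G) (x : Coord) : Coord →L[ℝ] ℂ :=
  ((D.Ω γ : ℂ) * D.coeff γ) •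
    ((2 * Real.pi : ℂ) • D.A γ x - (Complex.I * D.V γ x) • D.dθ γ x)

/-- `W + W^inst`, where `W = dθ_magnetic - τ dθ_electric`. -/
def conn (x : Coord) : Coord →L[ℝ] ℂ :=
  D.dθ D.magnetic x - D.tau x.1 • D.dθ D.electric x + ∑' γ : G, D.connTerm γ x

/-- The instanton corrected metric
`(N + N^inst) |dZ_electric|² + (1 / 4π²) (N + N^inst)⁻¹ |W + W^inst|²`. -/
def metric (x u v : Coord) : ℝ :=
  D.potential x * absSq (D.dZ D.electric x) u v
    + 1 / (4 * Real.pi ^ 2) * (D.potential x)⁻¹ * absSq (D.conn x) u v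

/-- All the series in the definitions above converge (absolutely) at `x`, and the formula for `ω₃`
gives a real form. -/
structure WellDefinedAt (x : Coord) : Prop where
  summable_V : ∀ γ, D.Ω γ ≠ 0 → Summable fun n : ℕ =>
    Complex.exp (Complex.I * ((n : ℂ) + 1) * D.θ γ x) *
      (besselK 0 (2 * Real.pi * ((n : ℝ) + 1) * ‖D.Z γ x.1‖) : ℂ)
  summable_A : ∀ γ, D.Ω γ ≠ 0 → Summable fun n : ℕ =>
    Complex.exp (Complex.I * ((n : ℂ) + 1) * D.θ γ x) *
      ((‖D.Z γ x.1‖ * besselK 1 (2 * Real.pi * ((n : ℝ) + 1) * ‖D.Z γ x.1‖) : ℝ) : ℂ)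
  summable_hol : Summable fun γ => D.holTerm γ x
  summable_real : Summable fun γ => D.realTerm γ x
  summable_conn : Summable fun γ => D.connTerm γ x
  summable_potential : Summable fun γ => (D.Ω γ : ℂ) * D.V γ x * (D.coeff γ : ℂ) ^ 2
  summable_tensorT : ∀ u v, Summable fun γ =>
    (D.Ω γ : ℂ) * D.V γ x * (absSq (D.dZ γ x) u v : ℂ)
  real_three : ∀ v, (D.omegaThree x v).im = 0

end BPSData

/-! ### The resolved conifold -/

/-- The base `M` of the affine special Kähler geometry of the resolved conifold. -/
def baseM : Set ℂ :=
  {t | t ≠ 0 ∧ |t.re| < 1 / 2 ∧ 2 * (Complex.exp (2 * Real.pi * Complex.I * t)).re ≠ 1}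

/-- The covering of the torus bundle over `M`: the points `(s, θ_β, θ_{β^∨})` with `exp s ∈ M`. -/
def cover : Set Coord := {x | Complex.exp x.1 ∈ baseM}

/-- The fibre of the charge lattice in the frame `(β^∨, β, δ)`: `(p, q, r)` stands for
`p β^∨ + q β + r δ`. -/
abbrev Charge : Type := ℤ × ℤ × ℤ

/-- The pairing with `⟨β^∨, β⟩ = 1` and `δ` in the kernel. -/
def chargePairing (γ γ' : Charge) : ℤ := γ.1 * γ'.2.1 - γ.2.1 * γ'.1

/-- The `k`-th power of the monodromy `β^∨ ↦ β^∨ + β`, `β ↦ β`, `δ ↦ δ`, for the anti-clockwise loop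
around `t = 0`: the charge `γ` at the point `s + 2 π i k` of the covering of `M` and the charge
`monodromy k γ` at the point `s` are the same element of the fibre of the local system at
`t = exp s`. -/
def monodromy (k : ℤ) (γ : Charge) : Charge := (γ.1, γ.2.1 + k * γ.1, γ.2.2)

/-- The period `Z_{β^∨}` on `M` cut along the ray `i ℝ_{≤ 0}`, given by principal branches. -/
def principalDualPeriod (t : ℂ) : ℂ :=
  -(1 / (2 * Real.pi * Complex.I) ^ 2) *
    (1 / 2 * Complex.log (Complex.exp (2 * Real.pi * Complex.I * t)) ^ 2
      + dilog (Complex.exp (2 * Real.pi * Complex.I * t)))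

/-- The sheet of the covering that contains `s`: the integer `k` with
`Im s - 2 π k ∈ (-π/2, 3π/2]`. -/
def sheet (s : ℂ) : ℤ := toIocDiv Real.two_pi_pos (-(Real.pi / 2)) s.im

/-- The continuation of `Z_{β^∨}` to the covering: `Z_{β^∨}` increases by `Z_β = t` each time the ray
`i ℝ_{≤ 0}` is crossed anti-clockwise. -/
def dualPeriod (s : ℂ) : ℂ :=
  principalDualPeriod (Complex.exp s) + sheet s * Complex.exp s

/-- The central charge `Z_δ = 1`, `Z_β = t`, `Z_{β^∨}`. -/
def conifoldZ (γ : Charge) (s : ℂ) : ℂ :=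
  γ.1 * dualPeriod s + γ.2.1 * Complex.exp s + γ.2.2

/-- A real lift of the angle `θ_γ`, for the character with `θ_β = a`, `θ_{β^∨} = b`, `θ_δ = 0` and
`θ_{γ + γ'} = θ_γ + θ_{γ'} + ε π ⟨γ, γ'⟩` modulo `2 π`. For `ε = 0` these are the unitary characters
and for `ε = 1` the twisted unitary characters of the lattice. -/
def conifoldAngle (ε : ℕ) (γ : Charge) (x : Coord) : ℝ :=
  γ.1 * x.2.2 + γ.2.1 * x.2.1 + ε * Real.pi * (γ.1 * γ.2.1)

theorem conifoldAngle_add (ε : ℕ) (γ γ' : Charge) (x : Coord) :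
    (conifoldAngle ε (γ + γ') x : Real.Angle) =
      (conifoldAngle ε γ x + conifoldAngle ε γ' x + ε * Real.pi * chargePairing γ γ' : ℝ) := by
  rw [Real.Angle.angle_eq_iff_two_pi_dvd_sub]
  refine ⟨ε * (γ.2.1 * γ'.1), ?_⟩
  simp only [conifoldAngle, chargePairing, Prod.fst_add, Prod.snd_add]
  push_cast
  ring

/-- The BPS indices of the resolved conifold: `1` on `± β + n δ`, and `-2` on `k δ` with `k ≠ 0`. -/
def conifoldIndex (γ : Charge) : ℤ :=
  if γ.1 = 0 ∧ (γ.2.1 = 1 ∨ γ.2.1 = -1) then 1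
  else if γ.1 = 0 ∧ γ.2.1 = 0 ∧ γ.2.2 ≠ 0 then -2
  else 0

/-- The data of the resolved conifold, with flavour angle `θ_δ = 0`. -/
def conifold (ε : ℕ) : BPSData Charge where
  Z := conifoldZ
  θ := conifoldAngle ε
  Ω := conifoldIndex
  magnetic := (1, 0, 0)
  electric := (0, 1, 0)
  coeff γ := γ.2.1

/-- Two points of the covering define the same point of the torus bundle over `M` of (for `ε = 1`:
twisted) unitary characters with `θ_δ = 0`: they lie over the same `t`, and they define the same
character of the fibre of the lattice at `t`. -/
def SamePoint (ε : ℕ) (x y : Coord) : Prop :=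
  ∃ k : ℤ, y.1 = x.1 + 2 * Real.pi * Complex.I * k ∧
    ∀ γ : Charge, (conifoldAngle ε γ y : Real.Angle) = conifoldAngle ε (monodromy k γ) x

/-- The deck transformations of the covering of the torus bundle. -/
def deck (ε : ℕ) (k l m : ℤ) (x : Coord) : Coord :=
  (x.1 + 2 * Real.pi * Complex.I * k, x.2.1 + 2 * Real.pi * l,
    x.2.2 + k * x.2.1 + ε * k * Real.pi + 2 * Real.pi * m)

theorem samePoint_iff (ε : ℕ) (x y : Coord) :
    SamePoint ε x y ↔ ∃ k l m : ℤ, y = deck ε k l m x := by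
  constructor
  · rintro ⟨k, hk, h⟩
    obtain ⟨l, hl⟩ := Real.Angle.angle_eq_iff_two_pi_dvd_sub.1 (h (0, 1, 0))
    obtain ⟨m, hm⟩ := Real.Angle.angle_eq_iff_two_pi_dvd_sub.1 (h (1, 0, 0))
    simp only [conifoldAngle, monodromy] at hl hm
    push_cast at hl hm
    refine ⟨k, l, m, Prod.ext hk (Prod.ext ?_ ?_)⟩ <;> simp only [deck] <;> linarith
  · rintro ⟨k, l, m, rfl⟩
    refine ⟨k, rfl, fun γ => ?_⟩
    rw [Real.Angle.angle_eq_iff_two_pi_dvd_sub]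
    obtain ⟨j, hj⟩ : ∃ j : ℤ, γ.1 * γ.1 - γ.1 = 2 * j := by
      obtain ⟨r, hr⟩ := Int.even_mul_pred_self γ.1
      exact ⟨r, by linarith⟩
    have hj' : (γ.1 : ℝ) * γ.1 - γ.1 = 2 * j := by exact_mod_cast hj
    refine ⟨γ.1 * m + γ.2.1 * l - ε * k * j, ?_⟩
    simp only [deck, conifoldAngle, monodromy]
    push_cast
    linear_combination (-(ε : ℝ) * k * Real.pi) * hj'

/-- `V_n^inst = V_{β - n δ}^inst + V_{-β + n δ}^inst`, as a function of `t` and `θ = θ_β`. -/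
def pairV (n : ℤ) (t : ℂ) (θ : ℝ) : ℂ := instV (t - n) θ + instV (-t + n) (-θ)

/-! ### The Ooguri-Vafa space -/

/-- The Ooguri-Vafa central charge `Z_β = t`, `Z_{β^∨} = (1 / 2πi) (t log (t / Λ) - t)`, where
`log (t / Λ) = s - log Λ` on the covering. The lattice is `ℤ β^∨ + ℤ β`. -/
def ovZ (Λ : ℂ) (γ : ℤ × ℤ) (s : ℂ) : ℂ :=
  γ.1 * (1 / (2 * Real.pi * Complex.I) *
      (Complex.exp s * (s - Complex.log Λ) - Complex.exp s))
    + γ.2 * Complex.exp s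

/-- The data of the Ooguri-Vafa space with cutoff `Λ`. -/
def ooguriVafa (ε : ℕ) (Λ : ℂ) : BPSData (ℤ × ℤ) where
  Z := ovZ Λ
  θ γ x := γ.1 * x.2.2 + γ.2 * x.2.1 + ε * Real.pi * (γ.1 * γ.2)
  Ω γ := if γ = (0, 1) ∨ γ = (0, -1) then 1 else 0
  magnetic := (1, 0)
  electric := (0, 1)
  coeff γ := γ.2

/-- The cutoff `Λ = i / 2π`. -/
def cutoff : ℂ := Complex.I / (2 * Real.pi)

/-! ### Adding the fibre over `t = 0` -/

/-- The coordinates `(t, θ_β)`. -/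
abbrev Base : Type := ℂ × ℝ

/-- `M ∪ {0}`. -/
def fullM : Set ℂ := insert 0 baseM

/-- The map `(s, θ_β, θ_{β^∨}) ↦ (t, θ_β)`. -/
def toBase (x : Coord) : Base := (Complex.exp x.1, x.2.1)

/-- The one-form `dt` on `Base`. -/
def dt : Base →L[ℝ] ℂ := ContinuousLinearMap.fst ℝ ℂ ℝ

/-- The one-form `Re dt` on `Base`. -/
def dtRe : Base →L[ℝ] ℂ := realForm (Complex.reCLM ∘L ContinuousLinearMap.fst ℝ ℂ ℝ)

/-- The one-form `Im dt` on `Base`. -/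
def dtIm : Base →L[ℝ] ℂ := realForm (Complex.imCLM ∘L ContinuousLinearMap.fst ℝ ℂ ℝ)

/-- The one-form `dθ_β` on `Base`. -/
def dθβ : Base →L[ℝ] ℂ := realForm (ContinuousLinearMap.snd ℝ ℂ ℝ)

section Manifold

variable (X : Type) [TopologicalSpace X] [ChartedSpace Coord X]

/-- Fields of two-forms on `X`. -/
abbrev FormField : Type := ∀ x : X, (TangentSpace 𝓘(ℝ, Coord) x) [⋀^Fin 2]→L[ℝ] ℝ

/-- Fields of bilinear forms on `X`. -/
abbrev BilinField : Type :=
  ∀ x : X, (TangentSpace 𝓘(ℝ, Coord) x) →L[ℝ] (TangentSpace 𝓘(ℝ, Coord) x) →L[ℝ] ℝ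

/-- Fields of endomorphisms of the tangent spaces of `X`. -/
abbrev EndField : Type :=
  ∀ x : X, (TangentSpace 𝓘(ℝ, Coord) x) →L[ℝ] (TangentSpace 𝓘(ℝ, Coord) x)

variable {X}

/-- The pull-back of a two-form along a map from `Coord`. -/
def pullForm (f : Coord → X) (Φ : FormField X) (y : Coord) : Coord [⋀^Fin 2]→L[ℝ] ℝ :=
  (Φ (f y)).compContinuousLinearMap (mfderiv 𝓘(ℝ, Coord) 𝓘(ℝ, Coord) f y)

/-- The pull-back of a bilinear form along a map from `Coord`. -/
def pullBilin (f : Coord → X) (g : BilinField X) (y : Coord) : Coord →L[ℝ] Coord →L[ℝ] ℝ :=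
  ContinuousLinearMap.bilinearComp (E := Coord) (F := Coord) (g (f y))
    (mfderiv 𝓘(ℝ, Coord) 𝓘(ℝ, Coord) f y) (mfderiv 𝓘(ℝ, Coord) 𝓘(ℝ, Coord) f y)

/-- An endomorphism field in the chart at `x₀`. -/
def chartEnd (x₀ : X) (J : EndField X) (y : Coord) : Coord →L[ℝ] Coord :=
  (mfderiv 𝓘(ℝ, Coord) 𝓘(ℝ, Coord) (chartAt Coord x₀) ((chartAt Coord x₀).symm y)) ∘L
    (J ((chartAt Coord x₀).symm y)) ∘L
      (mfderiv 𝓘(ℝ, Coord) 𝓘(ℝ, Coord) (chartAt Coord x₀).symm y)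

/-- The part of the target of the chart at `x₀` that corresponds to points of `U`. -/
def chartDomain (x₀ : X) (U : Set X) : Set Coord :=
  (chartAt Coord x₀).target ∩ (chartAt Coord x₀).symm ⁻¹' U

/-- A two-form on `X` is smooth if it is smooth in every chart. -/
def IsSmoothForm (Φ : FormField X) : Prop :=
  ∀ x₀ : X, ContDiffOn ℝ ∞ (pullForm (chartAt Coord x₀).symm Φ) (chartDomain x₀ univ)

/-- A hyperkähler structure on the open subset `U` of `X`, with Kähler forms `Φ`. -/
def IsHyperkahlerOnManifold (U : Set X) (g : BilinField X) (I : Fin 3 → EndField X)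
    (Φ : Fin 3 → FormField X) : Prop :=
  IsOpen U ∧ ∀ x₀ : X, IsHyperkahlerOn (chartDomain x₀ U)
    (pullBilin (chartAt Coord x₀).symm g) (fun α => chartEnd x₀ (I α))
    (fun α => pullForm (chartAt Coord x₀).symm (Φ α))

/-- The points where the three forms `ω₁, ω₂, ω₃` are all non-degenerate. -/
def nondegenerateLocus (Φ : Fin 3 → FormField X) : Set X :=
  {x | ∀ α, Nondegenerate (F := Coord) (Φ α x)}

/-- `X` is a smooth completion over `t = 0` of the torus bundle over `M` of twisted unitary
characters with `θ_δ = 0`: the torus bundle is the open submanifold `t ≠ 0` of `X` (it is presented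
by the map `q` from its covering), the functions `t` and `exp (i θ_β)` extend to smooth functions
`t`, `u` on `X`, the map `t : X → M ∪ {0}` is proper, and the fibre of `t` over `0` is a pinched torus
(a fibre of Kodaira type `I₁`), the pinching taking place at `θ_β = 0`. -/
structure Completion (X : Type) [TopologicalSpace X] [ChartedSpace Coord X] where
  q : Coord → X
  t : X → ℂ
  u : X → Circle
  smooth_t : ContMDiff 𝓘(ℝ, Coord) 𝓘(ℝ, ℂ) ∞ t
  smooth_u : ContMDiff 𝓘(ℝ, Coord) 𝓘(ℝ, ℂ) ∞ fun x => (u x : ℂ)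
  mem_fullM : ∀ x, t x ∈ fullM
  proper : ∀ K ⊆ fullM, IsCompact K → IsCompact (t ⁻¹' K)
  local_q : IsLocalDiffeomorphOn 𝓘(ℝ, Coord) 𝓘(ℝ, Coord) ∞ q cover
  image_q : q '' cover = {x | t x ≠ 0}
  q_eq_iff : ∀ x ∈ cover, ∀ y ∈ cover, q x = q y ↔ SamePoint 1 x y
  t_q : ∀ x ∈ cover, t (q x) = Complex.exp x.1
  u_q : ∀ x ∈ cover, u (q x) = Circle.exp x.2.1
  pinched : ∃ c : Circle × Circle → X, Continuous c ∧ range c = t ⁻¹' {0} ∧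
    (∀ v w, u (c (v, w)) = v) ∧
    ∀ v w v' w', c (v, w) = c (v', w') ↔ v = v' ∧ (v = 1 ∨ w = w')

namespace Completion

variable (C : Completion X)

/-- The one-form `dθ_β = Im (u⁻¹ du)` on `X`. -/
def dθ (x : X) : Coord →L[ℝ] ℝ :=
  Complex.imCLM ∘L (((starRingEnd ℂ) (C.u x : ℂ)) •
    (show Coord →L[ℝ] ℂ from mfderiv 𝓘(ℝ, Coord) 𝓘(ℝ, ℂ) (fun z => (C.u z : ℂ)) x))

/-- The pull-back to `X` of a two-form on `Base` that is `2 π`-periodic in `θ_β`. -/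
def pullBase (η : Base → Base [⋀^Fin 2]→L[ℝ] ℝ) : FormField X := fun x =>
  (η (C.t x, Complex.arg (C.u x))).compContinuousLinearMap
    ((show Coord →L[ℝ] ℂ from mfderiv 𝓘(ℝ, Coord) 𝓘(ℝ, ℂ) C.t x).prod (C.dθ x))

end Completion

end Manifold

end ConifoldHK

end

open ConifoldHK
open scoped ContDiff Manifold

/-! Every active charge with non-constant central charge has the form ±(β + nδ), and the charges kδ
drop out because their central charge is constant. Hence both the conifold and the Ooguri-Vafa data
are instances of one Gibbons-Hawking ansatz over the (t, θ_β)-space: all forms are determined by a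
potential w, a connection form Im(c̄ dt) and Re τ. `BPSData.IsElectric` records the common
structure, with N = ℤ for the conifold and N = {0} for Ooguri-Vafa, and
`BPSData.IsElectric.omega_eq` gives the common formula. The forms are linear in (c, w, Re τ), so
their difference is governed by the lattice sum over n ≠ 0 and by the difference of the two periods.

The sum over n ≠ 0 is smooth for |Re t| < 1/2, since t + n then stays away from 0. For the periods,
the factorisation 1 - exp(2πit) = -2πit · (sin πt / πt) · exp(πit) and an integration along vertical
rays show that the dilogarithm period equals the Ooguri-Vafa period with Λ = i/2π plus a holomorphic
function on the strip (`exists_dualPeriod_eq`). At t = 0 the connection term vanishes by the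
symmetry n ↦ -n, and τ differs by 0, which leaves only the sum S.

For the extension over t = 0, Poisson summation in θ_β turns the Bessel series of the n = 0 pair
into a sum over images: w = (log |t|²)/4π + 1/2D + smooth, with D² = 4π²|t|² + θ_β² (`pairPot_eq`,
`mul_pairConn_eq`). The logarithm cancels Im τ. The term 1/2D is the Gibbons-Hawking potential of
flat ℂ², with t = zw and θ_β = π(|z|² - |w|²). In the coordinates (z, w) of `taubNUT` the forms are
therefore the flat triple plus the pull-back of a smooth form along (z, w) ↦ (t, θ_β), and so extend
smoothly over zw = 0 (`ovForm_taubNUT`). The twist by π for ε = 1 is exactly what makes these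
coordinates single valued around t = 0 (`taubNUT_deck`). The manifold X is the domain |θ_β| < 2π of
ℂ² modulo the shift θ_β ↦ θ_β - 2π, expressed by `glue`; its fibre at t = 0 is two discs meeting at
the origin and glued along their outer annuli, a pinched torus.

Where w ≠ 0 the forms are a standard linear hyperkähler triple in the coframe (dt, Θ), with metric
g_N (`exists_isHKTriple_ghCoord`). The forms determine metric and complex structures algebraically,
so the quaternionic identities pass by density to all non-degenerate points of X, and no
compatibility of the structures on overlaps has to be proved separately. The forms are closed by
holomorphy of τ and the monopole equation, which is the Bessel recursion; integrability follows from
closedness by Hitchin's argument (`nijenhuis_eq_zero`). -/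

noncomputable section

namespace ConifoldHK

open MeasureTheory Filter Topology

/-! ### Bessel functions through a Gaussian integral -/

/-- The integrand of `besselInt`. -/
def besselKer (j : ℕ) (y u : ℝ) : ℝ :=
  u ^ j * u⁻¹ * Real.exp (-(u * y) - Real.pi ^ 2 / u)

/-- `½ ∫_0^∞ u^{j-1} exp (-u y - π² / u) du`. -/
def besselInt (j : ℕ) (y : ℝ) : ℝ := 1 / 2 * ∫ u in Ioi (0 : ℝ), besselKer j y u

/-- Because exp(c/u) ≥ 1 + c/u ≥ 1/u. It absorbs the pole u⁻¹ of `besselKer`, so that the case j = 0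
needs no separate treatment near u = 0. -/
theorem inv_mul_exp_neg_div_le {c u : ℝ} (hc : 1 ≤ c) (hu : 0 < u) :
    u⁻¹ * Real.exp (-(c / u)) ≤ 1 := by
  have h1 : c / u + 1 ≤ Real.exp (c / u) := Real.add_one_le_exp _
  rw [Real.exp_neg, ← div_eq_mul_inv, div_le_one (Real.exp_pos _)]
  have : u⁻¹ ≤ c / u := by
    rw [div_eq_mul_inv]; nlinarith [inv_pos.2 hu]
  linarith

theorem one_le_pi_sq_div_two : 1 ≤ Real.pi ^ 2 / 2 := by
  nlinarith [Real.pi_gt_three]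

theorem besselKer_nonneg (j : ℕ) (y : ℝ) {u : ℝ} (hu : 0 < u) : 0 ≤ besselKer j y u := by
  unfold besselKer; positivity

theorem besselKer_le (j : ℕ) (y : ℝ) {u : ℝ} (hu : 0 < u) :
    besselKer j y u ≤ u ^ j * Real.exp (-(u * y)) := by
  have h := inv_mul_exp_neg_div_le (c := Real.pi ^ 2) (by nlinarith [Real.pi_gt_three]) hu
  unfold besselKer
  rw [sub_eq_add_neg, Real.exp_add]
  calc u ^ j * u⁻¹ * (Real.exp (-(u * y)) * Real.exp (-(Real.pi ^ 2 / u)))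
      = (u ^ j * Real.exp (-(u * y))) * (u⁻¹ * Real.exp (-(Real.pi ^ 2 / u))) := by ring
    _ ≤ (u ^ j * Real.exp (-(u * y))) * 1 := by gcongr
    _ = _ := mul_one _

theorem integrableOn_pow_mul_exp_neg_mul (j : ℕ) {y : ℝ} (hy : 0 < y) :
    IntegrableOn (fun u => u ^ j * Real.exp (-(u * y))) (Ioi (0 : ℝ)) := by
  have h := integrableOn_rpow_mul_exp_neg_mul_rpow (p := 1) (s := j) (b := y)
    (by have : (0 : ℝ) ≤ j := Nat.cast_nonneg j
        linarith) one_pos hy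
  refine h.congr_fun (fun u _ => ?_) measurableSet_Ioi
  simp [mul_comm]

theorem measurable_besselKer (j : ℕ) (y : ℝ) : Measurable (besselKer j y) := by
  unfold besselKer; fun_prop

theorem integrableOn_besselKer (j : ℕ) {y : ℝ} (hy : 0 < y) :
    IntegrableOn (besselKer j y) (Ioi (0 : ℝ)) := by
  refine Integrable.mono' (integrableOn_pow_mul_exp_neg_mul j hy)
    (measurable_besselKer j y).aestronglyMeasurable ?_
  refine (ae_restrict_iff' measurableSet_Ioi).2 (Eventually.of_forall fun u hu => ?_)
  rw [Real.norm_of_nonneg (besselKer_nonneg j y hu)]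
  exact besselKer_le j y hu

theorem besselInt_nonneg (j : ℕ) (y : ℝ) : 0 ≤ besselInt j y :=
  mul_nonneg (by norm_num)
    (setIntegral_nonneg measurableSet_Ioi fun _ hu => besselKer_nonneg j y hu)

/-- Differentiation in y multiplies the integrand by -u, which raises j by one. This clean index
shift is the reason for working with y = |Z|² and a Gaussian-type integral in place of K_ν(2π|Z|).
For x > y/2 the differentiated kernel is dominated by its bound at y/2. -/
theorem hasDerivAt_besselInt (j : ℕ) {y : ℝ} (hy : 0 < y) :
    HasDerivAt (besselInt j) (-besselInt (j + 1) y) y := by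
  have h := (hasDerivAt_integral_of_dominated_loc_of_deriv_le (μ := volume.restrict (Ioi (0 : ℝ)))
    (F := fun y u => besselKer j y u) (F' := fun y u => -besselKer (j + 1) y u) (x₀ := y)
    (s := Ioi (y / 2)) (bound := fun u => u ^ (j + 1) * Real.exp (-(u * (y / 2))))
    (Ioi_mem_nhds (by linarith))
    (Eventually.of_forall fun y => (measurable_besselKer j y).aestronglyMeasurable)
    (integrableOn_besselKer j hy) (measurable_besselKer (j + 1) y).neg.aestronglyMeasurable
    ((ae_restrict_iff' measurableSet_Ioi).2 (Eventually.of_forall fun u hu x hx => ?_))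
    (integrableOn_pow_mul_exp_neg_mul (j + 1) (by linarith))
    ((ae_restrict_iff' measurableSet_Ioi).2 (Eventually.of_forall fun u hu x hx => ?_))).2
  · exact (h.const_mul (1 / 2 : ℝ)).congr_deriv (by rw [integral_neg, besselInt]; ring)
  · have hu' : 0 < u := hu
    rw [norm_neg, Real.norm_of_nonneg (besselKer_nonneg _ x hu')]
    refine (besselKer_le _ x hu').trans ?_
    have : y / 2 ≤ x := le_of_lt hx
    gcongr
  · have hu' : u ≠ 0 := ne_of_gt hu
    have h1 : HasDerivAt (fun x : ℝ => -(u * x) - Real.pi ^ 2 / u) (-u) x := by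
      simpa using (((hasDerivAt_id x).const_mul u).neg.sub_const (Real.pi ^ 2 / u))
    refine HasDerivAt.congr_deriv (f := fun x => besselKer j x u)
      (h1.exp.const_mul (u ^ j * u⁻¹)) ?_
    unfold besselKer
    field_simp
    ring

/-- Each of the exponents uy and π²/u is split in half. One pair of halves is at least π√y by the
arithmetic-geometric mean inequality; the other halves supply integrability at infinity and cancel
u⁻¹ at 0. The resulting rate is half the true one, which suffices. -/
theorem besselInt_le (j : ℕ) {y₀ : ℝ} (hy₀ : 0 < y₀) :
    ∃ C : ℝ, 0 ≤ C ∧ ∀ y, y₀ ≤ y → besselInt j y ≤ C * Real.exp (-(Real.pi * Real.sqrt y)) := by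
  refine ⟨1 / 2 * ∫ u in Ioi (0 : ℝ), u ^ j * Real.exp (-(u * (y₀ / 2))), mul_nonneg (by norm_num)
    (setIntegral_nonneg measurableSet_Ioi fun u (hu : 0 < u) => by positivity), fun y hy => ?_⟩
  have hy' : 0 < y := hy₀.trans_le hy
  have key : ∀ u ∈ Ioi (0 : ℝ), besselKer j y u ≤
      u ^ j * Real.exp (-(u * (y₀ / 2))) * Real.exp (-(Real.pi * Real.sqrt y)) := by
    intro u hu
    have hu' : 0 < u := hu
    have h := inv_mul_exp_neg_div_le one_le_pi_sq_div_two hu'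
    have hs : Real.sqrt y ^ 2 = y := Real.sq_sqrt hy'.le
    have h2 : Real.pi * Real.sqrt y ≤ u * y / 2 + Real.pi ^ 2 / 2 / u := by
      rw [div_add_div _ _ two_ne_zero hu'.ne', le_div_iff₀ (by positivity)]
      have h6 : 0 ≤ (u * Real.sqrt y - Real.pi) ^ 2 := sq_nonneg _
      have h7 : (u * Real.sqrt y - Real.pi) ^ 2 =
          u * y * u + Real.pi ^ 2 - Real.pi * Real.sqrt y * (2 * u) := by
        linear_combination u ^ 2 * hs
      linarith
    have h3 : Real.exp (-(u * y) - Real.pi ^ 2 / u) ≤ Real.exp (-(u * (y₀ / 2))) *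
        Real.exp (-(Real.pi ^ 2 / 2 / u)) * Real.exp (-(Real.pi * Real.sqrt y)) := by
      rw [← Real.exp_add, ← Real.exp_add, Real.exp_le_exp]
      have h4 : Real.pi ^ 2 / u = Real.pi ^ 2 / 2 / u + Real.pi ^ 2 / 2 / u := by ring
      have h5 : u * y₀ ≤ u * y := by gcongr
      rw [h4]; linarith
    unfold besselKer
    calc u ^ j * u⁻¹ * Real.exp (-(u * y) - Real.pi ^ 2 / u)
        ≤ u ^ j * u⁻¹ * (Real.exp (-(u * (y₀ / 2))) *
        Real.exp (-(Real.pi ^ 2 / 2 / u)) * Real.exp (-(Real.pi * Real.sqrt y))) := by gcongr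
      _ = u ^ j * Real.exp (-(u * (y₀ / 2))) * Real.exp (-(Real.pi * Real.sqrt y)) *
          (u⁻¹ * Real.exp (-(Real.pi ^ 2 / 2 / u))) := by ring
      _ ≤ u ^ j * Real.exp (-(u * (y₀ / 2))) * Real.exp (-(Real.pi * Real.sqrt y)) * 1 := by gcongr
      _ = _ := mul_one _
  have hI := setIntegral_mono_on (integrableOn_besselKer j hy')
    ((integrableOn_pow_mul_exp_neg_mul j (half_pos hy₀)).mul_const _) measurableSet_Ioi key
  rw [integral_mul_const] at hI
  unfold besselInt
  linarith

/-- The left side is half the integral over u > 0 of the derivative of u exp(-uy - π²/u), whose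
boundary values vanish. In classical terms it is K₂ - K₀ = (2/x) K₁ at x = 2π√y. -/
theorem besselInt_recursion {y : ℝ} (hy : 0 < y) :
    besselInt 1 y - y * besselInt 2 y + Real.pi ^ 2 * besselInt 0 y = 0 := by
  have h := integral_Ioi_of_hasDerivAt_of_tendsto
    (f := fun u => u * (u * u⁻¹ * Real.exp (-(u * y) - Real.pi ^ 2 / u)))
    (f' := fun u => besselKer 1 y u - y * besselKer 2 y u + Real.pi ^ 2 * besselKer 0 y u)
    (a := 0) (m := 0) ?_ ?_ ?_ ?_
  · rw [integral_add, integral_sub, integral_const_mul, integral_const_mul] at h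
    · unfold besselInt
      simp only [zero_mul, sub_zero] at h
      linear_combination (1 / 2) * h
    · exact integrableOn_besselKer 1 hy
    · exact (integrableOn_besselKer 2 hy).const_mul _
    · exact (integrableOn_besselKer 1 hy).sub ((integrableOn_besselKer 2 hy).const_mul _)
    · exact (integrableOn_besselKer 0 hy).const_mul _
  · rw [ContinuousWithinAt]
    simp only [zero_mul]
    refine squeeze_zero' (g := fun u : ℝ => u) ?_ ?_ ?_
    · filter_upwards [self_mem_nhdsWithin] with u hu
      have : (0 : ℝ) ≤ u := hu
      positivity
    · filter_upwards [self_mem_nhdsWithin] with u hu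
      have hu : (0 : ℝ) ≤ u := hu
      rcases hu.eq_or_lt with rfl | hu
      · simp
      · have : Real.exp (-(u * y) - Real.pi ^ 2 / u) ≤ 1 := by
          rw [Real.exp_le_one_iff]
          have : 0 ≤ u * y := by positivity
          have : 0 ≤ Real.pi ^ 2 / u := by positivity
          linarith
        rw [mul_inv_cancel₀ hu.ne', one_mul]
        exact mul_le_of_le_one_right hu.le this
    · exact tendsto_id.mono_left nhdsWithin_le_nhds
  · intro u hu
    have hu' : u ≠ 0 := ne_of_gt hu
    have h1 : HasDerivAt (fun x : ℝ => -(x * y) - Real.pi ^ 2 / x) (-y + Real.pi ^ 2 / u ^ 2) u := by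
      have h2 := (((hasDerivAt_id u).mul_const y).neg.sub
        ((hasDerivAt_inv hu').const_mul (Real.pi ^ 2)))
      exact HasDerivAt.congr_deriv h2 (by field_simp; ring)
    have h3 : HasDerivAt (fun u => u * Real.exp (-(u * y) - Real.pi ^ 2 / u)) _ u :=
      (hasDerivAt_id u).mul h1.exp
    refine (h3.congr_of_eventuallyEq ?_).congr_deriv ?_
    · filter_upwards [isOpen_ne.mem_nhds hu'] with x hx
      rw [mul_inv_cancel₀ hx, one_mul]
    · simp only [besselKer, id]
      field_simp
      ring
  · exact ((integrableOn_besselKer 1 hy).sub ((integrableOn_besselKer 2 hy).const_mul _)).add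
      ((integrableOn_besselKer 0 hy).const_mul _)
  · refine squeeze_zero' (g := fun u : ℝ => u ^ 1 * Real.exp (-y * u)) ?_ ?_ ?_
    · filter_upwards [eventually_gt_atTop 0] with u hu
      positivity
    · filter_upwards [eventually_gt_atTop 0] with u hu
      rw [mul_inv_cancel₀ hu.ne', one_mul, pow_one]
      gcongr
      have : 0 ≤ Real.pi ^ 2 / u := by positivity
      nlinarith
    · have := (Real.tendsto_pow_mul_exp_neg_atTop_nhds_zero 1).comp
        (tendsto_id.const_mul_atTop hy)
      have h2 := this.const_mul (y⁻¹)
      rw [mul_zero] at h2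
      refine h2.congr fun u => ?_
      simp [Function.comp]
      field_simp

/-! ### Exponential substitution and comparison with the Bessel functions K_j -/

theorem integral_Ioi_eq_integral_exp {c : ℝ} (hc : 0 < c) (g : ℝ → ℝ) :
    ∫ u in Ioi (0 : ℝ), g u = ∫ s : ℝ, c * Real.exp s * g (c * Real.exp s) := by
  have himg : (fun s => c * Real.exp s) '' univ = Ioi (0 : ℝ) := by
    ext u
    simp only [image_univ, mem_range, mem_Ioi]
    constructor
    · rintro ⟨s, rfl⟩; positivity
    · intro hu
      exact ⟨Real.log (u / c), by rw [Real.exp_log (by positivity)]; field_simp⟩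
  have h := integral_image_eq_integral_abs_deriv_smul (s := univ) (f := fun s => c * Real.exp s)
    (f' := fun s => c * Real.exp s) MeasurableSet.univ
    (fun s _ => ((Real.hasDerivAt_exp s).const_mul c).hasDerivWithinAt)
    (fun s _ s' _ h => Real.exp_injective (mul_left_cancel₀ hc.ne' h)) g
  rw [himg] at h
  rw [h, setIntegral_univ]
  refine integral_congr_ae (Eventually.of_forall fun s => ?_)
  have : 0 < c * Real.exp s := by positivity
  simp [abs_of_pos this]

theorem integrable_exp_of_integrableOn_Ioi {c : ℝ} (hc : 0 < c) {g : ℝ → ℝ}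
    (hg : IntegrableOn g (Ioi (0 : ℝ))) :
    Integrable (fun s : ℝ => c * Real.exp s * g (c * Real.exp s)) := by
  have himg : (fun s => c * Real.exp s) '' univ = Ioi (0 : ℝ) := by
    ext u
    simp only [image_univ, mem_range, mem_Ioi]
    constructor
    · rintro ⟨s, rfl⟩; positivity
    · intro hu
      exact ⟨Real.log (u / c), by rw [Real.exp_log (by positivity)]; field_simp⟩
  have h := (integrableOn_image_iff_integrableOn_abs_deriv_smul (s := univ)
    (f := fun s => c * Real.exp s)
    (f' := fun s => c * Real.exp s) MeasurableSet.univ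
    (fun s _ => ((Real.hasDerivAt_exp s).const_mul c).hasDerivWithinAt)
    (fun s _ s' _ h => Real.exp_injective (mul_left_cancel₀ hc.ne' h)) g).1 (by rwa [himg])
  rw [integrableOn_univ] at h
  refine h.congr (Eventually.of_forall fun s => ?_)
  have : 0 < c * Real.exp s := by positivity
  simp [abs_of_pos this]

theorem integral_eq_integral_Ioi_add {f : ℝ → ℝ} (hf : Integrable f) :
    ∫ s, f s = ∫ s in Ioi (0 : ℝ), (f s + f (-s)) := by
  rw [← intervalIntegral.integral_Iic_add_Ioi (b := 0) hf.integrableOn hf.integrableOn,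
    integral_add hf.integrableOn hf.comp_neg.integrableOn, integral_comp_neg_Ioi, neg_zero, add_comm]

/-- The substitution u = (π/√y) exp s balances the two exponents: uy + π²/u becomes 2π√y cosh s.
Folding s with -s then turns exp(js) into 2 cosh(js). -/
theorem besselInt_eq {j : ℕ} {y : ℝ} (hy : 0 < y) :
    besselInt j y = (Real.pi / Real.sqrt y) ^ j * besselK j (2 * Real.pi * Real.sqrt y) := by
  have hs : 0 < Real.sqrt y := Real.sqrt_pos.2 hy
  have hss : Real.sqrt y ^ 2 = y := Real.sq_sqrt hy.le
  have hpi := Real.pi_pos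
  set c := Real.pi / Real.sqrt y with hcdef
  have hc : 0 < c := by positivity
  have hker : ∀ s, c * Real.exp s * besselKer j y (c * Real.exp s) =
      c ^ j * (Real.exp (j * s) * Real.exp (-(2 * Real.pi * Real.sqrt y * Real.cosh s))) := by
    intro s
    have h1 : c * Real.exp s * y + Real.pi ^ 2 / (c * Real.exp s) =
        2 * Real.pi * Real.sqrt y * Real.cosh s := by
      rw [Real.cosh_eq, Real.exp_neg, hcdef]
      have := Real.exp_pos s
      field_simp
      linear_combination (-(Real.exp s ^ 2)) * hss
    unfold besselKer
    rw [mul_pow, ← Real.exp_nat_mul, ← neg_add', h1]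
    have := Real.exp_pos s
    field_simp
  have hint := integrable_exp_of_integrableOn_Ioi hc (integrableOn_besselKer j hy)
  unfold besselInt besselK
  rw [integral_Ioi_eq_integral_exp hc, integral_eq_integral_Ioi_add hint, ← integral_const_mul,
    ← integral_const_mul]
  refine setIntegral_congr_fun measurableSet_Ioi fun s _ => ?_
  simp only [hker, Real.cosh_neg]
  rw [Real.cosh_eq (j * s), mul_neg]
  ring

end ConifoldHK

end

noncomputable section

namespace ConifoldHK

open MeasureTheory Filter Topology

/-! ### Bessel-Fourier series -/

/-- A bootstrap: if the derivatives of a family are built from the family itself, C^n for all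
members gives C^(n+1) for all members. It serves the lattice sums and the image sums alike, and
reduces their smoothness to one termwise differentiation. -/
theorem contDiffOn_infty_of_hasFDerivAt_family {E F κ : Type*} [NormedAddCommGroup E]
    [NormedSpace ℝ E] [NormedAddCommGroup F] [NormedSpace ℝ F] {U : Set E} (hU : IsOpen U)
    (f : κ → E → F) (f' : κ → E → E →L[ℝ] F) (hf : ∀ k, ∀ x ∈ U, HasFDerivAt (f k) (f' k x) x)
    (hf' : ∀ n : ℕ, (∀ k, ContDiffOn ℝ n (f k) U) → ∀ k, ContDiffOn ℝ n (f' k) U) (k : κ) :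
    ContDiffOn ℝ ∞ (f k) U := by
  refine contDiffOn_infty.2 fun n => ?_
  induction n generalizing k with
  | zero => exact contDiffOn_zero.2 fun x hx => (hf k x hx).continuousAt.continuousWithinAt
  | succ n ih =>
    rw [Nat.cast_add, Nat.cast_one, contDiffOn_succ_iff_fderiv_of_isOpen hU]
    refine ⟨fun x hx => (hf k x hx).differentiableAt.differentiableWithinAt, by simp, ?_⟩
    exact (hf' n ih k).congr fun x hx => (hf k x hx).fderiv

/-- The terms of `fourierBessel`. -/
def fourierBesselTerm (p j m : ℕ) (y a : ℝ) : ℂ :=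
  ((m : ℂ) + 1) ^ p * Complex.exp (Complex.I * ((m : ℂ) + 1) * a) *
    (besselInt j (((m : ℝ) + 1) ^ 2 * y) : ℂ)

/-- `∑_{m ≥ 1} m^p exp (i m a) besselInt j (m² y)`. -/
def fourierBessel (p j : ℕ) (y a : ℝ) : ℂ := ∑' m : ℕ, fourierBesselTerm p j m y a

theorem norm_exp_I_mul_natCast_add_one (m : ℕ) (a : ℝ) :
    ‖Complex.exp (Complex.I * ((m : ℂ) + 1) * a)‖ = 1 := by
  rw [show Complex.I * ((m : ℂ) + 1) * a = ((((m : ℝ) + 1) * a : ℝ) : ℂ) * Complex.I by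
    push_cast; ring]
  exact Complex.norm_exp_ofReal_mul_I _

theorem norm_fourierBesselTerm (p j m : ℕ) (y a : ℝ) :
    ‖fourierBesselTerm p j m y a‖ = ((m : ℝ) + 1) ^ p * besselInt j (((m : ℝ) + 1) ^ 2 * y) := by
  unfold fourierBesselTerm
  rw [norm_mul, norm_mul, norm_pow, norm_exp_I_mul_natCast_add_one, Complex.norm_real,
    Real.norm_of_nonneg (besselInt_nonneg _ _)]
  have : ‖(m : ℂ) + 1‖ = (m : ℝ) + 1 := by
    rw [show (m : ℂ) + 1 = ((m + 1 : ℕ) : ℂ) by push_cast; ring, Complex.norm_natCast]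
    push_cast; ring
  rw [this]; ring

theorem summable_natCast_add_one_pow_mul_exp (p : ℕ) {r : ℝ} (hr : 0 < r) :
    Summable fun m : ℕ => ((m : ℝ) + 1) ^ p * Real.exp (-r * ((m : ℝ) + 1)) := by
  have := (summable_nat_add_iff 1).2 (Real.summable_pow_mul_exp_neg_nat_mul p hr)
  simpa using this

/-- The decay exp(-π m √y) is shared out, using π > 2: one factor makes the series in m converge
uniformly for y ≥ y₀, the remaining factor exp(-√y) is kept for the later sum over the lattice. -/
theorem fourierBesselTerm_bound (p j : ℕ) {y₀ : ℝ} (hy₀ : 0 < y₀) :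
    ∃ C : ℝ, 0 ≤ C ∧ ∀ (m : ℕ) (y a : ℝ), y₀ ≤ y → ‖fourierBesselTerm p j m y a‖ ≤
      C * (((m : ℝ) + 1) ^ p * Real.exp (-Real.sqrt y₀ * ((m : ℝ) + 1))) *
        Real.exp (-Real.sqrt y) := by
  obtain ⟨C, hC, h⟩ := besselInt_le j hy₀
  refine ⟨C, hC, fun m y a hy => ?_⟩
  have hm : (1 : ℝ) ≤ (m : ℝ) + 1 := by simp
  have hy' : 0 < y := hy₀.trans_le hy
  have h1 := h (((m : ℝ) + 1) ^ 2 * y) (hy.trans (le_mul_of_one_le_left hy'.le (by nlinarith)))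
  rw [Real.sqrt_mul (by positivity), Real.sqrt_sq (by positivity)] at h1
  have hs : Real.sqrt y₀ ≤ Real.sqrt y := Real.sqrt_le_sqrt hy
  have hs0 : 0 ≤ Real.sqrt y₀ := Real.sqrt_nonneg _
  have h2 : Real.exp (-(Real.pi * (((m : ℝ) + 1) * Real.sqrt y))) ≤
      Real.exp (-Real.sqrt y₀ * ((m : ℝ) + 1)) * Real.exp (-Real.sqrt y) := by
    rw [← Real.exp_add, Real.exp_le_exp]
    have hpi := Real.pi_gt_three
    have h3 : Real.sqrt y ≤ ((m : ℝ) + 1) * Real.sqrt y :=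
      le_mul_of_one_le_left (hs0.trans hs) hm
    have h4 : ((m : ℝ) + 1) * Real.sqrt y₀ ≤ ((m : ℝ) + 1) * Real.sqrt y := by gcongr
    nlinarith
  rw [norm_fourierBesselTerm]
  calc ((m : ℝ) + 1) ^ p * besselInt j (((m : ℝ) + 1) ^ 2 * y)
      ≤ ((m : ℝ) + 1) ^ p * (C * (Real.exp (-Real.sqrt y₀ * ((m : ℝ) + 1)) *
          Real.exp (-Real.sqrt y))) := by
        gcongr
        exact h1.trans (by gcongr)
    _ = _ := by ring

theorem summable_fourierBesselTerm (p j : ℕ) {y : ℝ} (hy : 0 < y) (a : ℝ) :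
    Summable fun m => fourierBesselTerm p j m y a := by
  obtain ⟨C, -, h⟩ := fourierBesselTerm_bound p j hy
  exact Summable.of_norm_bounded
    (((summable_natCast_add_one_pow_mul_exp p (Real.sqrt_pos.2 hy)).mul_left C).mul_right _)
    fun m => h m y a le_rfl

theorem norm_fourierBessel_le (p j : ℕ) {y₀ : ℝ} (hy₀ : 0 < y₀) :
    ∃ C : ℝ, 0 ≤ C ∧ ∀ y a : ℝ, y₀ ≤ y →
      ‖fourierBessel p j y a‖ ≤ C * Real.exp (-Real.sqrt y) := by
  obtain ⟨C, hC, h⟩ := fourierBesselTerm_bound p j hy₀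
  have hsum := (summable_natCast_add_one_pow_mul_exp p (Real.sqrt_pos.2 hy₀)).mul_left C
  refine ⟨∑' m : ℕ, C * (((m : ℝ) + 1) ^ p * Real.exp (-Real.sqrt y₀ * ((m : ℝ) + 1))),
    tsum_nonneg fun m => by positivity, fun y a hy => ?_⟩
  rw [← tsum_mul_right]
  exact tsum_of_norm_bounded (hsum.mul_right _).hasSum fun m => h m y a hy

/-- The covector `dy` on `ℝ × ℝ`. -/
def covFst : ℝ × ℝ →L[ℝ] ℂ := Complex.ofRealCLM ∘L ContinuousLinearMap.fst ℝ ℝ ℝ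

/-- The covector `da` on `ℝ × ℝ`. -/
def covSnd : ℝ × ℝ →L[ℝ] ℂ := Complex.ofRealCLM ∘L ContinuousLinearMap.snd ℝ ℝ ℝ

@[simp] theorem covFst_apply (v : ℝ × ℝ) : covFst v = (v.1 : ℂ) := rfl

@[simp] theorem covSnd_apply (v : ℝ × ℝ) : covSnd v = (v.2 : ℂ) := rfl

theorem norm_covFst_le : ‖covFst‖ ≤ 1 :=
  ContinuousLinearMap.opNorm_le_bound _ zero_le_one fun v => by
    simpa using norm_fst_le v

theorem norm_covSnd_le : ‖covSnd‖ ≤ 1 :=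
  ContinuousLinearMap.opNorm_le_bound _ zero_le_one fun v => by
    simpa using norm_snd_le v

theorem hasFDerivAt_fourierBesselTerm (p j m : ℕ) {x : ℝ × ℝ} (hx : 0 < x.1) :
    HasFDerivAt (fun x : ℝ × ℝ => fourierBesselTerm p j m x.1 x.2)
      ((-fourierBesselTerm (p + 2) (j + 1) m x.1 x.2) • covFst +
        (Complex.I * fourierBesselTerm (p + 1) j m x.1 x.2) • covSnd) x := by
  have hpos : 0 < ((m : ℝ) + 1) ^ 2 * x.1 := by positivity
  have h1 : HasFDerivAt (fun x : ℝ × ℝ => Complex.exp (Complex.I * ((m : ℂ) + 1) * (x.2 : ℂ)))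
      (Complex.exp (Complex.I * ((m : ℂ) + 1) * (x.2 : ℂ)) •
        ((Complex.I * ((m : ℂ) + 1)) • covSnd)) x :=
    (HasFDerivAt.const_mul (covSnd.hasFDerivAt) (Complex.I * ((m : ℂ) + 1))).cexp
  have h2 : HasFDerivAt (fun x : ℝ × ℝ => besselInt j (((m : ℝ) + 1) ^ 2 * x.1))
      (-besselInt (j + 1) (((m : ℝ) + 1) ^ 2 * x.1) •
        (((m : ℝ) + 1) ^ 2 • ContinuousLinearMap.fst ℝ ℝ ℝ)) x :=
    HasDerivAt.comp_hasFDerivAt (h₂ := besselInt j)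
      (f := fun x : ℝ × ℝ => ((m : ℝ) + 1) ^ 2 * x.1) x (hasDerivAt_besselInt j hpos)
      ((ContinuousLinearMap.fst ℝ ℝ ℝ).hasFDerivAt.const_mul (((m : ℝ) + 1) ^ 2))
  have h3 := (h1.const_mul (((m : ℂ) + 1) ^ p)).mul (Complex.ofRealCLM.hasFDerivAt.comp x h2)
  refine HasFDerivAt.congr_fderiv h3 ?_
  refine ContinuousLinearMap.ext fun v => ?_
  simp [fourierBesselTerm]
  ring

/-- Termwise differentiation on the half-plane where y exceeds half its value at the given point;
there the bounds of the differentiated series are uniform. -/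
theorem hasFDerivAt_fourierBessel (p j : ℕ) {x : ℝ × ℝ} (hx : 0 < x.1) :
    HasFDerivAt (fun x : ℝ × ℝ => fourierBessel p j x.1 x.2)
      ((-fourierBessel (p + 2) (j + 1) x.1 x.2) • covFst +
        (Complex.I * fourierBessel (p + 1) j x.1 x.2) • covSnd) x := by
  have hx2 : 0 < x.1 / 2 := by linarith
  obtain ⟨C₁, hC₁, h₁⟩ := fourierBesselTerm_bound (p + 2) (j + 1) hx2
  obtain ⟨C₂, hC₂, h₂⟩ := fourierBesselTerm_bound (p + 1) j hx2
  have hexp : ∀ y, Real.exp (-Real.sqrt y) ≤ 1 := fun y =>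
    Real.exp_le_one_iff.2 (neg_nonpos.2 (Real.sqrt_nonneg _))
  have hsum := ((summable_natCast_add_one_pow_mul_exp (p + 2) (Real.sqrt_pos.2 hx2)).mul_left
    C₁).add ((summable_natCast_add_one_pow_mul_exp (p + 1) (Real.sqrt_pos.2 hx2)).mul_left C₂)
  have hconv : Convex ℝ (Prod.fst ⁻¹' Ioi (x.1 / 2) : Set (ℝ × ℝ)) :=
    (convex_Ioi _).linear_preimage (LinearMap.fst ℝ ℝ ℝ)
  have key := hasFDerivAt_tsum_of_isPreconnected (𝕜 := ℝ) hsum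
    (isOpen_Ioi.preimage continuous_fst) hconv.isPreconnected
    (f := fun (m : ℕ) (x : ℝ × ℝ) => fourierBesselTerm p j m x.1 x.2)
    (f' := fun m x => (-fourierBesselTerm (p + 2) (j + 1) m x.1 x.2) • covFst +
        (Complex.I * fourierBesselTerm (p + 1) j m x.1 x.2) • covSnd)
    (fun m z (hz : x.1 / 2 < z.1) => hasFDerivAt_fourierBesselTerm p j m (hx2.trans hz))
    (fun m z (hz : x.1 / 2 < z.1) => ?_)
    (show x.1 / 2 < x.1 by linarith) (summable_fourierBesselTerm p j hx x.2)
    (show x.1 / 2 < x.1 by linarith)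
  · refine key.congr_fderiv ?_
    have s1 := (summable_fourierBesselTerm (p + 2) (j + 1) hx x.2).neg.smul_const covFst
    have s2 := ((summable_fourierBesselTerm (p + 1) j hx x.2).mul_left Complex.I).smul_const covSnd
    rw [s1.tsum_add s2,
      (summable_fourierBesselTerm (p + 2) (j + 1) hx x.2).neg.tsum_smul_const,
      ((summable_fourierBesselTerm (p + 1) j hx x.2).mul_left Complex.I).tsum_smul_const,
      tsum_neg, tsum_mul_left]
    rfl
  · refine (norm_add_le _ _).trans (add_le_add ?_ ?_)
    · rw [norm_smul, norm_neg]
      refine (mul_le_of_le_one_right (norm_nonneg _) norm_covFst_le).trans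
        ((h₁ m z.1 z.2 hz.le).trans (mul_le_of_le_one_right (by positivity) (hexp _)))
    · rw [norm_smul, norm_mul, Complex.norm_I, one_mul]
      refine (mul_le_of_le_one_right (norm_nonneg _) norm_covSnd_le).trans
        ((h₂ m z.1 z.2 hz.le).trans (mul_le_of_le_one_right (by positivity) (hexp _)))

/-- `besselInt_recursion` at m²y, weighted by m^p exp(ima) and summed. This is the differential
equation behind the monopole equation, hence behind the closedness of ω₃. -/
theorem fourierBessel_recursion (p : ℕ) {y : ℝ} (hy : 0 < y) (a : ℝ) :
    fourierBessel p 1 y a - y * fourierBessel (p + 2) 2 y a +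
      Real.pi ^ 2 * fourierBessel p 0 y a = 0 := by
  have s1 := summable_fourierBesselTerm p 1 hy a
  have s2 := (summable_fourierBesselTerm (p + 2) 2 hy a).mul_left (y : ℂ)
  have s3 := (summable_fourierBesselTerm p 0 hy a).mul_left ((Real.pi : ℂ) ^ 2)
  unfold fourierBessel
  rw [← tsum_mul_left, ← tsum_mul_left, ← s1.tsum_sub s2, ← (s1.sub s2).tsum_add s3]
  convert tsum_zero with m
  have h := besselInt_recursion (y := ((m : ℝ) + 1) ^ 2 * y) (by positivity)
  have h' := congrArg (Complex.ofReal) h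
  push_cast at h'
  unfold fourierBesselTerm
  linear_combination ((m : ℂ) + 1) ^ p * Complex.exp (Complex.I * ((m : ℂ) + 1) * a) * h'

/-- The charges γ and -γ contribute complex conjugate series, which is why the potential of a pair
is real. -/
theorem fourierBessel_neg (p j : ℕ) (y a : ℝ) :
    fourierBessel p j y (-a) = (starRingEnd ℂ) (fourierBessel p j y a) := by
  unfold fourierBessel
  rw [Complex.conj_tsum]
  congr 1; ext m
  unfold fourierBesselTerm
  simp only [map_mul, map_pow, Complex.conj_ofReal, map_add, Complex.conj_natCast, map_one,
    ← Complex.exp_conj, Complex.conj_I]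
  push_cast
  ring_nf

theorem fourierBessel_add_two_pi (p j : ℕ) (y a : ℝ) :
    fourierBessel p j y (a + 2 * Real.pi) = fourierBessel p j y a := by
  unfold fourierBessel
  congr 1; ext m
  unfold fourierBesselTerm
  congr 2
  rw [Complex.exp_eq_exp_iff_exists_int]
  exact ⟨(m : ℤ) + 1, by push_cast; ring⟩

/-! ### The functions `V` and `A` -/

theorem two_pi_mul_norm_eq (m : ℕ) (z : ℂ) :
    2 * Real.pi * ((m : ℝ) + 1) * ‖z‖ =
      2 * Real.pi * Real.sqrt (((m : ℝ) + 1) ^ 2 * Complex.normSq z) := by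
  rw [Real.sqrt_mul (by positivity), Real.sqrt_sq (by positivity), Complex.norm_def]
  ring

theorem instV_term_eq (m : ℕ) {z : ℂ} (hz : z ≠ 0) (θ : ℝ) :
    Complex.exp (Complex.I * ((m : ℂ) + 1) * θ) *
      (besselK 0 (2 * Real.pi * ((m : ℝ) + 1) * ‖z‖) : ℂ) =
      fourierBesselTerm 0 0 m (Complex.normSq z) θ := by
  have hz' := Complex.normSq_pos.2 hz
  rw [fourierBesselTerm, besselInt_eq (by positivity), two_pi_mul_norm_eq]
  simp

theorem instA_term_eq (m : ℕ) {z : ℂ} (hz : z ≠ 0) (θ : ℝ) :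
    Complex.exp (Complex.I * ((m : ℂ) + 1) * θ) *
      ((‖z‖ * besselK 1 (2 * Real.pi * ((m : ℝ) + 1) * ‖z‖) : ℝ) : ℂ) =
      (Complex.normSq z / Real.pi : ℝ) * fourierBesselTerm 1 1 m (Complex.normSq z) θ := by
  have hz' := Complex.normSq_pos.2 hz
  have hpi := Real.pi_pos
  have hs : 0 < ‖z‖ := norm_pos_iff.2 hz
  rw [fourierBesselTerm, besselInt_eq (by positivity), two_pi_mul_norm_eq, pow_one,
    Real.sqrt_mul (by positivity), Real.sqrt_sq (by positivity), Complex.normSq_eq_norm_sq,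
    Real.sqrt_sq hs.le]
  have hm : ((m : ℂ) + 1) ≠ 0 := Nat.cast_add_one_ne_zero m
  have hs' : (‖z‖ : ℂ) ≠ 0 := by exact_mod_cast hs.ne'
  push_cast
  field_simp

theorem instV_eq {z : ℂ} (hz : z ≠ 0) (θ : ℝ) :
    instV z θ = (1 / (2 * Real.pi) : ℂ) * fourierBessel 0 0 (Complex.normSq z) θ := by
  unfold instV fourierBessel
  congr 2; ext m; exact instV_term_eq m hz θ

/-- The factor |z|² will cancel the denominators of dZ/Z and its conjugate, so that only polynomials
in z and z̄ multiply the Bessel-Fourier series. -/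
theorem instA_eq {z : ℂ} (hz : z ≠ 0) (θ : ℝ) :
    instA z θ = -((Complex.normSq z / (4 * Real.pi ^ 2) : ℝ) : ℂ) *
      fourierBessel 1 1 (Complex.normSq z) θ := by
  unfold instA fourierBessel
  simp_rw [instA_term_eq _ hz θ]
  rw [tsum_mul_left]
  have hpi : (Real.pi : ℂ) ≠ 0 := by exact_mod_cast Real.pi_ne_zero
  push_cast
  field_simp

/-- The potential of a pair of opposite charges as a function of `y = |Z|²` and the angle. -/
def pairPot (y a : ℝ) : ℝ := 1 / Real.pi * (fourierBessel 0 0 y a).re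

/-- The coefficient of the connection form of a pair of opposite charges. -/
def pairConn (y a : ℝ) : ℝ := 2 / Real.pi * (fourierBessel 1 1 y a).im

theorem instV_add_neg {z : ℂ} (hz : z ≠ 0) (θ : ℝ) :
    instV z θ + instV (-z) (-θ) = (pairPot (Complex.normSq z) θ : ℂ) := by
  rw [instV_eq hz, instV_eq (neg_ne_zero.2 hz), Complex.normSq_neg, fourierBessel_neg, ← mul_add,
    Complex.add_conj, pairPot]
  have hpi : (Real.pi : ℂ) ≠ 0 := by exact_mod_cast Real.pi_ne_zero
  push_cast
  field_simp

end ConifoldHK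

end

noncomputable section

namespace ConifoldHK

open MeasureTheory Filter Topology

/-! ### Lattice sums of Bessel-Fourier series -/

@[simp] theorem dt_apply (v : Base) : dt v = v.1 := rfl

@[simp] theorem conjForm_apply {F : Type} [NormedAddCommGroup F] [NormedSpace ℝ F]
    (α : F →L[ℝ] ℂ) (v : F) : conjForm α v = (starRingEnd ℂ) (α v) := rfl

@[simp] theorem realForm_apply {F : Type} [NormedAddCommGroup F] [NormedSpace ℝ F]
    (α : F →L[ℝ] ℝ) (v : F) : realForm α v = (α v : ℂ) := rfl

@[simp] theorem dθβ_apply (v : Base) : dθβ v = (v.2 : ℂ) := rfl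

theorem norm_dt_le : ‖dt‖ ≤ 1 :=
  ContinuousLinearMap.opNorm_le_bound _ zero_le_one fun v => by simpa using norm_fst_le v

theorem norm_conjForm_dt_le : ‖conjForm dt‖ ≤ 1 :=
  ContinuousLinearMap.opNorm_le_bound _ zero_le_one fun v => by simpa using norm_fst_le v

theorem norm_dθβ_le : ‖dθβ‖ ≤ 1 :=
  ContinuousLinearMap.opNorm_le_bound _ zero_le_one fun v => by simpa using norm_snd_le v

/-- The terms of `latticeBessel`. -/
def latticeBesselTerm (k : ℕ × ℕ × ℕ × ℕ) (n : ℤ) (x : Base) : ℂ :=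
  (x.1 + n) ^ k.2.2.1 * (starRingEnd ℂ) (x.1 + n) ^ k.2.2.2 *
    fourierBessel k.1 k.2.1 (Complex.normSq (x.1 + n)) x.2

/-- The sum of `z ^ q * conj z ^ r * fourierBessel p j |z|² θ` over `z = t + n` with `n ∈ N`, where
`k = (p, j, q, r)`. -/
def latticeBessel (N : Set ℤ) (k : ℕ × ℕ × ℕ × ℕ) (x : Base) : ℂ :=
  ∑' n : N, latticeBesselTerm k n x

/-- The translates `t + n`, `n ∈ N`, stay away from `0`, locally uniformly in `t` and linearly
in `n`. -/
def AwayFrom (N : Set ℤ) (t : ℂ) : Prop :=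
  ∃ ε > 0, ∃ δ > 0, ∀ t' ∈ Metric.ball t ε, ∀ n ∈ N, δ * (|(n : ℝ)| + 1) ≤ ‖t' + n‖

theorem AwayFrom.ne_zero {N : Set ℤ} {t : ℂ} (h : AwayFrom N t) {n : ℤ} (hn : n ∈ N) :
    t + n ≠ 0 := by
  obtain ⟨ε, hε, δ, hδ, h⟩ := h
  have := h t (Metric.mem_ball_self hε) n hn
  intro h0
  rw [h0, norm_zero] at this
  have : 0 < δ * (|(n : ℝ)| + 1) := by positivity
  linarith

theorem AwayFrom.mono {N N' : Set ℤ} (hN : N ⊆ N') {t : ℂ} (h : AwayFrom N' t) : AwayFrom N t := by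
  obtain ⟨ε, hε, δ, hδ, h⟩ := h
  exact ⟨ε, hε, δ, hδ, fun t' ht' n hn => h t' ht' n (hN hn)⟩

theorem awayFrom_compl_zero {t : ℂ} (ht : |t.re| < 1 / 2) : AwayFrom {0}ᶜ t := by
  -- The ball keeps |Re t'| < 1/2, and |n| - 1/2 ≥ (|n| + 1)/4 for |n| ≥ 1, with equality at |n| =
  -- 1; hence 1/4.
  refine ⟨1 / 2 - |t.re|, by linarith, 1 / 4, by norm_num, fun t' ht' n hn => ?_⟩
  have h1 : |t'.re| < 1 / 2 := by
    have h2 : |t'.re - t.re| < 1 / 2 - |t.re| := by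
      have := Complex.abs_re_le_norm (t' - t)
      rw [Complex.sub_re] at this
      exact this.trans_lt (by simpa [dist_eq_norm] using ht')
    have := abs_sub_abs_le_abs_sub t'.re t.re
    linarith
  have hn1 : (1 : ℝ) ≤ |(n : ℝ)| := by
    have : (1 : ℤ) ≤ |n| := Int.one_le_abs hn
    exact_mod_cast this
  have h3 : |(n : ℝ)| - |t'.re| ≤ |(t' + n).re| := by
    have := abs_sub_abs_le_abs_sub (n : ℝ) (-t'.re)
    simp only [abs_neg, sub_neg_eq_add] at this
    simpa [add_comm] using this
  have := Complex.abs_re_le_norm (t' + n)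
  linarith

theorem awayFrom_univ {t : ℂ} (ht : |t.re| < 1 / 2) (ht0 : t ≠ 0) : AwayFrom univ t := by
  obtain ⟨ε, hε, δ, hδ, h⟩ := awayFrom_compl_zero ht
  have h0 : 0 < ‖t‖ := norm_pos_iff.2 ht0
  refine ⟨min ε (‖t‖ / 2), by positivity, min δ (‖t‖ / 2), by positivity, fun t' ht' n _ => ?_⟩
  rw [Metric.mem_ball, lt_min_iff] at ht'
  by_cases hn : n = 0
  · subst hn
    have h1 := norm_sub_norm_le t t'
    rw [norm_sub_rev] at h1
    have h2 := ht'.2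
    rw [dist_eq_norm] at h2
    have h3 := min_le_right δ (‖t‖ / 2)
    simp only [Int.cast_zero, abs_zero, zero_add, mul_one, add_zero]
    linarith
  · refine le_trans ?_ (h t' ht'.1 n hn)
    gcongr
    exact min_le_left _ _

theorem summable_int_abs_add_one_pow_mul_exp (p : ℕ) {r : ℝ} (hr : 0 < r) :
    Summable fun n : ℤ => (|(n : ℝ)| + 1) ^ p * Real.exp (-r * (|(n : ℝ)| + 1)) := by
  have h := summable_natCast_add_one_pow_mul_exp p hr
  refine Summable.of_nat_of_neg ?_ ?_ <;> simpa using h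

/-- The powers of t + n grow like a power of |n| + 1, whereas `norm_fourierBessel_le` decays like
exp(-|t + n|) ≤ exp(-δ(|n| + 1)). -/
theorem latticeBesselTerm_bound {N : Set ℤ} {t : ℂ} {ε δ : ℝ} (hδ : 0 < δ)
    (h : ∀ t' ∈ Metric.ball t ε, ∀ n ∈ N, δ * (|(n : ℝ)| + 1) ≤ ‖t' + n‖) (k : ℕ × ℕ × ℕ × ℕ) :
    ∃ u : N → ℝ, Summable u ∧
      ∀ (n : N) (x : Base), x.1 ∈ Metric.ball t ε → ‖latticeBesselTerm k n x‖ ≤ u n := by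
  obtain ⟨C, hC, hb⟩ := norm_fourierBessel_le k.1 k.2.1 (y₀ := δ ^ 2) (by positivity)
  set R := ‖t‖ + |ε| + 1 with hR
  have hR1 : 1 ≤ R := by rw [hR]; linarith [norm_nonneg t, abs_nonneg ε]
  set e := k.2.2.1 + k.2.2.2 with he
  have hsum : Summable fun n : ℤ => R ^ e * C *
      ((|(n : ℝ)| + 1) ^ e * Real.exp (-δ * (|(n : ℝ)| + 1))) :=
    (summable_int_abs_add_one_pow_mul_exp e hδ).mul_left _
  refine ⟨_, hsum.comp_injective (Subtype.val_injective (p := fun n : ℤ => n ∈ N)),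
    fun n x hx => ?_⟩
  have h1 := h x.1 hx n n.2
  have hn1 : (1 : ℝ) ≤ |((n : ℤ) : ℝ)| + 1 := by linarith [abs_nonneg ((n : ℤ) : ℝ)]
  have h2 : ‖x.1 + (n : ℤ)‖ ≤ R * (|((n : ℤ) : ℝ)| + 1) := by
    have h3 : ‖x.1‖ ≤ ‖t‖ + |ε| := by
      have h4 := norm_sub_norm_le x.1 t
      have h5 : ‖x.1 - t‖ < ε := by simpa [dist_eq_norm] using hx
      linarith [le_abs_self ε]
    have h6 := norm_add_le x.1 ((n : ℤ) : ℂ)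
    rw [Complex.norm_intCast] at h6
    have := abs_nonneg ((n : ℤ) : ℝ)
    nlinarith
  have h0 : 0 ≤ ‖x.1 + (n : ℤ)‖ := norm_nonneg _
  have h7 := hb (Complex.normSq (x.1 + (n : ℤ))) x.2 (by
    rw [Complex.normSq_eq_norm_sq]
    have : δ ≤ ‖x.1 + (n : ℤ)‖ := le_trans (le_mul_of_one_le_right hδ.le hn1) h1
    gcongr)
  rw [Complex.normSq_eq_norm_sq, Real.sqrt_sq h0] at h7
  unfold latticeBesselTerm
  rw [norm_mul, norm_mul, norm_pow, norm_pow, RCLike.norm_conj, ← pow_add,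
    Complex.normSq_eq_norm_sq]
  calc ‖x.1 + (n : ℤ)‖ ^ e * ‖fourierBessel k.1 k.2.1 (‖x.1 + (n : ℤ)‖ ^ 2) x.2‖
      ≤ (R * (|((n : ℤ) : ℝ)| + 1)) ^ e * (C * Real.exp (-δ * (|((n : ℤ) : ℝ)| + 1))) := by
        gcongr
        refine h7.trans ?_
        gcongr
        linarith
    _ = R ^ e * C * ((|((n : ℤ) : ℝ)| + 1) ^ e * Real.exp (-δ * (|((n : ℤ) : ℝ)| + 1))) := by
        rw [mul_pow]; ring

theorem summable_latticeBesselTerm {N : Set ℤ} {x : Base} (h : AwayFrom N x.1)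
    (k : ℕ × ℕ × ℕ × ℕ) : Summable fun n : N => latticeBesselTerm k n x := by
  obtain ⟨ε, hε, δ, hδ, h⟩ := h
  obtain ⟨u, hu, hb⟩ := latticeBesselTerm_bound hδ h k
  exact Summable.of_norm_bounded hu fun n => hb n x (Metric.mem_ball_self hε)

/-- The coefficients of the derivative of `latticeBessel` in the direction of `dt`. -/
def dtIdx (k : ℕ × ℕ × ℕ × ℕ) (f : ℕ × ℕ × ℕ × ℕ → ℂ) : ℂ :=
  k.2.2.1 * f (k.1, k.2.1, k.2.2.1 - 1, k.2.2.2) -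
    f (k.1 + 2, k.2.1 + 1, k.2.2.1, k.2.2.2 + 1)

/-- The coefficients of the derivative of `latticeBessel` in the direction of `dt̄`. -/
def dtbarIdx (k : ℕ × ℕ × ℕ × ℕ) (f : ℕ × ℕ × ℕ × ℕ → ℂ) : ℂ :=
  k.2.2.2 * f (k.1, k.2.1, k.2.2.1, k.2.2.2 - 1) -
    f (k.1 + 2, k.2.1 + 1, k.2.2.1 + 1, k.2.2.2)

/-- The coefficients of the derivative of `latticeBessel` in the direction of `dθ_β`. -/
def dθIdx (k : ℕ × ℕ × ℕ × ℕ) (f : ℕ × ℕ × ℕ × ℕ → ℂ) : ℂ :=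
  Complex.I * f (k.1 + 1, k.2.1, k.2.2.1, k.2.2.2)

/-- With y = |z|² one has dy = z̄ dz + z dz̄, so the Bessel factor contributes an extra z̄ in the
direction dt and an extra z in the direction dt̄. The truncated exponents q - 1 and r - 1 at zero
are harmless, being multiplied by q or r. -/
theorem hasFDerivAt_latticeBesselTerm (k : ℕ × ℕ × ℕ × ℕ) (n : ℤ) {x : Base}
    (hx : x.1 + n ≠ 0) :
    HasFDerivAt (latticeBesselTerm k n)
      (dtIdx k (fun k => latticeBesselTerm k n x) • dt +
        dtbarIdx k (fun k => latticeBesselTerm k n x) • conjForm dt +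
        dθIdx k (fun k => latticeBesselTerm k n x) • dθβ) x := by
  have hpos := Complex.normSq_pos.2 hx
  have hz : HasFDerivAt (fun x : Base => x.1 + (n : ℂ)) dt x := dt.hasFDerivAt.add_const _
  have hzb : HasFDerivAt (fun x : Base => (starRingEnd ℂ) (x.1 + (n : ℂ))) (conjForm dt) x :=
    (Complex.conjCLE : ℂ →L[ℝ] ℂ).hasFDerivAt.comp x hz
  have hn : HasFDerivAt (fun x : Base => Complex.normSq (x.1 + (n : ℂ)))
      (Complex.reCLM ∘L ((x.1 + (n : ℂ)) • conjForm dt +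
        (starRingEnd ℂ) (x.1 + (n : ℂ)) • dt)) x := by
    refine (Complex.reCLM.hasFDerivAt.comp x (hz.mul hzb)).congr_of_eventuallyEq
      (Eventually.of_forall fun y => ?_)
    simp [Complex.normSq_apply]
  have hF := (hasFDerivAt_fourierBessel k.1 k.2.1
    (x := (Complex.normSq (x.1 + (n : ℂ)), x.2)) hpos).comp x
    (hn.prodMk ((ContinuousLinearMap.snd ℝ ℂ ℝ).hasFDerivAt (x := x)))
  have h := ((hz.pow k.2.2.1).mul (hzb.pow k.2.2.2)).mul hF
  refine HasFDerivAt.congr_fderiv h ?_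
  refine ContinuousLinearMap.ext fun v => ?_
  have hre : (((x.1 + (n : ℂ)) * (starRingEnd ℂ) v.1 + (starRingEnd ℂ) (x.1 + (n : ℂ)) * v.1).re
      : ℂ) = (x.1 + (n : ℂ)) * (starRingEnd ℂ) v.1 + (starRingEnd ℂ) (x.1 + (n : ℂ)) * v.1 := by
    apply Complex.conj_eq_iff_re.1
    simp [mul_comm, add_comm]
  simp only [add_apply, smul_apply,
    ContinuousLinearMap.comp_apply, ContinuousLinearMap.prod_apply, covFst_apply, covSnd_apply,
    Complex.reCLM_apply, dt_apply, conjForm_apply, dθβ_apply, smul_eq_mul, hre,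
    ContinuousLinearMap.coe_snd', dtIdx, dtbarIdx, dθIdx, latticeBesselTerm, Function.comp,
    nsmul_eq_mul, Pi.mul_apply]
  ring

theorem latticeBessel_congr {N : Set ℤ} {x : Base} (h : AwayFrom N x.1) (k : ℕ × ℕ × ℕ × ℕ) :
    (∑' n : N, (dtIdx k (fun k => latticeBesselTerm k n x) • dt +
        dtbarIdx k (fun k => latticeBesselTerm k n x) • conjForm dt +
        dθIdx k (fun k => latticeBesselTerm k n x) • dθβ)) =
      dtIdx k (fun k => latticeBessel N k x) • dt +
        dtbarIdx k (fun k => latticeBessel N k x) • conjForm dt +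
        dθIdx k (fun k => latticeBessel N k x) • dθβ := by
  have hs := summable_latticeBesselTerm h
  have H : ∀ k, HasSum (fun n : N => latticeBesselTerm k n x) (latticeBessel N k x) :=
    fun k => (hs k).hasSum
  refine HasSum.tsum_eq ?_
  unfold dtIdx dtbarIdx dθIdx
  exact (((((H _).mul_left _).sub (H _)).smul_const dt).add
    ((((H _).mul_left _).sub (H _)).smul_const (conjForm dt))).add
    (((H _).mul_left _).smul_const dθβ)

theorem hasFDerivAt_latticeBessel {N : Set ℤ} {x : Base} (h : AwayFrom N x.1)
    (k : ℕ × ℕ × ℕ × ℕ) :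
    HasFDerivAt (latticeBessel N k)
      (dtIdx k (fun k => latticeBessel N k x) • dt +
        dtbarIdx k (fun k => latticeBessel N k x) • conjForm dt +
        dθIdx k (fun k => latticeBessel N k x) • dθβ) x := by
  rw [← latticeBessel_congr h k]
  have hsum0 := summable_latticeBesselTerm h k
  obtain ⟨ε, hε, δ, hδ, h⟩ := h
  have hb := fun k => latticeBesselTerm_bound hδ h k
  choose u hu hb using hb
  have hconv : Convex ℝ (Prod.fst ⁻¹' Metric.ball x.1 ε : Set Base) :=
    (convex_ball _ _).linear_preimage (LinearMap.fst ℝ ℂ ℝ)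
  have hxs : x ∈ (Prod.fst ⁻¹' Metric.ball x.1 ε : Set Base) := Metric.mem_ball_self hε
  have hu' : Summable fun n : N =>
      (k.2.2.1 * u (k.1, k.2.1, k.2.2.1 - 1, k.2.2.2) n +
        u (k.1 + 2, k.2.1 + 1, k.2.2.1, k.2.2.2 + 1) n) +
      (k.2.2.2 * u (k.1, k.2.1, k.2.2.1, k.2.2.2 - 1) n +
        u (k.1 + 2, k.2.1 + 1, k.2.2.1 + 1, k.2.2.2) n) +
      u (k.1 + 1, k.2.1, k.2.2.1, k.2.2.2) n :=
    ((((hu _).mul_left _).add (hu _)).add (((hu _).mul_left _).add (hu _))).add (hu _)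
  refine hasFDerivAt_tsum_of_isPreconnected (𝕜 := ℝ) hu'
    (Metric.isOpen_ball.preimage continuous_fst) hconv.isPreconnected
    (f := fun (n : N) => latticeBesselTerm k n)
    (fun n z hz => hasFDerivAt_latticeBesselTerm k n ?_) (fun n z hz => ?_) hxs hsum0 hxs
  · intro h0
    have := h z.1 hz n n.2
    rw [h0, norm_zero] at this
    have : 0 < δ * (|((n : ℤ) : ℝ)| + 1) := by positivity
    linarith
  · have hb' := fun k => hb k n z hz
    have key : ∀ (c : ℂ) (L : Base →L[ℝ] ℂ) (B : ℝ), ‖L‖ ≤ 1 → ‖c‖ ≤ B → ‖c • L‖ ≤ B := by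
      intro c L B hL hc
      rw [norm_smul]
      exact (mul_le_of_le_one_right (norm_nonneg _) hL).trans hc
    refine norm_add₃_le.trans (add_le_add_three (key _ _ _ norm_dt_le ?_)
      (key _ _ _ norm_conjForm_dt_le ?_) (key _ _ _ norm_dθβ_le ?_))
    · refine (norm_sub_le _ _).trans (add_le_add ?_ (hb' _))
      rw [norm_mul, Complex.norm_natCast]
      exact mul_le_mul_of_nonneg_left (hb' _) (Nat.cast_nonneg _)
    · refine (norm_sub_le _ _).trans (add_le_add ?_ (hb' _))
      rw [norm_mul, Complex.norm_natCast]
      exact mul_le_mul_of_nonneg_left (hb' _) (Nat.cast_nonneg _)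
    · unfold dθIdx
      rw [norm_mul, Complex.norm_I, one_mul]
      exact hb' _

theorem contDiffOn_latticeBessel {N : Set ℤ} {U : Set Base} (hU : IsOpen U)
    (h : ∀ x ∈ U, AwayFrom N x.1) (k : ℕ × ℕ × ℕ × ℕ) :
    ContDiffOn ℝ ∞ (latticeBessel N k) U := by
  have hd : ∀ k, ∀ x ∈ U, HasFDerivAt (latticeBessel N k)
      (dtIdx k (fun k => latticeBessel N k x) • dt +
        dtbarIdx k (fun k => latticeBessel N k x) • conjForm dt +
        dθIdx k (fun k => latticeBessel N k x) • dθβ) x :=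
    fun k x hx => hasFDerivAt_latticeBessel (h x hx) k
  refine contDiffOn_infty_of_hasFDerivAt_family hU _ _ hd (fun n ih k => ?_) k
  unfold dtIdx dtbarIdx dθIdx
  exact ((((contDiffOn_const.mul (ih _)).sub (ih _)).smul contDiffOn_const).add
    (((contDiffOn_const.mul (ih _)).sub (ih _)).smul contDiffOn_const)).add
    ((contDiffOn_const.mul (ih _)).smul contDiffOn_const)

/-- The factor y = z z̄ of the middle term is absorbed into the exponents (1, 1), so the recursion
stays within the family. -/
theorem latticeBessel_recursion {N : Set ℤ} {x : Base} (h : AwayFrom N x.1) (p : ℕ) :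
    latticeBessel N (p, 1, 0, 0) x - latticeBessel N (p + 2, 2, 1, 1) x +
      Real.pi ^ 2 * latticeBessel N (p, 0, 0, 0) x = 0 := by
  have hs := summable_latticeBesselTerm h
  unfold latticeBessel
  rw [← tsum_mul_left, ← (hs _).tsum_sub (hs _),
    ← ((hs _).sub (hs _)).tsum_add ((hs _).mul_left _)]
  convert tsum_zero with n
  have hz := h.ne_zero n.2
  have := fourierBessel_recursion p (Complex.normSq_pos.2 hz) x.2
  rw [Complex.normSq_eq_conj_mul_self] at this
  simp only [latticeBesselTerm, pow_zero, one_mul, pow_one]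
  linear_combination this

/-! ### Monopole pairs -/

/-- The potential `∑_{n ∈ N} pairPot |t + n|² θ`. -/
def latticePot (N : Set ℤ) (x : Base) : ℝ := 1 / Real.pi * (latticeBessel N (0, 0, 0, 0) x).re

/-- The sum `∑_{n ∈ N} pairConn |t + n|² θ * (t + n)`. -/
def latticeConn (N : Set ℤ) (x : Base) : ℂ :=
  1 / (Complex.I * Real.pi) * (latticeBessel N (1, 1, 1, 0) x -
    (starRingEnd ℂ) (latticeBessel N (1, 1, 0, 1) x))

/-- The monopole equation for a potential `w` and a connection form `Im (conj c dt)`. -/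
def IsMonopoleAt (c : Base → ℂ) (w : Base → ℝ) (x : Base) : Prop :=
  ∃ P Q ct cb : ℂ, HasFDerivAt (fun x => (w x : ℂ))
      (P • dt + (starRingEnd ℂ) P • conjForm dt + Q • dθβ) x ∧
    HasFDerivAt c (ct • dt + cb • conjForm dt + (-2 * (starRingEnd ℂ) P) • dθβ) x ∧
    (ct + (starRingEnd ℂ) ct) = 4 * Real.pi ^ 2 * Q

theorem hasFDerivAt_conj {E : Type} [NormedAddCommGroup E] [NormedSpace ℝ E] {f : E → ℂ}
    {f' : E →L[ℝ] ℂ} {x : E} (h : HasFDerivAt f f' x) :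
    HasFDerivAt (fun x => (starRingEnd ℂ) (f x)) (conjForm f') x :=
  (Complex.conjCLE : ℂ →L[ℝ] ℂ).hasFDerivAt.comp x h

/-- Everything is read off from the index rules except ∂c/∂t: there the combination with indices
(1,1,0,0) and (3,2,1,1) appears, together with its conjugate, and the recursion replaces it by -π²
times the series (1,0,0,0), which is also what ∂w/∂θ produces. -/
theorem isMonopoleAt_lattice {N : Set ℤ} {x : Base} (h : AwayFrom N x.1) :
    IsMonopoleAt (latticeConn N) (latticePot N) x := by
  have hd := hasFDerivAt_latticeBessel h
  have hpi : (Real.pi : ℂ) ≠ 0 := by exact_mod_cast Real.pi_ne_zero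
  have hrec : latticeBessel N (1, 1, 0, 0) x - latticeBessel N (3, 2, 1, 1) x +
    Real.pi ^ 2 * latticeBessel N (1, 0, 0, 0) x = 0 := latticeBessel_recursion h 1
  have h2 : (starRingEnd ℂ) 2 = 2 := map_ofNat _ 2
  have hrec' := congrArg (starRingEnd ℂ) hrec
  simp only [map_add, map_sub, map_mul, map_pow, Complex.conj_ofReal, map_zero] at hrec'
  refine ⟨-(1 / (2 * Real.pi)) * (latticeBessel N (2, 1, 0, 1) x +
      (starRingEnd ℂ) (latticeBessel N (2, 1, 1, 0) x)),
    Complex.I / (2 * Real.pi) * (latticeBessel N (1, 0, 0, 0) x -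
      (starRingEnd ℂ) (latticeBessel N (1, 0, 0, 0) x)),
    Complex.I * Real.pi * (latticeBessel N (1, 0, 0, 0) x -
      (starRingEnd ℂ) (latticeBessel N (1, 0, 0, 0) x)),
    1 / (Complex.I * Real.pi) * (-latticeBessel N (3, 2, 2, 0) x +
      (starRingEnd ℂ) (latticeBessel N (3, 2, 0, 2) x)), ?_, ?_, ?_⟩
  · have h0 := ((hd (0, 0, 0, 0)).add (hasFDerivAt_conj (hd (0, 0, 0, 0)))).const_mul
      (1 / (2 * Real.pi) : ℂ)
    refine (h0.congr_of_eventuallyEq (Eventually.of_forall fun y => ?_)).congr_fderiv ?_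
    · simp only [latticePot, Pi.add_apply, Complex.add_conj]
      push_cast
      field_simp
    · refine ContinuousLinearMap.ext fun v => ?_
      simp [dtIdx, dtbarIdx, dθIdx, h2]
      field_simp
      ring
  · have h0 := ((hd (1, 1, 1, 0)).sub (hasFDerivAt_conj (hd (1, 1, 0, 1)))).const_mul
      (1 / (Complex.I * Real.pi) : ℂ)
    refine HasFDerivAt.congr_fderiv h0 ?_
    refine ContinuousLinearMap.ext fun v => ?_
    simp [dtIdx, dtbarIdx, dθIdx, h2]
    field_simp
    ring_nf
    simp only [Complex.I_sq]
    linear_combination (-Complex.I) * v.1 * hrec + Complex.I * v.1 * hrec'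
  · simp
    field_simp
    ring

end ConifoldHK

end

noncomputable section

namespace ConifoldHK

open MeasureTheory Filter Topology

/-! ### Gibbons-Hawking forms on the base -/

/-- The form `(1 / 2π) dt ∧ (Im (conj c dt) - (κ + i w) dθ)`. -/
def ghHol (c : ℂ) (w κ : ℝ) : Base [⋀^Fin 2]→L[ℝ] ℂ :=
  (Complex.I / (4 * Real.pi) * c) • wedge dt (conjForm dt) -
    ((κ + Complex.I * w) / (2 * Real.pi)) • wedge dt dθβ

/-- The form `(i / 2) w dt ∧ d(conj t) + (1 / 4π²) dθ ∧ Im (conj c dt)`. -/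
def ghThree (c : ℂ) (w : ℝ) : Base [⋀^Fin 2]→L[ℝ] ℂ :=
  (Complex.I / 2 * w) • wedge dt (conjForm dt) -
    (Complex.I / (8 * Real.pi ^ 2) * (starRingEnd ℂ) c) • wedge dθβ dt +
    (Complex.I / (8 * Real.pi ^ 2) * c) • wedge dθβ (conjForm dt)

/-- The real forms with holomorphic part `ghHol` and third form `ghThree`. -/
def gh (α : Fin 3) (c : ℂ) (w κ : ℝ) : Base [⋀^Fin 2]→L[ℝ] ℝ :=
  ![Complex.reCLM.compContinuousAlternatingMap (ghHol c w κ),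
    Complex.imCLM.compContinuousAlternatingMap (ghHol c w κ),
    Complex.reCLM.compContinuousAlternatingMap (ghThree c w)] α

theorem ghHol_apply (c : ℂ) (w κ : ℝ) (v : Fin 2 → Base) :
    ghHol c w κ v = Complex.I / (4 * Real.pi) * c *
        ((v 0).1 * (starRingEnd ℂ) (v 1).1 - (v 1).1 * (starRingEnd ℂ) (v 0).1) -
      (κ + Complex.I * w) / (2 * Real.pi) * ((v 0).1 * (v 1).2 - (v 1).1 * (v 0).2) := by
  simp [ghHol, wedge_apply]

theorem ghThree_apply (c : ℂ) (w : ℝ) (v : Fin 2 → Base) :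
    ghThree c w v = Complex.I / 2 * w *
        ((v 0).1 * (starRingEnd ℂ) (v 1).1 - (v 1).1 * (starRingEnd ℂ) (v 0).1) -
      Complex.I / (8 * Real.pi ^ 2) * (starRingEnd ℂ) c *
        ((v 0).2 * (v 1).1 - (v 1).2 * (v 0).1) +
      Complex.I / (8 * Real.pi ^ 2) * c *
        ((v 0).2 * (starRingEnd ℂ) (v 1).1 - (v 1).2 * (starRingEnd ℂ) (v 0).1) := by
  simp [ghThree, wedge_apply]

theorem ghHol_add (c c' : ℂ) (w w' κ κ' : ℝ) :
    ghHol (c + c') (w + w') (κ + κ') = ghHol c w κ + ghHol c' w' κ' := by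
  ext v
  simp only [ContinuousAlternatingMap.add_apply, ghHol_apply]
  push_cast
  ring

theorem ghThree_add (c c' : ℂ) (w w' : ℝ) :
    ghThree (c + c') (w + w') = ghThree c w + ghThree c' w' := by
  ext v
  simp only [ContinuousAlternatingMap.add_apply, ghThree_apply, map_add]
  push_cast
  ring

theorem contDiffOn_ofReal {E : Type} [NormedAddCommGroup E] [NormedSpace ℝ E] {w : E → ℝ}
    {U : Set E} (hw : ContDiffOn ℝ ∞ w U) : ContDiffOn ℝ ∞ (fun x => (w x : ℂ)) U :=
  Complex.ofRealCLM.contDiff.comp_contDiffOn hw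

theorem contDiffOn_conj {E : Type} [NormedAddCommGroup E] [NormedSpace ℝ E] {w : E → ℂ}
    {U : Set E} (hw : ContDiffOn ℝ ∞ w U) : ContDiffOn ℝ ∞ (fun x => (starRingEnd ℂ) (w x)) U :=
  (Complex.conjCLE : ℂ →L[ℝ] ℂ).contDiff.comp_contDiffOn hw

/-- Composition with a real linear functional as a linear map on two-forms. -/
def realPart (F : Type) [NormedAddCommGroup F] [NormedSpace ℝ F] (L : ℂ →L[ℝ] ℝ) :
    F [⋀^Fin 2]→L[ℝ] ℂ →L[ℝ] F [⋀^Fin 2]→L[ℝ] ℝ :=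
  ContinuousLinearMap.compContinuousAlternatingMapCLM ℝ F ℂ ℝ (Fin 2) L

theorem contDiffOn_realPart {E F : Type} [NormedAddCommGroup E] [NormedSpace ℝ E]
    [NormedAddCommGroup F] [NormedSpace ℝ F] (L : ℂ →L[ℝ] ℝ) {Φ : E → F [⋀^Fin 2]→L[ℝ] ℂ}
    {U : Set E} (h : ContDiffOn ℝ ∞ Φ U) :
    ContDiffOn ℝ ∞ (fun x => L.compContinuousAlternatingMap (Φ x)) U :=
  (realPart F L).contDiff.comp_contDiffOn h

theorem contDiffOn_gh {E : Type} [NormedAddCommGroup E] [NormedSpace ℝ E] (α : Fin 3)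
    {c : E → ℂ} {w κ : E → ℝ} {U : Set E} (hc : ContDiffOn ℝ ∞ c U) (hw : ContDiffOn ℝ ∞ w U)
    (hκ : ContDiffOn ℝ ∞ κ U) : ContDiffOn ℝ ∞ (fun x => gh α (c x) (w x) (κ x)) U := by
  have hw' := contDiffOn_ofReal hw
  have hκ' := contDiffOn_ofReal hκ
  have h1 : ContDiffOn ℝ ∞ (fun x => ghHol (c x) (w x) (κ x)) U :=
    ((contDiffOn_const.mul hc).smul contDiffOn_const).sub
      (((hκ'.add (contDiffOn_const.mul hw')).div_const _).smul contDiffOn_const)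
  have h2 : ContDiffOn ℝ ∞ (fun x => ghThree (c x) (w x)) U :=
    (((contDiffOn_const.mul hw').smul contDiffOn_const).sub
      ((contDiffOn_const.mul (contDiffOn_conj hc)).smul contDiffOn_const)).add
      ((contDiffOn_const.mul hc).smul contDiffOn_const)
  fin_cases α
  · exact contDiffOn_realPart _ h1
  · exact contDiffOn_realPart _ h1
  · exact contDiffOn_realPart _ h2

theorem extDeriv_apply_of_hasFDerivAt {E G : Type} [NormedAddCommGroup E] [NormedSpace ℝ E]
    [NormedAddCommGroup G] [NormedSpace ℝ G] {n : ℕ} {Ψ : E → E [⋀^Fin n]→L[ℝ] G}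
    {Ψ' : E →L[ℝ] E [⋀^Fin n]→L[ℝ] G} {x : E} (h : HasFDerivAt Ψ Ψ' x) (v : Fin (n + 1) → E) :
    extDeriv Ψ x v = ∑ i, (-1) ^ i.val • Ψ' (v i) (i.removeNth v) := by
  rw [extDeriv, h.fderiv, ContinuousAlternatingMap.alternatizeUncurryFin_apply]

theorem extDeriv_realPart {F : Type} [NormedAddCommGroup F] [NormedSpace ℝ F] (L : ℂ →L[ℝ] ℝ)
    {Φ : F → F [⋀^Fin 2]→L[ℝ] ℂ} {x : F} (h : DifferentiableAt ℝ Φ x) :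
    extDeriv (fun x => L.compContinuousAlternatingMap (Φ x)) x =
      L.compContinuousAlternatingMap (extDeriv Φ x) := by
  have h1 : HasFDerivAt (fun x => L.compContinuousAlternatingMap (Φ x))
      ((realPart F L) ∘L fderiv ℝ Φ x) x := (realPart F L).hasFDerivAt.comp x h.hasFDerivAt
  ext v
  rw [extDeriv_apply_of_hasFDerivAt h1, ContinuousLinearMap.compContinuousAlternatingMap_coe,
    Function.comp, extDeriv_apply_of_hasFDerivAt h.hasFDerivAt, map_sum]
  refine Finset.sum_congr rfl fun i _ => ?_
  rw [map_zsmul]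
  rfl

/-- On a three-dimensional base only the component dt ∧ dt̄ ∧ dθ matters; it vanishes because ∂c/∂θ
= -2 ∂w/∂t̄. -/
theorem extDeriv_ghHol {c : Base → ℂ} {w : Base → ℝ} {x : Base} (h : IsMonopoleAt c w x) :
    DifferentiableAt ℝ (fun x => ghHol (c x) (w x) 0) x ∧
      extDeriv (fun x => ghHol (c x) (w x) 0) x = 0 := by
  obtain ⟨P, Q, ct, cb, hw, hc, -⟩ := h
  have hd : HasFDerivAt (fun x => ghHol (c x) (w x) 0) _ x :=
    ((hc.const_mul (Complex.I / (4 * Real.pi))).smul_const (wedge dt (conjForm dt))).sub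
      ((((hw.const_mul Complex.I).const_add (((0 : ℝ) : ℂ))).mul_const
        ((2 * Real.pi : ℂ)⁻¹)).smul_const (wedge dt dθβ))
  refine ⟨hd.differentiableAt, ?_⟩
  ext v
  rw [extDeriv_apply_of_hasFDerivAt hd]
  simp [Fin.sum_univ_three, wedge_apply, Fin.removeNth, Fin.succAbove]
  ring

/-- Here the single component vanishes by the remaining monopole equation 2 Re ∂c/∂t = 4π² ∂w/∂θ. -/
theorem extDeriv_ghThree {c : Base → ℂ} {w : Base → ℝ} {x : Base} (h : IsMonopoleAt c w x) :
    DifferentiableAt ℝ (fun x => ghThree (c x) (w x)) x ∧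
      extDeriv (fun x => ghThree (c x) (w x)) x = 0 := by
  obtain ⟨P, Q, ct, cb, hw, hc, hQ⟩ := h
  have hd : HasFDerivAt (fun x => ghThree (c x) (w x)) _ x :=
    (((hw.const_mul (Complex.I / 2)).smul_const (wedge dt (conjForm dt))).sub
      (((hasFDerivAt_conj hc).const_mul
        (Complex.I / (8 * Real.pi ^ 2))).smul_const (wedge dθβ dt))).add
      ((hc.const_mul (Complex.I / (8 * Real.pi ^ 2))).smul_const (wedge dθβ (conjForm dt)))
  refine ⟨hd.differentiableAt, ?_⟩
  have hpi : (Real.pi : ℂ) ≠ 0 := by exact_mod_cast Real.pi_ne_zero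
  have hQ' : Q = (ct + (starRingEnd ℂ) ct) / (4 * Real.pi ^ 2) := by rw [hQ]; field_simp
  ext v
  rw [extDeriv_apply_of_hasFDerivAt hd, hQ']
  simp [Fin.sum_univ_three, wedge_apply, Fin.removeNth, Fin.succAbove]
  field_simp
  ring

end ConifoldHK

end

noncomputable section

namespace ConifoldHK

open MeasureTheory Filter Topology

/-! ### The dual period of the resolved conifold -/

/-- The strip `|Re t| < 1 / 2`. -/
def strip : Set ℂ := {t | |t.re| < 1 / 2}

theorem isOpen_strip : IsOpen strip :=
  isOpen_lt (continuous_abs.comp Complex.continuous_re) continuous_const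

theorem convex_strip : Convex ℝ strip := by
  have : strip = Complex.reLm ⁻¹' (Metric.ball 0 (1 / 2)) := by
    ext t; simp [strip]
  rw [this]
  exact (convex_ball _ _).linear_preimage _

/-- The function `sin (π t) / (π t)`. -/
def csinc (t : ℂ) : ℂ := dslope Complex.sin 0 (Real.pi * t)

theorem csinc_zero : csinc 0 = 1 := by simp [csinc]

theorem csinc_of_ne {t : ℂ} (ht : t ≠ 0) :
    csinc t = Complex.sin (Real.pi * t) / (Real.pi * t) := by
  have hpi : (Real.pi : ℂ) ≠ 0 := by exact_mod_cast Real.pi_ne_zero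
  rw [csinc, dslope_of_ne _ (mul_ne_zero hpi ht), slope_def_field]
  simp

theorem differentiable_csinc : Differentiable ℂ csinc := by
  have h : Differentiable ℂ (dslope Complex.sin 0) := by
    rw [← differentiableOn_univ, Complex.differentiableOn_dslope univ_mem]
    exact Complex.differentiable_sin.differentiableOn
  exact h.comp (differentiable_id.const_mul _)

/-- For z = πt = x + iy, the real part of z̄ sin z is x sin x cosh y + y sinh y cos x, a sum of
non-negative terms when |x| < π/2 that do not both vanish for z ≠ 0. Thus the principal logarithm of
`csinc` is holomorphic on the whole strip. -/
theorem csinc_re_pos {t : ℂ} (ht : t ∈ strip) : 0 < (csinc t).re := by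
  by_cases h0 : t = 0
  · simp [h0, csinc_zero]
  rw [csinc_of_ne h0]
  set z : ℂ := Real.pi * t with hz
  have hpi := Real.pi_pos
  have hz0 : z ≠ 0 := mul_ne_zero (by exact_mod_cast Real.pi_ne_zero) h0
  have hzre : z.re = Real.pi * t.re := by simp [hz]
  have hx : |z.re| < Real.pi / 2 := by
    rw [hzre, abs_mul, abs_of_pos hpi]
    have : |t.re| < 1 / 2 := ht
    nlinarith
  obtain ⟨hx1, hx2⟩ := abs_lt.1 hx
  have hcos : 0 < Real.cos z.re := Real.cos_pos_of_mem_Ioo ⟨hx1, hx2⟩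
  rw [Complex.div_re, ← add_div]
  refine div_pos ?_ (Complex.normSq_pos.2 hz0)
  have hs : Complex.sin z = (Real.sin z.re * Real.cosh z.im : ℝ) +
      (Real.cos z.re * Real.sinh z.im : ℝ) * Complex.I := by
    rw [Complex.sin_eq]; push_cast; rfl
  have hparts {p q : ℝ} : ((p : ℂ) + q * Complex.I).re = p ∧
      ((p : ℂ) + q * Complex.I).im = q := by constructor <;> simp
  have hre : (Complex.sin z).re = Real.sin z.re * Real.cosh z.im := by
    rw [hs, hparts.1]
  have him : (Complex.sin z).im = Real.cos z.re * Real.sinh z.im := by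
    rw [hs, hparts.2]
  rw [hre, him]
  have h1 : 0 ≤ Real.sin z.re * z.re := by
    rcases le_total 0 z.re with h | h
    · exact mul_nonneg (Real.sin_nonneg_of_nonneg_of_le_pi h (by linarith)) h
    · exact mul_nonneg_of_nonpos_of_nonpos
        (Real.sin_nonpos_of_nonpos_of_neg_pi_le h (by linarith)) h
  have h2 : 0 ≤ Real.sinh z.im * z.im := by
    rcases le_total 0 z.im with h | h
    · exact mul_nonneg (Real.sinh_nonneg_iff.2 h) h
    · exact mul_nonneg_of_nonpos_of_nonpos (Real.sinh_nonpos_iff.2 h) h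
  have hch := Real.cosh_pos z.im
  have key : 0 < Real.sin z.re * z.re ∨ 0 < Real.sinh z.im * z.im := by
    by_contra! hcon
    obtain ⟨k1, k2⟩ := hcon
    have e1 : Real.sin z.re * z.re = 0 := le_antisymm k1 h1
    have e2 : Real.sinh z.im * z.im = 0 := le_antisymm k2 h2
    apply hz0
    apply Complex.ext
    · rcases mul_eq_zero.1 e1 with h | h
      · exact (Real.sin_eq_zero_iff_of_lt_of_lt (by linarith) (by linarith)).1 h
      · exact h
    · rcases mul_eq_zero.1 e2 with h | h
      · exact Real.sinh_eq_zero.1 h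
      · exact h
  have e : Real.sin z.re * Real.cosh z.im * z.re + Real.cos z.re * Real.sinh z.im * z.im =
      Real.cosh z.im * (Real.sin z.re * z.re) + Real.cos z.re * (Real.sinh z.im * z.im) := by ring
  rw [e]
  rcases key with h | h
  · exact add_pos_of_pos_of_nonneg (mul_pos hch h) (mul_nonneg hcos.le h2)
  · exact add_pos_of_nonneg_of_pos (mul_nonneg hch.le h1) (mul_pos hcos h)

/-! ### The principal logarithm of 1 - exp(2πit) on the strip -/

/-- The holomorphic function by which `τ` differs from its Ooguri-Vafa counterpart. -/
def tauDiff (t : ℂ) : ℂ := -t / 2 + 1 / (2 * Real.pi * Complex.I) * Complex.log (csinc t)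

theorem tauDiff_zero : tauDiff 0 = 0 := by simp [tauDiff, csinc_zero]

theorem differentiableOn_tauDiff : DifferentiableOn ℂ tauDiff strip := by
  have h : DifferentiableOn ℂ (fun t => Complex.log (csinc t)) strip := fun t ht =>
    ((differentiable_csinc t).clog (Or.inl (csinc_re_pos ht))).differentiableWithinAt
  have h1 : DifferentiableOn ℂ (fun t : ℂ => -t / 2) strip := by fun_prop
  exact h1.add (h.const_mul _)

/-- Isolates the zero at t = 0: the factor -2πit is t/Λ for Λ = i/2π, and the two other factors have
no zero in the strip. -/
theorem one_sub_exp_eq {t : ℂ} (ht : t ≠ 0) :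
    1 - Complex.exp (2 * Real.pi * Complex.I * t) =
      (-(2 * Real.pi * Complex.I * t)) * csinc t * Complex.exp (Real.pi * Complex.I * t) := by
  have hpi : (Real.pi : ℂ) ≠ 0 := by exact_mod_cast Real.pi_ne_zero
  rw [csinc_of_ne ht, Complex.sin,
    show 2 * (Real.pi : ℂ) * Complex.I * t = Real.pi * Complex.I * t + Real.pi * Complex.I * t by
      ring, Complex.exp_add, show -(Real.pi * t : ℂ) * Complex.I = -(Real.pi * Complex.I * t) by ring,
    show (Real.pi * t : ℂ) * Complex.I = Real.pi * Complex.I * t by ring, Complex.exp_neg]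
  have he := Complex.exp_ne_zero (Real.pi * Complex.I * t)
  field_simp
  ring_nf
  simp only [Complex.I_sq]
  ring

/-- The sum of the principal logarithms is a logarithm of the left side; it remains to see that its
imaginary part lies in (-π, π]. The ranges of the arguments allow an excess of less than π on one
side only, and such an excess would give sin the wrong sign, since the imaginary part of 1 -
exp(2πit) is opposite in sign to sin(2π Re t). For Re t = 0 the factor `csinc t` is positive. -/
theorem log_one_sub_exp_eq {t : ℂ} (ht : t ∈ strip) (h0 : t ≠ 0) :
    Complex.log (1 - Complex.exp (2 * Real.pi * Complex.I * t)) =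
      Complex.log (-(2 * Real.pi * Complex.I * t)) + Complex.log (csinc t) +
        Real.pi * Complex.I * t := by
  have hpi := Real.pi_pos
  have hB := csinc_re_pos ht
  have hB0 : csinc t ≠ 0 := by intro h; simp [h] at hB
  have hA0 : -(2 * Real.pi * Complex.I * t) ≠ 0 := by
    simp [h0, Real.pi_ne_zero]
  set w := Complex.log (-(2 * Real.pi * Complex.I * t)) + Complex.log (csinc t) +
        Real.pi * Complex.I * t with hw
  have hexp : Complex.exp w = 1 - Complex.exp (2 * Real.pi * Complex.I * t) := by
    rw [hw, Complex.exp_add, Complex.exp_add, Complex.exp_log hA0, Complex.exp_log hB0,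
      one_sub_exp_eq h0]
  have him : w.im = Complex.arg (-(2 * Real.pi * Complex.I * t)) + Complex.arg (csinc t) +
      Real.pi * t.re := by
    simp [hw, Complex.log_im]
  have hAim : (-(2 * Real.pi * Complex.I * t)).im = -(2 * Real.pi * t.re) := by simp
  have hargB := abs_lt.1 (Complex.abs_arg_lt_pi_div_two_iff.2 (Or.inl hB))
  have hx := abs_lt.1 (show |t.re| < 1 / 2 from ht)
  have hsin : Real.exp w.re * Real.sin w.im =
      -(Real.exp (-(2 * Real.pi * t.im)) * Real.sin (2 * Real.pi * t.re)) := by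
    have := congrArg Complex.im hexp
    rw [Complex.exp_im, Complex.sub_im, Complex.exp_im] at this
    rw [this]
    simp
  have hexp1 := Real.exp_pos w.re
  have hexp2 := Real.exp_pos (-(2 * Real.pi * t.im))
  have h1 := Complex.neg_pi_lt_arg (-(2 * Real.pi * Complex.I * t))
  have h2 := Complex.arg_le_pi (-(2 * Real.pi * Complex.I * t))
  rw [← hexp]
  have hrange : -Real.pi < w.im ∧ w.im ≤ Real.pi := by
    rcases lt_trichotomy t.re 0 with h | h | h
    · have hargA : 0 < Complex.arg (-(2 * Real.pi * Complex.I * t)) := by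
        have h3 := Complex.arg_nonneg_iff.2 (show 0 ≤ (-(2 * Real.pi * Complex.I * t)).im by
          rw [hAim]; nlinarith)
        refine lt_of_le_of_ne h3 fun h4 => ?_
        have := (Complex.arg_eq_zero_iff.1 h4.symm).2
        rw [hAim] at this
        nlinarith
      refine ⟨by rw [him]; nlinarith, ?_⟩
      by_contra! hcon
      have h5 : 0 ≤ Real.sin (w.im - Real.pi) :=
        Real.sin_nonneg_of_nonneg_of_le_pi (by linarith) (by rw [him]; nlinarith)
      rw [Real.sin_sub_pi] at h5
      have h6 : Real.sin (2 * Real.pi * t.re) < 0 :=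
        Real.sin_neg_of_neg_of_neg_pi_lt (by nlinarith) (by nlinarith)
      nlinarith [mul_pos hexp2 (neg_pos.2 h6), mul_nonneg hexp1.le h5]
    · have hA : -(2 * Real.pi * Complex.I * t) = ((2 * Real.pi * t.im : ℝ) : ℂ) := by
        apply Complex.ext <;> simp [h]
      have hBim : (csinc t).im = 0 := by
        rw [csinc_of_ne h0, show t = (t.im : ℂ) * Complex.I by apply Complex.ext <;> simp [h],
          ← mul_assoc, Complex.sin_mul_I, mul_div_mul_right _ _ Complex.I_ne_zero]
        rw [← Complex.ofReal_mul, ← Complex.ofReal_sinh, ← Complex.ofReal_div, Complex.ofReal_im]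
      have : Complex.arg (csinc t) = 0 := Complex.arg_eq_zero_iff.2 ⟨hB.le, hBim⟩
      rw [him, this, h]
      constructor <;> linarith
    · have hargA : Complex.arg (-(2 * Real.pi * Complex.I * t)) < 0 :=
        Complex.arg_neg_iff.2 (by rw [hAim]; nlinarith)
      refine ⟨?_, by rw [him]; nlinarith⟩
      by_contra! hcon
      have h5 : 0 ≤ Real.sin (w.im + 2 * Real.pi) :=
        Real.sin_nonneg_of_nonneg_of_le_pi (by rw [him]; nlinarith) (by linarith)
      rw [Real.sin_add_two_pi] at h5
      have h6 : 0 < Real.sin (2 * Real.pi * t.re) :=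
        Real.sin_pos_of_pos_of_lt_pi (by nlinarith) (by nlinarith)
      nlinarith [mul_pos hexp2 h6, mul_nonneg hexp1.le h5]
  exact Complex.log_exp hrange.1 hrange.2

/-! ### Logarithms on the real axis, vertical rays and the integrand of the dilogarithm -/

theorem clog_ofReal (r : ℝ) :
    Complex.log (r : ℂ) = (Real.log r : ℂ) + (if r < 0 then Real.pi * Complex.I else 0) := by
  split_ifs with h
  · apply Complex.ext
    · simp [Complex.log_re, Real.log_abs]
    · simp [Complex.log_im, Complex.arg_ofReal_of_neg h]
  · rw [add_zero, Complex.ofReal_log (not_lt.1 h)]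

/-- A path inside the real axis may run along the branch cut but never crosses it away from 0: on
negative reals the branch only adds the constant πi. This covers the ray Re t = 0, where -2πit is
real. -/
theorem hasDerivAt_clog_ofReal {r : ℝ → ℝ} {r' u : ℝ} (hr : HasDerivAt r r' u) (h0 : r u ≠ 0) :
    HasDerivAt (fun u => Complex.log (r u : ℂ)) (r' / r u : ℂ) u := by
  have h1 : HasDerivAt (fun u => (Real.log (r u) : ℂ) +
      (if r u < 0 then Real.pi * Complex.I else 0)) ((r' / r u : ℝ) : ℂ) u := by
    have h2 := ((hr.log h0).ofReal_comp).add_const (if r u < 0 then Real.pi * Complex.I else 0)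
    refine h2.congr_of_eventuallyEq ?_
    rcases h0.lt_or_gt with h | h
    · filter_upwards [hr.continuousAt.eventually_lt continuousAt_const h] with v hv
      simp [h, hv]
    · filter_upwards [continuousAt_const.eventually_lt hr.continuousAt h] with v hv
      simp [h.not_gt, hv.not_gt]
  simp_rw [clog_ofReal]
  simpa using h1

/-- The factor r absorbs both the logarithmic singularity and the jump πi at 0, so that a vertical
ray may pass through t = 0. -/
theorem continuous_mul_clog_ofReal : Continuous fun r : ℝ => (r : ℂ) * Complex.log (r : ℂ) := by
  have : (fun r : ℝ => (r : ℂ) * Complex.log (r : ℂ)) =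
      fun r : ℝ => ((r * Real.log r : ℝ) : ℂ) + Real.pi * Complex.I * ((min r 0 : ℝ) : ℂ) := by
    ext r
    rw [clog_ofReal]
    split_ifs with h
    · rw [min_eq_left h.le]; push_cast; ring
    · rw [min_eq_right (not_lt.1 h)]; push_cast; ring
  rw [this]
  exact (Complex.continuous_ofReal.comp Real.continuous_mul_log).add
    (continuous_const.mul (Complex.continuous_ofReal.comp (continuous_id.min continuous_const)))

/-- The vertical ray that starts at `t`, parametrised by `exp (2 π i raise t u) = u * exp (2 π i t)`. -/
def raise (t : ℂ) (u : ℝ) : ℂ := t - Complex.I * (Real.log u / (2 * Real.pi) : ℝ)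

theorem raise_re (t : ℂ) (u : ℝ) : (raise t u).re = t.re := by
  simp only [raise, Complex.sub_re, Complex.mul_re, Complex.I_re, Complex.I_im, Complex.ofReal_re,
    Complex.ofReal_im]
  ring

theorem raise_im (t : ℂ) (u : ℝ) : (raise t u).im = t.im - Real.log u / (2 * Real.pi) := by
  simp only [raise, Complex.sub_im, Complex.mul_im, Complex.I_re, Complex.I_im, Complex.ofReal_re,
    Complex.ofReal_im]
  ring

theorem exp_raise (t : ℂ) {u : ℝ} (hu : 0 < u) :
    Complex.exp (2 * Real.pi * Complex.I * raise t u) =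
      u * Complex.exp (2 * Real.pi * Complex.I * t) := by
  have hpi : (Real.pi : ℂ) ≠ 0 := by exact_mod_cast Real.pi_ne_zero
  rw [raise, show 2 * (Real.pi : ℂ) * Complex.I * (t - Complex.I * ((Real.log u / (2 * Real.pi) : ℝ)
    : ℂ)) = Real.log u + 2 * Real.pi * Complex.I * t by
      push_cast; field_simp; ring_nf; simp only [Complex.I_sq]; ring, Complex.exp_add,
    ← Complex.ofReal_exp, Real.exp_log hu]

theorem hasDerivAt_raise (t : ℂ) {u : ℝ} (hu : 0 < u) :
    HasDerivAt (raise t) (-(Complex.I / (2 * Real.pi * u))) u := by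
  have h := ((((Real.hasDerivAt_log hu.ne').div_const (2 * Real.pi)).ofReal_comp).const_mul
    Complex.I).const_sub t
  refine h.congr_deriv ?_
  push_cast
  field_simp

/-- Near u = 0 the logarithm is O(u) and cancels the denominator. Further out the denominator is
bounded below, the imaginary part of the logarithm is bounded by π, and its real part has at worst
logarithmic singularities. -/
theorem intervalIntegrable_log_one_sub_div (z : ℂ) :
    IntervalIntegrable (fun u : ℝ => Complex.log (1 - (u : ℂ) * z) / (u : ℂ)) volume 0 1 := by
  have hmeas : Measurable (fun u : ℝ => Complex.log (1 - (u : ℂ) * z) / (u : ℂ)) := by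
    apply Measurable.div
    · exact Complex.measurable_log.comp (by fun_prop)
    · fun_prop
  -- Chosen so that u‖z‖ ≤ 1/2 for u ≤ ε, the range of the estimate |log(1 + x)| ≤ (3/2)|x|.
  set ε : ℝ := min 1 (1 / (2 * (‖z‖ + 1))) with hε
  have hz1 : 0 < ‖z‖ + 1 := by positivity
  have hε0 : 0 < ε := by positivity
  have hε1 : ε ≤ 1 := min_le_left _ _
  have hεz : ε * ‖z‖ ≤ 1 / 2 := by
    have h1 : ε * ‖z‖ ≤ 1 / (2 * (‖z‖ + 1)) * (‖z‖ + 1) := by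
      gcongr
      · exact min_le_right _ _
      · linarith
    refine h1.trans (le_of_eq ?_)
    field_simp
  refine IntervalIntegrable.trans (b := ε) ?_ ?_
  · rw [intervalIntegrable_iff_integrableOn_Ioc_of_le hε0.le]
    refine Integrable.mono' (g := fun _ => 3 / 2 * ‖z‖) (integrable_const _)
      hmeas.aestronglyMeasurable ?_
    refine (ae_restrict_iff' measurableSet_Ioc).2 (Eventually.of_forall fun u hu => ?_)
    have hun : ‖-((u : ℂ) * z)‖ = u * ‖z‖ := by
      rw [norm_neg, norm_mul, Complex.norm_real, Real.norm_of_nonneg hu.1.le]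
    have h1 := Complex.norm_log_one_add_half_le_self (z := -((u : ℂ) * z)) (by
      rw [hun]; nlinarith [hu.2, norm_nonneg z])
    rw [hun, ← sub_eq_add_neg] at h1
    rw [norm_div, Complex.norm_real, Real.norm_of_nonneg hu.1.le, div_le_iff₀ hu.1]
    linarith
  · have hlog : IntervalIntegrable (fun u : ℝ => Real.log ‖1 - (u : ℂ) * z‖) volume ε 1 := by
      refine MeromorphicOn.intervalIntegrable_log_norm (f := fun u : ℝ => 1 - (u : ℂ) * z) ?_
      intro u _
      refine AnalyticAt.meromorphicAt ?_
      exact analyticAt_const.sub ((Complex.ofRealCLM.analyticAt u).mul analyticAt_const)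
    rw [intervalIntegrable_iff_integrableOn_Ioc_of_le hε1] at hlog ⊢
    refine Integrable.mono' (g := fun u => ε⁻¹ * (|Real.log ‖1 - (u : ℂ) * z‖| + Real.pi))
      ((hlog.abs.add (integrable_const _)).const_mul _) hmeas.aestronglyMeasurable ?_
    refine (ae_restrict_iff' measurableSet_Ioc).2 (Eventually.of_forall fun u hu => ?_)
    have hu0 : 0 < u := hε0.trans hu.1
    rw [norm_div, Complex.norm_real, Real.norm_of_nonneg hu0.le, div_eq_inv_mul]
    have h1 : ‖Complex.log (1 - (u : ℂ) * z)‖ ≤ |Real.log ‖1 - (u : ℂ) * z‖| + Real.pi := by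
      refine (Complex.norm_le_abs_re_add_abs_im _).trans ?_
      rw [Complex.log_re, Complex.log_im]
      gcongr
      exact Complex.abs_arg_le_pi _
    have := hu.1.le
    gcongr

end ConifoldHK

end

noncomputable section

namespace ConifoldHK

open MeasureTheory Filter Topology

/-! ### The dilogarithm by integration along vertical rays -/

theorem raise_mem_strip {t : ℂ} (ht : t ∈ strip) (u : ℝ) : raise t u ∈ strip := by
  change |(raise t u).re| < 1 / 2
  rw [raise_re]; exact ht

theorem raise_one (t : ℂ) : raise t 1 = t := by simp [raise]

theorem neg_two_pi_I_mul_im (t : ℂ) : (-(2 * Real.pi * Complex.I * t)).im = -(2 * Real.pi * t.re) := by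
  simp

theorem neg_two_pi_I_mul_of_re_eq_zero {t : ℂ} (h : t.re = 0) :
    -(2 * Real.pi * Complex.I * t) = ((2 * Real.pi * t.im : ℝ) : ℂ) := by
  apply Complex.ext <;> simp [h]

theorem eq_im_mul_I_of_re_eq_zero {t : ℂ} (h : t.re = 0) : t = (t.im : ℂ) * Complex.I := by
  apply Complex.ext <;> simp [h]

/-- Off the imaginary axis the ray keeps -2πit out of the real axis and the principal branch is
holomorphic there. On the imaginary axis the path is real and may lie on the cut, which
`hasDerivAt_clog_ofReal` permits. -/
theorem hasDerivAt_log_raise (t : ℂ) {u : ℝ} (hu : 0 < u) (h0 : raise t u ≠ 0) :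
    HasDerivAt (fun u => Complex.log (-(2 * Real.pi * Complex.I * raise t u)))
      (-(Complex.I / (2 * Real.pi * u)) / raise t u) u := by
  have hpi : (Real.pi : ℂ) ≠ 0 := by exact_mod_cast Real.pi_ne_zero
  have hu' : (u : ℂ) ≠ 0 := by exact_mod_cast hu.ne'
  by_cases hx : t.re = 0
  · have hre : ∀ v, (raise t v).re = 0 := fun v => by rw [raise_re, hx]
    simp_rw [fun v => neg_two_pi_I_mul_of_re_eq_zero (hre v)]
    have hd : HasDerivAt (fun v => 2 * Real.pi * (raise t v).im) (-u⁻¹) u := by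
      simp_rw [raise_im]
      refine ((((Real.hasDerivAt_log hu.ne').div_const (2 * Real.pi)).const_sub
        t.im).const_mul (2 * Real.pi)).congr_deriv ?_
      field_simp
    have him : (raise t u).im ≠ 0 := fun h => h0 (Complex.ext (hre u) h)
    refine (hasDerivAt_clog_ofReal hd (by simp [him, Real.pi_ne_zero])).congr_deriv ?_
    rw [eq_im_mul_I_of_re_eq_zero (hre u)]
    have him' : ((raise t u).im : ℂ) ≠ 0 := by exact_mod_cast him
    push_cast
    simp only [Complex.mul_im, Complex.ofReal_re, Complex.ofReal_im, Complex.I_re, Complex.I_im,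
      mul_one, mul_zero, add_zero]
    field_simp
  · have hsl : -(2 * Real.pi * Complex.I * raise t u) ∈ Complex.slitPlane := by
      refine Or.inr ?_
      rw [neg_two_pi_I_mul_im, raise_re]
      simp [hx, Real.pi_ne_zero]
    refine (((hasDerivAt_raise t hu).const_mul (2 * Real.pi * Complex.I)).neg.clog_real
      hsl).congr_deriv ?_
    simp only [Pi.neg_apply]
    field_simp

/-- A primitive of `log (1 - exp (2 π i t)) / 2 π i`, given a primitive `H` of `tauDiff`. -/
def periodPrim (H : ℂ → ℂ) (t : ℂ) : ℂ :=
  1 / (2 * Real.pi * Complex.I) * (t * Complex.log (-(2 * Real.pi * Complex.I * t)) - t) + H t +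
    t ^ 2 / 2

/-- By `log_one_sub_exp_eq` the derivative of `periodPrim` in t is log(1 - exp(2πit))/2πi: the terms
-t/2 of `tauDiff` and t of t²/2 combine to the contribution of πit. Along the ray, dt = -i du/(2πu)
yields the integrand of the dilogarithm. -/
theorem hasDerivAt_periodPrim_raise {H : ℂ → ℂ} (hH : ∀ t ∈ strip, HasDerivAt H (tauDiff t) t)
    {t : ℂ} (ht : t ∈ strip) {u : ℝ} (hu : 0 < u) (h0 : raise t u ≠ 0) :
    HasDerivAt (fun u => periodPrim H (raise t u)) (-(1 / (4 * Real.pi ^ 2)) *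
      (Complex.log (1 - u * Complex.exp (2 * Real.pi * Complex.I * t)) / u)) u := by
  have hpi : (Real.pi : ℂ) ≠ 0 := by exact_mod_cast Real.pi_ne_zero
  have hu' : (u : ℂ) ≠ 0 := by exact_mod_cast hu.ne'
  have hr := hasDerivAt_raise t hu
  have hlog := hasDerivAt_log_raise t hu h0
  have hHr : HasDerivAt (fun u => H (raise t u)) _ u :=
    (hH _ (raise_mem_strip ht u)).comp_of_eq u hr rfl
  have h := ((((hr.mul hlog).sub hr).const_mul (1 / (2 * Real.pi * Complex.I))).add hHr).add
    ((hr.pow 2).div_const 2)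
  refine h.congr_deriv ?_
  rw [← exp_raise t hu, log_one_sub_exp_eq (raise_mem_strip ht u) h0, tauDiff]
  simp only [Nat.cast_ofNat, Nat.add_one_sub_one, pow_one]
  field_simp
  ring_nf

theorem hasDerivAt_periodPrim {H : ℂ → ℂ} (hH : ∀ t ∈ strip, HasDerivAt H (tauDiff t) t)
    {t : ℂ} (ht : t ∈ strip) (hsl : 0 < t.im) :
    HasDerivAt (periodPrim H) (1 / (2 * Real.pi * Complex.I) *
      Complex.log (1 - Complex.exp (2 * Real.pi * Complex.I * t))) t := by
  have hpi : (Real.pi : ℂ) ≠ 0 := by exact_mod_cast Real.pi_ne_zero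
  have h0 : t ≠ 0 := by rintro rfl; simp at hsl
  have hsl' : -(2 * Real.pi * Complex.I * t) ∈ Complex.slitPlane := by
    refine Or.inl ?_
    have : (-(2 * Real.pi * Complex.I * t)).re = 2 * Real.pi * t.im := by simp
    rw [this]
    have := Real.pi_pos
    positivity
  have hlog := ((hasDerivAt_id t).const_mul (2 * Real.pi * Complex.I)).neg.clog hsl'
  have h := (((((hasDerivAt_id t).mul hlog).sub (hasDerivAt_id t)).const_mul
    (1 / (2 * Real.pi * Complex.I))).add (hH t ht)).add (((hasDerivAt_id t).pow 2).div_const 2)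
  refine HasDerivAt.congr_deriv h ?_
  rw [log_one_sub_exp_eq ht h0, tauDiff]
  simp only [id, Pi.neg_apply, Nat.cast_ofNat, Nat.add_one_sub_one, pow_one]
  field_simp
  ring

/-- At height Y the derivative is O(exp(-2πY)) along the horizontal segment, so the limit at the top
of a vertical ray does not depend on the real part. This gives one integration constant for the
whole strip. -/
theorem tendsto_periodPrim_sub {H : ℂ → ℂ} (hH : ∀ t ∈ strip, HasDerivAt H (tauDiff t) t)
    {x : ℝ} (hx : |x| < 1 / 2) :
    Tendsto (fun Y : ℝ => periodPrim H (x + Y * Complex.I) - periodPrim H (Y * Complex.I))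
      atTop (𝓝 0) := by
  have hpi := Real.pi_gt_three
  have hlim : Tendsto (fun Y : ℝ => 3 / 2 * Real.exp (-(2 * Real.pi * Y)) * |x|) atTop (𝓝 0) := by
    have h1 : Tendsto (fun Y : ℝ => Real.exp (-(2 * Real.pi * Y))) atTop (𝓝 0) :=
      Real.tendsto_exp_neg_atTop_nhds_zero.comp (tendsto_id.const_mul_atTop (by positivity))
    simpa using (h1.const_mul (3 / 2 : ℝ)).mul_const |x|
  refine squeeze_zero_norm' ?_ hlim
  filter_upwards [eventually_ge_atTop 1] with Y hY
  have hseg : ∀ z ∈ segment ℝ ((Y : ℂ) * Complex.I) (x + Y * Complex.I),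
      z ∈ strip ∧ z.im = Y := by
    intro z hz
    rw [segment_eq_image'] at hz
    obtain ⟨r, hr, rfl⟩ := hz
    refine ⟨?_, by simp⟩
    have : ((Y : ℂ) * Complex.I + r • (x + Y * Complex.I - Y * Complex.I)).re = r * x := by simp
    change |((Y : ℂ) * Complex.I + r • (x + Y * Complex.I - Y * Complex.I)).re| < 1 / 2
    rw [this, abs_mul, abs_of_nonneg hr.1]
    have := abs_nonneg x
    nlinarith [hr.2]
  have hb := (convex_segment ((Y : ℂ) * Complex.I) (x + Y * Complex.I)).norm_image_sub_le_of_norm_hasDerivWithin_le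
    (𝕜 := ℂ) (f := periodPrim H) (C := 3 / 2 * Real.exp (-(2 * Real.pi * Y)))
    (fun z hz => (hasDerivAt_periodPrim hH (hseg z hz).1
      (by rw [(hseg z hz).2]; linarith)).hasDerivWithinAt) (fun z hz => ?_)
    (left_mem_segment ℝ _ _) (right_mem_segment ℝ _ _)
  · refine hb.trans (le_of_eq ?_)
    simp
  · have hn : ‖-Complex.exp (2 * Real.pi * Complex.I * z)‖ = Real.exp (-(2 * Real.pi * Y)) := by
      rw [norm_neg, Complex.norm_exp]
      congr 1
      simp [(hseg z hz).2]
    have hsmall : Real.exp (-(2 * Real.pi * Y)) ≤ 1 / 2 := by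
      have h2 : Real.exp (-(2 * Real.pi * Y)) ≤ Real.exp (-1) := Real.exp_le_exp.2 (by nlinarith)
      have h3 := Real.exp_neg_one_lt_d9
      have h4 : Real.exp (-1) ≤ 1 / 2 := by linarith
      linarith
    have hlog := Complex.norm_log_one_add_half_le_self
      (z := -Complex.exp (2 * Real.pi * Complex.I * z)) (by rw [hn]; exact hsmall)
    rw [hn, ← sub_eq_add_neg] at hlog
    rw [norm_mul]
    have h1 : ‖(1 / (2 * Real.pi * Complex.I) : ℂ)‖ ≤ 1 := by
      rw [norm_div, norm_mul, norm_mul, Complex.norm_I, Complex.norm_real,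
        Real.norm_of_nonneg (by linarith), norm_one, mul_one, div_le_one (by simp; linarith)]
      simp; linarith
    exact (mul_le_of_le_one_left (norm_nonneg _) h1).trans hlog

theorem continuousOn_periodPrim_raise {H : ℂ → ℂ} (hH : ∀ t ∈ strip, HasDerivAt H (tauDiff t) t)
    {t : ℂ} (ht : t ∈ strip) {ε : ℝ} (hε : 0 < ε) :
    ContinuousOn (fun u => periodPrim H (raise t u)) (Icc ε 1) := by
  have hpi : (Real.pi : ℂ) ≠ 0 := by exact_mod_cast Real.pi_ne_zero
  intro u hu
  have hu0 : 0 < u := hε.trans_le hu.1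
  by_cases h0 : raise t u = 0
  · have hx : t.re = 0 := by rw [← raise_re t u, h0]; rfl
    have hre : ∀ v, (raise t v).re = 0 := fun v => by rw [raise_re, hx]
    have hr : ContinuousAt (raise t) u := (hasDerivAt_raise t hu0).continuousAt
    have hcont : ContinuousAt (fun v => raise t v *
        Complex.log (-(2 * Real.pi * Complex.I * raise t v))) u := by
      have h1 : (fun v => raise t v * Complex.log (-(2 * Real.pi * Complex.I * raise t v))) =
          fun v => Complex.I / (2 * Real.pi) * (((2 * Real.pi * (raise t v).im : ℝ) : ℂ) *
            Complex.log ((2 * Real.pi * (raise t v).im : ℝ) : ℂ)) := by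
        ext v
        rw [neg_two_pi_I_mul_of_re_eq_zero (hre v)]
        nth_rewrite 1 [eq_im_mul_I_of_re_eq_zero (hre v)]
        push_cast
        field_simp
      rw [h1]
      refine continuousAt_const.mul (continuous_mul_clog_ofReal.continuousAt.comp ?_)
      exact continuousAt_const.mul (Complex.continuous_im.continuousAt.comp hr)
    have hHc : ContinuousAt (fun v => H (raise t v)) u :=
      ContinuousAt.comp (hH _ (raise_mem_strip ht u)).continuousAt hr
    exact (((continuousAt_const.mul (hcont.sub hr)).add hHc).add
      ((hr.pow 2).div_const 2)).continuousWithinAt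
  · exact (hasDerivAt_periodPrim_raise hH ht hu0 h0).continuousAt.continuousWithinAt

theorem tendsto_periodPrim_raise {H : ℂ → ℂ} (hH : ∀ t ∈ strip, HasDerivAt H (tauDiff t) t)
    {t : ℂ} (ht : t ∈ strip) :
    Tendsto (fun u => periodPrim H (raise t u)) (𝓝[>] 0)
      (𝓝 (periodPrim H t - 1 / (4 * Real.pi ^ 2) *
        dilog (Complex.exp (2 * Real.pi * Complex.I * t)))) := by
  have hpi : (Real.pi : ℂ) ≠ 0 := by exact_mod_cast Real.pi_ne_zero
  set z := Complex.exp (2 * Real.pi * Complex.I * t) with hz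
  set φ : ℝ → ℂ := fun u => Complex.log (1 - (u : ℂ) * z) / (u : ℂ) with hφ
  have hint : IntervalIntegrable φ volume 0 1 := intervalIntegrable_log_one_sub_div z
  have hFTC : ∀ ε ∈ Ioc (0 : ℝ) 1, periodPrim H (raise t ε) =
      periodPrim H t + 1 / (4 * Real.pi ^ 2) * ∫ u in ε..1, φ u := by
    intro ε hε
    -- The ray meets t = 0 for at most one u; the fundamental theorem of calculus tolerates this
    -- exceptional point because the primitive stays continuous there.
    have hcount : {u | raise t u = 0 ∧ 0 < u}.Countable := by
      refine Set.Subsingleton.countable ?_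
      rintro u ⟨hu, hu0⟩ v ⟨hv, hv0⟩
      have h1 := congrArg Complex.im (hu.trans hv.symm)
      rw [raise_im, raise_im] at h1
      have : Real.log u = Real.log v := by
        have := Real.pi_pos
        field_simp at h1
        linarith
      exact Real.log_injOn_pos hu0 hv0 this
    have h := integral_eq_of_hasDerivAt_off_countable_of_le
      (fun u => periodPrim H (raise t u)) (fun u => -(1 / (4 * Real.pi ^ 2) : ℂ) * φ u) hε.2 hcount
      (continuousOn_periodPrim_raise hH ht hε.1)
      (fun u hu => hasDerivAt_periodPrim_raise hH ht (hε.1.trans hu.1.1)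
        fun h => hu.2 ⟨h, hε.1.trans hu.1.1⟩)
      ((hint.mono_set (by
        rw [uIcc_of_le hε.2, uIcc_of_le zero_le_one]
        exact Icc_subset_Icc hε.1.le le_rfl)).const_mul _)
    rw [intervalIntegral.integral_const_mul, raise_one] at h
    linear_combination h
  have hlim : Tendsto (fun ε => ∫ u in ε..1, φ u) (𝓝[>] 0) (𝓝 (∫ u in (0 : ℝ)..1, φ u)) := by
    have h1 := intervalIntegral.continuousOn_primitive_interval_left
      (μ := volume) (f := φ) (a := 0) (b := 1)
      ((intervalIntegrable_iff_integrableOn_Icc_of_le zero_le_one).1 hint |>.mono_set (by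
        rw [uIcc_of_le zero_le_one]))
    have h2 := h1 0 left_mem_uIcc
    refine h2.tendsto.mono_left ?_
    rw [uIcc_of_le zero_le_one]
    have : Ioc (0 : ℝ) 1 ⊆ Icc 0 1 := Ioc_subset_Icc_self
    rw [← nhdsWithin_Ioc_eq_nhdsGT zero_lt_one]
    exact nhdsWithin_mono _ this
  have h3 := (hlim.const_mul (1 / (4 * Real.pi ^ 2) : ℂ)).const_add (periodPrim H t)
  have h4 : periodPrim H t - 1 / (4 * Real.pi ^ 2) * dilog z =
      periodPrim H t + 1 / (4 * Real.pi ^ 2) * ∫ u in (0 : ℝ)..1, φ u := by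
    rw [dilog]; ring
  rw [h4]
  refine h3.congr' ?_
  filter_upwards [Ioc_mem_nhdsGT zero_lt_one] with ε hε
  exact (hFTC ε hε).symm

/-- The constant ℓ is the common limit of `periodPrim` at +i∞; it is exhibited through its value
computed from the ray starting at t = 0. -/
theorem exists_dilog_eq {H : ℂ → ℂ} (hH : ∀ t ∈ strip, HasDerivAt H (tauDiff t) t) :
    ∃ ℓ : ℂ, ∀ t ∈ strip, 1 / (4 * Real.pi ^ 2) * dilog (Complex.exp (2 * Real.pi * Complex.I * t)) =
      periodPrim H t - ℓ := by
  have hpi := Real.pi_pos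
  have key : ∀ t ∈ strip, Tendsto (fun Y : ℝ => periodPrim H (Y * Complex.I)) atTop
      (𝓝 (periodPrim H t - 1 / (4 * Real.pi ^ 2) *
        dilog (Complex.exp (2 * Real.pi * Complex.I * t)))) := by
    intro t ht
    have h1 : Tendsto (fun Y : ℝ => Real.exp (-(2 * Real.pi * (Y - t.im)))) atTop (𝓝[>] 0) := by
      refine tendsto_nhdsWithin_iff.2 ⟨?_, Eventually.of_forall fun Y => Real.exp_pos _⟩
      exact Real.tendsto_exp_neg_atTop_nhds_zero.comp
        ((tendsto_atTop_add_const_right _ (-t.im) tendsto_id).const_mul_atTop (by positivity))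
    have h2 := (tendsto_periodPrim_raise hH ht).comp h1
    have h3 := h2.sub (tendsto_periodPrim_sub hH (x := t.re) ht)
    rw [sub_zero] at h3
    refine h3.congr fun Y => ?_
    have : raise t (Real.exp (-(2 * Real.pi * (Y - t.im)))) = t.re + Y * Complex.I := by
      apply Complex.ext
      · rw [raise_re]; simp
      · rw [raise_im, Real.log_exp]
        simp
        field_simp
        ring
    simp only [Function.comp, this]
    ring
  refine ⟨periodPrim H 0 - 1 / (4 * Real.pi ^ 2) *
        dilog (Complex.exp (2 * Real.pi * Complex.I * 0)), fun t ht => ?_⟩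
  have := tendsto_nhds_unique (key t ht) (key 0 (by simp [strip]))
  rw [← this]; ring

/-- Since 1/Λ = -2πi, the argument is t/Λ. The cutoff has argument π/2, and `sheet` places Im s in
(-π/2, 3π/2] modulo 2π, so the right side has imaginary part in (-π, π]. -/
theorem log_neg_two_pi_I_mul_exp (s : ℂ) :
    Complex.log (-(2 * Real.pi * Complex.I * Complex.exp s)) =
      s - Complex.log cutoff - 2 * Real.pi * Complex.I * sheet s := by
  have hpi := Real.pi_pos
  have hpi' : (Real.pi : ℂ) ≠ 0 := by exact_mod_cast Real.pi_ne_zero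
  have hcut0 : cutoff ≠ 0 := by simp [cutoff, Real.pi_ne_zero]
  have him : (Complex.log cutoff).im = Real.pi / 2 := by
    rw [Complex.log_im, cutoff, show Complex.I / (2 * Real.pi) =
      (((2 * Real.pi)⁻¹ : ℝ) : ℂ) * Complex.I by push_cast; field_simp,
      Complex.arg_real_mul _ (by positivity), Complex.arg_I]
  have hmem := sub_toIocDiv_zsmul_mem_Ioc Real.two_pi_pos (-(Real.pi / 2)) s.im
  change s.im - (sheet s) • (2 * Real.pi) ∈ _ at hmem
  rw [zsmul_eq_mul] at hmem
  have hexp : Complex.exp (s - Complex.log cutoff - 2 * Real.pi * Complex.I * sheet s) =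
      -(2 * Real.pi * Complex.I * Complex.exp s) := by
    rw [Complex.exp_sub, Complex.exp_sub, Complex.exp_log hcut0,
      show 2 * Real.pi * Complex.I * (sheet s : ℂ) = sheet s * (2 * Real.pi * Complex.I) by ring,
      Complex.exp_int_mul_two_pi_mul_I, cutoff]
    have := Complex.I_ne_zero
    field_simp
    rw [Complex.I_sq]; ring
  have himw : (s - Complex.log cutoff - 2 * Real.pi * Complex.I * sheet s).im =
      s.im - sheet s * (2 * Real.pi) - Real.pi / 2 := by
    simp [him]
    ring
  rw [← hexp]
  refine Complex.log_exp ?_ ?_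
  · rw [himw]; linarith [hmem.1]
  · rw [himw]; linarith [hmem.2]

/-- Two cancellations occur: half the square of log exp(2πit) contributes -t²/2 against the t²/2 in
`periodPrim`, and the term with `sheet` in the continued period removes the branch jump of t
log(t/Λ). Hence both periods have the same monodromy and differ by a holomorphic function of t. -/
theorem exists_dualPeriod_eq : ∃ H : ℂ → ℂ, (∀ t ∈ strip, HasDerivAt H (tauDiff t) t) ∧
    ∀ s, Complex.exp s ∈ strip → dualPeriod s = 1 / (2 * Real.pi * Complex.I) *
      (Complex.exp s * (s - Complex.log cutoff) - Complex.exp s) + H (Complex.exp s) := by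
  have hpi := Real.pi_pos
  have hpi' : (Real.pi : ℂ) ≠ 0 := by exact_mod_cast Real.pi_ne_zero
  obtain ⟨H₀, hH₀⟩ := convex_strip.exists_forall_hasDerivWithinAt differentiableOn_tauDiff
  have hH : ∀ t ∈ strip, HasDerivAt H₀ (tauDiff t) t := fun t ht =>
    (hH₀ t ht).hasDerivAt (isOpen_strip.mem_nhds ht)
  obtain ⟨ℓ, hℓ⟩ := exists_dilog_eq hH
  refine ⟨fun t => H₀ t - ℓ, fun t ht => (hH t ht).sub_const _, fun s hs => ?_⟩
  have h1 := hℓ _ hs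
  have hlogexp : Complex.log (Complex.exp (2 * Real.pi * Complex.I * Complex.exp s)) =
      2 * Real.pi * Complex.I * Complex.exp s := by
    have him : (2 * Real.pi * Complex.I * Complex.exp s).im = 2 * Real.pi * (Complex.exp s).re := by
      simp
    have := abs_lt.1 (show |(Complex.exp s).re| < 1 / 2 from hs)
    refine Complex.log_exp ?_ ?_ <;> rw [him] <;> nlinarith
  unfold dualPeriod principalDualPeriod
  rw [hlogexp]
  have h2 : -(1 / (2 * Real.pi * Complex.I) ^ 2) = (1 / (4 * Real.pi ^ 2) : ℂ) := by
    have := Complex.I_sq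
    field_simp
    rw [this]; ring
  rw [h2, mul_add, h1, periodPrim, log_neg_two_pi_I_mul_exp]
  field_simp
  ring_nf
  rw [Complex.I_pow_three]
  ring

/-! ### The derivatives of the two dual periods -/

/-- The period `τ` of the Ooguri-Vafa space with cutoff `i / 2π`. -/
def tauOV (s : ℂ) : ℂ := 1 / (2 * Real.pi * Complex.I) * (s - Complex.log cutoff)

theorem hasDerivAt_ovZ_magnetic (s : ℂ) :
    HasDerivAt (fun s => 1 / (2 * Real.pi * Complex.I) *
      (Complex.exp s * (s - Complex.log cutoff) - Complex.exp s))
      (tauOV s * Complex.exp s) s := by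
  have h := (((Complex.hasDerivAt_exp s).mul ((hasDerivAt_id s).sub_const
    (Complex.log cutoff))).sub (Complex.hasDerivAt_exp s)).const_mul (1 / (2 * Real.pi * Complex.I))
  refine h.congr_deriv ?_
  simp only [id, tauOV]
  ring

theorem hasDerivAt_dualPeriod {s : ℂ} (hs : Complex.exp s ∈ strip) :
    HasDerivAt dualPeriod ((tauOV s + tauDiff (Complex.exp s)) * Complex.exp s) s := by
  obtain ⟨H, hH, hd⟩ := exists_dualPeriod_eq
  have h := (hasDerivAt_ovZ_magnetic s).add
    ((hH _ hs).comp_of_eq s (Complex.hasDerivAt_exp s) rfl)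
  refine (h.congr_of_eventuallyEq ?_).congr_deriv (by ring)
  filter_upwards [(isOpen_strip.preimage Complex.continuous_exp).mem_nhds hs] with s' hs'
  exact hd s' hs'

end ConifoldHK

end

noncomputable section
namespace ConifoldHK
open MeasureTheory Filter Topology

/-! ### The forms of a lattice of electric charges -/

/-- The one-form `dt` at a point of `Coord`. -/
def dtCoord (x : Coord) : Coord →L[ℝ] ℂ := Complex.exp x.1 • ContinuousLinearMap.fst ℝ ℂ (ℝ × ℝ)

/-- The one-form `dθ_β` on `Coord`. -/
def dθelec : Coord →L[ℝ] ℂ :=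
  realForm (ContinuousLinearMap.fst ℝ ℝ ℝ ∘L ContinuousLinearMap.snd ℝ ℂ (ℝ × ℝ))

/-- The one-form `dθ_{β^∨}` on `Coord`. -/
def dθmag : Coord →L[ℝ] ℂ :=
  realForm (ContinuousLinearMap.snd ℝ ℝ ℝ ∘L ContinuousLinearMap.snd ℝ ℂ (ℝ × ℝ))

@[simp] theorem dtCoord_apply (x v : Coord) : dtCoord x v = Complex.exp x.1 * v.1 := rfl
@[simp] theorem dθelec_apply (v : Coord) : dθelec v = (v.2.1 : ℂ) := rfl
@[simp] theorem dθmag_apply (v : Coord) : dθmag v = (v.2.2 : ℂ) := rfl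

theorem hasFDerivAt_toBase (x : Coord) : HasFDerivAt toBase
    ((dtCoord x).prod (ContinuousLinearMap.fst ℝ ℝ ℝ ∘L ContinuousLinearMap.snd ℝ ℂ (ℝ × ℝ))) x := by
  refine HasFDerivAt.prodMk ?_ (ContinuousLinearMap.fst ℝ ℝ ℝ ∘L ContinuousLinearMap.snd ℝ ℂ (ℝ × ℝ)).hasFDerivAt
  exact ((Complex.hasDerivAt_exp x.1).comp_hasFDerivAt x
    (ContinuousLinearMap.fst ℝ ℂ (ℝ × ℝ)).hasFDerivAt)

theorem fderiv_toBase_apply (x v : Coord) :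
    fderiv ℝ toBase x v = (Complex.exp x.1 * v.1, v.2.1) := by
  rw [(hasFDerivAt_toBase x).fderiv]; rfl

/-- The form `(1 / 2π) dt ∧ dθ_{β^∨}` plus the pull-back of `ghHol`. -/
def ghCoordHol (x : Coord) (c : ℂ) (w κ : ℝ) : Coord [⋀^Fin 2]→L[ℝ] ℂ :=
  (1 / (2 * Real.pi) : ℂ) • wedge (dtCoord x) dθmag +
    (ghHol c w κ).compContinuousLinearMap (fderiv ℝ toBase x)

/-- The form `(1 / 4π²) dθ_β ∧ dθ_{β^∨}` plus the pull-back of `ghThree`. -/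
def ghCoordThree (x : Coord) (c : ℂ) (w : ℝ) : Coord [⋀^Fin 2]→L[ℝ] ℂ :=
  (1 / (4 * Real.pi ^ 2) : ℂ) • wedge dθelec dθmag +
    (ghThree c w).compContinuousLinearMap (fderiv ℝ toBase x)

/-- The real forms with holomorphic part `ghCoordHol` and third form `ghCoordThree`. -/
def ghCoord (α : Fin 3) (x : Coord) (c : ℂ) (w κ : ℝ) : Coord [⋀^Fin 2]→L[ℝ] ℝ :=
  ![Complex.reCLM.compContinuousAlternatingMap (ghCoordHol x c w κ),
    Complex.imCLM.compContinuousAlternatingMap (ghCoordHol x c w κ),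
    Complex.reCLM.compContinuousAlternatingMap (ghCoordThree x c w)] α

theorem ghCoordHol_apply (x : Coord) (c : ℂ) (w κ : ℝ) (v : Fin 2 → Coord) :
    ghCoordHol x c w κ v = 1 / (2 * Real.pi) *
        (Complex.exp x.1 * (v 0).1 * (v 1).2.2 - Complex.exp x.1 * (v 1).1 * (v 0).2.2) +
      (Complex.I / (4 * Real.pi) * c *
        (Complex.exp x.1 * (v 0).1 * (starRingEnd ℂ) (Complex.exp x.1 * (v 1).1) -
          Complex.exp x.1 * (v 1).1 * (starRingEnd ℂ) (Complex.exp x.1 * (v 0).1)) -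
      (κ + Complex.I * w) / (2 * Real.pi) *
        (Complex.exp x.1 * (v 0).1 * (v 1).2.1 - Complex.exp x.1 * (v 1).1 * (v 0).2.1)) := by
  simp only [ghCoordHol, ContinuousAlternatingMap.add_apply, ContinuousAlternatingMap.smul_apply,
    ContinuousAlternatingMap.compContinuousLinearMap_apply, ghHol_apply, wedge_apply,
    Function.comp, fderiv_toBase_apply, dtCoord_apply, dθmag_apply, smul_eq_mul]

theorem ghCoordThree_apply (x : Coord) (c : ℂ) (w : ℝ) (v : Fin 2 → Coord) :
    ghCoordThree x c w v = 1 / (4 * Real.pi ^ 2) *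
        ((v 0).2.1 * (v 1).2.2 - (v 1).2.1 * (v 0).2.2) +
      (Complex.I / 2 * w *
        (Complex.exp x.1 * (v 0).1 * (starRingEnd ℂ) (Complex.exp x.1 * (v 1).1) -
          Complex.exp x.1 * (v 1).1 * (starRingEnd ℂ) (Complex.exp x.1 * (v 0).1)) -
      Complex.I / (8 * Real.pi ^ 2) * (starRingEnd ℂ) c *
        ((v 0).2.1 * (Complex.exp x.1 * (v 1).1) - (v 1).2.1 * (Complex.exp x.1 * (v 0).1)) +
      Complex.I / (8 * Real.pi ^ 2) * c *
        ((v 0).2.1 * (starRingEnd ℂ) (Complex.exp x.1 * (v 1).1) -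
          (v 1).2.1 * (starRingEnd ℂ) (Complex.exp x.1 * (v 0).1))) := by
  simp only [ghCoordThree, ContinuousAlternatingMap.add_apply, ContinuousAlternatingMap.smul_apply,
    ContinuousAlternatingMap.compContinuousLinearMap_apply, ghThree_apply, wedge_apply,
    Function.comp, fderiv_toBase_apply, dθelec_apply, dθmag_apply, smul_eq_mul]

theorem ghCoord_add (α : Fin 3) (x : Coord) (c c' : ℂ) (w w' κ κ' : ℝ) :
    ghCoord α x (c + c') (w + w') (κ + κ') = ghCoord α x c w κ +
      (gh α c' w' κ').compContinuousLinearMap (fderiv ℝ toBase x) := by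
  ext v
  fin_cases α <;> simp [ghCoord, gh, ghCoordHol, ghCoordThree, ghHol_add, ghThree_add, add_assoc]

/-! ### Common treatment of the charges ±(β + nδ): all instanton sums as lattice sums -/

namespace BPSData

variable {G : Type}

/-- The BPS structure `D` has the active charges `± (electric + n)`, `n ∈ N`, apart from charges with
a constant central charge. -/
structure IsElectric (D : BPSData G) (N : Set ℤ) (pos neg : N → G) (x : Coord) (τ : ℂ) : Prop where
  inj : Function.Injective (Sum.elim pos neg)
  away : AwayFrom N (Complex.exp x.1)
  Z_pos : ∀ n : N, ∀ s, D.Z (pos n) s = Complex.exp s + (n : ℤ)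
  Z_neg : ∀ n : N, ∀ s, D.Z (neg n) s = -(Complex.exp s + (n : ℤ))
  θ_pos : ∀ n y, D.θ (pos n) y = y.2.1
  θ_neg : ∀ n y, D.θ (neg n) y = -y.2.1
  Ω_pos : ∀ n, D.Ω (pos n) = 1
  Ω_neg : ∀ n, D.Ω (neg n) = 1
  coeff_pos : ∀ n, D.coeff (pos n) = 1
  coeff_neg : ∀ n, D.coeff (neg n) = -1
  rest : ∀ γ ∉ range (Sum.elim pos neg), D.Ω γ ≠ 0 →
    D.coeff γ = 0 ∧ ∃ k : ℂ, k ≠ 0 ∧ ∀ s, D.Z γ s = k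
  Z_magnetic : HasDerivAt (D.Z D.magnetic) (τ * Complex.exp x.1) x.1
  Z_electric : ∀ s, D.Z D.electric s = Complex.exp s
  θ_magnetic : ∀ y, D.θ D.magnetic y = y.2.2
  θ_electric : ∀ y, D.θ D.electric y = y.2.1

theorem dZ_eq {D : BPSData G} {γ : G} {x : Coord} {z : ℂ} (h : HasDerivAt (D.Z γ) z x.1) :
    D.dZ γ x = z • ContinuousLinearMap.fst ℝ ℂ (ℝ × ℝ) := by
  have := h.comp_hasFDerivAt x (ContinuousLinearMap.fst ℝ ℂ (ℝ × ℝ)).hasFDerivAt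
  exact this.fderiv

namespace IsElectric

variable {D : BPSData G} {N : Set ℤ} {pos neg : N → G} {x : Coord} {τ : ℂ}

theorem hasSum {E : Type} [AddCommGroup E] [TopologicalSpace E] [ContinuousAdd E]
    (h : D.IsElectric N pos neg x τ) {F : G → E} {p q r : E} (hr : p + q = r) (hp : HasSum (fun n => F (pos n)) p) (hq : HasSum (fun n => F (neg n)) q)
    (h0 : ∀ γ ∉ range (Sum.elim pos neg), F γ = 0) : HasSum F r := by
  rw [← hr, ← h.inj.hasSum_iff h0]
  refine HasSum.sum ?_ ?_
  · exact hp
  · exact hq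

theorem dZ_pos (h : D.IsElectric N pos neg x τ) (n : N) : D.dZ (pos n) x = dtCoord x := by
  refine dZ_eq ?_
  rw [show D.Z (pos n) = fun s => Complex.exp s + (n : ℤ) from funext (h.Z_pos n)]
  exact (Complex.hasDerivAt_exp _).add_const _

theorem dZ_neg (h : D.IsElectric N pos neg x τ) (n : N) : D.dZ (neg n) x = -dtCoord x := by
  have hneg : -dtCoord x = (-Complex.exp x.1) • ContinuousLinearMap.fst ℝ ℂ (ℝ × ℝ) :=
    ContinuousLinearMap.ext fun v => by simp
  rw [hneg]
  refine dZ_eq ?_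
  rw [show D.Z (neg n) = fun s => -(Complex.exp s + (n : ℤ)) from funext (h.Z_neg n)]
  exact ((Complex.hasDerivAt_exp _).add_const _).neg

theorem dZ_electric (h : D.IsElectric N pos neg x τ) : D.dZ D.electric x = dtCoord x := by
  refine dZ_eq ?_
  rw [show D.Z D.electric = fun s => Complex.exp s from funext h.Z_electric]
  exact Complex.hasDerivAt_exp _

theorem dZ_magnetic (h : D.IsElectric N pos neg x τ) : D.dZ D.magnetic x = τ • dtCoord x := by
  rw [dZ_eq h.Z_magnetic, dtCoord, smul_smul]

/-- The multiples of δ have constant central charge, so every term of the two-forms that contains dZ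
or A disappears for them. -/
theorem dZ_rest (h : D.IsElectric N pos neg x τ) {γ : G} (hγ : γ ∉ range (Sum.elim pos neg))
    (h0 : D.Ω γ ≠ 0) : D.dZ γ x = 0 := by
  obtain ⟨-, k, -, hk⟩ := h.rest γ hγ h0
  rw [← zero_smul ℂ (ContinuousLinearMap.fst ℝ ℂ (ℝ × ℝ))]
  refine dZ_eq ?_
  rw [show D.Z γ = fun s => k from funext hk]
  exact hasDerivAt_const _ _

theorem tau_eq (h : D.IsElectric N pos neg x τ) : D.tau x.1 = τ := by
  rw [tau, h.Z_magnetic.deriv, show D.Z D.electric = fun s => Complex.exp s from funext h.Z_electric,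
    (Complex.hasDerivAt_exp _).deriv, mul_div_cancel_right₀ _ (Complex.exp_ne_zero _)]

theorem dθ_of_eq {γ : G} (hγ : ∀ y, D.θ γ y = y.2.1) : D.dθ γ x = dθelec := by
  rw [dθ, show D.θ γ = fun y => (ContinuousLinearMap.fst ℝ ℝ ℝ ∘L
    ContinuousLinearMap.snd ℝ ℂ (ℝ × ℝ)) y from funext hγ, ContinuousLinearMap.fderiv]
  rfl

theorem dθ_neg (h : D.IsElectric N pos neg x τ) (n : N) : D.dθ (neg n) x = -dθelec := by
  rw [dθ, show D.θ (neg n) = fun y => (-(ContinuousLinearMap.fst ℝ ℝ ℝ ∘L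
    ContinuousLinearMap.snd ℝ ℂ (ℝ × ℝ))) y from funext (h.θ_neg n), ContinuousLinearMap.fderiv]
  refine ContinuousLinearMap.ext fun v => ?_
  simp [realForm]

theorem dθ_magnetic (h : D.IsElectric N pos neg x τ) : D.dθ D.magnetic x = dθmag := by
  rw [dθ, show D.θ D.magnetic = fun y => (ContinuousLinearMap.snd ℝ ℝ ℝ ∘L
    ContinuousLinearMap.snd ℝ ℂ (ℝ × ℝ)) y from funext h.θ_magnetic, ContinuousLinearMap.fderiv]
  rfl

theorem ne_zero (h : D.IsElectric N pos neg x τ) (n : N) : Complex.exp x.1 + (n : ℤ) ≠ 0 :=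
  h.away.ne_zero n.2

theorem V_pos (h : D.IsElectric N pos neg x τ) (n : N) :
    D.V (pos n) x = 1 / (2 * Real.pi) * latticeBesselTerm (0, 0, 0, 0) n (toBase x) := by
  rw [V, h.Z_pos, h.θ_pos, instV_eq (h.ne_zero n)]
  simp [latticeBesselTerm, toBase]

theorem V_neg (h : D.IsElectric N pos neg x τ) (n : N) :
    D.V (neg n) x = 1 / (2 * Real.pi) *
      (starRingEnd ℂ) (latticeBesselTerm (0, 0, 0, 0) n (toBase x)) := by
  rw [V, h.Z_neg, h.θ_neg, instV_eq (neg_ne_zero.2 (h.ne_zero n)), Complex.normSq_neg,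
    fourierBessel_neg]
  simp [latticeBesselTerm, toBase]

/-- The factor |z|² = z z̄ from `instA_eq` turns dZ/Z into z̄ dt and its conjugate into z dt̄. -/
theorem A_pos (h : D.IsElectric N pos neg x τ) (n : N) :
    D.A (pos n) x = -(1 / (4 * Real.pi ^ 2) : ℂ) •
      (latticeBesselTerm (1, 1, 0, 1) n (toBase x) • dtCoord x -
        latticeBesselTerm (1, 1, 1, 0) n (toBase x) • conjForm (dtCoord x)) := by
  have hz := h.ne_zero n
  have hz' := (map_ne_zero (starRingEnd ℂ)).2 hz
  rw [A, h.Z_pos, h.θ_pos, instA_eq hz, h.dZ_pos]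
  refine ContinuousLinearMap.ext fun v => ?_
  simp only [smul_apply, sub_apply, smul_eq_mul,
    conjForm_apply, map_mul, map_inv₀, latticeBesselTerm, toBase, pow_one, pow_zero, mul_one,
    one_mul]
  push_cast
  rw [← Complex.mul_conj]
  field_simp

theorem A_neg (h : D.IsElectric N pos neg x τ) (n : N) :
    D.A (neg n) x = -(1 / (4 * Real.pi ^ 2) : ℂ) •
      ((starRingEnd ℂ) (latticeBesselTerm (1, 1, 1, 0) n (toBase x)) • dtCoord x -
        (starRingEnd ℂ) (latticeBesselTerm (1, 1, 0, 1) n (toBase x)) •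
          conjForm (dtCoord x)) := by
  have hz := h.ne_zero n
  have hz' := (map_ne_zero (starRingEnd ℂ)).2 hz
  rw [A, h.Z_neg, h.θ_neg, instA_eq (neg_ne_zero.2 hz), h.dZ_neg, Complex.normSq_neg,
    fourierBessel_neg]
  refine ContinuousLinearMap.ext fun v => ?_
  simp only [smul_apply, sub_apply, smul_eq_mul,
    conjForm_apply, map_mul, map_inv₀, latticeBesselTerm, toBase, pow_one, pow_zero, mul_one,
    one_mul, neg_apply, map_neg, Complex.conj_conj]
  push_cast
  rw [← Complex.mul_conj]
  field_simp

theorem hasSum_lattice (h : D.IsElectric N pos neg x τ) (k : ℕ × ℕ × ℕ × ℕ) :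
    HasSum (fun n : N => latticeBesselTerm k n (toBase x)) (latticeBessel N k (toBase x)) :=
  (summable_latticeBesselTerm (x := toBase x) h.away k).hasSum

theorem hasSum_conj_lattice (h : D.IsElectric N pos neg x τ) (k : ℕ × ℕ × ℕ × ℕ) :
    HasSum (fun n : N => (starRingEnd ℂ) (latticeBesselTerm k n (toBase x)))
      ((starRingEnd ℂ) (latticeBessel N k (toBase x))) :=
  (h.hasSum_lattice k).mapL (Complex.conjCLE : ℂ →L[ℝ] ℂ)

/-- The value of `h.hasSum` for a summand that is given by lattice sums. -/
theorem hasSum_two {E : Type} [AddCommGroup E] [TopologicalSpace E] [ContinuousAdd E] [Module ℂ E]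
    [ContinuousSMul ℂ E] (h : D.IsElectric N pos neg x τ) {F : G → E} {e₁ e₂ e₃ f₁ f₂ f₃ r : E}
    (hp : ∀ n : N, F (pos n) = latticeBesselTerm (1, 1, 1, 0) n (toBase x) • e₁ +
      latticeBesselTerm (1, 1, 0, 1) n (toBase x) • e₂ +
      latticeBesselTerm (0, 0, 0, 0) n (toBase x) • e₃)
    (hq : ∀ n : N, F (neg n) =
      (starRingEnd ℂ) (latticeBesselTerm (1, 1, 0, 1) n (toBase x)) • f₁ +
      (starRingEnd ℂ) (latticeBesselTerm (1, 1, 1, 0) n (toBase x)) • f₂ +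
      (starRingEnd ℂ) (latticeBesselTerm (0, 0, 0, 0) n (toBase x)) • f₃)
    (h0 : ∀ γ ∉ range (Sum.elim pos neg), F γ = 0)
    (hr : latticeBessel N (1, 1, 1, 0) (toBase x) • e₁ +
      latticeBessel N (1, 1, 0, 1) (toBase x) • e₂ +
      latticeBessel N (0, 0, 0, 0) (toBase x) • e₃ +
      ((starRingEnd ℂ) (latticeBessel N (1, 1, 0, 1) (toBase x)) • f₁ +
      (starRingEnd ℂ) (latticeBessel N (1, 1, 1, 0) (toBase x)) • f₂ +
      (starRingEnd ℂ) (latticeBessel N (0, 0, 0, 0) (toBase x)) • f₃) = r) :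
    HasSum F r := by
  refine h.hasSum hr ?_ ?_ h0
  · simp_rw [hp]
    exact (((h.hasSum_lattice _).smul_const _).add ((h.hasSum_lattice _).smul_const _)).add
      ((h.hasSum_lattice _).smul_const _)
  · simp_rw [hq]
    exact (((h.hasSum_conj_lattice _).smul_const _).add
      ((h.hasSum_conj_lattice _).smul_const _)).add ((h.hasSum_conj_lattice _).smul_const _)

theorem hasSum_holTerm (h : D.IsElectric N pos neg x τ) :
    HasSum (fun γ => D.holTerm γ x)
      ((ghHol (latticeConn N (toBase x)) (latticePot N (toBase x)) 0).compContinuousLinearMap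
        (fderiv ℝ toBase x)) := by
  have hpi : (Real.pi : ℂ) ≠ 0 := by exact_mod_cast Real.pi_ne_zero
  refine h.hasSum_two
    -- Only the dt̄ part of A survives the wedge with dZ, because dt ∧ dt = 0; the coefficients e₂
    -- and f₂ are therefore zero.
    (e₁ := (1 / (4 * Real.pi ^ 2) : ℂ) • wedge (dtCoord x) (conjForm (dtCoord x))) (e₂ := (0 : ℂ) • wedge dθelec dθelec)
    (e₃ := (Complex.I / (4 * Real.pi ^ 2) : ℂ) • wedge dθelec (dtCoord x))
    (f₁ := -(1 / (4 * Real.pi ^ 2) : ℂ) • wedge (dtCoord x) (conjForm (dtCoord x))) (f₂ := (0 : ℂ) • wedge dθelec dθelec)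
    (f₃ := (Complex.I / (4 * Real.pi ^ 2) : ℂ) • wedge dθelec (dtCoord x))
    (fun n => ?_) (fun n => ?_) (fun γ hγ => ?_) ?_
  · ext v
    simp only [holTerm, h.Ω_pos, h.dZ_pos, h.A_pos, h.V_pos, dθ_of_eq (h.θ_pos n),
      ContinuousAlternatingMap.add_apply, ContinuousAlternatingMap.smul_apply, wedge_apply,
      smul_apply, sub_apply, smul_eq_mul]
    push_cast
    field_simp
    ring
  · ext v
    simp only [holTerm, h.Ω_neg, h.dZ_neg, h.A_neg, h.V_neg, h.dθ_neg,
      ContinuousAlternatingMap.add_apply, ContinuousAlternatingMap.smul_apply, wedge_apply,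
      smul_apply, sub_apply, smul_eq_mul, neg_apply]
    push_cast
    field_simp
    ring
  · ext v
    by_cases h0 : D.Ω γ = 0
    · simp [holTerm, h0]
    · simp [holTerm, h.dZ_rest hγ h0, wedge_apply]
  · ext v
    simp only [ContinuousAlternatingMap.compContinuousLinearMap_apply, ghHol_apply,
      ContinuousAlternatingMap.add_apply, ContinuousAlternatingMap.smul_apply, wedge_apply,
      Function.comp, fderiv_toBase_apply, dtCoord_apply,
      dθelec_apply, conjForm_apply, smul_eq_mul, latticeConn, latticePot]
    push_cast
    rw [Complex.re_eq_add_conj]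
    field_simp
    ring_nf
    try simp only [Complex.I_sq]
    try ring

theorem hasSum_realTerm (h : D.IsElectric N pos neg x τ) :
    HasSum (fun γ => D.realTerm γ x)
      ((ghThree (latticeConn N (toBase x)) (latticePot N (toBase x))).compContinuousLinearMap
        (fderiv ℝ toBase x)) := by
  have hpi : (Real.pi : ℂ) ≠ 0 := by exact_mod_cast Real.pi_ne_zero
  refine h.hasSum_two
    (e₁ := (1 / (8 * Real.pi ^ 3) : ℂ) • wedge dθelec (conjForm (dtCoord x)))
    (e₂ := -(1 / (8 * Real.pi ^ 3) : ℂ) • wedge dθelec (dtCoord x))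
    (e₃ := (Complex.I / (4 * Real.pi) : ℂ) • wedge (dtCoord x) (conjForm (dtCoord x)))
    (f₁ := -(1 / (8 * Real.pi ^ 3) : ℂ) • wedge dθelec (conjForm (dtCoord x)))
    (f₂ := (1 / (8 * Real.pi ^ 3) : ℂ) • wedge dθelec (dtCoord x))
    (f₃ := (Complex.I / (4 * Real.pi) : ℂ) • wedge (dtCoord x) (conjForm (dtCoord x)))
    (fun n => ?_) (fun n => ?_) (fun γ hγ => ?_) ?_
  · ext v
    simp only [realTerm, h.Ω_pos, h.dZ_pos, h.A_pos, h.V_pos, dθ_of_eq (h.θ_pos n),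
      ContinuousAlternatingMap.add_apply, ContinuousAlternatingMap.smul_apply, wedge_apply,
      smul_apply, sub_apply, smul_eq_mul]
    push_cast
    field_simp
    ring
  · ext v
    simp only [realTerm, h.Ω_neg, h.dZ_neg, h.A_neg, h.V_neg, h.dθ_neg,
      ContinuousAlternatingMap.add_apply, ContinuousAlternatingMap.smul_apply, wedge_apply,
      smul_apply, sub_apply, smul_eq_mul, neg_apply, conjForm_apply, map_neg]
    push_cast
    field_simp
    ring
  · ext v
    by_cases h0 : D.Ω γ = 0
    · simp [realTerm, h0]
    · simp [realTerm, h.dZ_rest hγ h0, wedge_apply, A]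
  · ext v
    simp only [ContinuousAlternatingMap.compContinuousLinearMap_apply, ghThree_apply,
      ContinuousAlternatingMap.add_apply, ContinuousAlternatingMap.smul_apply, wedge_apply,
      Function.comp, fderiv_toBase_apply, dtCoord_apply,
      dθelec_apply, conjForm_apply, smul_eq_mul, latticeConn, latticePot, map_mul, map_sub,
      map_div₀, Complex.conj_conj, Complex.conj_I, Complex.conj_ofReal, map_one]
    push_cast
    rw [Complex.re_eq_add_conj]
    field_simp
    ring_nf
    try simp only [Complex.I_sq]
    try ring

theorem hasSum_connTerm (h : D.IsElectric N pos neg x τ) :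
    HasSum (fun γ => D.connTerm γ x)
      (-(Complex.I / 2 * (starRingEnd ℂ) (latticeConn N (toBase x))) • dtCoord x +
        (Complex.I / 2 * latticeConn N (toBase x)) • conjForm (dtCoord x) -
        (Complex.I * latticePot N (toBase x)) • dθelec) := by
  have hpi : (Real.pi : ℂ) ≠ 0 := by exact_mod_cast Real.pi_ne_zero
  refine h.hasSum_two
    (e₁ := (1 / (2 * Real.pi) : ℂ) • conjForm (dtCoord x))
    (e₂ := -(1 / (2 * Real.pi) : ℂ) • dtCoord x)
    (e₃ := -(Complex.I / (2 * Real.pi) : ℂ) • dθelec)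
    (f₁ := -(1 / (2 * Real.pi) : ℂ) • conjForm (dtCoord x))
    (f₂ := (1 / (2 * Real.pi) : ℂ) • dtCoord x)
    (f₃ := -(Complex.I / (2 * Real.pi) : ℂ) • dθelec)
    (fun n => ?_) (fun n => ?_) (fun γ hγ => ?_) ?_
  · refine ContinuousLinearMap.ext fun v => ?_
    simp only [connTerm, h.Ω_pos, h.coeff_pos, h.A_pos, h.V_pos, dθ_of_eq (h.θ_pos n),
      smul_apply, sub_apply, add_apply, smul_eq_mul]
    push_cast
    field_simp
    ring
  · refine ContinuousLinearMap.ext fun v => ?_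
    simp only [connTerm, h.Ω_neg, h.coeff_neg, h.A_neg, h.V_neg, h.dθ_neg,
      smul_apply, sub_apply, add_apply, neg_apply, smul_eq_mul]
    push_cast
    field_simp
    ring
  · refine ContinuousLinearMap.ext fun v => ?_
    by_cases h0 : D.Ω γ = 0
    · simp [connTerm, h0]
    · simp [connTerm, (h.rest γ hγ h0).1]
  · refine ContinuousLinearMap.ext fun v => ?_
    simp only [smul_apply, sub_apply, add_apply, dtCoord_apply,
      dθelec_apply, conjForm_apply, smul_eq_mul, latticeConn, latticePot, map_mul, map_sub,
      map_div₀, Complex.conj_conj, Complex.conj_I, Complex.conj_ofReal, map_one]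
    push_cast
    rw [Complex.re_eq_add_conj]
    field_simp
    ring_nf
    try simp only [Complex.I_sq]
    try ring

theorem hasSum_potential (h : D.IsElectric N pos neg x τ) :
    HasSum (fun γ => (D.Ω γ : ℂ) * D.V γ x * (D.coeff γ : ℂ) ^ 2) (latticePot N (toBase x) : ℂ) := by
  have hpi : (Real.pi : ℂ) ≠ 0 := by exact_mod_cast Real.pi_ne_zero
  refine h.hasSum_two (E := ℂ) (e₁ := 0) (e₂ := 0) (f₁ := 0) (f₂ := 0)
    (e₃ := 1 / (2 * Real.pi)) (f₃ := 1 / (2 * Real.pi))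
    (fun n => ?_) (fun n => ?_) (fun γ hγ => ?_) ?_
  · simp only [h.Ω_pos, h.coeff_pos, h.V_pos, smul_eq_mul]
    push_cast
    ring
  · simp only [h.Ω_neg, h.coeff_neg, h.V_neg, smul_eq_mul]
    push_cast
    ring
  · by_cases h0 : D.Ω γ = 0
    · simp [h0]
    · simp [(h.rest γ hγ h0).1]
  · simp only [latticePot, smul_eq_mul]
    push_cast
    rw [Complex.re_eq_add_conj]
    field_simp
    ring

theorem hasSum_tensorT (h : D.IsElectric N pos neg x τ) (u v : Coord) :
    HasSum (fun γ => (D.Ω γ : ℂ) * D.V γ x * (absSq (D.dZ γ x) u v : ℂ))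
      (latticePot N (toBase x) * absSq (dtCoord x) u v : ℂ) := by
  have hneg : absSq (-dtCoord x) u v = absSq (dtCoord x) u v := by simp [absSq]
  have hpi : (Real.pi : ℂ) ≠ 0 := by exact_mod_cast Real.pi_ne_zero
  refine h.hasSum_two (E := ℂ) (e₁ := 0) (e₂ := 0) (f₁ := 0) (f₂ := 0)
    (e₃ := absSq (dtCoord x) u v / (2 * Real.pi)) (f₃ := absSq (dtCoord x) u v / (2 * Real.pi))
    (fun n => ?_) (fun n => ?_) (fun γ hγ => ?_) ?_
  · simp only [h.Ω_pos, h.dZ_pos, h.V_pos, smul_eq_mul]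
    push_cast
    ring
  · simp only [h.Ω_neg, h.dZ_neg, hneg, h.V_neg, smul_eq_mul]
    push_cast
    ring
  · by_cases h0 : D.Ω γ = 0
    · simp [h0]
    · simp [h.dZ_rest hγ h0, absSq]
  · simp only [latticePot, smul_eq_mul]
    push_cast
    rw [Complex.re_eq_add_conj]
    field_simp
    ring

/-- The special Kähler terms have the shape of the instanton terms: τ enters by adding Im τ to the
potential and by putting κ = Re τ. -/
theorem omegaHol_eq (h : D.IsElectric N pos neg x τ) : D.omegaHol x =
    ghCoordHol x (latticeConn N (toBase x)) (latticePot N (toBase x) + τ.im) τ.re := by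
  have hpi : (Real.pi : ℂ) ≠ 0 := by exact_mod_cast Real.pi_ne_zero
  rw [ghCoordHol, omegaHol, h.hasSum_holTerm.tsum_eq]
  ext v
  simp only [pair, h.dZ_magnetic, h.dZ_electric, h.dθ_magnetic, dθ_of_eq h.θ_electric,
    ContinuousAlternatingMap.compContinuousLinearMap_apply, ghHol_apply,
    ContinuousAlternatingMap.add_apply, ContinuousAlternatingMap.sub_apply,
    ContinuousAlternatingMap.smul_apply, wedge_apply, smul_apply,
    Function.comp, fderiv_toBase_apply, dtCoord_apply, dθelec_apply, dθmag_apply, smul_eq_mul]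
  conv_lhs => rw [← Complex.re_add_im τ]
  push_cast
  field_simp
  ring

theorem omegaThree_eq (h : D.IsElectric N pos neg x τ) : D.omegaThree x =
    ghCoordThree x (latticeConn N (toBase x)) (latticePot N (toBase x) + τ.im) := by
  have hpi : (Real.pi : ℂ) ≠ 0 := by exact_mod_cast Real.pi_ne_zero
  rw [ghCoordThree, omegaThree, h.hasSum_realTerm.tsum_eq]
  ext v
  simp only [pair, h.dZ_magnetic, h.dZ_electric, h.dθ_magnetic, dθ_of_eq h.θ_electric,
    ContinuousAlternatingMap.compContinuousLinearMap_apply, ghThree_apply,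
    ContinuousAlternatingMap.add_apply, ContinuousAlternatingMap.sub_apply,
    ContinuousAlternatingMap.smul_apply, wedge_apply, smul_apply, conjForm_apply, map_mul,
    Function.comp, fderiv_toBase_apply, dtCoord_apply, dθelec_apply, dθmag_apply, smul_eq_mul]
  conv_lhs => rw [← Complex.re_add_im τ]
  simp only [map_add, map_mul, Complex.conj_ofReal, Complex.conj_I]
  push_cast
  field_simp
  ring

theorem omega_eq (h : D.IsElectric N pos neg x τ) (α : Fin 3) :
    D.omega α x = ghCoord α x (latticeConn N (toBase x)) (latticePot N (toBase x) + τ.im) τ.re := by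
  ext v
  fin_cases α <;> simp [omega, ghCoord, h.omegaHol_eq, h.omegaThree_eq]

theorem potential_eq (h : D.IsElectric N pos neg x τ) :
    D.potential x = latticePot N (toBase x) + τ.im := by
  rw [potential, h.hasSum_potential.tsum_eq, h.tau_eq, Complex.ofReal_re, add_comm]

theorem tensorT_eq (h : D.IsElectric N pos neg x τ) (u v : Coord) :
    D.tensorT x u v = (latticePot N (toBase x) + τ.im) * absSq (dtCoord x) u v := by
  rw [tensorT, (h.hasSum_tensorT u v).tsum_eq, h.tau_eq, h.dZ_electric, ← Complex.ofReal_mul,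
    Complex.ofReal_re]
  ring

theorem conn_eq (h : D.IsElectric N pos neg x τ) : D.conn x =
    dθmag - (τ + Complex.I * latticePot N (toBase x)) • dθelec
      - (Complex.I / 2 * (starRingEnd ℂ) (latticeConn N (toBase x))) • dtCoord x +
        (Complex.I / 2 * latticeConn N (toBase x)) • conjForm (dtCoord x) := by
  rw [conn, h.hasSum_connTerm.tsum_eq, h.tau_eq, h.dθ_magnetic, dθ_of_eq h.θ_electric]
  refine ContinuousLinearMap.ext fun v => ?_
  simp only [smul_apply, sub_apply, add_apply, smul_eq_mul]
  ring

/-- The tensor T is the potential times |dt|², and dt is injective on the normal direction. -/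
theorem horizontallyNondegenerate_iff (h : D.IsElectric N pos neg x τ) :
    D.HorizontallyNondegenerate x ↔ latticePot N (toBase x) + τ.im ≠ 0 := by
  simp only [HorizontallyNondegenerate, h.tensorT_eq]
  constructor
  · intro H h0
    have := H (1, 0, 0) fun v => by rw [h0, zero_mul]
    exact one_ne_zero this
  · intro h0 u hu
    have := (mul_eq_zero.1 (hu u)).resolve_left h0
    rw [absSq, Complex.mul_conj, Complex.ofReal_re, Complex.normSq_eq_zero, dtCoord_apply] at this
    exact (mul_eq_zero.1 this).resolve_left (Complex.exp_ne_zero _)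

/-- No active central charge vanishes at x, so each Bessel series converges; the sums over charges
are the lattice sums just evaluated. Reality of ω₃ is visible from the closed formula, which is its
own conjugate. -/
theorem wellDefinedAt (h : D.IsElectric N pos neg x τ) : D.WellDefinedAt x := by
  have hne : ∀ γ, D.Ω γ ≠ 0 → D.Z γ x.1 ≠ 0 := by
    intro γ h0
    by_cases hγ : γ ∈ range (Sum.elim pos neg)
    · obtain ⟨n | n, rfl⟩ := hγ
      · rw [Sum.elim_inl, h.Z_pos]; exact h.ne_zero n
      · rw [Sum.elim_inr, h.Z_neg]; exact neg_ne_zero.2 (h.ne_zero n)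
    · obtain ⟨-, k, hk, hZ⟩ := h.rest γ hγ h0
      rwa [hZ]
  refine ⟨fun γ h0 => ?_, fun γ h0 => ?_, h.hasSum_holTerm.summable, h.hasSum_realTerm.summable,
    h.hasSum_connTerm.summable, h.hasSum_potential.summable,
    fun u v => (h.hasSum_tensorT u v).summable, fun v => ?_⟩
  · simp_rw [fun n => instV_term_eq n (hne γ h0) (D.θ γ x)]
    exact summable_fourierBesselTerm 0 0 (Complex.normSq_pos.2 (hne γ h0)) _
  · simp_rw [fun n => instA_term_eq n (hne γ h0) (D.θ γ x)]
    exact (summable_fourierBesselTerm 1 1 (Complex.normSq_pos.2 (hne γ h0)) _).mul_left _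
  · rw [h.omegaThree_eq, ← Complex.conj_eq_iff_im]
    simp only [ghCoordThree_apply, map_add, map_sub, map_mul, map_div₀, Complex.conj_conj,
      Complex.conj_I, Complex.conj_ofReal, map_one, map_pow, map_ofNat]
    ring

end IsElectric
end BPSData
end ConifoldHK
end

noncomputable section
namespace ConifoldHK
open MeasureTheory Filter Topology

/-! ### The forms of the resolved conifold and of the Ooguri-Vafa space -/

theorem baseM_subset_strip : baseM ⊆ strip := fun _ ht => ht.2.1

theorem fullM_subset_strip : fullM ⊆ strip := by
  rintro t (rfl | ht)
  · simp [strip]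
  · exact baseM_subset_strip ht

theorem isElectric_conifold (ε : ℕ) {x : Coord} (hx : Complex.exp x.1 ∈ strip) :
    (conifold ε).IsElectric univ (fun n => (0, 1, (n : ℤ))) (fun n => (0, -1, -(n : ℤ))) x
      (tauOV x.1 + tauDiff (Complex.exp x.1)) where
  inj := by
    rintro (⟨a, _⟩ | ⟨a, _⟩) (⟨b, _⟩ | ⟨b, _⟩) h <;> simp at h <;> simp [h]
  away := awayFrom_univ hx (Complex.exp_ne_zero _)
  Z_pos n s := by simp [conifold, conifoldZ]
  Z_neg n s := by simp [conifold, conifoldZ]; ring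
  θ_pos n y := by simp [conifold, conifoldAngle]
  θ_neg n y := by simp [conifold, conifoldAngle]
  Ω_pos n := by simp [conifold, conifoldIndex]
  Ω_neg n := by simp [conifold, conifoldIndex]
  coeff_pos n := rfl
  coeff_neg n := rfl
  rest := by
    rintro ⟨p, q, r⟩ hγ h0
    have hq : p = 0 ∧ q = 0 ∧ r ≠ 0 := by
      by_contra hcon
      refine h0 ?_
      have h1 : ¬ (p = 0 ∧ (q = 1 ∨ q = -1)) := by
        rintro ⟨rfl, rfl | rfl⟩
        · exact hγ ⟨Sum.inl ⟨r, trivial⟩, rfl⟩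
        · exact hγ ⟨Sum.inr ⟨-r, trivial⟩, by simp⟩
      simp [conifold, conifoldIndex, h1, hcon]
    obtain ⟨rfl, rfl, hr⟩ := hq
    exact ⟨rfl, (r : ℂ), by exact_mod_cast hr, fun s => by simp [conifold, conifoldZ]⟩
  Z_magnetic := by
    have h : (conifold ε).Z (conifold ε).magnetic = dualPeriod := by
      funext s; simp [conifold, conifoldZ]
    rw [h]
    exact hasDerivAt_dualPeriod hx
  Z_electric s := by simp [conifold, conifoldZ]
  θ_magnetic y := by simp [conifold, conifoldAngle]
  θ_electric y := by simp [conifold, conifoldAngle]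

theorem isElectric_ooguriVafa (ε : ℕ) {x : Coord} (hx : Complex.exp x.1 ∈ strip) :
    (ooguriVafa ε cutoff).IsElectric {0} (fun _ => (0, 1)) (fun _ => (0, -1)) x
      (tauOV x.1) where
  inj := by
    rintro (⟨a, rfl⟩ | ⟨a, rfl⟩) (⟨b, rfl⟩ | ⟨b, rfl⟩) h <;> simp at h <;> rfl
  away := (awayFrom_univ hx (Complex.exp_ne_zero _)).mono (subset_univ _)
  Z_pos n s := by
    obtain ⟨n, rfl : n = 0⟩ := n
    simp [ooguriVafa, ovZ]
  Z_neg n s := by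
    obtain ⟨n, rfl : n = 0⟩ := n
    simp [ooguriVafa, ovZ]
  θ_pos n y := by simp [ooguriVafa]
  θ_neg n y := by simp [ooguriVafa]
  Ω_pos n := by simp [ooguriVafa]
  Ω_neg n := by simp [ooguriVafa]
  coeff_pos n := rfl
  coeff_neg n := rfl
  rest := by
    intro γ hγ h0
    refine absurd ?_ h0
    have h1 : ¬ (γ = (0, 1) ∨ γ = (0, -1)) := by
      rintro (rfl | rfl)
      · exact hγ ⟨Sum.inl ⟨0, rfl⟩, rfl⟩
      · exact hγ ⟨Sum.inr ⟨0, rfl⟩, rfl⟩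
    simp [ooguriVafa, h1]
  Z_magnetic := by
    have h : (ooguriVafa ε cutoff).Z (ooguriVafa ε cutoff).magnetic = fun s =>
        1 / (2 * Real.pi * Complex.I) *
          (Complex.exp s * (s - Complex.log cutoff) - Complex.exp s) := by
      funext s; simp [ooguriVafa, ovZ]
    rw [h]
    exact hasDerivAt_ovZ_magnetic x.1
  Z_electric s := by simp [ooguriVafa, ovZ]
  θ_magnetic y := by simp [ooguriVafa]
  θ_electric y := by simp [ooguriVafa]

/-! ### Splitting off n = 0, and invariance under the deck transformations -/

theorem latticeBessel_add_two_pi (N : Set ℤ) (k : ℕ × ℕ × ℕ × ℕ) (t : ℂ) (θ : ℝ) :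
    latticeBessel N k (t, θ + 2 * Real.pi) = latticeBessel N k (t, θ) := by
  simp only [latticeBessel, latticeBesselTerm, fourierBessel_add_two_pi]

theorem latticePot_periodic (N : Set ℤ) (t : ℂ) :
    Function.Periodic (fun θ => latticePot N (t, θ)) (2 * Real.pi) := fun θ => by
  simp only [latticePot, latticeBessel_add_two_pi]

theorem latticeConn_periodic (N : Set ℤ) (t : ℂ) :
    Function.Periodic (fun θ => latticeConn N (t, θ)) (2 * Real.pi) := fun θ => by
  simp only [latticeConn, latticeBessel_add_two_pi]

theorem latticeBessel_univ {x : Base} (h : AwayFrom univ x.1) (k : ℕ × ℕ × ℕ × ℕ) :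
    latticeBessel univ k x = latticeBessel {0} k x + latticeBessel {0}ᶜ k x := by
  have h1 := (summable_latticeBesselTerm (h.mono (subset_univ {0})) k).hasSum
  have h2 := (summable_latticeBesselTerm (h.mono (subset_univ {0}ᶜ)) k).hasSum
  have h3 : HasSum (fun n : ℤ => latticeBesselTerm k n x) _ := h1.add_compl h2
  rw [latticeBessel, tsum_univ (fun n : ℤ => latticeBesselTerm k n x), h3.tsum_eq]
  rfl

theorem latticePot_univ {x : Base} (h : AwayFrom univ x.1) :
    latticePot univ x = latticePot {0} x + latticePot {0}ᶜ x := by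
  rw [latticePot, latticeBessel_univ h, Complex.add_re, mul_add]
  rfl

theorem latticeConn_univ {x : Base} (h : AwayFrom univ x.1) :
    latticeConn univ x = latticeConn {0} x + latticeConn {0}ᶜ x := by
  simp only [latticeConn, latticeBessel_univ h, map_add]
  ring

theorem tauOV_add (s : ℂ) (k : ℤ) : tauOV (s + 2 * Real.pi * Complex.I * k) = tauOV s + k := by
  have hpi : (Real.pi : ℂ) ≠ 0 := by exact_mod_cast Real.pi_ne_zero
  unfold tauOV
  field_simp
  ring

theorem exp_add_two_pi_I_mul (s : ℂ) (k : ℤ) :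
    Complex.exp (s + 2 * Real.pi * Complex.I * k) = Complex.exp s := by
  rw [show s + 2 * Real.pi * Complex.I * k = s + k * (2 * Real.pi * Complex.I) by ring]
  exact Complex.exp_periodic.int_mul k s

theorem toBase_deck (ε : ℕ) (k l m : ℤ) (x : Coord) :
    toBase (deck ε k l m x) = (Complex.exp x.1, x.2.1 + l * (2 * Real.pi)) := by
  simp only [toBase, deck, exp_add_two_pi_I_mul]
  rw [mul_comm (l : ℝ)]

theorem fderiv_deck_apply (ε : ℕ) (k l m : ℤ) (x v : Coord) :
    fderiv ℝ (deck ε k l m) x v = (v.1, v.2.1, v.2.2 + k * v.2.1) := by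
  have h : HasFDerivAt (deck ε k l m) ((ContinuousLinearMap.fst ℝ ℂ (ℝ × ℝ)).prod
      ((ContinuousLinearMap.fst ℝ ℝ ℝ ∘L ContinuousLinearMap.snd ℝ ℂ (ℝ × ℝ)).prod
        (ContinuousLinearMap.snd ℝ ℝ ℝ ∘L ContinuousLinearMap.snd ℝ ℂ (ℝ × ℝ) +
          (k : ℝ) • (ContinuousLinearMap.fst ℝ ℝ ℝ ∘L ContinuousLinearMap.snd ℝ ℂ (ℝ × ℝ))))) x := by
    have h1 := (ContinuousLinearMap.fst ℝ ℂ (ℝ × ℝ)).hasFDerivAt (x := x)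
    have h2 := (ContinuousLinearMap.fst ℝ ℝ ℝ ∘L
      ContinuousLinearMap.snd ℝ ℂ (ℝ × ℝ)).hasFDerivAt (x := x)
    have h3 := (ContinuousLinearMap.snd ℝ ℝ ℝ ∘L
      ContinuousLinearMap.snd ℝ ℂ (ℝ × ℝ)).hasFDerivAt (x := x)
    exact (h1.add_const _).prodMk ((h2.add_const _).prodMk
      (((h3.add (h2.const_mul (k : ℝ))).add_const _).add_const _))
  rw [h.fderiv]
  simp

/-- The deck transformation adds k dθ_β to dθ_{β^∨}, and the monodromy adds k to Re τ; the two
changes cancel. The constant επk does not enter the derivative, so the argument is the same for both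
kinds of characters. -/
theorem ghCoord_deck (ε : ℕ) (α : Fin 3) (k l m : ℤ) (x : Coord) (c : ℂ) (w κ : ℝ) :
    (ghCoord α (deck ε k l m x) c w (κ + k)).compContinuousLinearMap
      (fderiv ℝ (deck ε k l m) x) = ghCoord α x c w κ := by
  have he : Complex.exp (deck ε k l m x).1 = Complex.exp x.1 := exp_add_two_pi_I_mul _ _
  have h1 (v : Fin 2 → Coord) : ghCoordHol (deck ε k l m x) c w (κ + k)
      (fderiv ℝ (deck ε k l m) x ∘ v) = ghCoordHol x c w κ v := by
    simp only [ghCoordHol_apply, he, Function.comp, fderiv_deck_apply]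
    push_cast
    ring
  have h2 (v : Fin 2 → Coord) : ghCoordThree (deck ε k l m x) c w
      (fderiv ℝ (deck ε k l m) x ∘ v) = ghCoordThree x c w v := by
    simp only [ghCoordThree_apply, he, Function.comp, fderiv_deck_apply]
    push_cast
    ring
  ext v
  fin_cases α <;> simp [ghCoord, h1, h2]

theorem BPSData.IsElectric.omega_deck {G : Type} {D : BPSData G} {N : Set ℤ} {pos neg : N → G}
    {ε : ℕ} {k l m : ℤ} {x : Coord} {τ : ℂ} (h : D.IsElectric N pos neg x τ)
    (h' : D.IsElectric N pos neg (deck ε k l m x) (τ + k)) (α : Fin 3) :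
    (D.omega α (deck ε k l m x)).compContinuousLinearMap (fderiv ℝ (deck ε k l m) x) =
      D.omega α x := by
  have h1 : latticeConn N (toBase (deck ε k l m x)) = latticeConn N (toBase x) := by
    rw [toBase_deck]; exact (latticeConn_periodic N _).int_mul l _
  have h2 : latticePot N (toBase (deck ε k l m x)) = latticePot N (toBase x) := by
    rw [toBase_deck]; exact (latticePot_periodic N _).int_mul l _
  rw [h.omega_eq, h'.omega_eq, h1, h2]
  simpa using ghCoord_deck ε α k l m x (latticeConn N (toBase x)) (latticePot N (toBase x) + τ.im)
    τ.re

theorem exp_mem_strip {x : Coord} (hx : x ∈ cover) : Complex.exp x.1 ∈ strip :=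
  baseM_subset_strip hx

theorem omega_conifold_deck (ε : ℕ) {x : Coord} (hx : x ∈ cover) (α : Fin 3) (k l m : ℤ) :
    ((conifold ε).omega α (deck ε k l m x)).compContinuousLinearMap
      (fderiv ℝ (deck ε k l m) x) = (conifold ε).omega α x := by
  have he : Complex.exp (deck ε k l m x).1 = Complex.exp x.1 := exp_add_two_pi_I_mul _ _
  refine (isElectric_conifold ε (exp_mem_strip hx)).omega_deck ?_ α
  have := isElectric_conifold ε (x := deck ε k l m x) (he ▸ exp_mem_strip hx)
  rw [he] at this
  convert this using 1
  rw [show (deck ε k l m x).1 = x.1 + 2 * Real.pi * Complex.I * k from rfl, tauOV_add]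
  ring

theorem omega_ooguriVafa_deck (ε : ℕ) {x : Coord} (hx : x ∈ cover) (α : Fin 3) (k l m : ℤ) :
    ((ooguriVafa ε cutoff).omega α (deck ε k l m x)).compContinuousLinearMap
      (fderiv ℝ (deck ε k l m) x) = (ooguriVafa ε cutoff).omega α x := by
  have he : Complex.exp (deck ε k l m x).1 = Complex.exp x.1 := exp_add_two_pi_I_mul _ _
  refine (isElectric_ooguriVafa ε (exp_mem_strip hx)).omega_deck ?_ α
  rw [← tauOV_add]
  exact isElectric_ooguriVafa ε (x := deck ε k l m x) (he ▸ exp_mem_strip hx)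

/-! ### The difference of the forms -/

/-- The difference of the forms of the resolved conifold and of the Ooguri-Vafa space. -/
def etaForm (α : Fin 3) (y : Base) : Base [⋀^Fin 2]→L[ℝ] ℝ :=
  gh α (latticeConn {0}ᶜ y) (latticePot {0}ᶜ y + (tauDiff y.1).im) (tauDiff y.1).re

theorem isOpen_stripBase : IsOpen (strip ×ˢ (univ : Set ℝ)) := isOpen_strip.prod isOpen_univ

theorem contDiffOn_latticePot {N : Set ℤ} {U : Set Base} (hU : IsOpen U)
    (h : ∀ x ∈ U, AwayFrom N x.1) : ContDiffOn ℝ ∞ (latticePot N) U :=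
  contDiffOn_const.mul
    (Complex.reCLM.contDiff.comp_contDiffOn (contDiffOn_latticeBessel hU h _))

theorem contDiffOn_latticeConn {N : Set ℤ} {U : Set Base} (hU : IsOpen U)
    (h : ∀ x ∈ U, AwayFrom N x.1) : ContDiffOn ℝ ∞ (latticeConn N) U :=
  contDiffOn_const.mul ((contDiffOn_latticeBessel hU h _).sub
    (contDiffOn_conj (contDiffOn_latticeBessel hU h _)))

theorem contDiffOn_tauDiff : ContDiffOn ℝ ∞ tauDiff strip :=
  (differentiableOn_tauDiff.contDiffOn isOpen_strip).restrict_scalars ℝ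

theorem contDiffOn_tauDiff_fst :
    ContDiffOn ℝ ∞ (fun y : Base => tauDiff y.1) (strip ×ˢ (univ : Set ℝ)) :=
  contDiffOn_tauDiff.comp contDiff_fst.contDiffOn fun _ hy => hy.1

theorem contDiffOn_latticePot_compl :
    ContDiffOn ℝ ∞ (latticePot {0}ᶜ) (strip ×ˢ (univ : Set ℝ)) :=
  contDiffOn_latticePot isOpen_stripBase fun _ hx => awayFrom_compl_zero hx.1

theorem contDiffOn_latticeConn_compl :
    ContDiffOn ℝ ∞ (latticeConn {0}ᶜ) (strip ×ˢ (univ : Set ℝ)) :=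
  contDiffOn_latticeConn isOpen_stripBase fun _ hx => awayFrom_compl_zero hx.1

theorem contDiffOn_etaForm (α : Fin 3) :
    ContDiffOn ℝ ∞ (etaForm α) (strip ×ˢ (univ : Set ℝ)) :=
  contDiffOn_gh α contDiffOn_latticeConn_compl (contDiffOn_latticePot_compl.add
    (Complex.imCLM.contDiff.comp_contDiffOn contDiffOn_tauDiff_fst))
    (Complex.reCLM.contDiff.comp_contDiffOn contDiffOn_tauDiff_fst)

theorem etaForm_periodic (α : Fin 3) (t : ℂ) (θ : ℝ) :
    etaForm α (t, θ + 2 * Real.pi) = etaForm α (t, θ) := by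
  have h1 := latticeConn_periodic {0}ᶜ t θ
  have h2 := latticePot_periodic {0}ᶜ t θ
  simp only at h1 h2
  rw [etaForm, h1, h2]
  rfl

/-- The forms are additive in the potential, the connection coefficient and Re τ. The n = 0 pair and
the Ooguri-Vafa period reproduce the Ooguri-Vafa forms; the pairs n ≠ 0 and `tauDiff` make up
`etaForm`, which involves neither dθ_{β^∨} nor a singularity at t = 0. -/
theorem omega_conifold_eq (ε : ℕ) (α : Fin 3) {x : Coord} (hx : x ∈ cover) :
    (conifold ε).omega α x = (ooguriVafa ε cutoff).omega α x +
      (etaForm α (toBase x)).compContinuousLinearMap (fderiv ℝ toBase x) := by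
  have hx' := exp_mem_strip hx
  have haway : AwayFrom univ (toBase x).1 := awayFrom_univ hx' (Complex.exp_ne_zero _)
  rw [(isElectric_conifold ε hx').omega_eq, (isElectric_ooguriVafa ε hx').omega_eq, etaForm,
    ← ghCoord_add, latticePot_univ haway, latticeConn_univ haway, Complex.add_re, Complex.add_im,
    add_add_add_comm]
  rfl

/-- At t = 0 the summands carry one odd power of n and a Bessel factor depending on n² only, so n ↦
-n changes the sign of the sum. -/
theorem latticeConn_compl_zero (θ : ℝ) : latticeConn {0}ᶜ (0, θ) = 0 := by
  have key : ∀ k : ℕ × ℕ × ℕ × ℕ, k.2.2.1 + k.2.2.2 = 1 → latticeBessel {0}ᶜ k (0, θ) = 0 := by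
    intro k hk
    let e : ({0}ᶜ : Set ℤ) ≃ ({0}ᶜ : Set ℤ) := (Equiv.neg ℤ).subtypeEquiv fun n => by simp
    have h1 : ∀ n : ({0}ᶜ : Set ℤ), latticeBesselTerm k (e n) (0, θ) =
        -latticeBesselTerm k n (0, θ) := by
      intro n
      have he : ((e n : ℤ) : ℂ) = -(n : ℤ) := by simp [e]
      simp only [latticeBesselTerm, zero_add, he, Complex.normSq_neg, map_neg]
      obtain ⟨h, h'⟩ | ⟨h, h'⟩ : k.2.2.1 = 1 ∧ k.2.2.2 = 0 ∨ k.2.2.1 = 0 ∧ k.2.2.2 = 1 := by omega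
      · rw [h, h']; ring
      · rw [h, h']; ring
    have h2 := e.tsum_eq fun n : ({0}ᶜ : Set ℤ) => latticeBesselTerm k n (0, θ)
    simp_rw [h1] at h2
    rw [tsum_neg] at h2
    exact self_eq_neg.1 h2.symm
  rw [latticeConn, key _ rfl, key _ rfl]
  simp

/-- The pairs are labelled by t - n whereas the lattice sum uses t + n; at t = 0 only |n|² matters,
so no reindexing is needed. -/
theorem hasSum_pairV (θ : ℝ) : HasSum (fun n : {n : ℤ // n ≠ 0} => pairV n 0 θ)
    (latticePot {0}ᶜ (0, θ) : ℂ) := by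
  have h := (summable_latticeBesselTerm (N := {0}ᶜ) (x := (0, θ))
    (awayFrom_compl_zero (by simp)) (0, 0, 0, 0)).hasSum
  have h1 := ((h.mapL Complex.reCLM).mul_left (1 / Real.pi)).mapL Complex.ofRealCLM
  refine HasSum.congr_fun h1 fun n => ?_
  have hn : (-((n : ℤ) : ℂ)) ≠ 0 := by
    have : (n : ℤ) ≠ 0 := n.2
    exact_mod_cast neg_ne_zero.2 this
  have h2 := instV_add_neg hn θ
  rw [pairV, zero_sub, show -(0 : ℂ) + ((n : ℤ) : ℂ) = -(-((n : ℤ) : ℂ)) by ring, h2]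
  simp [pairPot, latticeBesselTerm]

theorem etaForm_zero (α : Fin 3) (θ : ℝ) :
    etaForm α (0, θ) = gh α 0 (latticePot {0}ᶜ (0, θ)) 0 := by
  simp [etaForm, latticeConn_compl_zero, tauDiff_zero]

theorem etaForm_zero_apply (θ : ℝ) :
    (∀ v, (etaForm 0 (0, θ) v : ℂ) =
      ((1 / (2 * Real.pi) * latticePot {0}ᶜ (0, θ) : ℝ) : ℂ) * wedge dtIm dθβ v) ∧
    (∀ v, (etaForm 1 (0, θ) v : ℂ) =
      ((-(1 / (2 * Real.pi)) * latticePot {0}ᶜ (0, θ) : ℝ) : ℂ) * wedge dtRe dθβ v) ∧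
    (∀ v, (etaForm 2 (0, θ) v : ℂ) =
      Complex.I / 2 * (latticePot {0}ᶜ (0, θ) : ℂ) * wedge dt (conjForm dt) v) := by
  set S := latticePot {0}ᶜ (0, θ) with hS
  have hneg (z : ℂ) : (-Complex.I * z).re = z.im ∧ (-Complex.I * z).im = -z.re := by simp
  have hhol (v : Fin 2 → Base) : ghHol 0 S 0 v = ((1 / (2 * Real.pi) * S : ℝ) : ℂ) *
      (-Complex.I * ((v 0).1 * (v 1).2 - (v 1).1 * (v 0).2)) := by
    rw [ghHol_apply]; push_cast; ring
  refine ⟨fun v => ?_, fun v => ?_, fun v => ?_⟩ <;> rw [etaForm_zero, ← hS]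
  · change (((ghHol 0 S 0 v).re : ℝ) : ℂ) = _
    rw [hhol, Complex.re_ofReal_mul, (hneg _).1, Complex.ofReal_mul]
    congr 1
    simp [wedge_apply, dtIm, realForm]
  · change (((ghHol 0 S 0 v).im : ℝ) : ℂ) = _
    rw [hhol, Complex.im_ofReal_mul, (hneg _).2, neg_mul, Complex.ofReal_mul, Complex.ofReal_neg,
      Complex.ofReal_neg]
    rw [mul_neg, neg_mul]
    congr 2
    simp [wedge_apply, dtRe, realForm]
  · change (((ghThree 0 S v).re : ℝ) : ℂ) = _
    rw [← (Complex.conj_eq_iff_re (z := Complex.I / 2 * (S : ℂ) * wedge dt (conjForm dt) v)).1]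
    · congr 2
      simp [ghThree_apply, wedge_apply]
    · simp only [wedge_apply, map_mul, map_sub, map_div₀, dt_apply, conjForm_apply,
        Complex.conj_conj, Complex.conj_I, Complex.conj_ofReal, map_ofNat]
      ring

end ConifoldHK
end

noncomputable section
namespace ConifoldHK
open MeasureTheory Filter Topology

/-! ### Sums over the lattice of images in the angle variable -/

/-- The translate `a + 2 π (n + 1)`. -/
def gapX (n : ℕ) (p : ℝ × ℝ) : ℝ := p.2 + 2 * Real.pi * (n + 1)

/-- The distance `√(4 π² y + (a + 2 π (n + 1))²)`. -/
def gapD (n : ℕ) (p : ℝ × ℝ) : ℝ := Real.sqrt (4 * Real.pi ^ 2 * p.1 + gapX n p ^ 2)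

/-- The monomials `x ^ i / (D ^ j (D + x) ^ l)` for `k = (i, j, l)`. -/
def gapTerm (k : ℕ × ℕ × ℕ) (n : ℕ) (p : ℝ × ℝ) : ℝ :=
  gapX n p ^ k.1 * (gapD n p)⁻¹ ^ k.2.1 * (gapD n p + gapX n p)⁻¹ ^ k.2.2

/-- The sum of `gapTerm k n`. -/
def gapSum (k : ℕ × ℕ × ℕ) (p : ℝ × ℝ) : ℝ := ∑' n, gapTerm k n p

/-- A convex open region on which the sums `gapSum` converge uniformly. -/
def gapRegion (δ R : ℝ) : Set (ℝ × ℝ) :=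
  {p | -δ ^ 2 < 4 * Real.pi ^ 2 * p.1} ∩ ({p | 2 * δ - 2 * Real.pi < p.2} ∩ {p | p.2 < R})

theorem isOpen_gapRegion (δ R : ℝ) : IsOpen (gapRegion δ R) :=
  (isOpen_lt continuous_const (by fun_prop)).inter
    ((isOpen_lt continuous_const continuous_snd).inter (isOpen_lt continuous_snd continuous_const))

theorem convex_gapRegion (δ R : ℝ) : Convex ℝ (gapRegion δ R) := by
  refine Convex.inter ?_ (Convex.inter ?_ ?_)
  · exact convex_halfSpace_gt (f := fun p : ℝ × ℝ => 4 * Real.pi ^ 2 * p.1)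
      ⟨fun _ _ => by simp; ring, fun _ _ => by simp; ring⟩ _
  · exact convex_halfSpace_gt (f := fun p : ℝ × ℝ => p.2) ⟨fun _ _ => rfl, fun _ _ => rfl⟩ _
  · exact convex_halfSpace_lt (f := fun p : ℝ × ℝ => p.2) ⟨fun _ _ => rfl, fun _ _ => rfl⟩ _

variable {δ R : ℝ} {p : ℝ × ℝ}

theorem two_mul_le_gapX (hp : p ∈ gapRegion δ R) (n : ℕ) :
    2 * δ + 2 * Real.pi * n ≤ gapX n p := by
  have := hp.2.1
  simp only [mem_ofPred_eq] at this
  unfold gapX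
  linarith

theorem gapX_pos (hδ : 0 < δ) (hp : p ∈ gapRegion δ R) (n : ℕ) : 0 < gapX n p := by
  have := two_mul_le_gapX hp n
  have : 0 ≤ 2 * Real.pi * n := by positivity
  linarith

theorem gapX_le (hp : p ∈ gapRegion δ R) (n : ℕ) :
    gapX n p ≤ (|R| + 2 * Real.pi) * (n + 1) := by
  have h1 : p.2 < R := hp.2.2
  have h2 := le_abs_self R
  have h3 : 0 ≤ |R| * n := by positivity
  unfold gapX
  nlinarith

/-- The first variable may be slightly negative, so that y = 0 is an interior point of the region
and smoothness through t = 0 is meaningful. The defect δ² is compensated by x ≥ 2δ + 2πn. -/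
theorem gapD_sq_le (hδ : 0 < δ) (hδ1 : δ ≤ 1) (hp : p ∈ gapRegion δ R) (n : ℕ) :
    (δ * (n + 1)) ^ 2 ≤ 4 * Real.pi ^ 2 * p.1 + gapX n p ^ 2 := by
  have h1 : -δ ^ 2 < 4 * Real.pi ^ 2 * p.1 := hp.1
  have h2 := two_mul_le_gapX hp n
  have h3 : (2 * δ) ^ 2 + (2 * Real.pi * n) ^ 2 ≤ gapX n p ^ 2 := by
    have : 0 ≤ 2 * Real.pi * n := by positivity
    nlinarith
  have hpi := Real.pi_gt_three
  have h4 : (2 * (n : ℝ)) ^ 2 ≤ (2 * Real.pi * n) ^ 2 := by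
    have : 0 ≤ (n : ℝ) := n.cast_nonneg
    refine pow_le_pow_left₀ (by positivity) ?_ 2
    nlinarith
  have h5 : δ ^ 2 ≤ 1 := by nlinarith
  have h6 : δ ^ 2 * (n : ℝ) ^ 2 ≤ (n : ℝ) ^ 2 := by nlinarith [sq_nonneg (n : ℝ)]
  nlinarith [sq_nonneg ((n : ℝ) - 1), sq_nonneg δ, mul_nonneg (sq_nonneg δ) (sq_nonneg ((n : ℝ) - 1))]

theorem le_gapD (hδ : 0 < δ) (hδ1 : δ ≤ 1) (hp : p ∈ gapRegion δ R) (n : ℕ) :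
    δ * (n + 1) ≤ gapD n p :=
  Real.le_sqrt_of_sq_le (gapD_sq_le hδ hδ1 hp n)

theorem gapD_pos (hδ : 0 < δ) (hδ1 : δ ≤ 1) (hp : p ∈ gapRegion δ R) (n : ℕ) : 0 < gapD n p :=
  lt_of_lt_of_le (by positivity) (le_gapD hδ hδ1 hp n)

theorem summable_natCast_add_one_inv_sq : Summable fun n : ℕ => ((n : ℝ) + 1)⁻¹ ^ 2 := by
  have h := (summable_nat_add_iff 1).2 (Real.summable_nat_pow_inv.2 one_lt_two)
  refine h.congr fun n => ?_
  push_cast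
  rw [inv_pow]

/-- Both x and D are comparable to n + 1, so a monomial decays like (n + 1)^(i - j - l). The
condition i + 2 ≤ j + l is preserved by the index changes in `gapDy` and `gapDa`, which makes the
family closed under differentiation. -/
theorem gapTerm_bound (hδ : 0 < δ) (hδ1 : δ ≤ 1) (R : ℝ) {k : ℕ × ℕ × ℕ}
    (hk : k.1 + 2 ≤ k.2.1 + k.2.2) :
    ∃ C : ℝ, 0 ≤ C ∧ ∀ n, ∀ p ∈ gapRegion δ R, ‖gapTerm k n p‖ ≤ C * ((n : ℝ) + 1)⁻¹ ^ 2 := by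
  obtain ⟨i, j, l⟩ := k
  obtain ⟨r, hr⟩ := Nat.exists_eq_add_of_le hk
  simp only at hr
  refine ⟨(|R| + 2 * Real.pi) ^ i * δ⁻¹ ^ (j + l), by positivity, fun n p hp => ?_⟩
  have hx := gapX_pos hδ hp n
  have hD := gapD_pos hδ hδ1 hp n
  have hn : (0 : ℝ) < n + 1 := by positivity
  have h1 : (gapD n p)⁻¹ ≤ δ⁻¹ * ((n : ℝ) + 1)⁻¹ := by
    rw [← mul_inv]
    exact inv_anti₀ (by positivity) (le_gapD hδ hδ1 hp n)
  have h2 : (gapD n p + gapX n p)⁻¹ ≤ δ⁻¹ * ((n : ℝ) + 1)⁻¹ :=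
    (inv_anti₀ hD (by linarith)).trans h1
  rw [Real.norm_of_nonneg (by unfold gapTerm; positivity)]
  calc gapTerm (i, j, l) n p ≤ ((|R| + 2 * Real.pi) * (n + 1)) ^ i * (δ⁻¹ * ((n : ℝ) + 1)⁻¹) ^ j *
        (δ⁻¹ * ((n : ℝ) + 1)⁻¹) ^ l := by
        unfold gapTerm
        gcongr
        exact gapX_le hp n
    _ = (|R| + 2 * Real.pi) ^ i * δ⁻¹ ^ (j + l) * (((n : ℝ) + 1) ^ i *
        ((n : ℝ) + 1)⁻¹ ^ (j + l)) := by rw [mul_pow, mul_pow, mul_pow]; ring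
    _ ≤ (|R| + 2 * Real.pi) ^ i * δ⁻¹ ^ (j + l) * ((n : ℝ) + 1)⁻¹ ^ 2 := by
        gcongr
        rw [hr, pow_add, pow_add, ← mul_assoc, ← mul_assoc, ← mul_pow, mul_inv_cancel₀ hn.ne',
          one_pow, one_mul]
        refine mul_le_of_le_one_right (by positivity) (pow_le_one₀ (by positivity) ?_)
        exact inv_le_one_of_one_le₀ (by linarith [n.cast_nonneg (α := ℝ)])

theorem summable_gapTerm (hδ : 0 < δ) (hδ1 : δ ≤ 1) (hp : p ∈ gapRegion δ R) {k : ℕ × ℕ × ℕ}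
    (hk : k.1 + 2 ≤ k.2.1 + k.2.2) : Summable fun n => gapTerm k n p := by
  obtain ⟨C, -, h⟩ := gapTerm_bound hδ hδ1 R hk
  exact Summable.of_norm_bounded (summable_natCast_add_one_inv_sq.mul_left C) fun n => h n p hp

theorem hasDerivAt_inv_pow (j : ℕ) {z : ℝ} (hz : z ≠ 0) :
    HasDerivAt (fun z : ℝ => z⁻¹ ^ j) (-(j * z⁻¹ ^ (j + 1))) z := by
  refine ((hasDerivAt_inv hz).pow j).congr_deriv ?_
  rcases j with _ | j
  · simp
  · simp only [Nat.add_sub_cancel, pow_succ]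
    field_simp

theorem hasDerivAt_pow_coe (i : ℕ) (z : ℝ) :
    HasDerivAt (fun z : ℝ => z ^ i) (i * z ^ (i - 1)) z := hasDerivAt_pow i z

theorem hasFDerivAt_gapX (n : ℕ) (p : ℝ × ℝ) :
    HasFDerivAt (gapX n) (ContinuousLinearMap.snd ℝ ℝ ℝ) p :=
  (ContinuousLinearMap.snd ℝ ℝ ℝ).hasFDerivAt.add_const _

theorem hasFDerivAt_gapD (n : ℕ) {p : ℝ × ℝ} (hp : 0 < gapD n p) :
    HasFDerivAt (gapD n) ((2 * Real.pi ^ 2 * (gapD n p)⁻¹) • ContinuousLinearMap.fst ℝ ℝ ℝ +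
      (gapX n p * (gapD n p)⁻¹) • ContinuousLinearMap.snd ℝ ℝ ℝ) p := by
  have h0 : 4 * Real.pi ^ 2 * p.1 + gapX n p ^ 2 ≠ 0 := (Real.sqrt_pos.1 hp).ne'
  have h1 := ((ContinuousLinearMap.fst ℝ ℝ ℝ).hasFDerivAt (x := p)).const_mul (4 * Real.pi ^ 2)
  have h2 := (hasDerivAt_pow 2 (gapX n p)).comp_hasFDerivAt p (hasFDerivAt_gapX n p)
  refine ((h1.add h2).sqrt h0).congr_fderiv ?_
  refine ContinuousLinearMap.ext fun v => ?_
  have hD : √((fun y : ℝ × ℝ => 4 * Real.pi ^ 2 * (ContinuousLinearMap.fst ℝ ℝ ℝ) y) p +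
    ((fun x => x ^ 2) ∘ gapX n) p) = gapD n p := rfl
  simp only [Pi.add_apply]
  rw [hD]
  simp
  field_simp
  ring

/-- The derivative of `gapSum k` in the first variable, as a combination of the family `f`. -/
def gapDy (k : ℕ × ℕ × ℕ) (f : ℕ × ℕ × ℕ → ℝ) : ℝ :=
  -(2 * Real.pi ^ 2) * (k.2.1 * f (k.1, k.2.1 + 2, k.2.2) + k.2.2 * f (k.1, k.2.1 + 1, k.2.2 + 1))

/-- The derivative of `gapSum k` in the second variable, as a combination of the family `f`. -/
def gapDa (k : ℕ × ℕ × ℕ) (f : ℕ × ℕ × ℕ → ℝ) : ℝ :=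
  k.1 * f (k.1 - 1, k.2.1, k.2.2) - k.2.1 * f (k.1 + 1, k.2.1 + 2, k.2.2) -
    k.2.2 * f (k.1, k.2.1 + 1, k.2.2)

/-- From ∂D/∂y = 2π²/D and ∂D/∂a = x/D. In the second direction ∂(D + x)/∂a = (D + x)/D, so a power
of (D + x)⁻¹ only acquires a factor D⁻¹ and its exponent l is unchanged. -/
theorem hasFDerivAt_gapTerm (k : ℕ × ℕ × ℕ) (n : ℕ) {p : ℝ × ℝ} (hD : 0 < gapD n p)
    (hx : 0 < gapX n p) :
    HasFDerivAt (gapTerm k n)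
      (gapDy k (fun k => gapTerm k n p) • ContinuousLinearMap.fst ℝ ℝ ℝ +
        gapDa k (fun k => gapTerm k n p) • ContinuousLinearMap.snd ℝ ℝ ℝ) p := by
  have h1 := (hasDerivAt_pow_coe k.1 (gapX n p)).comp_hasFDerivAt p (hasFDerivAt_gapX n p)
  have h2 := (hasDerivAt_inv_pow k.2.1 hD.ne').comp_hasFDerivAt p (hasFDerivAt_gapD n hD)
  have h3 := (hasDerivAt_inv_pow k.2.2 (add_pos hD hx).ne').comp_hasFDerivAt p
    ((hasFDerivAt_gapD n hD).add (hasFDerivAt_gapX n p))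
  refine ((h1.mul h2).mul h3).congr_fderiv ?_
  refine ContinuousLinearMap.ext fun v => ?_
  have hDx : gapD n p * (gapD n p)⁻¹ = 1 := mul_inv_cancel₀ hD.ne'
  have hS : (gapD n p + gapX n p) * (gapD n p + gapX n p)⁻¹ = 1 :=
    mul_inv_cancel₀ (add_pos hD hx).ne'
  simp only [gapDy, gapDa, gapTerm, add_apply, smul_apply, smul_eq_mul, Function.comp,
    ContinuousLinearMap.coe_fst', ContinuousLinearMap.coe_snd', Pi.mul_apply]
  generalize (gapD n p + gapX n p)⁻¹ = S at *
  generalize (gapD n p)⁻¹ = E at *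
  generalize gapX n p = x at *
  generalize gapD n p = D at *
  linear_combination (-(k.2.2 : ℝ) * x ^ k.1 * E ^ k.2.1 * S ^ (k.2.2) * v.2 * E) * hS +
    (k.2.2 : ℝ) * x ^ k.1 * E ^ k.2.1 * S ^ (k.2.2 + 1) * v.2 * hDx

theorem hasFDerivAt_gapSum (hδ : 0 < δ) (hδ1 : δ ≤ 1) (hp : p ∈ gapRegion δ R) {k : ℕ × ℕ × ℕ}
    (hk : k.1 + 2 ≤ k.2.1 + k.2.2) :
    HasFDerivAt (gapSum k)
      (gapDy k (fun k => gapSum k p) • ContinuousLinearMap.fst ℝ ℝ ℝ +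
        gapDa k (fun k => gapSum k p) • ContinuousLinearMap.snd ℝ ℝ ℝ) p := by
  have hS : ∀ {k : ℕ × ℕ × ℕ}, k.1 + 2 ≤ k.2.1 + k.2.2 →
      HasSum (fun n => gapTerm k n p) (gapSum k p) :=
    fun hk => (summable_gapTerm hδ hδ1 hp hk).hasSum
  obtain ⟨i, j, l⟩ := k
  simp only at hk
  obtain ⟨C₁, hC₁, h₁⟩ := gapTerm_bound hδ hδ1 R (k := (i, j + 2, l)) (by simp only; omega)
  obtain ⟨C₂, hC₂, h₂⟩ := gapTerm_bound hδ hδ1 R (k := (i, j + 1, l + 1)) (by simp only; omega)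
  obtain ⟨C₃, hC₃, h₃⟩ := gapTerm_bound hδ hδ1 R (k := (i - 1, j, l)) (by simp only; omega)
  obtain ⟨C₄, hC₄, h₄⟩ := gapTerm_bound hδ hδ1 R (k := (i + 1, j + 2, l)) (by simp only; omega)
  obtain ⟨C₅, hC₅, h₅⟩ := gapTerm_bound hδ hδ1 R (k := (i, j + 1, l)) (by simp only; omega)
  have hsum : HasSum (fun n => gapDy (i, j, l) (fun k => gapTerm k n p) •
      ContinuousLinearMap.fst ℝ ℝ ℝ + gapDa (i, j, l) (fun k => gapTerm k n p) •
      ContinuousLinearMap.snd ℝ ℝ ℝ) (gapDy (i, j, l) (fun k => gapSum k p) •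
      ContinuousLinearMap.fst ℝ ℝ ℝ + gapDa (i, j, l) (fun k => gapSum k p) •
      ContinuousLinearMap.snd ℝ ℝ ℝ) := by
    unfold gapDy gapDa
    simp only
    refine (((((hS ?_).mul_left _).add ((hS ?_).mul_left _)).mul_left _).smul_const _).add
      (((((hS ?_).mul_left _).sub ((hS ?_).mul_left _)).sub ((hS ?_).mul_left _)).smul_const _) <;>
    simp only <;> omega
  rw [← hsum.tsum_eq]
  have hfs : ∀ c d : ℝ, ‖c • ContinuousLinearMap.fst ℝ ℝ ℝ + d • ContinuousLinearMap.snd ℝ ℝ ℝ‖ ≤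
      |c| + |d| := by
    intro c d
    refine (norm_add_le _ _).trans (add_le_add ?_ ?_) <;> rw [norm_smul]
    · exact mul_le_of_le_one_right (norm_nonneg _) (ContinuousLinearMap.norm_fst_le ℝ ℝ ℝ)
    · exact mul_le_of_le_one_right (norm_nonneg _) (ContinuousLinearMap.norm_snd_le ℝ ℝ ℝ)
  refine hasFDerivAt_tsum_of_isPreconnected (𝕜 := ℝ)
    (u := fun n : ℕ => ((2 * Real.pi ^ 2) * (j * C₁ + l * C₂) + (i * C₃ + j * C₄ + l * C₅)) *
      ((n : ℝ) + 1)⁻¹ ^ 2)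
    (summable_natCast_add_one_inv_sq.mul_left _) (isOpen_gapRegion δ R)
    (convex_gapRegion δ R).isPreconnected (f := fun n => gapTerm (i, j, l) n)
    (fun n z hz => hasFDerivAt_gapTerm _ n (gapD_pos hδ hδ1 hz n) (gapX_pos hδ hz n))
    (fun n z hz => (hfs _ _).trans ?_) hp
    (hS (k := (i, j, l)) hk).summable hp
  have g₁ := h₁ n z hz
  have g₂ := h₂ n z hz
  have g₃ := h₃ n z hz
  have g₄ := h₄ n z hz
  have g₅ := h₅ n z hz
  set q := ((n : ℝ) + 1)⁻¹ ^ 2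
  have hm : ∀ (m : ℕ) {A B : ℝ}, ‖A‖ ≤ B → |(m : ℝ) * A| ≤ m * B := fun m A B h => by
    rw [abs_mul, Nat.abs_cast]
    exact mul_le_mul_of_nonneg_left h (Nat.cast_nonneg _)
  rw [add_mul]
  refine add_le_add ?_ ?_
  · unfold gapDy
    rw [abs_mul, abs_neg, abs_of_pos (by positivity : (0 : ℝ) < 2 * Real.pi ^ 2), mul_assoc (2 * Real.pi ^ 2)]
    refine mul_le_mul_of_nonneg_left ((abs_add_le _ _).trans ?_)
      (by positivity : (0 : ℝ) ≤ 2 * Real.pi ^ 2)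
    rw [add_mul, mul_assoc, mul_assoc]
    exact add_le_add (hm _ g₁) (hm _ g₂)
  · unfold gapDa
    rw [add_mul, add_mul, mul_assoc, mul_assoc, mul_assoc]
    exact (abs_sub _ _).trans (add_le_add ((abs_sub _ _).trans (add_le_add (hm _ g₃) (hm _ g₄)))
      (hm _ g₅))

theorem contDiffOn_gapSum (hδ : 0 < δ) (hδ1 : δ ≤ 1) {k : ℕ × ℕ × ℕ}
    (hk : k.1 + 2 ≤ k.2.1 + k.2.2) : ContDiffOn ℝ ∞ (gapSum k) (gapRegion δ R) := by
  have hd : ∀ k : {k : ℕ × ℕ × ℕ // k.1 + 2 ≤ k.2.1 + k.2.2}, ∀ p ∈ gapRegion δ R,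
      HasFDerivAt (gapSum k.1) (gapDy k.1 (fun k => gapSum k p) • ContinuousLinearMap.fst ℝ ℝ ℝ +
        gapDa k.1 (fun k => gapSum k p) • ContinuousLinearMap.snd ℝ ℝ ℝ) p :=
    fun k p hp => hasFDerivAt_gapSum hδ hδ1 hp k.2
  refine contDiffOn_infty_of_hasFDerivAt_family (isOpen_gapRegion δ R)
    (fun k : {k : ℕ × ℕ × ℕ // k.1 + 2 ≤ k.2.1 + k.2.2} => gapSum k.1) _ hd
    (fun n ih => ?_) ⟨k, hk⟩
  rintro ⟨⟨i, j, l⟩, hk⟩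
  simp only at hk
  have ih' : ∀ k : ℕ × ℕ × ℕ, k.1 + 2 ≤ k.2.1 + k.2.2 →
    ContDiffOn ℝ n (fun p => gapSum k p) (gapRegion δ R) := fun k hk => ih ⟨k, hk⟩
  unfold gapDy gapDa
  refine ((contDiffOn_const.mul ((contDiffOn_const.mul (ih' _ ?_)).add
    (contDiffOn_const.mul (ih' _ ?_)))).smul contDiffOn_const).add
    ((((contDiffOn_const.mul (ih' _ ?_)).sub (contDiffOn_const.mul (ih' _ ?_))).sub
      (contDiffOn_const.mul (ih' _ ?_))).smul contDiffOn_const) <;> simp only <;> omega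

/-! ### The renormalised sum of inverse distances -/

/-- The sum of the renormalised terms `1 / 2D - 1 / 4π(n + 1)`. -/
def gapPot (p : ℝ × ℝ) : ℝ :=
  ∑' n : ℕ, ((gapD n p)⁻¹ / 2 - (4 * Real.pi * ((n : ℝ) + 1))⁻¹)

theorem hasFDerivAt_gapPot (hδ : 0 < δ) (hδ1 : δ ≤ 1) (hR : 0 < R) (hp : p ∈ gapRegion δ R) :
    HasFDerivAt gapPot ((-Real.pi ^ 2 * gapSum (0, 3, 0) p) • ContinuousLinearMap.fst ℝ ℝ ℝ +
      (-(1 / 2) * gapSum (1, 3, 0) p) • ContinuousLinearMap.snd ℝ ℝ ℝ) p := by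
  have hS : ∀ {k : ℕ × ℕ × ℕ}, k.1 + 2 ≤ k.2.1 + k.2.2 →
      HasSum (fun n => gapTerm k n p) (gapSum k p) :=
    fun hk => (summable_gapTerm hδ hδ1 hp hk).hasSum
  obtain ⟨C₁, hC₁, h₁⟩ := gapTerm_bound hδ hδ1 R (k := (0, 3, 0)) (by norm_num)
  obtain ⟨C₂, hC₂, h₂⟩ := gapTerm_bound hδ hδ1 R (k := (1, 3, 0)) (by norm_num)
  have hsum : HasSum (fun n => (-Real.pi ^ 2 * gapTerm (0, 3, 0) n p) •
      ContinuousLinearMap.fst ℝ ℝ ℝ + (-(1 / 2) * gapTerm (1, 3, 0) n p) •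
      ContinuousLinearMap.snd ℝ ℝ ℝ) ((-Real.pi ^ 2 * gapSum (0, 3, 0) p) •
      ContinuousLinearMap.fst ℝ ℝ ℝ +
      (-(1 / 2) * gapSum (1, 3, 0) p) • ContinuousLinearMap.snd ℝ ℝ ℝ) :=
    (((hS (by norm_num)).mul_left _).smul_const _).add
      (((hS (by norm_num)).mul_left _).smul_const _)
  rw [← hsum.tsum_eq]
  have hfs : ∀ c d : ℝ, ‖c • ContinuousLinearMap.fst ℝ ℝ ℝ + d • ContinuousLinearMap.snd ℝ ℝ ℝ‖ ≤
      |c| + |d| := by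
    intro c d
    refine (norm_add_le _ _).trans (add_le_add ?_ ?_) <;> rw [norm_smul]
    · exact mul_le_of_le_one_right (norm_nonneg _) (ContinuousLinearMap.norm_fst_le ℝ ℝ ℝ)
    · exact mul_le_of_le_one_right (norm_nonneg _) (ContinuousLinearMap.norm_snd_le ℝ ℝ ℝ)
  have hpi := Real.pi_gt_three
  -- Termwise differentiation needs convergence at one point only; at the origin D = 2π(n + 1) and
  -- every renormalised term is zero.
  have h0 : ((0, 0) : ℝ × ℝ) ∈ gapRegion δ R := by
    refine ⟨?_, ?_, hR⟩
    · simp; positivity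
    · simp only [mem_ofPred_eq]; linarith
  refine hasFDerivAt_tsum_of_isPreconnected (𝕜 := ℝ)
    (u := fun n : ℕ => (Real.pi ^ 2 * C₁ + 1 / 2 * C₂) * ((n : ℝ) + 1)⁻¹ ^ 2)
    (summable_natCast_add_one_inv_sq.mul_left _) (isOpen_gapRegion δ R)
    (convex_gapRegion δ R).isPreconnected
    (f := fun (n : ℕ) p => (gapD n p)⁻¹ / 2 - (4 * Real.pi * ((n : ℝ) + 1))⁻¹)
    (f' := fun n p => (-Real.pi ^ 2 * gapTerm (0, 3, 0) n p) • ContinuousLinearMap.fst ℝ ℝ ℝ +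
      (-(1 / 2) * gapTerm (1, 3, 0) n p) • ContinuousLinearMap.snd ℝ ℝ ℝ)
    (fun n z hz => ?_)
    (fun n z hz => (hfs _ _).trans ?_) h0 ?_ hp
  · have hD := gapD_pos hδ hδ1 hz n
    have h := (((hasDerivAt_inv hD.ne').comp_hasFDerivAt z (hasFDerivAt_gapD n hD)).mul_const
      (2 : ℝ)⁻¹).sub_const (4 * Real.pi * ((n : ℝ) + 1))⁻¹
    refine h.congr_fderiv ?_
    refine ContinuousLinearMap.ext fun v => ?_
    simp [gapTerm]
    field_simp
  · rw [add_mul]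
    refine add_le_add ?_ ?_
    · rw [abs_mul, abs_neg, abs_of_pos (by positivity : (0 : ℝ) < Real.pi ^ 2), mul_assoc]
      exact mul_le_mul_of_nonneg_left (h₁ n z hz) (by positivity)
    · rw [abs_mul, abs_neg, abs_of_pos (by positivity : (0 : ℝ) < 1 / 2), mul_assoc]
      exact mul_le_mul_of_nonneg_left (h₂ n z hz) (by positivity)
  · refine summable_zero.congr fun n => ?_
    have : gapD n (0, 0) = 2 * Real.pi * (n + 1) := by
      rw [gapD, gapX]
      simp only [mul_zero, zero_add]
      exact Real.sqrt_sq (by positivity)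
    rw [this]
    field_simp
    ring

theorem contDiffOn_gapPot (hδ : 0 < δ) (hδ1 : δ ≤ 1) (hR : 0 < R) :
    ContDiffOn ℝ ∞ gapPot (gapRegion δ R) := by
  have hd : ∀ p ∈ gapRegion δ R, HasFDerivAt gapPot _ p :=
    fun p hp => hasFDerivAt_gapPot hδ hδ1 hR hp
  rw [contDiffOn_infty_iff_fderiv_of_isOpen (isOpen_gapRegion δ R)]
  refine ⟨fun p hp => (hd p hp).differentiableAt.differentiableWithinAt, ?_⟩
  refine ContDiffOn.congr (f := fun p => (-Real.pi ^ 2 * gapSum (0, 3, 0) p) •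
    ContinuousLinearMap.fst ℝ ℝ ℝ + (-(1 / 2) * gapSum (1, 3, 0) p) •
    ContinuousLinearMap.snd ℝ ℝ ℝ) ?_ fun p hp => (hd p hp).fderiv
  exact ((contDiffOn_const.mul (contDiffOn_gapSum hδ hδ1 (by norm_num))).smul contDiffOn_const).add
    ((contDiffOn_const.mul (contDiffOn_gapSum hδ hδ1 (by norm_num))).smul contDiffOn_const)

end ConifoldHK
end

noncomputable section
namespace ConifoldHK
open MeasureTheory Filter Topology

/-! ### Poisson summation -/

/-- The kernel `exp (-π² v - Y / v)`. -/
def heatKer (Y v : ℝ) : ℝ := Real.exp (-(Real.pi ^ 2 * v) - Y / v)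

theorem heatKer_zero (v : ℝ) : heatKer 0 v = Real.exp (-Real.pi ^ 2 * v) := by
  simp [heatKer]

theorem heatKer_eq_besselKer {Y : ℝ} (hY : 0 < Y) {v : ℝ} (hv : 0 < v) :
    heatKer Y v = besselKer 1 Y (Real.pi ^ 2 / Y * v) := by
  have hpi := Real.pi_pos
  have hu : Real.pi ^ 2 / Y * v ≠ 0 := by positivity
  rw [heatKer, besselKer, pow_one, mul_inv_cancel₀ hu, one_mul]
  congr 1
  field_simp

theorem integrableOn_heatKer {Y : ℝ} (hY : 0 ≤ Y) : IntegrableOn (heatKer Y) (Ioi 0) := by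
  have hpi := Real.pi_pos
  rcases hY.eq_or_lt with rfl | hY
  · simp_rw [funext heatKer_zero]
    exact exp_neg_integrableOn_Ioi 0 (by positivity)
  · have hb : 0 < Real.pi ^ 2 / Y := by positivity
    have h := (integrableOn_Ioi_comp_mul_left_iff (besselKer 1 Y) 0 hb).2
      (by rw [mul_zero]; exact integrableOn_besselKer 1 hY)
    exact h.congr_fun (fun v hv => (heatKer_eq_besselKer hY hv).symm) measurableSet_Ioi

theorem integral_heatKer_zero : ∫ v in Ioi (0 : ℝ), heatKer 0 v = 1 / Real.pi ^ 2 := by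
  have hpi := Real.pi_pos
  simp_rw [heatKer_zero]
  rw [integral_exp_mul_Ioi (by simp; positivity)]
  simp

theorem integral_heatKer {Y : ℝ} (hY : 0 < Y) :
    ∫ v in Ioi (0 : ℝ), heatKer Y v = 2 * Y / Real.pi ^ 2 * besselInt 1 Y := by
  have hpi := Real.pi_pos
  have hb : 0 < Real.pi ^ 2 / Y := by positivity
  rw [setIntegral_congr_fun measurableSet_Ioi fun v hv => heatKer_eq_besselKer hY hv,
    integral_comp_mul_left_Ioi (besselKer 1 Y) 0 hb, mul_zero, besselInt, smul_eq_mul]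
  field_simp

/-- The transformation formula of the theta function with parameter y/(πv) and imaginary shift
ia/2π, multiplied by exp(-π²v). Integrated over v, the left terms become Bessel terms and the right
terms become images at distance D. -/
theorem tsum_exp_mul_heatKer {y : ℝ} (hy : 0 < y) (a : ℝ) {v : ℝ} (hv : 0 < v) :
    ∑' m : ℤ, Complex.exp (Complex.I * m * a) * (heatKer ((m : ℝ) ^ 2 * y) v : ℂ) =
      ∑' n : ℤ, ((Real.sqrt (Real.pi / y) * (v ^ ((3 / 2 : ℝ) - 1) * Real.exp
        (-((4 * Real.pi ^ 2 * y + (2 * Real.pi * n - a) ^ 2) / (4 * y) * v))) : ℝ) : ℂ) := by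
  have hpi := Real.pi_pos
  have hpi' : (Real.pi : ℂ) ≠ 0 := by exact_mod_cast hpi.ne'
  have hy' : (y : ℂ) ≠ 0 := by exact_mod_cast hy.ne'
  have hv' : (v : ℂ) ≠ 0 := by exact_mod_cast hv.ne'
  have hA : 0 < y / (Real.pi * v) := by positivity
  have h := Complex.tsum_exp_neg_quadratic (a := ((y / (Real.pi * v) : ℝ) : ℂ))
    (by rw [Complex.ofReal_re]; exact hA) (Complex.I * a / (2 * Real.pi))
  have h2 : (1 : ℂ) / ((y / (Real.pi * v) : ℝ) : ℂ) ^ (1 / 2 : ℂ) =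
      ((Real.sqrt (Real.pi / y) * v ^ ((3 / 2 : ℝ) - 1) : ℝ) : ℂ) := by
    rw [show (1 / 2 : ℂ) = ((1 / 2 : ℝ) : ℂ) by norm_num, ← Complex.ofReal_cpow hA.le,
      ← Complex.ofReal_one, ← Complex.ofReal_div]
    congr 1
    rw [show (3 / 2 : ℝ) - 1 = 1 / 2 by norm_num, ← Real.sqrt_eq_rpow, ← Real.sqrt_eq_rpow,
      one_div, ← Real.sqrt_inv, ← Real.sqrt_mul (by positivity)]
    congr 1
    field_simp
  rw [h2] at h
  have hl : ∀ m : ℤ, Complex.exp (Complex.I * m * a) * (heatKer ((m : ℝ) ^ 2 * y) v : ℂ) =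
      (Real.exp (-(Real.pi ^ 2 * v)) : ℂ) * Complex.exp (-Real.pi * ((y / (Real.pi * v) : ℝ) : ℂ) *
        m ^ 2 + 2 * Real.pi * (Complex.I * a / (2 * Real.pi)) * m) := by
    intro m
    rw [heatKer]
    push_cast
    rw [← Complex.exp_add, ← Complex.exp_add]
    congr 1
    field_simp
    ring
  rw [tsum_congr hl, tsum_mul_left, h, ← tsum_mul_left, ← tsum_mul_left]
  refine tsum_congr fun n => ?_
  have hr : Complex.exp (-Real.pi / ((y / (Real.pi * v) : ℝ) : ℂ) *
      (n + Complex.I * (Complex.I * a / (2 * Real.pi))) ^ 2) =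
      ((Real.exp (-((2 * Real.pi * n - a) ^ 2 / (4 * y) * v)) : ℝ) : ℂ) := by
    push_cast
    congr 1
    have : Complex.I * (Complex.I * a / (2 * Real.pi)) = -(a / (2 * Real.pi)) := by
      rw [← mul_div_assoc, ← mul_assoc, Complex.I_mul_I]
      ring
    rw [this]
    field_simp
    ring
  rw [hr, show -((4 * Real.pi ^ 2 * y + (2 * Real.pi * n - a) ^ 2) / (4 * y) * v) =
    -(Real.pi ^ 2 * v) + -((2 * Real.pi * n - a) ^ 2 / (4 * y) * v) by field_simp; ring,
    Real.exp_add]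
  push_cast
  ring

theorem gapTerm_zero_three_zero (n : ℕ) (p : ℝ × ℝ) : gapTerm (0, 3, 0) n p =
    (Real.sqrt (4 * Real.pi ^ 2 * p.1 + (p.2 + 2 * Real.pi * (n + 1)) ^ 2))⁻¹ ^ 3 := by
  simp [gapTerm, gapD, gapX]

theorem mem_gapRegion_of_nonneg {y a : ℝ} (hy : 0 ≤ y) (ha : |a| < 2 * Real.pi) :
    ∃ δ R : ℝ, 0 < δ ∧ δ ≤ 1 ∧ 0 < R ∧ (y, a) ∈ gapRegion δ R ∧ (y, -a) ∈ gapRegion δ R := by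
  have h1 := (abs_lt.1 ha).1
  have h2 := (abs_lt.1 ha).2
  have hpi := Real.pi_pos
  set δ := min 1 ((2 * Real.pi - |a|) / 4) with hδ
  have hδ0 : 0 < δ := lt_min one_pos (by linarith)
  have hδ1 : δ ≤ (2 * Real.pi - |a|) / 4 := min_le_right _ _
  have h3 : -δ ^ 2 < 4 * Real.pi ^ 2 * y := by
    have h4 : 0 ≤ 4 * Real.pi ^ 2 * y := by positivity
    have h5 : 0 < δ ^ 2 := by positivity
    linarith
  have h6 := le_abs_self a
  have h7 := neg_abs_le a
  refine ⟨δ, 2 * Real.pi, hδ0, min_le_left _ _, by positivity, ⟨h3, ?_, ?_⟩, ⟨h3, ?_, ?_⟩⟩ <;>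
    simp only [mem_ofPred_eq] <;> linarith

theorem summable_gapTerm_of_nonneg {y a : ℝ} (hy : 0 ≤ y) (ha : |a| < 2 * Real.pi)
    {k : ℕ × ℕ × ℕ} (hk : k.1 + 2 ≤ k.2.1 + k.2.2) : Summable fun n => gapTerm k n (y, a) := by
  obtain ⟨δ, R, hδ, hδ1, -, h, -⟩ := mem_gapRegion_of_nonneg hy ha
  exact summable_gapTerm hδ hδ1 h hk

/-- The distance `D` of the principal image. -/
def gapD₀ (p : ℝ × ℝ) : ℝ := Real.sqrt (4 * Real.pi ^ 2 * p.1 + p.2 ^ 2)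

theorem hasSum_images {y a : ℝ} (hy : 0 < y) (ha : |a| < 2 * Real.pi) :
    HasSum (fun n : ℤ => 4 * Real.pi * y *
      (Real.sqrt (4 * Real.pi ^ 2 * y + (2 * Real.pi * n - a) ^ 2))⁻¹ ^ 3)
      (4 * Real.pi * y * ((gapD₀ (y, a))⁻¹ ^ 3 + gapSum (0, 3, 0) (y, a) +
        gapSum (0, 3, 0) (y, -a))) := by
  have h1 := (summable_gapTerm_of_nonneg hy.le ha (k := (0, 3, 0)) (by norm_num)).hasSum
  have h2 := (summable_gapTerm_of_nonneg hy.le (a := -a) (by rwa [abs_neg])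
    (k := (0, 3, 0)) (by norm_num)).hasSum
  have h := HasSum.of_add_one_of_neg_add_one (f := fun n : ℤ =>
      (Real.sqrt (4 * Real.pi ^ 2 * y + (2 * Real.pi * n - a) ^ 2))⁻¹ ^ 3)
    (h2.congr_fun fun n => ?_) (h1.congr_fun fun n => ?_)
  · have h0 := h.mul_left (4 * Real.pi * y)
    have hval : (gapD₀ (y, a))⁻¹ ^ 3 + gapSum (0, 3, 0) (y, a) + gapSum (0, 3, 0) (y, -a) =
        gapSum (0, 3, 0) (y, -a) + (Real.sqrt (4 * Real.pi ^ 2 * y +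
          (2 * Real.pi * ((0 : ℤ) : ℝ) - a) ^ 2))⁻¹ ^ 3 + gapSum (0, 3, 0) (y, a) := by
      rw [Int.cast_zero, mul_zero, zero_sub, neg_sq, gapD₀]
      ring
    rw [hval]
    exact h0
  · rw [gapTerm_zero_three_zero]
    push_cast
    congr 5
    ring
  · rw [gapTerm_zero_three_zero]
    push_cast
    congr 4
    ring

/-- A Gamma integral with exponent 3/2, where Γ(3/2) = √π/2 and r^(-3/2) = (2√y/D)³. -/
theorem integral_image {y r : ℝ} (hy : 0 < y) (D : ℝ) (hD : 0 < D) (hr : r = D ^ 2 / (4 * y)) :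
    IntegrableOn (fun v : ℝ => Real.sqrt (Real.pi / y) *
      (v ^ ((3 / 2 : ℝ) - 1) * Real.exp (-(r * v)))) (Ioi 0) ∧
    ∫ v in Ioi (0 : ℝ), Real.sqrt (Real.pi / y) *
      (v ^ ((3 / 2 : ℝ) - 1) * Real.exp (-(r * v))) = 4 * Real.pi * y * D⁻¹ ^ 3 := by
  have hpi := Real.pi_pos
  have hr0 : 0 < r := by rw [hr]; positivity
  constructor
  · refine Integrable.const_mul ?_ _
    have h := integrableOn_rpow_mul_exp_neg_mul_rpow (p := 1) (s := (3 / 2 : ℝ) - 1) (b := r)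
      (by norm_num) one_pos hr0
    refine h.congr_fun (fun v _ => ?_) measurableSet_Ioi
    simp
  · rw [integral_const_mul, Real.integral_rpow_mul_exp_neg_mul_Ioi (by norm_num) hr0]
    have h1 : Real.Gamma (3 / 2) = Real.sqrt Real.pi / 2 := by
      rw [show (3 / 2 : ℝ) = 1 / 2 + 1 by norm_num, Real.Gamma_add_one (by norm_num),
        Real.Gamma_one_half_eq]
      ring
    have h2 : (1 / r) ^ (3 / 2 : ℝ) = (2 * Real.sqrt y / D) ^ 3 := by
      have h3 : 1 / r = (2 * Real.sqrt y / D) ^ 2 := by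
        rw [hr, div_pow, mul_pow, Real.sq_sqrt hy.le]
        field_simp
        norm_num
      rw [h3, ← Real.rpow_natCast _ 2, ← Real.rpow_mul (by positivity), ← Real.rpow_natCast _ 3]
      norm_num
    rw [h1, h2, Real.sqrt_div hpi.le]
    have hsy : Real.sqrt y ^ 2 = y := Real.sq_sqrt hy.le
    have hsp : Real.sqrt Real.pi ^ 2 = Real.pi := Real.sq_sqrt hpi.le
    have hs0 : Real.sqrt y ≠ 0 := (Real.sqrt_pos.2 hy).ne'
    field_simp
    rw [hsp, hsy]
    ring

/-- Poisson summation for the y-derivative of the potential: the images then contribute D⁻³ and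
converge absolutely, whereas the images D⁻¹ of the potential itself do not. The term 1/π² is the
frequency m = 0, and the frequencies m and -m combine to twice a real part. -/
theorem fourierBessel_two_one_re {y a : ℝ} (hy : 0 < y) (ha : |a| < 2 * Real.pi) :
    1 / Real.pi ^ 2 + 4 * y / Real.pi ^ 2 * (fourierBessel 2 1 y a).re =
      4 * Real.pi * y * ((gapD₀ (y, a))⁻¹ ^ 3 + gapSum (0, 3, 0) (y, a) +
        gapSum (0, 3, 0) (y, -a)) := by
  have hpi := Real.pi_pos
  have hnorm : ∀ m : ℤ, ‖Complex.exp (Complex.I * m * a)‖ = 1 := fun m => by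
    rw [show Complex.I * m * a = (((m : ℝ) * a : ℝ) : ℂ) * Complex.I by push_cast; ring]
    exact Complex.norm_exp_ofReal_mul_I _
  have hint : ∀ m : ℤ, IntegrableOn (heatKer ((m : ℝ) ^ 2 * y)) (Ioi 0) :=
    fun m => integrableOn_heatKer (by positivity)
  set F : ℤ → ℝ → ℂ := fun m v =>
    Complex.exp (Complex.I * m * a) * (heatKer ((m : ℝ) ^ 2 * y) v : ℂ) with hF
  have hFint : ∀ m, Integrable (F m) (volume.restrict (Ioi 0)) := fun m =>
    ((hint m).ofReal (𝕜 := ℂ)).const_mul _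
  have hFnorm : ∀ m, ∫ v in Ioi (0 : ℝ), ‖F m v‖ = ∫ v in Ioi (0 : ℝ), heatKer ((m : ℝ) ^ 2 * y) v := by
    intro m
    congr 1
    ext v
    rw [hF, norm_mul, hnorm, one_mul, Complex.norm_real, Real.norm_of_nonneg (r := heatKer _ _) (Real.exp_pos _).le]
  have hFval : ∀ m, ∫ v in Ioi (0 : ℝ), F m v = Complex.exp (Complex.I * m * a) *
      ((∫ v in Ioi (0 : ℝ), heatKer ((m : ℝ) ^ 2 * y) v : ℝ) : ℂ) := by
    intro m
    rw [hF, integral_const_mul, integral_complex_ofReal]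
  have hheat : ∀ n : ℕ, ∫ v in Ioi (0 : ℝ), heatKer (((n : ℝ) + 1) ^ 2 * y) v =
      2 * y / Real.pi ^ 2 * (((n : ℝ) + 1) ^ 2 * besselInt 1 (((n : ℝ) + 1) ^ 2 * y)) := fun n => by
    rw [integral_heatKer (by positivity)]
    ring
  have hs := summable_fourierBesselTerm 2 1 hy a
  have hsn : Summable fun n : ℕ => ∫ v in Ioi (0 : ℝ), heatKer (((n : ℝ) + 1) ^ 2 * y) v := by
    simp_rw [hheat]
    refine (hs.norm.congr fun n => ?_).mul_left _
    rw [norm_fourierBesselTerm]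
  have hsum : Summable fun m => ∫ v in Ioi (0 : ℝ), ‖F m v‖ := by
    simp_rw [hFnorm]
    refine Summable.of_add_one_of_neg_add_one (hsn.congr fun n => ?_) (hsn.congr fun n => ?_)
    · push_cast; rfl
    · push_cast; rw [neg_sq]
  have H := hasSum_integral_of_summable_integral_norm hFint hsum
  simp_rw [hFval] at H
  have hL1 : HasSum (fun n : ℕ => Complex.exp (Complex.I * ((n : ℤ) + 1 : ℤ) * a) *
      ((∫ v in Ioi (0 : ℝ), heatKer ((((n : ℤ) + 1 : ℤ) : ℝ) ^ 2 * y) v : ℝ) : ℂ))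
      ((2 * y / Real.pi ^ 2 : ℝ) * fourierBessel 2 1 y a) := by
    refine (hs.hasSum.mul_left _).congr_fun fun n => ?_
    push_cast
    rw [hheat, fourierBesselTerm]
    push_cast
    ring
  have hL2 : HasSum (fun n : ℕ => Complex.exp (Complex.I * (-((n : ℤ) + 1) : ℤ) * a) *
      ((∫ v in Ioi (0 : ℝ), heatKer (((-((n : ℤ) + 1) : ℤ) : ℝ) ^ 2 * y) v : ℝ) : ℂ))
      ((2 * y / Real.pi ^ 2 : ℝ) * fourierBessel 2 1 y (-a)) := by
    refine ((summable_fourierBesselTerm 2 1 hy (-a)).hasSum.mul_left _).congr_fun fun n => ?_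
    push_cast
    rw [neg_sq, hheat, fourierBesselTerm]
    push_cast
    rw [show Complex.I * -((n : ℂ) + 1) * a = Complex.I * ((n : ℂ) + 1) * -a by ring]
    ring
  have hL := HasSum.of_add_one_of_neg_add_one (f := fun m : ℤ => Complex.exp (Complex.I * m * a) *
      ((∫ v in Ioi (0 : ℝ), heatKer ((m : ℝ) ^ 2 * y) v : ℝ) : ℂ)) hL1 hL2
  have hD : ∀ n : ℤ, 0 < Real.sqrt (4 * Real.pi ^ 2 * y + (2 * Real.pi * n - a) ^ 2) :=
    fun n => Real.sqrt_pos.2 (by positivity)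
  have hG := fun n : ℤ => integral_image (r := (4 * Real.pi ^ 2 * y + (2 * Real.pi * n - a) ^ 2) /
    (4 * y)) hy _ (hD n) (by rw [Real.sq_sqrt (by positivity)])
  set G : ℤ → ℝ → ℝ := fun n v => Real.sqrt (Real.pi / y) * (v ^ ((3 / 2 : ℝ) - 1) * Real.exp
        (-((4 * Real.pi ^ 2 * y + (2 * Real.pi * n - a) ^ 2) / (4 * y) * v))) with hGdef
  have hGnorm : ∀ n, ∫ v in Ioi (0 : ℝ), ‖(G n v : ℂ)‖ = ∫ v in Ioi (0 : ℝ), G n v := by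
    intro n
    refine setIntegral_congr_fun measurableSet_Ioi fun v hv => ?_
    have hv' : 0 < v := hv
    simp only [Complex.norm_real]
    exact Real.norm_of_nonneg (by rw [hGdef]; positivity)
  have himg := hasSum_images hy ha
  have H2 := hasSum_integral_of_summable_integral_norm (μ := volume.restrict (Ioi (0 : ℝ)))
    (F := fun n v => (G n v : ℂ)) (fun n => ((hG n).1.ofReal (𝕜 := ℂ)))
    (by simp_rw [hGnorm]; exact himg.summable.congr fun n => ((hG n).2).symm)
  have hR := himg.mapL Complex.ofRealCLM
  have hR' : HasSum (fun n => ∫ v in Ioi (0 : ℝ), (G n v : ℂ)) _ := hR.congr_fun fun n => by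
    rw [integral_complex_ofReal]
    exact congrArg _ (hG n).2
  -- The theta identity holds for each v > 0; on both sides sum and integral may be exchanged by
  -- summability of the norms.
  have hpt : ∫ v in Ioi (0 : ℝ), ∑' m, F m v = ∫ v in Ioi (0 : ℝ), ∑' n, (G n v : ℂ) :=
    setIntegral_congr_fun measurableSet_Ioi fun v hv => tsum_exp_mul_heatKer hy a hv
  have hfin := (hL.unique H).trans (hpt.trans (H2.unique hR'))
  have hre := congrArg Complex.re hfin
  rw [fourierBessel_neg] at hre
  simp only [Int.cast_zero, mul_zero, zero_mul, Complex.exp_zero, one_mul, ne_eq, OfNat.ofNat_ne_zero,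
    not_false_eq_true, zero_pow, integral_heatKer_zero, Complex.add_re, Complex.re_ofReal_mul,
    Complex.conj_re, Complex.ofReal_re, Complex.ofRealCLM_apply] at hre
  rw [← hre]
  ring

end ConifoldHK
end

noncomputable section
namespace ConifoldHK
open MeasureTheory Filter Topology

/-! ### The potential and the connection form near the singular point -/

/-- The region `y > 0`, `|a| < 2π`. -/
def polarRegion : Set (ℝ × ℝ) := Ioi 0 ×ˢ Ioo (-(2 * Real.pi)) (2 * Real.pi)

theorem isOpen_polarRegion : IsOpen polarRegion := isOpen_Ioi.prod isOpen_Ioo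

theorem isPreconnected_polarRegion : IsPreconnected polarRegion :=
  isPreconnected_Ioi.prod isPreconnected_Ioo

theorem hasFDerivAt_gapD₀ {p : ℝ × ℝ} (hp : 0 < gapD₀ p) :
    HasFDerivAt gapD₀ ((2 * Real.pi ^ 2 * (gapD₀ p)⁻¹) • ContinuousLinearMap.fst ℝ ℝ ℝ +
      (p.2 * (gapD₀ p)⁻¹) • ContinuousLinearMap.snd ℝ ℝ ℝ) p := by
  have h0 : 4 * Real.pi ^ 2 * p.1 + p.2 ^ 2 ≠ 0 := (Real.sqrt_pos.1 hp).ne'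
  have h1 := ((ContinuousLinearMap.fst ℝ ℝ ℝ).hasFDerivAt (x := p)).const_mul (4 * Real.pi ^ 2)
  have h2 := (hasDerivAt_pow 2 p.2).comp_hasFDerivAt p
    ((ContinuousLinearMap.snd ℝ ℝ ℝ).hasFDerivAt (x := p))
  refine ((h1.add h2).sqrt h0).congr_fderiv ?_
  refine ContinuousLinearMap.ext fun v => ?_
  have hD : √(4 * Real.pi ^ 2 * (ContinuousLinearMap.fst ℝ ℝ ℝ) p +
    ((fun x => x ^ 2) ∘ Prod.snd) p) = gapD₀ p := rfl
  simp only [Pi.add_apply]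
  rw [hD]
  simp
  field_simp
  ring

theorem hasFDerivAt_pairPot {p : ℝ × ℝ} (hp : 0 < p.1) :
    HasFDerivAt (fun x : ℝ × ℝ => pairPot x.1 x.2)
      ((-(1 / Real.pi) * (fourierBessel 2 1 p.1 p.2).re) • ContinuousLinearMap.fst ℝ ℝ ℝ +
        (-(1 / Real.pi) * (fourierBessel 1 0 p.1 p.2).im) • ContinuousLinearMap.snd ℝ ℝ ℝ) p := by
  have h := (Complex.reCLM.hasFDerivAt.comp p (hasFDerivAt_fourierBessel 0 0 hp)).const_mul
    (1 / Real.pi)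
  refine HasFDerivAt.congr_fderiv (f := fun x : ℝ × ℝ => pairPot x.1 x.2) h ?_
  refine ContinuousLinearMap.ext fun v => ?_
  simp
  ring

theorem hasFDerivAt_pairConn {p : ℝ × ℝ} (hp : 0 < p.1) :
    HasFDerivAt (fun x : ℝ × ℝ => pairConn x.1 x.2)
      ((-(2 / Real.pi) * (fourierBessel 3 2 p.1 p.2).im) • ContinuousLinearMap.fst ℝ ℝ ℝ +
        ((2 / Real.pi) * (fourierBessel 2 1 p.1 p.2).re) • ContinuousLinearMap.snd ℝ ℝ ℝ) p := by
  have h := (Complex.imCLM.hasFDerivAt.comp p (hasFDerivAt_fourierBessel 1 1 hp)).const_mul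
    (2 / Real.pi)
  refine HasFDerivAt.congr_fderiv (f := fun x : ℝ × ℝ => pairConn x.1 x.2) h ?_
  refine ContinuousLinearMap.ext fun v => ?_
  simp
  ring

/-- The reflection in the second variable. -/
def reflSnd : ℝ × ℝ →L[ℝ] ℝ × ℝ :=
  (ContinuousLinearMap.fst ℝ ℝ ℝ).prod (-ContinuousLinearMap.snd ℝ ℝ ℝ)

theorem reflSnd_apply (p : ℝ × ℝ) : reflSnd p = (p.1, -p.2) := rfl

/-- The smooth part of the connection form. -/
def connReg (p : ℝ × ℝ) : ℝ :=
  -(2 * Real.pi ^ 2) * (gapSum (0, 1, 1) p - gapSum (0, 1, 1) (reflSnd p))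

/-- The smooth part of the potential, up to a constant. -/
def potSum (p : ℝ × ℝ) : ℝ := gapPot p + gapPot (reflSnd p)

/-- The points with `y ≥ 0`, `|a| < 2π`, on a neighbourhood of which the sums are smooth. -/
theorem exists_gapRegion {p : ℝ × ℝ} (hp : 0 ≤ p.1) (ha : |p.2| < 2 * Real.pi) :
    ∃ δ R : ℝ, 0 < δ ∧ δ ≤ 1 ∧ 0 < R ∧ p ∈ gapRegion δ R ∧ reflSnd p ∈ gapRegion δ R :=
  mem_gapRegion_of_nonneg hp ha

theorem hasSum_gapTerm {p : ℝ × ℝ} (hp : 0 ≤ p.1) (ha : |p.2| < 2 * Real.pi) {k : ℕ × ℕ × ℕ}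
    (hk : k.1 + 2 ≤ k.2.1 + k.2.2) : HasSum (fun n => gapTerm k n p) (gapSum k p) :=
  (summable_gapTerm_of_nonneg hp ha hk).hasSum

/-- Termwise algebra with 4π²y = D² - x²; these relations remove the factors (D + x)⁻¹ from the
derivatives of y times `connReg`. -/
theorem gapSum_relations {p : ℝ × ℝ} (hp : 0 ≤ p.1) (ha : |p.2| < 2 * Real.pi) :
    gapSum (1, 3, 1) p + gapSum (0, 2, 1) p = gapSum (0, 3, 0) p ∧
    gapSum (0, 1, 1) p - 2 * Real.pi ^ 2 * p.1 * (gapSum (0, 3, 1) p + gapSum (0, 2, 2) p) =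
      1 / 2 * gapSum (1, 3, 0) p := by
  obtain ⟨δ, R, hδ, hδ1, -, hm, -⟩ := exists_gapRegion hp ha
  have H : ∀ {k : ℕ × ℕ × ℕ}, k.1 + 2 ≤ k.2.1 + k.2.2 →
    HasSum (fun n => gapTerm k n p) (gapSum k p) := fun hk => hasSum_gapTerm hp ha hk
  have hpos : ∀ n, 0 < gapD n p ∧ 0 < gapX n p := fun n =>
    ⟨gapD_pos hδ hδ1 hm n, gapX_pos hδ hm n⟩
  have hsq : ∀ n, 4 * Real.pi ^ 2 * p.1 = gapD n p ^ 2 - gapX n p ^ 2 := fun n => by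
    rw [gapD, Real.sq_sqrt (Real.sqrt_pos.1 (hpos n).1).le]
    ring
  constructor
  · refine ((H (by norm_num)).add (H (by norm_num))).unique ((H (by norm_num)).congr_fun
      fun n => ?_)
    obtain ⟨h1, h2⟩ := hpos n
    simp only [gapTerm]
    field_simp
    ring
  · refine ((H (by norm_num)).sub (((H (by norm_num)).add (H (by norm_num))).mul_left _)).unique
      (((H (by norm_num)).mul_left _).congr_fun fun n => ?_)
    obtain ⟨h1, h2⟩ := hpos n
    rw [show 2 * Real.pi ^ 2 * p.1 = (gapD n p ^ 2 - gapX n p ^ 2) / 2 by linarith [hsq n]]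
    simp only [gapTerm]
    field_simp
    ring

/-- Since y/(D(D + x)) = (1 - x/D)/4π², the product y `connReg` is the image sum of the connection
form. Writing it with D + x in the denominator displays the factor y, so division by |t|² loses no
smoothness. -/
theorem hasFDerivAt_mul_connReg {p : ℝ × ℝ} (hp : 0 ≤ p.1) (ha : |p.2| < 2 * Real.pi) :
    HasFDerivAt (fun p : ℝ × ℝ => p.1 * connReg p)
      ((-Real.pi ^ 2 * (gapSum (1, 3, 0) p - gapSum (1, 3, 0) (reflSnd p))) •
        ContinuousLinearMap.fst ℝ ℝ ℝ +
      (2 * Real.pi ^ 2 * p.1 * (gapSum (0, 3, 0) p + gapSum (0, 3, 0) (reflSnd p))) •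
        ContinuousLinearMap.snd ℝ ℝ ℝ) p := by
  obtain ⟨δ, R, hδ, hδ1, -, hm, hm'⟩ := exists_gapRegion hp ha
  obtain ⟨r1, r2⟩ := gapSum_relations hp ha
  obtain ⟨r3, r4⟩ := gapSum_relations (p := reflSnd p) hp
    (by rw [reflSnd_apply]; simpa using ha)
  have h1 := hasFDerivAt_gapSum hδ hδ1 hm (k := (0, 1, 1)) (by norm_num)
  have h2 := (hasFDerivAt_gapSum hδ hδ1 hm' (k := (0, 1, 1)) (by norm_num)).comp p
    reflSnd.hasFDerivAt
  have h := ((ContinuousLinearMap.fst ℝ ℝ ℝ).hasFDerivAt (x := p)).mul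
    ((h1.sub h2).const_mul (-(2 * Real.pi ^ 2)))
  refine HasFDerivAt.congr_fderiv (f := fun p : ℝ × ℝ => p.1 * connReg p) h ?_
  refine ContinuousLinearMap.ext fun v => ?_
  rw [show (reflSnd p).1 = p.1 from rfl] at r4
  simp [gapDy, gapDa, reflSnd_apply] at r1 r2 r3 r4 ⊢
  linear_combination (2 * Real.pi ^ 2 * p.1 * v.2) * (r1 + r3) - (2 * Real.pi ^ 2 * v.1) * (r2 - r4)

theorem hasFDerivAt_potSum {p : ℝ × ℝ} (hp : 0 ≤ p.1) (ha : |p.2| < 2 * Real.pi) :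
    HasFDerivAt potSum
      ((-Real.pi ^ 2 * (gapSum (0, 3, 0) p + gapSum (0, 3, 0) (reflSnd p))) •
        ContinuousLinearMap.fst ℝ ℝ ℝ +
      (-(1 / 2) * (gapSum (1, 3, 0) p - gapSum (1, 3, 0) (reflSnd p))) •
        ContinuousLinearMap.snd ℝ ℝ ℝ) p := by
  obtain ⟨δ, R, hδ, hδ1, hR, hm, hm'⟩ := exists_gapRegion hp ha
  have h1 := hasFDerivAt_gapPot hδ hδ1 hR hm
  have h2 := (hasFDerivAt_gapPot hδ hδ1 hR hm').comp p reflSnd.hasFDerivAt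
  refine HasFDerivAt.congr_fderiv (f := potSum) (h1.add h2) ?_
  refine ContinuousLinearMap.ext fun v => ?_
  simp [reflSnd_apply]
  ring

theorem polarRegion_spec {p : ℝ × ℝ} (hp : p ∈ polarRegion) :
    0 < p.1 ∧ |p.2| < 2 * Real.pi ∧ 0 < gapD₀ p ∧
      gapD₀ p ^ 2 = 4 * Real.pi ^ 2 * p.1 + p.2 ^ 2 := by
  have h1 : 0 < p.1 := hp.1
  have hpi := Real.pi_pos
  have h2 : 0 < 4 * Real.pi ^ 2 * p.1 + p.2 ^ 2 := by positivity
  exact ⟨h1, abs_lt.2 hp.2, Real.sqrt_pos.2 h2, Real.sq_sqrt h2.le⟩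

/-- The defect in `mul_pairConn_eq`. -/
theorem hasFDerivAt_connDefect {p : ℝ × ℝ} (hp : p ∈ polarRegion) :
    HasFDerivAt (fun p : ℝ × ℝ => p.1 * pairConn p.1 p.2 + p.2 / (2 * Real.pi) -
        p.2 / (2 * gapD₀ p) - p.1 * connReg p)
      ((-(2 * Real.pi) * (fourierBessel 1 0 p.1 p.2).im + Real.pi ^ 2 * (p.2 * (gapD₀ p)⁻¹ ^ 3 +
        gapSum (1, 3, 0) p - gapSum (1, 3, 0) (reflSnd p))) • ContinuousLinearMap.fst ℝ ℝ ℝ) p := by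
  obtain ⟨h1, h2, h3, h4⟩ := polarRegion_spec hp
  have hpi := Real.pi_pos
  have hid := fourierBessel_two_one_re h1 h2
  have hrec := congrArg Complex.im (fourierBessel_recursion 1 h1 p.2)
  have g1 := ((ContinuousLinearMap.fst ℝ ℝ ℝ).hasFDerivAt (x := p)).mul (hasFDerivAt_pairConn h1)
  have g2 := ((ContinuousLinearMap.snd ℝ ℝ ℝ).hasFDerivAt (x := p)).mul_const (2 * Real.pi)⁻¹
  have g3 := ((ContinuousLinearMap.snd ℝ ℝ ℝ).hasFDerivAt (x := p)).mul
    ((hasDerivAt_inv (mul_pos two_pos h3).ne').comp_hasFDerivAt p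
      ((hasFDerivAt_gapD₀ h3).const_mul 2))
  have g := ((g1.add g2).sub g3).sub (hasFDerivAt_mul_connReg h1.le h2)
  refine HasFDerivAt.congr_fderiv (f := fun p : ℝ × ℝ => p.1 * pairConn p.1 p.2 +
    p.2 / (2 * Real.pi) - p.2 / (2 * gapD₀ p) - p.1 * connReg p) g ?_
  refine ContinuousLinearMap.ext fun v => ?_
  have hp' : (p.1, p.2) = p := rfl
  have hr' : (p.1, -p.2) = reflSnd p := rfl
  rw [hp', hr'] at hid
  have hrec' : (fourierBessel 1 1 p.1 p.2).im - p.1 * (fourierBessel 3 2 p.1 p.2).im +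
      Real.pi ^ 2 * (fourierBessel 1 0 p.1 p.2).im = 0 := by
    simpa [← Complex.ofReal_pow] using hrec
  -- The Poisson identity makes the coefficient of da vanish; the recursion rewrites the coefficient
  -- of dy.
  have hX : p.1 * (fourierBessel 2 1 p.1 p.2).re = Real.pi ^ 3 * p.1 * ((gapD₀ p)⁻¹ ^ 3 +
      gapSum (0, 3, 0) p + gapSum (0, 3, 0) (reflSnd p)) - 1 / 4 := by
    generalize (gapD₀ p)⁻¹ ^ 3 = E at *
    field_simp at hid
    linear_combination hid / 4
  have hE : gapD₀ p * (gapD₀ p)⁻¹ = 1 := mul_inv_cancel₀ h3.ne'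
  have hP : Real.pi * Real.pi⁻¹ = 1 := mul_inv_cancel₀ hpi.ne'
  simp only [add_apply, sub_apply, smul_apply, smul_eq_mul, ContinuousLinearMap.coe_fst',
    ContinuousLinearMap.coe_snd', pairConn, Function.comp, mul_inv, mul_pow, div_eq_mul_inv, ← inv_pow]
  generalize gapSum (1, 3, 0) p = A1 at *
  generalize gapSum (0, 3, 0) p = A2 at *
  generalize gapSum (1, 3, 0) (reflSnd p) = A3 at *
  generalize gapSum (0, 3, 0) (reflSnd p) = A4 at *
  generalize (gapD₀ p)⁻¹ = E at *
  generalize Real.pi⁻¹ = P at *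
  generalize (fourierBessel 1 1 p.1 p.2).im = B1 at *
  generalize (fourierBessel 3 2 p.1 p.2).im = B2 at *
  generalize (fourierBessel 1 0 p.1 p.2).im = B3 at *
  generalize (fourierBessel 2 1 p.1 p.2).re = X at *
  generalize gapD₀ p = D at *
  linear_combination v.1 * (2 * P * hrec' - 2 * Real.pi * B3 * hP) +
    v.2 * (2 * P * hX + 2 * Real.pi ^ 2 * p.1 * (E ^ 3 + A2 + A4) * hP - 1 / 2 * E ^ 3 * h4 +
      1 / 2 * E * (E * D + 1) * hE)

theorem pairConn_zero (y : ℝ) : pairConn y 0 = 0 := by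
  have h := congrArg Complex.im (fourierBessel_neg 1 1 y 0)
  rw [neg_zero, Complex.conj_im] at h
  rw [pairConn, self_eq_neg.1 h, mul_zero]

/-- For fixed y the defect has vanishing derivative in a by `hasFDerivAt_connDefect`, and it is zero
at a = 0, where every term is odd. -/
theorem mul_pairConn_eq {p : ℝ × ℝ} (hp : p ∈ polarRegion) :
    p.1 * pairConn p.1 p.2 + p.2 / (2 * Real.pi) - p.2 / (2 * gapD₀ p) - p.1 * connReg p = 0 := by
  have hpi := Real.pi_pos
  have h0 : (p.1, (0 : ℝ)) ∈ polarRegion := ⟨hp.1, by constructor <;> simp [hpi]⟩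
  have hsub : ∀ a ∈ Ioo (-(2 * Real.pi)) (2 * Real.pi), (p.1, a) ∈ polarRegion :=
    fun a ha => ⟨hp.1, ha⟩
  have hd : ∀ a ∈ Ioo (-(2 * Real.pi)) (2 * Real.pi), HasDerivAt
      ((fun p : ℝ × ℝ => p.1 * pairConn p.1 p.2 + p.2 / (2 * Real.pi) -
        p.2 / (2 * gapD₀ p) - p.1 * connReg p) ∘ fun a => (p.1, a)) 0 a := by
    intro a ha
    have h := (hasFDerivAt_connDefect (hsub a ha)).comp_hasDerivAt a
      ((hasDerivAt_const a p.1).prodMk (hasDerivAt_id a))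
    refine h.congr_deriv ?_
    simp
  have hc := isOpen_Ioo.is_const_of_deriv_eq_zero isPreconnected_Ioo
    (fun a ha => (hd a ha).differentiableAt.differentiableWithinAt)
    (fun a ha => (hd a ha).deriv) hp.2 h0.2
  simp only [Function.comp] at hc
  refine hc.trans ?_
  simp [pairConn_zero, connReg, reflSnd_apply]

/-- The defect vanishes identically, hence so does its y-derivative. This yields the image formula
for the a-derivative of the potential without a second Poisson summation. -/
theorem fourierBessel_one_zero_im {p : ℝ × ℝ} (hp : p ∈ polarRegion) :
    (fourierBessel 1 0 p.1 p.2).im = Real.pi / 2 * (p.2 * (gapD₀ p)⁻¹ ^ 3 +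
        gapSum (1, 3, 0) p - gapSum (1, 3, 0) (reflSnd p)) := by
  have hpi := Real.pi_pos
  have h1 := hasFDerivAt_connDefect hp
  have h2 : HasFDerivAt (fun p : ℝ × ℝ => p.1 * pairConn p.1 p.2 + p.2 / (2 * Real.pi) -
        p.2 / (2 * gapD₀ p) - p.1 * connReg p) (0 : ℝ × ℝ →L[ℝ] ℝ) p := by
    refine (hasFDerivAt_const (0 : ℝ) p).congr_of_eventuallyEq ?_
    filter_upwards [isOpen_polarRegion.mem_nhds hp] with q hq
    exact mul_pairConn_eq hq
  have h3 := congrArg (fun L : ℝ × ℝ →L[ℝ] ℝ => L (1, 0)) (h1.unique h2)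
  simp at h3
  have h4 : Real.pi * (-(2 * (fourierBessel 1 0 p.1 p.2).im) + Real.pi *
      (p.2 * (gapD₀ p)⁻¹ ^ 3 + gapSum (1, 3, 0) p - gapSum (1, 3, 0) (reflSnd p))) = 0 := by
    simp only [inv_pow]
    linear_combination h3
  have h5 := (mul_eq_zero.1 h4).resolve_left hpi.ne'
  linarith

/-- The y-derivative is `fourierBessel_two_one_re`, whose zero frequency integrates to the
logarithm; the a-derivative is `fourierBessel_one_zero_im`. The constant left over is never
computed, as any constant is smooth. -/
theorem hasFDerivAt_potDefect {p : ℝ × ℝ} (hp : p ∈ polarRegion) :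
    HasFDerivAt (fun p : ℝ × ℝ => pairPot p.1 p.2 - 1 / (4 * Real.pi) * Real.log p.1 -
        (2 * gapD₀ p)⁻¹ - potSum p) (0 : ℝ × ℝ →L[ℝ] ℝ) p := by
  obtain ⟨h1, h2, h3, h4⟩ := polarRegion_spec hp
  have hpi := Real.pi_pos
  have hid := fourierBessel_two_one_re h1 h2
  have him := fourierBessel_one_zero_im hp
  have g1 := (hasFDerivAt_pairPot h1).sub ((((Real.hasDerivAt_log h1.ne').comp_hasFDerivAt p
    ((ContinuousLinearMap.fst ℝ ℝ ℝ).hasFDerivAt (x := p)))).const_mul (1 / (4 * Real.pi)))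
  have g2 := (hasDerivAt_inv (mul_pos two_pos h3).ne').comp_hasFDerivAt p
      ((hasFDerivAt_gapD₀ h3).const_mul 2)
  have g := (g1.sub g2).sub (hasFDerivAt_potSum h1.le h2)
  refine HasFDerivAt.congr_fderiv (f := fun p : ℝ × ℝ => pairPot p.1 p.2 -
    1 / (4 * Real.pi) * Real.log p.1 - (2 * gapD₀ p)⁻¹ - potSum p) g ?_
  refine ContinuousLinearMap.ext fun v => ?_
  have hp' : (p.1, p.2) = p := rfl
  have hr' : (p.1, -p.2) = reflSnd p := rfl
  rw [hp', hr'] at hid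
  have hX : (fourierBessel 2 1 p.1 p.2).re = Real.pi ^ 3 * ((gapD₀ p)⁻¹ ^ 3 +
      gapSum (0, 3, 0) p + gapSum (0, 3, 0) (reflSnd p)) - p.1⁻¹ / 4 := by
    generalize (gapD₀ p)⁻¹ ^ 3 = E at *
    field_simp at hid ⊢
    linear_combination hid
  have hP : Real.pi * Real.pi⁻¹ = 1 := mul_inv_cancel₀ hpi.ne'
  simp only [add_apply, sub_apply, smul_apply, smul_eq_mul, ContinuousLinearMap.coe_fst',
    ContinuousLinearMap.coe_snd', mul_inv, mul_pow, div_eq_mul_inv, him, hX, zero_apply, ← inv_pow]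
  generalize gapSum (1, 3, 0) p = A1 at *
  generalize gapSum (0, 3, 0) p = A2 at *
  generalize gapSum (1, 3, 0) (reflSnd p) = A3 at *
  generalize gapSum (0, 3, 0) (reflSnd p) = A4 at *
  generalize (gapD₀ p)⁻¹ = E at *
  generalize Real.pi⁻¹ = P at *
  linear_combination (-(v.1 * Real.pi ^ 2 * (E ^ 3 + A2 + A4)) -
    v.2 / 2 * (p.2 * E ^ 3 + A1 - A3)) * hP

/-- The constant in the expansion of the potential. -/
def potConst : ℝ := pairPot 1 0 - (2 * gapD₀ (1, 0))⁻¹ - potSum (1, 0)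

/-- The smooth part of the potential. -/
def potReg (p : ℝ × ℝ) : ℝ := potSum p + potConst

theorem pairPot_eq {p : ℝ × ℝ} (hp : p ∈ polarRegion) :
    pairPot p.1 p.2 = 1 / (4 * Real.pi) * Real.log p.1 + (2 * gapD₀ p)⁻¹ + potReg p := by
  have hpi := Real.pi_pos
  have h0 : ((1, 0) : ℝ × ℝ) ∈ polarRegion := ⟨mem_Ioi.2 one_pos, by constructor <;> simp [hpi]⟩
  have hc := isOpen_polarRegion.is_const_of_fderiv_eq_zero isPreconnected_polarRegion
    (fun q hq => (hasFDerivAt_potDefect hq).differentiableAt.differentiableWithinAt)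
    (fun q hq => (hasFDerivAt_potDefect hq).fderiv) hp h0
  simp only [Real.log_one, mul_zero, sub_zero] at hc
  rw [potReg, potConst]
  linarith

end ConifoldHK
end

noncomputable section
namespace ConifoldHK
open MeasureTheory Filter Topology

/-! ### The regular part of the Ooguri-Vafa forms -/

/-- The region `|θ| < 2π` of the base. -/
def slab : Set Base := {y | |y.2| < 2 * Real.pi}

/-- The point `(|t|², θ)`. -/
def sqBase (y : Base) : ℝ × ℝ := (Complex.normSq y.1, y.2)

theorem contDiff_normSq : ContDiff ℝ ∞ (Complex.normSq : ℂ → ℝ) := by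
  have h : (Complex.normSq : ℂ → ℝ) = fun z => Complex.reCLM z * Complex.reCLM z +
      Complex.imCLM z * Complex.imCLM z := by
    funext z; simp [Complex.normSq_apply]
  rw [h]
  fun_prop

theorem contDiff_sqBase : ContDiff ℝ ∞ sqBase :=
  (contDiff_normSq.comp contDiff_fst).prodMk contDiff_snd

/-- At t = 0 the point (|t|², θ) lies on the boundary y = 0 but inside some `gapRegion`, where
`connReg` is smooth, and |t|² is smooth in t. -/
theorem contDiffOn_connReg_sqBase : ContDiffOn ℝ ∞ (fun y => connReg (sqBase y)) slab := by
  intro y hy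
  obtain ⟨δ, R, hδ, hδ1, -, hm, hm'⟩ :=
    exists_gapRegion (p := sqBase y) (Complex.normSq_nonneg _) hy
  have h := contDiffOn_gapSum hδ hδ1 (R := R) (k := (0, 1, 1)) (by norm_num)
  have h1 := (h _ hm).contDiffAt ((isOpen_gapRegion δ R).mem_nhds hm)
  have h2 := (h _ hm').contDiffAt ((isOpen_gapRegion δ R).mem_nhds hm')
  have h3 : ContDiffAt ℝ ∞ connReg (sqBase y) :=
    contDiffAt_const.mul (h1.sub (h2.comp _ reflSnd.contDiff.contDiffAt))
  exact (h3.comp y contDiff_sqBase.contDiffAt).contDiffWithinAt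

theorem contDiffOn_potReg_sqBase : ContDiffOn ℝ ∞ (fun y => potReg (sqBase y)) slab := by
  intro y hy
  obtain ⟨δ, R, hδ, hδ1, hR, hm, hm'⟩ :=
    exists_gapRegion (p := sqBase y) (Complex.normSq_nonneg _) hy
  have h := contDiffOn_gapPot hδ hδ1 hR
  have h1 := (h _ hm).contDiffAt ((isOpen_gapRegion δ R).mem_nhds hm)
  have h2 := (h _ hm').contDiffAt ((isOpen_gapRegion δ R).mem_nhds hm')
  have h3 : ContDiffAt ℝ ∞ potReg (sqBase y) :=
    (h1.add (h2.comp _ reflSnd.contDiff.contDiffAt)).add contDiffAt_const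
  exact (h3.comp y contDiff_sqBase.contDiffAt).contDiffWithinAt

/-- The regular part of the connection form. -/
def regConn (y : Base) : ℂ := connReg (sqBase y) * y.1

/-- The regular part of the potential. -/
def regPot (y : Base) : ℝ := potReg (sqBase y) - Real.log (2 * Real.pi) / (2 * Real.pi)

theorem contDiffOn_regConn : ContDiffOn ℝ ∞ regConn slab :=
  (contDiffOn_ofReal contDiffOn_connReg_sqBase).mul contDiff_fst.contDiffOn

theorem contDiffOn_regPot : ContDiffOn ℝ ∞ regPot slab :=
  contDiffOn_potReg_sqBase.sub contDiffOn_const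

theorem latticeBessel_singleton (k : ℕ × ℕ × ℕ × ℕ) (x : Base) :
    latticeBessel {0} k x = latticeBesselTerm k 0 x :=
  tsum_singleton 0 fun n : ℤ => latticeBesselTerm k n x

theorem latticePot_singleton (x : Base) :
    latticePot {0} x = pairPot (Complex.normSq x.1) x.2 := by
  simp [latticePot, latticeBessel_singleton, latticeBesselTerm, pairPot]

theorem latticeConn_singleton (x : Base) :
    latticeConn {0} x = pairConn (Complex.normSq x.1) x.2 * x.1 := by
  have hpi : (Real.pi : ℂ) ≠ 0 := by exact_mod_cast Real.pi_ne_zero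
  have h := Complex.sub_conj (fourierBessel 1 1 (Complex.normSq x.1) x.2)
  simp only [latticeConn, latticeBessel_singleton, latticeBesselTerm, pairConn]
  simp only [Int.cast_zero, add_zero, pow_zero, pow_one, one_mul, mul_one, map_mul,
    Complex.conj_conj]
  push_cast at h ⊢
  rw [← mul_sub, h]
  field_simp

/-- The norm `D = √(4π² |t|² + a²)`. -/
def momNorm (y : Base) : ℝ := gapD₀ (sqBase y)

theorem momNorm_sq (y : Base) :
    momNorm y ^ 2 = 4 * Real.pi ^ 2 * Complex.normSq y.1 + y.2 ^ 2 :=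
  Real.sq_sqrt (by have := Complex.normSq_nonneg y.1; simp only [sqBase]; positivity)

theorem abs_le_momNorm (y : Base) : |y.2| ≤ momNorm y := by
  refine Real.abs_le_sqrt ?_
  have := Complex.normSq_nonneg y.1
  simp only [sqBase]
  nlinarith [Real.pi_pos, mul_nonneg (mul_pos Real.pi_pos Real.pi_pos).le this]

theorem abs_lt_momNorm {y : Base} (hy : y.1 ≠ 0) : |y.2| < momNorm y := by
  refine Real.lt_sqrt_of_sq_lt ?_
  have h1 := Complex.normSq_pos.2 hy
  have h2 := mul_pos (mul_pos Real.pi_pos Real.pi_pos) h1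
  simp only [sqBase, sq_abs]
  nlinarith

theorem mul_normSq_eq (y : Base) : 4 * Real.pi ^ 2 * Complex.normSq y.1 =
    (momNorm y - y.2) * (momNorm y + y.2) := by linarith [momNorm_sq y]

/-- The coefficient of the connection form of the Taub-NUT part. -/
def singConn (y : Base) : ℂ :=
  ((-(y.2 / (2 * Real.pi)) + y.2 / (2 * momNorm y)) / Complex.normSq y.1 : ℝ) * y.1

theorem latticeConn_eq {y : Base} (hy : y ∈ slab) (h0 : y.1 ≠ 0) :
    latticeConn {0} y = singConn y + regConn y := by
  have hp : sqBase y ∈ polarRegion := ⟨Complex.normSq_pos.2 h0, abs_lt.1 hy⟩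
  have h := mul_pairConn_eq hp
  have h1 : (0 : ℝ) < (sqBase y).1 := hp.1
  rw [latticeConn_singleton, singConn, regConn, ← add_mul, ← Complex.ofReal_add]
  congr 2
  change pairConn (sqBase y).1 (sqBase y).2 = (-((sqBase y).2 / (2 * Real.pi)) +
    (sqBase y).2 / (2 * gapD₀ (sqBase y))) / (sqBase y).1 + _
  rw [← mul_right_inj' h1.ne', mul_add, mul_div_cancel₀ _ h1.ne']
  linarith

/-- From log Λ = -log 2π + iπ/2. The constants -1/4 and -log(2π)/2π reappear in `ovForm` and
`regPot`. -/
theorem tauOV_re_im (s : ℂ) : (tauOV s).re = s.im / (2 * Real.pi) + -1 / 4 ∧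
    (tauOV s).im = -(1 / (2 * Real.pi)) * s.re - Real.log (2 * Real.pi) / (2 * Real.pi) := by
  have hpi := Real.pi_pos
  have hc : Complex.log cutoff = (-(Real.log (2 * Real.pi)) : ℝ) + (Real.pi / 2 : ℝ) * Complex.I := by
    have : cutoff = ((2 * Real.pi)⁻¹ : ℝ) * Complex.I := by
      rw [cutoff]; push_cast; ring
    rw [this, Complex.log_ofReal_mul (by positivity) Complex.I_ne_zero, Complex.log_I,
      Real.log_inv]
    push_cast
    ring
  have h : tauOV s = ((s.im / (2 * Real.pi) + -1 / 4 : ℝ) : ℂ) +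
      ((-(1 / (2 * Real.pi)) * s.re - Real.log (2 * Real.pi) / (2 * Real.pi) : ℝ) : ℂ) *
        Complex.I := by
    have hpi' : (Real.pi : ℂ) ≠ 0 := by exact_mod_cast Real.pi_ne_zero
    rw [tauOV, hc]
    conv_lhs => rw [← Complex.re_add_im s]
    push_cast
    field_simp
    ring_nf
    simp only [Complex.I_sq]
    ring
  rw [h]
  generalize s.im / (2 * Real.pi) + -1 / 4 = A
  generalize -(1 / (2 * Real.pi)) * s.re - Real.log (2 * Real.pi) / (2 * Real.pi) = B
  simp

end ConifoldHK
end

noncomputable section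
namespace ConifoldHK
open MeasureTheory Filter Topology

/-! ### The Taub-NUT coordinates -/

/-- The space `Coord` seen as `ℂ²`. -/
def coordC : Coord ≃L[ℝ] ℂ × ℂ :=
  (ContinuousLinearEquiv.refl ℝ ℂ).prodCongr Complex.equivRealProdCLM.symm

/-- The first complex coordinate. -/
def zfst : Coord →L[ℝ] ℂ := ContinuousLinearMap.fst ℝ ℂ ℂ ∘L (coordC : Coord →L[ℝ] ℂ × ℂ)

/-- The second complex coordinate. -/
def zsnd : Coord →L[ℝ] ℂ := ContinuousLinearMap.snd ℝ ℂ ℂ ∘L (coordC : Coord →L[ℝ] ℂ × ℂ)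

/-- The point with given complex coordinates. -/
def mkZ (z w : ℂ) : Coord := coordC.symm (z, w)

@[simp] theorem zfst_mkZ (z w : ℂ) : zfst (mkZ z w) = z := by simp [zfst, mkZ]
@[simp] theorem zsnd_mkZ (z w : ℂ) : zsnd (mkZ z w) = w := by simp [zsnd, mkZ]
@[simp] theorem mkZ_zfst_zsnd (y : Coord) : mkZ (zfst y) (zsnd y) = y := by simp [zfst, zsnd, mkZ]

theorem coord_ext_z {y y' : Coord} (h : zfst y = zfst y') (h' : zsnd y = zsnd y') : y = y' := by
  rw [← mkZ_zfst_zsnd y, h, h', mkZ_zfst_zsnd]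

theorem contDiff_mkZ {E : Type} [NormedAddCommGroup E] [NormedSpace ℝ E] {f g : E → ℂ} {s : Set E}
    (hf : ContDiffOn ℝ ∞ f s) (hg : ContDiffOn ℝ ∞ g s) :
    ContDiffOn ℝ ∞ (fun x => mkZ (f x) (g x)) s :=
  coordC.symm.contDiff.comp_contDiffOn (hf.prodMk hg)

/-- The moment map of the circle action on `ℂ²`. -/
def moment (y : Coord) : ℝ := Real.pi * (Complex.normSq (zfst y) - Complex.normSq (zsnd y))

/-- The map `(z, w) ↦ (t, θ_β) = (z w, π (|z|² - |w|²))`. -/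
def zBase (y : Coord) : Base := (zfst y * zsnd y, moment y)

theorem contDiff_moment : ContDiff ℝ ∞ moment :=
  contDiff_const.mul ((contDiff_normSq.comp zfst.contDiff).sub (contDiff_normSq.comp zsnd.contDiff))

theorem contDiff_zBase : ContDiff ℝ ∞ zBase :=
  (zfst.contDiff.mul zsnd.contDiff).prodMk contDiff_moment

/-- Since 4|zw|² + (|z|² - |w|²)² = (|z|² + |w|²)². The singular distance D becomes a smooth
function on ℂ², and 1/2D is the Gibbons-Hawking potential of the flat metric. -/
theorem momNorm_zBase (y : Coord) :
    momNorm (zBase y) = Real.pi * (Complex.normSq (zfst y) + Complex.normSq (zsnd y)) := by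
  have h1 := Complex.normSq_nonneg (zfst y)
  have h2 := Complex.normSq_nonneg (zsnd y)
  have hpi := Real.pi_pos
  rw [momNorm, gapD₀, ← Real.sqrt_sq (by positivity : 0 ≤ Real.pi * (Complex.normSq (zfst y) +
    Complex.normSq (zsnd y)))]
  congr 1
  simp only [sqBase, zBase, moment, Complex.normSq_mul]
  ring

theorem normSq_zfst (y : Coord) :
    Complex.normSq (zfst y) = (moment y + momNorm (zBase y)) / (2 * Real.pi) := by
  have hpi := Real.pi_pos
  rw [momNorm_zBase, moment]
  field_simp
  ring

/-- The logarithm of the first complex coordinate, as a function of `(s, θ_β, θ_{β^∨})`. -/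
def logZ (x : Coord) : ℂ :=
  ((1 / 2 * Real.log ((x.2.1 + momNorm (toBase x)) / (2 * Real.pi)) : ℝ) : ℂ) +
    ((x.2.2 - x.1.im / (2 * Real.pi) * (x.2.1 - Real.pi) : ℝ) : ℂ) * Complex.I

/-- The Taub-NUT coordinates of the point `(s, θ_β, θ_{β^∨})`. -/
def taubNUT (x : Coord) : Coord := mkZ (Complex.exp (logZ x)) (Complex.exp (x.1 - logZ x))

theorem momNorm_toBase_pos (x : Coord) : 0 < momNorm (toBase x) :=
  (abs_nonneg _).trans_lt (abs_lt_momNorm (Complex.exp_ne_zero _))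

theorem add_momNorm_pos (x : Coord) : 0 < x.2.1 + momNorm (toBase x) := by
  have h := (abs_lt.1 (abs_lt_momNorm (y := toBase x) (Complex.exp_ne_zero _))).1
  change -momNorm (toBase x) < x.2.1 at h
  linarith

theorem zfst_mul_zsnd_taubNUT (x : Coord) :
    zfst (taubNUT x) * zsnd (taubNUT x) = Complex.exp x.1 := by
  rw [taubNUT, zfst_mkZ, zsnd_mkZ, ← Complex.exp_add, add_sub_cancel]

theorem normSq_exp (z : ℂ) : Complex.normSq (Complex.exp z) = Real.exp (2 * z.re) := by
  rw [Complex.normSq_eq_norm_sq, Complex.norm_exp, ← Real.exp_nat_mul]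
  norm_num

theorem normSq_zfst_taubNUT (x : Coord) :
    Complex.normSq (zfst (taubNUT x)) = (x.2.1 + momNorm (toBase x)) / (2 * Real.pi) := by
  have hpi := Real.pi_pos
  have h := div_pos (add_momNorm_pos x) (mul_pos two_pos hpi)
  rw [taubNUT, zfst_mkZ, normSq_exp]
  conv_rhs => rw [← Real.exp_log h]
  congr 1
  rw [logZ, Complex.add_re, Complex.ofReal_re, Complex.re_ofReal_mul, Complex.I_re]
  ring

theorem normSq_zsnd_taubNUT (x : Coord) :
    Complex.normSq (zsnd (taubNUT x)) = (momNorm (toBase x) - x.2.1) / (2 * Real.pi) := by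
  have hpi := Real.pi_pos
  have h := add_momNorm_pos x
  have h1 := congrArg Complex.normSq (zfst_mul_zsnd_taubNUT x)
  rw [Complex.normSq_mul, normSq_zfst_taubNUT] at h1
  have h2 := mul_normSq_eq (toBase x)
  change 4 * Real.pi ^ 2 * Complex.normSq (Complex.exp x.1) =
    (momNorm (toBase x) - x.2.1) * (momNorm (toBase x) + x.2.1) at h2
  rw [← h1] at h2
  field_simp at h2 ⊢
  refine mul_left_cancel₀ h.ne' ?_
  linarith

theorem zBase_taubNUT (x : Coord) : zBase (taubNUT x) = toBase x := by
  have hpi := Real.pi_pos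
  refine Prod.ext (zfst_mul_zsnd_taubNUT x) ?_
  simp only [zBase, moment, normSq_zfst_taubNUT, normSq_zsnd_taubNUT, toBase]
  field_simp
  ring

/-- The differential of `logZ`. -/
def dlogZ (x : Coord) : Coord →L[ℝ] ℂ :=
  ((2 * momNorm (toBase x) : ℂ)⁻¹) • dθelec +
    (((momNorm (toBase x) - x.2.1) / (2 * momNorm (toBase x)) : ℝ) : ℂ) •
      realForm (Complex.reCLM ∘L ContinuousLinearMap.fst ℝ ℂ (ℝ × ℝ)) +
    Complex.I • (dθmag - ((x.1.im / (2 * Real.pi) : ℝ) : ℂ) • dθelec -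
      (((x.2.1 - Real.pi) / (2 * Real.pi) : ℝ) : ℂ) •
        realForm (Complex.imCLM ∘L ContinuousLinearMap.fst ℝ ℂ (ℝ × ℝ)))

theorem hasFDerivAt_momNorm_toBase (x : Coord) :
    HasFDerivAt (fun x : Coord => momNorm (toBase x))
      (((momNorm (toBase x) ^ 2 - x.2.1 ^ 2) / momNorm (toBase x)) •
        (Complex.reCLM ∘L ContinuousLinearMap.fst ℝ ℂ (ℝ × ℝ)) +
      (x.2.1 / momNorm (toBase x)) •
        (ContinuousLinearMap.fst ℝ ℝ ℝ ∘L ContinuousLinearMap.snd ℝ ℂ (ℝ × ℝ))) x := by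
  have hre := (Complex.reCLM ∘L ContinuousLinearMap.fst ℝ ℂ (ℝ × ℝ)).hasFDerivAt (x := x)
  have ha := (ContinuousLinearMap.fst ℝ ℝ ℝ ∘L ContinuousLinearMap.snd ℝ ℂ (ℝ × ℝ)).hasFDerivAt
    (x := x)
  have hf : (fun x : Coord => momNorm (toBase x)) =
      fun x : Coord => gapD₀ (Real.exp (2 * x.1.re), x.2.1) := by
    funext x
    rw [momNorm, sqBase, ← normSq_exp]
    rfl
  have h0 := momNorm_toBase_pos x
  have hx := congrFun hf x
  have hsq := momNorm_sq (toBase x)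
  simp only [toBase, normSq_exp] at hsq
  have h := (hasFDerivAt_gapD₀ (p := (Real.exp (2 * x.1.re), x.2.1)) (hx ▸ h0)).comp x
    (((hre.const_mul 2).exp).prodMk ha)
  rw [hf]
  refine h.congr_fderiv ?_
  refine ContinuousLinearMap.ext fun v => ?_
  rw [← hx]
  simp
  have hsq' : 4 * Real.pi ^ 2 * Real.exp (2 * x.1.re) = momNorm (toBase x) ^ 2 - x.2.1 ^ 2 := by
    rw [toBase]; linarith
  rw [← hsq']
  field_simp
  ring

theorem hasFDerivAt_logZ (x : Coord) : HasFDerivAt logZ (dlogZ x) x := by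
  have hpi := Real.pi_pos
  have him := (Complex.imCLM ∘L ContinuousLinearMap.fst ℝ ℂ (ℝ × ℝ)).hasFDerivAt (x := x)
  have ha := (ContinuousLinearMap.fst ℝ ℝ ℝ ∘L ContinuousLinearMap.snd ℝ ℂ (ℝ × ℝ)).hasFDerivAt
    (x := x)
  have hb := (ContinuousLinearMap.snd ℝ ℝ ℝ ∘L ContinuousLinearMap.snd ℝ ℂ (ℝ × ℝ)).hasFDerivAt
    (x := x)
  have hpos := add_momNorm_pos x
  have hD := momNorm_toBase_pos x
  have h1 := ((((ha.add (hasFDerivAt_momNorm_toBase x)).mul_const (2 * Real.pi)⁻¹).log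
    (mul_pos hpos (inv_pos.2 (mul_pos two_pos hpi))).ne').const_mul (1 / 2 : ℝ))
  have h2 := hb.sub ((him.mul_const (2 * Real.pi)⁻¹).mul (ha.sub_const Real.pi))
  have h := (Complex.ofRealCLM.hasFDerivAt.comp x h1).add
    ((Complex.ofRealCLM.hasFDerivAt.comp x h2).mul_const Complex.I)
  refine HasFDerivAt.congr_fderiv (f := logZ) h ?_
  refine ContinuousLinearMap.ext fun v => ?_
  -- The factor D² - θ² = (D - θ)(D + θ) in the derivative of D cancels the D + θ inside the
  -- logarithm.
  have key : 1 / 2 * (((x.2.1 + momNorm (toBase x)) * (2 * Real.pi)⁻¹)⁻¹ * ((2 * Real.pi)⁻¹ *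
      (v.2.1 + ((momNorm (toBase x) ^ 2 - x.2.1 ^ 2) / momNorm (toBase x) * v.1.re +
        x.2.1 / momNorm (toBase x) * v.2.1)))) = (2 * momNorm (toBase x))⁻¹ * v.2.1 +
      (momNorm (toBase x) - x.2.1) / (2 * momNorm (toBase x)) * v.1.re := by
    field_simp
    ring
  have key' := congrArg (fun r : ℝ => (r : ℂ)) key
  simp [dlogZ] at key' ⊢
  linear_combination key'

theorem hasFDerivAt_taubNUT (x : Coord) : HasFDerivAt taubNUT
    ((coordC.symm : ℂ × ℂ →L[ℝ] Coord) ∘L ((zfst (taubNUT x) • dlogZ x).prod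
      (zsnd (taubNUT x) • (ContinuousLinearMap.fst ℝ ℂ (ℝ × ℝ) - dlogZ x)))) x := by
  have h1 := hasFDerivAt_logZ x
  have h2 := ((ContinuousLinearMap.fst ℝ ℂ (ℝ × ℝ)).hasFDerivAt (x := x)).sub h1
  have h3 := (coordC.symm : ℂ × ℂ →L[ℝ] Coord).hasFDerivAt.comp x (h1.cexp.prodMk h2.cexp)
  simp only [taubNUT, zfst_mkZ, zsnd_mkZ]
  exact h3

theorem zfst_fderiv_taubNUT (x v : Coord) :
    zfst (fderiv ℝ taubNUT x v) = zfst (taubNUT x) * dlogZ x v := by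
  rw [(hasFDerivAt_taubNUT x).fderiv]; simp [zfst]

theorem zsnd_fderiv_taubNUT (x v : Coord) :
    zsnd (fderiv ℝ taubNUT x v) = zsnd (taubNUT x) * (v.1 - dlogZ x v) := by
  rw [(hasFDerivAt_taubNUT x).fderiv]; simp [zsnd]

theorem dlogZ_apply (x v : Coord) : dlogZ x v =
    ((v.2.1 / (2 * momNorm (toBase x)) +
      (momNorm (toBase x) - x.2.1) / (2 * momNorm (toBase x)) * v.1.re : ℝ) : ℂ) +
    ((v.2.2 - x.1.im / (2 * Real.pi) * v.2.1 -
      (x.2.1 - Real.pi) / (2 * Real.pi) * v.1.im : ℝ) : ℂ) * Complex.I := by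
  simp [dlogZ]
  ring

/-! ### The flat forms -/

/-- The holomorphic symplectic form of `ℂ²`. -/
def flatHol : Coord [⋀^Fin 2]→L[ℝ] ℂ := (Complex.I / (2 * Real.pi)) • wedge zfst zsnd

/-- The flat Kähler form of `ℂ²`. -/
def flatThree : Coord [⋀^Fin 2]→L[ℝ] ℂ :=
  (Complex.I / (4 * Real.pi)) • (wedge zfst (conjForm zfst) + wedge zsnd (conjForm zsnd))

/-- The flat hyperkähler triple of `ℂ²`. -/
def flat (α : Fin 3) : Coord [⋀^Fin 2]→L[ℝ] ℝ :=
  ![Complex.reCLM.compContinuousAlternatingMap flatHol,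
    Complex.imCLM.compContinuousAlternatingMap flatHol,
    Complex.reCLM.compContinuousAlternatingMap flatThree] α

theorem conj_eq_re_sub_im (z : ℂ) : (starRingEnd ℂ) z = (z.re : ℂ) - (z.im : ℂ) * Complex.I := by
  refine Complex.ext ?_ ?_ <;> simp

theorem singConn_mul_conj (x : Coord) :
    singConn (toBase x) * (starRingEnd ℂ) (Complex.exp x.1) =
      ((-(x.2.1 / (2 * Real.pi)) + x.2.1 / (2 * momNorm (toBase x)) : ℝ) : ℂ) := by
  have h0 : Complex.normSq (Complex.exp x.1) ≠ 0 :=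
    (Complex.normSq_pos.2 (Complex.exp_ne_zero _)).ne'
  rw [singConn, mul_assoc]
  simp only [toBase]
  rw [Complex.mul_conj, ← Complex.ofReal_mul, div_mul_cancel₀ _ h0]

/-- With z = exp(logZ) and zw = exp s one has dz ∧ dw = t dlogZ ∧ ds, so the claim is an identity
between constant-coefficient forms in ds, dθ_β and dθ_{β^∨}, multiplied by t. -/
theorem flatHol_taubNUT (x : Coord) : flatHol.compContinuousLinearMap (fderiv ℝ taubNUT x) =
    ghCoordHol x (singConn (toBase x)) (2 * momNorm (toBase x))⁻¹ (x.1.im / (2 * Real.pi)) := by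
  ext v
  have hpi : (Real.pi : ℂ) ≠ 0 := by exact_mod_cast Real.pi_ne_zero
  have hc := singConn_mul_conj x
  have ht := zfst_mul_zsnd_taubNUT x
  have hD : (momNorm (toBase x) : ℂ) ≠ 0 := by exact_mod_cast (momNorm_toBase_pos x).ne'
  have hs : ∀ i, (v i).1 = ((v i).1.re : ℂ) + ((v i).1.im : ℂ) * Complex.I :=
    fun i => (Complex.re_add_im _).symm
  have hs' : ∀ i, (starRingEnd ℂ) (v i).1 = ((v i).1.re : ℂ) - ((v i).1.im : ℂ) * Complex.I :=
    fun i => conj_eq_re_sub_im _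
  have key : (Complex.I / (2 * Real.pi)) * (dlogZ x (v 0) * (v 1).1 - dlogZ x (v 1) * (v 0).1) =
      1 / (2 * Real.pi) * ((v 0).1 * (v 1).2.2 - (v 1).1 * (v 0).2.2) +
      Complex.I / (4 * Real.pi) *
        ((-(x.2.1 / (2 * Real.pi)) + x.2.1 / (2 * momNorm (toBase x)) : ℝ) : ℂ) *
        ((v 0).1 * (starRingEnd ℂ) (v 1).1 - (v 1).1 * (starRingEnd ℂ) (v 0).1) -
      ((x.1.im / (2 * Real.pi) : ℝ) + Complex.I * ((2 * momNorm (toBase x))⁻¹ : ℝ)) /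
        (2 * Real.pi) * ((v 0).1 * (v 1).2.1 - (v 1).1 * (v 0).2.1) := by
    rw [dlogZ_apply, dlogZ_apply, hs' 0, hs' 1]
    have hs0 := hs 0
    have hs1 := hs 1
    generalize (v 0).1.re = p₀ at *
    generalize (v 1).1.re = p₁ at *
    generalize (v 0).1.im = q₀ at *
    generalize (v 1).1.im = q₁ at *
    rw [hs0, hs1]
    push_cast
    field_simp
    ring_nf
    simp only [Complex.I_sq, Complex.I_pow_three]
    ring
  rw [ghCoordHol_apply]
  simp only [ContinuousAlternatingMap.compContinuousLinearMap_apply, flatHol,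
    ContinuousAlternatingMap.smul_apply, wedge_apply, Function.comp, zfst_fderiv_taubNUT,
    zsnd_fderiv_taubNUT, smul_eq_mul, map_mul]
  linear_combination Complex.exp x.1 * key - Complex.I / (4 * Real.pi) * Complex.exp x.1 *
    ((v 0).1 * (starRingEnd ℂ) (v 1).1 - (v 1).1 * (starRingEnd ℂ) (v 0).1) * hc +
    (Complex.I / (2 * Real.pi)) * (dlogZ x (v 0) * (v 1).1 - dlogZ x (v 1) * (v 0).1) * ht

/-- Here only |z|² = (D + θ)/2π and |w|² = (D - θ)/2π enter, next to dlogZ and ds; the factor |t|²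
is their product. -/
theorem flatThree_taubNUT (x : Coord) : flatThree.compContinuousLinearMap (fderiv ℝ taubNUT x) =
    ghCoordThree x (singConn (toBase x)) (2 * momNorm (toBase x))⁻¹ := by
  ext v
  have hpi : (Real.pi : ℂ) ≠ 0 := by exact_mod_cast Real.pi_ne_zero
  have hc := singConn_mul_conj x
  have hc' := congrArg (starRingEnd ℂ) hc
  rw [map_mul, Complex.conj_conj, Complex.conj_ofReal] at hc'
  have hD : (momNorm (toBase x) : ℂ) ≠ 0 := by exact_mod_cast (momNorm_toBase_pos x).ne'
  have hs : ∀ i, (v i).1 = ((v i).1.re : ℂ) + ((v i).1.im : ℂ) * Complex.I :=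
    fun i => (Complex.re_add_im _).symm
  have hs' : ∀ i, (starRingEnd ℂ) (v i).1 = ((v i).1.re : ℂ) - ((v i).1.im : ℂ) * Complex.I :=
    fun i => conj_eq_re_sub_im _
  have h1 := Complex.mul_conj (zfst (taubNUT x))
  have h2 := Complex.mul_conj (zsnd (taubNUT x))
  have h3 : Complex.exp x.1 * (starRingEnd ℂ) (Complex.exp x.1) =
      (((x.2.1 + momNorm (toBase x)) / (2 * Real.pi) *
        ((momNorm (toBase x) - x.2.1) / (2 * Real.pi)) : ℝ) : ℂ) := by
    rw [← zfst_mul_zsnd_taubNUT, Complex.mul_conj, Complex.normSq_mul, normSq_zfst_taubNUT,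
      normSq_zsnd_taubNUT]
  rw [normSq_zfst_taubNUT] at h1
  rw [normSq_zsnd_taubNUT] at h2
  have key : (Complex.I / (4 * Real.pi)) *
      ((((x.2.1 + momNorm (toBase x)) / (2 * Real.pi) : ℝ) : ℂ) *
        (dlogZ x (v 0) * (starRingEnd ℂ) (dlogZ x (v 1)) -
          dlogZ x (v 1) * (starRingEnd ℂ) (dlogZ x (v 0))) +
      (((momNorm (toBase x) - x.2.1) / (2 * Real.pi) : ℝ) : ℂ) *
        (((v 0).1 - dlogZ x (v 0)) * (starRingEnd ℂ) ((v 1).1 - dlogZ x (v 1)) -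
          ((v 1).1 - dlogZ x (v 1)) * (starRingEnd ℂ) ((v 0).1 - dlogZ x (v 0)))) =
      1 / (4 * Real.pi ^ 2) * ((v 0).2.1 * (v 1).2.2 - (v 1).2.1 * (v 0).2.2) +
      (Complex.I / 2 * ((2 * momNorm (toBase x))⁻¹ : ℝ) *
        (((x.2.1 + momNorm (toBase x)) / (2 * Real.pi) *
          ((momNorm (toBase x) - x.2.1) / (2 * Real.pi)) : ℝ) : ℂ) *
        ((v 0).1 * (starRingEnd ℂ) (v 1).1 - (v 1).1 * (starRingEnd ℂ) (v 0).1) -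
      Complex.I / (8 * Real.pi ^ 2) *
        ((-(x.2.1 / (2 * Real.pi)) + x.2.1 / (2 * momNorm (toBase x)) : ℝ) : ℂ) *
        ((v 0).2.1 * (v 1).1 - (v 1).2.1 * (v 0).1) +
      Complex.I / (8 * Real.pi ^ 2) *
        ((-(x.2.1 / (2 * Real.pi)) + x.2.1 / (2 * momNorm (toBase x)) : ℝ) : ℂ) *
        ((v 0).2.1 * (starRingEnd ℂ) (v 1).1 - (v 1).2.1 * (starRingEnd ℂ) (v 0).1)) := by
    simp only [dlogZ_apply, map_sub, map_add, map_mul, Complex.conj_ofReal, Complex.conj_I,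
      hs' 0, hs' 1]
    have hs0 := hs 0
    have hs1 := hs 1
    generalize (v 0).1.re = p₀ at *
    generalize (v 1).1.re = p₁ at *
    generalize (v 0).1.im = q₀ at *
    generalize (v 1).1.im = q₁ at *
    rw [hs0, hs1]
    push_cast
    field_simp
    ring_nf
    simp only [Complex.I_sq]
    ring
  rw [ghCoordThree_apply]
  simp only [ContinuousAlternatingMap.compContinuousLinearMap_apply, flatThree,
    ContinuousAlternatingMap.smul_apply, ContinuousAlternatingMap.add_apply, wedge_apply,
    Function.comp, conjForm_apply, zfst_fderiv_taubNUT, zsnd_fderiv_taubNUT, smul_eq_mul, map_mul]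
  rw [← h1, ← h2] at key
  linear_combination key - Complex.I / 2 * ((2 * momNorm (toBase x))⁻¹ : ℝ) *
      ((v 0).1 * (starRingEnd ℂ) (v 1).1 - (v 1).1 * (starRingEnd ℂ) (v 0).1) * h3 +
    Complex.I / (8 * Real.pi ^ 2) * ((v 0).2.1 * (v 1).1 - (v 1).2.1 * (v 0).1) * hc' -
    Complex.I / (8 * Real.pi ^ 2) *
      ((v 0).2.1 * (starRingEnd ℂ) (v 1).1 - (v 1).2.1 * (starRingEnd ℂ) (v 0).1) * hc

theorem flat_taubNUT (α : Fin 3) (x : Coord) :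
    (flat α).compContinuousLinearMap (fderiv ℝ taubNUT x) =
      ghCoord α x (singConn (toBase x)) (2 * momNorm (toBase x))⁻¹ (x.1.im / (2 * Real.pi)) := by
  have h1 (v) := congrArg (fun φ : Coord [⋀^Fin 2]→L[ℝ] ℂ => φ v) (flatHol_taubNUT x)
  have h2 (v) := congrArg (fun φ : Coord [⋀^Fin 2]→L[ℝ] ℂ => φ v) (flatThree_taubNUT x)
  simp only [ContinuousAlternatingMap.compContinuousLinearMap_apply] at h1 h2
  ext v
  fin_cases α <;> simp [flat, ghCoord, h1, h2]

/-! ### The forms in the Taub-NUT coordinates -/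

/-- The Ooguri-Vafa forms in the Taub-NUT coordinates. -/
def ovForm (α : Fin 3) (y : Coord) : Coord [⋀^Fin 2]→L[ℝ] ℝ :=
  flat α + (gh α (regConn (zBase y)) (regPot (zBase y)) (-1 / 4)).compContinuousLinearMap
    (fderiv ℝ zBase y)

/-- The forms of the resolved conifold in the Taub-NUT coordinates. -/
def conForm (α : Fin 3) (y : Coord) : Coord [⋀^Fin 2]→L[ℝ] ℝ :=
  ovForm α y + (etaForm α (zBase y)).compContinuousLinearMap (fderiv ℝ zBase y)

theorem pullback_zBase_taubNUT (η : Base [⋀^Fin 2]→L[ℝ] ℝ) (x : Coord) :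
    (η.compContinuousLinearMap (fderiv ℝ zBase (taubNUT x))).compContinuousLinearMap
      (fderiv ℝ taubNUT x) = η.compContinuousLinearMap (fderiv ℝ toBase x) := by
  have h : fderiv ℝ (zBase ∘ taubNUT) x = fderiv ℝ zBase (taubNUT x) ∘L fderiv ℝ taubNUT x :=
    fderiv_comp x (contDiff_zBase.differentiable (by simp) _)
      (hasFDerivAt_taubNUT x).differentiableAt
  rw [show zBase ∘ taubNUT = toBase from funext zBase_taubNUT] at h
  rw [h]
  rfl

theorem add_compContinuousLinearMap {E F : Type} [NormedAddCommGroup E] [NormedSpace ℝ E]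
    [NormedAddCommGroup F] [NormedSpace ℝ F] (φ ψ : F [⋀^Fin 2]→L[ℝ] ℝ) (L : E →L[ℝ] F) :
    (φ + ψ).compContinuousLinearMap L =
      φ.compContinuousLinearMap L + ψ.compContinuousLinearMap L := rfl

/-- The logarithm (log |t|²)/4π = Re s/2π of the potential cancels the term -Re s/2π of Im τ, and Im
s/2π is shared by Re τ and the flat triple. What remains besides the flat forms is the regular data,
pulled back from (t, θ_β). -/
theorem ovForm_taubNUT (α : Fin 3) {x : Coord} (hx : x.2.1 ∈ Ioo (-(2 * Real.pi)) (2 * Real.pi)) :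
    (ovForm α (taubNUT x)).compContinuousLinearMap (fderiv ℝ taubNUT x) =
      ghCoord α x (latticeConn {0} (toBase x)) (latticePot {0} (toBase x) + (tauOV x.1).im)
        (tauOV x.1).re := by
  have hs : toBase x ∈ slab := abs_lt.2 hx
  have h0 : (toBase x).1 ≠ 0 := Complex.exp_ne_zero _
  have hp : sqBase (toBase x) ∈ polarRegion := ⟨Complex.normSq_pos.2 h0, hx⟩
  rw [ovForm, add_compContinuousLinearMap, flat_taubNUT, pullback_zBase_taubNUT, zBase_taubNUT,
    ← ghCoord_add, ← latticeConn_eq hs h0, (tauOV_re_im x.1).1, (tauOV_re_im x.1).2]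
  congr 1
  have h := pairPot_eq hp
  have hlog : Real.log (sqBase (toBase x)).1 = 2 * x.1.re := by
    rw [sqBase, toBase, normSq_exp, Real.log_exp]
  rw [latticePot_singleton, regPot]
  change pairPot (Complex.normSq (toBase x).1) (toBase x).2 = _ at h
  rw [h, hlog, momNorm]
  have hpi := Real.pi_pos
  field_simp
  ring

theorem ovForm_taubNUT_eq (ε : ℕ) (α : Fin 3) {x : Coord} (hx : x ∈ cover)
    (ha : x.2.1 ∈ Ioo (-(2 * Real.pi)) (2 * Real.pi)) :
    (ovForm α (taubNUT x)).compContinuousLinearMap (fderiv ℝ taubNUT x) =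
      (ooguriVafa ε cutoff).omega α x := by
  rw [ovForm_taubNUT α ha, (isElectric_ooguriVafa ε (exp_mem_strip hx)).omega_eq]

theorem conForm_taubNUT_eq (ε : ℕ) (α : Fin 3) {x : Coord} (hx : x ∈ cover)
    (ha : x.2.1 ∈ Ioo (-(2 * Real.pi)) (2 * Real.pi)) :
    (conForm α (taubNUT x)).compContinuousLinearMap (fderiv ℝ taubNUT x) =
      (conifold ε).omega α x := by
  rw [conForm, add_compContinuousLinearMap, ovForm_taubNUT_eq ε α hx ha, pullback_zBase_taubNUT,
    zBase_taubNUT, omega_conifold_eq ε α hx]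

end ConifoldHK
end

noncomputable section
namespace ConifoldHK
open MeasureTheory Filter Topology

/-! ### Smoothness and closedness of the forms -/

section Forms

variable {E F : Type} [NormedAddCommGroup E] [NormedSpace ℝ E] [NormedAddCommGroup F]
  [NormedSpace ℝ F]

theorem form_eq_vec (Φ : F [⋀^Fin 2]→L[ℝ] ℝ) (v : Fin 2 → F) : Φ v = Φ ![v 0, v 1] := by
  congr 1
  ext i
  fin_cases i <;> rfl

theorem form_swap (Φ : F [⋀^Fin 2]→L[ℝ] ℝ) (u v : F) : Φ ![v, u] = -Φ ![u, v] := by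
  have h := Φ.map_swap ![u, v] (i := 0) (j := 1) (by decide)
  change _ = -Φ ![u, v] at h
  rw [← h]
  change _ = Φ _
  congr 1
  ext i
  fin_cases i <;> rfl

theorem form_comp_vec {G : Type} [NormedAddCommGroup G] [NormedSpace ℝ G] (Φ : F [⋀^Fin 2]→L[ℝ] ℝ)
    (L : G →L[ℝ] F) (u v : G) : Φ.compContinuousLinearMap L ![u, v] = Φ ![L u, L v] := by
  rw [ContinuousAlternatingMap.compContinuousLinearMap_apply, form_eq_vec]
  rfl

/-- The map from vectors to covectors of a two-form. -/
def flatMap [FiniteDimensional ℝ F] (Φ : F [⋀^Fin 2]→L[ℝ] ℝ) : F →L[ℝ] F →L[ℝ] ℝ :=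
  LinearMap.toContinuousLinearMap
    { toFun := fun u => (ContinuousAlternatingMap.ofSubsingleton ℝ F ℝ (0 : Fin 1)).symm
        (Φ.curryLeft u)
      map_add' := fun u v => by ext w; simp
      map_smul' := fun r u => by ext w; simp }

theorem flatMap_apply [FiniteDimensional ℝ F] (Φ : F [⋀^Fin 2]→L[ℝ] ℝ) (u v : F) :
    flatMap Φ u v = Φ ![u, v] := by
  change Φ (Matrix.vecCons u fun _ => v) = _
  congr 1
  ext i
  fin_cases i <;> rfl

theorem contDiffOn_form_apply {Φ : E → F [⋀^Fin 2]→L[ℝ] ℝ} {s : Set E} (h : ContDiffOn ℝ ∞ Φ s)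
    (v : Fin 2 → F) : ContDiffOn ℝ ∞ (fun x => Φ x v) s :=
  (ContinuousAlternatingMap.apply ℝ F ℝ v).contDiff.comp_contDiffOn h

theorem contDiffOn_flatMap [FiniteDimensional ℝ F] {Φ : E → F [⋀^Fin 2]→L[ℝ] ℝ} {s : Set E}
    (h : ContDiffOn ℝ ∞ Φ s) : ContDiffOn ℝ ∞ (fun x => flatMap (Φ x)) s := by
  refine contDiffOn_clm_apply.2 fun u => contDiffOn_clm_apply.2 fun v => ?_
  simp only [flatMap_apply]
  exact contDiffOn_form_apply h _

theorem contDiffOn_form [FiniteDimensional ℝ F] {Φ : E → F [⋀^Fin 2]→L[ℝ] ℝ} {s : Set E}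
    (h : ∀ u v : F, ContDiffOn ℝ ∞ (fun x => Φ x ![u, v]) s) : ContDiffOn ℝ ∞ Φ s := by
  set b := Module.finBasis ℝ F
  let d : ∀ i, F →L[ℝ] ℂ := fun i => realForm (b.coord i).toContinuousLinearMap
  -- Every unordered pair of basis vectors occurs twice in the double sum, hence the factor 1/2.
  have key : ∀ φ : F [⋀^Fin 2]→L[ℝ] ℝ, φ = ∑ i, ∑ j, (1 / 2 * φ ![b i, b j]) •
      Complex.reCLM.compContinuousAlternatingMap (wedge (d i) (d j)) := by
    intro φ
    refine ContinuousAlternatingMap.toAlternatingMap_injective (b.ext_alternating fun v _ => ?_)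
    have h1 : ∀ i j, d i (b j) = if j = i then 1 else 0 := fun i j => by
      by_cases h : j = i <;> simp [d, h]
    change φ (fun i => b (v i)) = (∑ i, ∑ j, (1 / 2 * φ ![b i, b j]) •
      Complex.reCLM.compContinuousAlternatingMap (wedge (d i) (d j))) (fun i => b (v i))
    rw [form_eq_vec φ]
    simp only [ContinuousAlternatingMap.sum_apply, ContinuousAlternatingMap.smul_apply,
      ContinuousLinearMap.compContinuousAlternatingMap_coe, Function.comp, wedge_apply, h1]
    have h2 := form_swap φ (b (v 0)) (b (v 1))
    have h3 : ∀ i j, Complex.reCLM ((if v 0 = i then (1 : ℂ) else 0) * (if v 1 = j then 1 else 0) -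
        (if v 1 = i then 1 else 0) * (if v 0 = j then 1 else 0)) =
        (if v 0 = i then (1 : ℝ) else 0) * (if v 1 = j then 1 else 0) -
        (if v 1 = i then 1 else 0) * (if v 0 = j then 1 else 0) := by
      intro i j
      split_ifs <;> simp
    simp only [smul_eq_mul]
    simp_rw [h3]
    simp only [mul_sub, Finset.sum_sub_distrib, mul_ite, mul_one, mul_zero,
      Finset.sum_ite_eq, Finset.mem_univ, if_true]
    linarith
  have h2 : Φ = fun x => ∑ i, ∑ j, (1 / 2 * Φ x ![b i, b j]) •
      Complex.reCLM.compContinuousAlternatingMap (wedge (d i) (d j)) := funext fun x => key (Φ x)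
  rw [h2]
  exact ContDiffOn.sum fun i _ => ContDiffOn.sum fun j _ =>
    (contDiffOn_const.mul (h _ _)).smul contDiffOn_const

theorem contDiffOn_form_comp {G : Type} [NormedAddCommGroup G] [NormedSpace ℝ G]
    [FiniteDimensional ℝ F] [FiniteDimensional ℝ G] {Φ : E → F [⋀^Fin 2]→L[ℝ] ℝ}
    {L : E → G →L[ℝ] F} {s : Set E} (h : ContDiffOn ℝ ∞ Φ s) (hL : ContDiffOn ℝ ∞ L s) :
    ContDiffOn ℝ ∞ (fun x => (Φ x).compContinuousLinearMap (L x)) s := by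
  refine contDiffOn_form fun u v => ?_
  refine (((contDiffOn_flatMap h).clm_apply (hL.clm_apply (contDiffOn_const (c := u)))).clm_apply
    (hL.clm_apply (contDiffOn_const (c := v)))).congr fun x _ => ?_
  rw [flatMap_apply, form_comp_vec]

theorem contDiffOn_extDeriv {Φ : E → E [⋀^Fin 2]→L[ℝ] ℝ} {s : Set E} (hs : IsOpen s)
    (h : ContDiffOn ℝ ∞ Φ s) : ContinuousOn (extDeriv Φ) s :=
  (ContinuousAlternatingMap.alternatizeUncurryFinCLM ℝ E ℝ).continuous.comp_continuousOn
    (h.continuousOn_fderiv_of_isOpen hs (by simp))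

end Forms

/-- Identities are checked where zw ≠ 0, on which the Taub-NUT coordinates reach every point, and
are carried over the axes by continuity. -/
theorem eqOn_of_dense {A B : Type} [TopologicalSpace A] [TopologicalSpace B] [T2Space B]
    {f g : A → B} {U D : Set A} (hU : IsOpen U) (hD : Dense D) (hf : ContinuousOn f U)
    (hg : ContinuousOn g U) (h : ∀ y ∈ U, y ∈ D → f y = g y) : EqOn f g U := by
  intro y hy
  have hc : y ∈ closure (U ∩ D) := hD.open_subset_closure_inter hU hy
  have : (𝓝[U ∩ D] y).NeBot := mem_closure_iff_nhdsWithin_neBot.1 hc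
  refine tendsto_nhds_unique_of_eventuallyEq (l := 𝓝[U ∩ D] y) ((hf y hy).mono inter_subset_left)
    ((hg y hy).mono inter_subset_left) ?_
  filter_upwards [self_mem_nhdsWithin] with z hz using h z hz.1 hz.2

/-! ### The domain of the Taub-NUT coordinates and the smoothness of the forms on it -/

/-- The points of `ℂ²` off the coordinate axes. -/
def offAxes : Set Coord := {y | zfst y * zsnd y ≠ 0}

theorem dense_offAxes : Dense offAxes := by
  have h : ∀ (L : Coord →L[ℝ] ℂ) (e : Coord), L e ≠ 0 → Dense {y | L y ≠ 0} := by
    intro L e he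
    have h1 : Dense ((L : Coord →ₗ[ℝ] ℂ).ker : Set Coord)ᶜ := by
      rw [← interior_eq_empty_iff_dense_compl, ← not_nonempty_iff_eq_empty]
      intro h
      have h2 := Submodule.eq_top_of_nonempty_interior' _ h
      have : e ∈ (L : Coord →ₗ[ℝ] ℂ).ker := h2 ▸ Submodule.mem_top
      exact he this
    exact h1
  have h1 := (h zfst (mkZ 1 1) (by simp)).inter_of_isOpen_left (h zsnd (mkZ 1 1) (by simp))
    (isOpen_ne_fun zfst.continuous continuous_const)
  refine h1.mono fun y hy => mul_ne_zero hy.1 hy.2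

theorem isOpen_fullM : IsOpen fullM := by
  have h : fullM = {t | |t.re| < 1 / 2} ∩ {t | 2 * (Complex.exp (2 * Real.pi * Complex.I * t)).re ≠ 1} := by
    ext t
    constructor
    · rintro (rfl | ht)
      · simp
      · exact ⟨ht.2.1, ht.2.2⟩
    · rintro ⟨h1, h2⟩
      by_cases h0 : t = 0
      · exact Or.inl h0
      · exact Or.inr ⟨h0, h1, h2⟩
  rw [h]
  exact (isOpen_lt (by fun_prop) continuous_const).inter (isOpen_ne_fun (by fun_prop) continuous_const)

/-- The domain of the Taub-NUT coordinates. -/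
def tnDomain : Set Coord := {y | zfst y * zsnd y ∈ fullM ∧ |moment y| < 2 * Real.pi}

theorem isOpen_tnDomain : IsOpen tnDomain :=
  (isOpen_fullM.preimage (by fun_prop)).inter
    (isOpen_lt (contDiff_moment.continuous.abs) continuous_const)

theorem isOpen_cover : IsOpen cover := by
  have h : cover = (fun x : Coord => Complex.exp x.1) ⁻¹' fullM := by
    ext x
    refine ⟨fun h => Or.inr h, fun h => h.resolve_left (Complex.exp_ne_zero _)⟩
  rw [h]
  exact isOpen_fullM.preimage (by fun_prop)

/-- The part `|θ_β| < 2π` of the covering. -/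
def coverSlab : Set Coord := cover ∩ {x | x.2.1 ∈ Ioo (-(2 * Real.pi)) (2 * Real.pi)}

theorem isOpen_coverSlab : IsOpen coverSlab :=
  isOpen_cover.inter (isOpen_Ioo.preimage (by fun_prop))

theorem taubNUT_mem {x : Coord} (hx : x ∈ coverSlab) : taubNUT x ∈ tnDomain := by
  refine ⟨?_, ?_⟩
  · rw [zfst_mul_zsnd_taubNUT]; exact Or.inr hx.1
  · have h : moment (taubNUT x) = x.2.1 := congrArg Prod.snd (zBase_taubNUT x)
    rw [h]; exact abs_lt.2 hx.2

/-- The preimage has s = log(zw), θ_β the moment map, and θ_{β^∨} chosen so that the imaginary part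
of `logZ` is arg z; the real part is right by `normSq_zfst`. -/
theorem exists_taubNUT_eq {y : Coord} (hy : y ∈ tnDomain) (h0 : y ∈ offAxes) :
    ∃ x ∈ coverSlab, taubNUT x = y := by
  have hpi := Real.pi_pos
  have h1 : zfst y ≠ 0 := left_ne_zero_of_mul h0
  set s := Complex.log (zfst y * zsnd y)
  have hs : Complex.exp s = zfst y * zsnd y := Complex.exp_log h0
  set x : Coord := (s, moment y, Complex.arg (zfst y) + s.im / (2 * Real.pi) * (moment y - Real.pi))
  have hb : toBase x = zBase y := Prod.ext hs rfl
  have hl : logZ x = Complex.log (zfst y) := by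
    have h2 := normSq_zfst y
    rw [logZ, hb]
    change ((1 / 2 * Real.log ((moment y + momNorm (zBase y)) / (2 * Real.pi)) : ℝ) : ℂ) + _ = _
    rw [← h2, Complex.normSq_eq_norm_sq, Real.log_pow, Complex.log]
    simp [x]
  refine ⟨x, ⟨?_, abs_lt.1 hy.2⟩, coord_ext_z ?_ ?_⟩
  · change Complex.exp s ∈ baseM
    rw [hs]
    exact hy.1.resolve_left h0
  · rw [taubNUT, zfst_mkZ, hl, Complex.exp_log h1]
  · rw [taubNUT, zsnd_mkZ, hl, Complex.exp_sub, Complex.exp_log h1]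
    change Complex.exp s / _ = _
    rw [hs]
    field_simp

theorem ghCoordHol_nondegenerate {x : Coord} {c : ℂ} {w κ : ℝ} (hw : w ≠ 0) {u : Coord}
    (h : ∀ v, ghCoordHol x c w κ ![u, v] = 0) : u = 0 := by
  have hpi : (Real.pi : ℂ) ≠ 0 := by exact_mod_cast Real.pi_ne_zero
  have he := Complex.exp_ne_zero x.1
  have h1 := h (0, 0, 1)
  simp [ghCoordHol_apply] at h1
  have h1 : u.1 = 0 := by simpa [he, hpi] using h1
  have h2 := h (1, 0, 0)
  simp [ghCoordHol_apply, h1] at h2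
  have h3 : (u.2.2 : ℂ) = (κ + Complex.I * w) * u.2.1 := by
    field_simp at h2
    have := (mul_eq_zero.1 (h2.trans (mul_zero _))).resolve_left he
    linear_combination -this
  have h4 := congrArg Complex.im h3
  simp [hw] at h4
  rw [h4] at h3
  refine Prod.ext h1 (Prod.ext h4 ?_)
  simpa using h3

/-- A vector in the kernel would lie in the kernel of the pulled-back holomorphic symplectic form;
by `flatHol_taubNUT` that form has potential 1/2D ≠ 0 and is non-degenerate. -/
theorem injective_fderiv_taubNUT (x : Coord) : Function.Injective (fderiv ℝ taubNUT x) := by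
  rw [injective_iff_map_eq_zero]
  intro u hu
  refine ghCoordHol_nondegenerate (x := x) (c := singConn (toBase x))
    (κ := x.1.im / (2 * Real.pi)) (inv_ne_zero (mul_pos two_pos (momNorm_toBase_pos x)).ne')
    fun v => ?_
  rw [← flatHol_taubNUT, ContinuousAlternatingMap.compContinuousLinearMap_apply]
  refine ContinuousAlternatingMap.map_coord_zero _ 0 ?_
  exact hu

theorem contDiff_taubNUT : ContDiff ℝ ∞ taubNUT := by
  have hpos : ∀ x : Coord, (x.2.1 + momNorm (toBase x)) / (2 * Real.pi) ≠ 0 := fun x =>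
    (div_pos (add_momNorm_pos x) (mul_pos two_pos Real.pi_pos)).ne'
  have h1 : ContDiff ℝ ∞ fun x : Coord => momNorm (toBase x) := by
    have hc : ContDiff ℝ ∞ toBase :=
      contDiff_fst.cexp.prodMk (by fun_prop)
    have h2 : ContDiff ℝ ∞ fun x : Coord => 4 * Real.pi ^ 2 * Complex.normSq (toBase x).1 +
        (toBase x).2 ^ 2 :=
      (contDiff_const.mul (contDiff_normSq.comp (contDiff_fst.comp hc))).add
        ((contDiff_snd.comp hc).pow 2)
    refine h2.sqrt fun x => ?_
    rw [← momNorm_sq]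
    exact (pow_pos (momNorm_toBase_pos x) 2).ne'
  have him : ContDiff ℝ ∞ fun x : Coord => x.1.im := Complex.imCLM.contDiff.comp contDiff_fst
  have h2 : ContDiff ℝ ∞ logZ := by
    refine (Complex.ofRealCLM.contDiff.comp (contDiff_const.mul (ContDiff.log
      ((ContDiff.add (by fun_prop) h1).div_const _) hpos))).add
      ((Complex.ofRealCLM.contDiff.comp (ContDiff.sub (by fun_prop)
        ((him.div_const _).mul (by fun_prop)))).mul contDiff_const)
  exact coordC.symm.contDiff.comp (h2.cexp.prodMk (contDiff_fst.sub h2).cexp)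

theorem contDiffOn_pull_zBase {η : Base → Base [⋀^Fin 2]→L[ℝ] ℝ} {s : Set Base} {U : Set Coord}
    (hη : ContDiffOn ℝ ∞ η s) (hU : MapsTo zBase U s) :
    ContDiffOn ℝ ∞ (fun y => (η (zBase y)).compContinuousLinearMap (fderiv ℝ zBase y)) U := by
  exact contDiffOn_form_comp (hη.comp contDiff_zBase.contDiffOn hU)
    (contDiff_zBase.fderiv_right (by simp)).contDiffOn

theorem mapsTo_zBase : MapsTo zBase tnDomain (fullM ×ˢ univ) ∧ MapsTo zBase tnDomain slab :=
  ⟨fun _ hy => ⟨hy.1, trivial⟩, fun _ hy => hy.2⟩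

theorem contDiffOn_ovForm (α : Fin 3) : ContDiffOn ℝ ∞ (ovForm α) tnDomain :=
  contDiffOn_const.add (contDiffOn_pull_zBase
    (contDiffOn_gh α contDiffOn_regConn contDiffOn_regPot contDiffOn_const) mapsTo_zBase.2)

theorem contDiffOn_conForm (α : Fin 3) : ContDiffOn ℝ ∞ (conForm α) tnDomain :=
  (contDiffOn_ovForm α).add (contDiffOn_pull_zBase ((contDiffOn_etaForm α).mono
    (prod_mono fullM_subset_strip subset_rfl)) mapsTo_zBase.1)

/-! ### Closedness of the special Kähler part -/

/-- The part of `ghCoordHol` that depends on `τ`. -/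
theorem ghCoordHol_zero (x : Coord) (τ : ℂ) : ghCoordHol x 0 τ.im τ.re =
    (Complex.exp x.1 / (2 * Real.pi)) • wedge (ContinuousLinearMap.fst ℝ ℂ (ℝ × ℝ)) dθmag -
      (τ * Complex.exp x.1 / (2 * Real.pi)) •
        wedge (ContinuousLinearMap.fst ℝ ℂ (ℝ × ℝ)) dθelec := by
  ext v
  rw [ghCoordHol_apply, show ((τ.re : ℂ) + Complex.I * τ.im) = τ by
    rw [mul_comm]; exact Complex.re_add_im τ]
  simp [wedge_apply]
  ring

theorem ghCoordThree_zero (x : Coord) (τ : ℂ) : ghCoordThree x 0 τ.im =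
    (1 / (4 * Real.pi ^ 2) : ℂ) • wedge dθelec dθmag +
      (Complex.I / 2 * (τ.im : ℂ) * (Complex.exp x.1 * (starRingEnd ℂ) (Complex.exp x.1))) •
        wedge (ContinuousLinearMap.fst ℝ ℂ (ℝ × ℝ))
          (conjForm (ContinuousLinearMap.fst ℝ ℂ (ℝ × ℝ))) := by
  ext v
  rw [ghCoordThree_apply]
  simp [wedge_apply]
  ring

/-- By holomorphy the differentials of τ and exp s are multiples of ds, and each term of the form
already contains ds. -/
theorem extDeriv_ghCoordHol_zero {τ : ℂ → ℂ} {τ' : ℂ} {x : Coord} (hτ : HasDerivAt τ τ' x.1) :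
    DifferentiableAt ℝ (fun x : Coord => ghCoordHol x 0 (τ x.1).im (τ x.1).re) x ∧
      extDeriv (fun x : Coord => ghCoordHol x 0 (τ x.1).im (τ x.1).re) x = 0 := by
  simp only [ghCoordHol_zero]
  have hfst := (ContinuousLinearMap.fst ℝ ℂ (ℝ × ℝ)).hasFDerivAt (x := x)
  have he := (Complex.hasDerivAt_exp x.1).comp_hasFDerivAt x hfst
  have ht := hτ.comp_hasFDerivAt x hfst
  have hd : HasFDerivAt (fun x : Coord => (Complex.exp x.1 / (2 * Real.pi)) •
      wedge (ContinuousLinearMap.fst ℝ ℂ (ℝ × ℝ)) dθmag - (τ x.1 * Complex.exp x.1 /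
        (2 * Real.pi)) • wedge (ContinuousLinearMap.fst ℝ ℂ (ℝ × ℝ)) dθelec) _ x :=
    ((he.mul_const (2 * Real.pi : ℂ)⁻¹).smul_const
      (wedge (ContinuousLinearMap.fst ℝ ℂ (ℝ × ℝ)) dθmag)).sub
    (((ht.mul he).mul_const (2 * Real.pi : ℂ)⁻¹).smul_const
      (wedge (ContinuousLinearMap.fst ℝ ℂ (ℝ × ℝ)) dθelec))
  refine ⟨hd.differentiableAt, ?_⟩
  ext v
  rw [extDeriv_apply_of_hasFDerivAt hd]
  simp [Fin.sum_univ_three, wedge_apply, Fin.removeNth, Fin.succAbove]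
  ring

/-- The variable coefficient depends on s alone and multiplies ds ∧ ds̄, which is already of top
degree in s. -/
theorem extDeriv_ghCoordThree_zero {τ : ℂ → ℂ} {τ' : ℂ} {x : Coord} (hτ : HasDerivAt τ τ' x.1) :
    DifferentiableAt ℝ (fun x : Coord => ghCoordThree x 0 (τ x.1).im) x ∧
      extDeriv (fun x : Coord => ghCoordThree x 0 (τ x.1).im) x = 0 := by
  simp only [ghCoordThree_zero _ (τ _)]
  have hfst := (ContinuousLinearMap.fst ℝ ℂ (ℝ × ℝ)).hasFDerivAt (x := x)
  have he := (Complex.hasDerivAt_exp x.1).comp_hasFDerivAt x hfst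
  have ht := (Complex.ofRealCLM ∘L Complex.imCLM).hasFDerivAt.comp x (hτ.comp_hasFDerivAt x hfst)
  have hd : HasFDerivAt (fun x : Coord => (1 / (4 * Real.pi ^ 2) : ℂ) • wedge dθelec dθmag +
      (Complex.I / 2 * ((τ x.1).im : ℂ) * (Complex.exp x.1 * (starRingEnd ℂ) (Complex.exp x.1))) •
        wedge (ContinuousLinearMap.fst ℝ ℂ (ℝ × ℝ))
          (conjForm (ContinuousLinearMap.fst ℝ ℂ (ℝ × ℝ)))) _ x :=
    (((ht.const_mul (Complex.I / 2)).mul (he.mul (hasFDerivAt_conj he))).smul_const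
      (wedge (ContinuousLinearMap.fst ℝ ℂ (ℝ × ℝ))
          (conjForm (ContinuousLinearMap.fst ℝ ℂ (ℝ × ℝ))))).const_add _
  refine ⟨hd.differentiableAt, ?_⟩
  ext v
  have hs : ∀ i, (v i).1 = ((v i).1.re : ℂ) + ((v i).1.im : ℂ) * Complex.I :=
    fun i => (Complex.re_add_im _).symm
  rw [extDeriv_apply_of_hasFDerivAt hd]
  simp [Fin.sum_univ_three, wedge_apply, Fin.removeNth, Fin.succAbove]
  simp only [conj_eq_re_sub_im (v _).1]
  have h0 := hs 0
  have h1 := hs 1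
  have h2 := hs 2
  generalize (v 0).1.re = p₀ at *
  generalize (v 0).1.im = q₀ at *
  generalize (v 1).1.re = p₁ at *
  generalize (v 1).1.im = q₁ at *
  generalize (v 2).1.re = p₂ at *
  generalize (v 2).1.im = q₂ at *
  rw [h0, h1, h2]
  ring

end ConifoldHK
end

noncomputable section
namespace ConifoldHK
open MeasureTheory Filter Topology

/-! ### Closedness of the conifold forms, on the covering and over t = 0 -/

theorem minSmoothness_two_le : minSmoothness ℝ 2 ≤ (∞ : WithTop ℕ∞) := by
  rw [minSmoothness_of_isRCLikeNormedField]
  exact WithTop.coe_le_coe.2 (le_top : (2 : ℕ∞) ≤ ⊤)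

theorem extDeriv_gh {c : Base → ℂ} {w : Base → ℝ} {x : Base} (h : IsMonopoleAt c w x) (α : Fin 3) :
    DifferentiableAt ℝ (fun x => gh α (c x) (w x) 0) x ∧
      extDeriv (fun x => gh α (c x) (w x) 0) x = 0 := by
  have key : ∀ (L : ℂ →L[ℝ] ℝ) {Φ : Base → Base [⋀^Fin 2]→L[ℝ] ℂ},
      DifferentiableAt ℝ Φ x ∧ extDeriv Φ x = 0 →
      DifferentiableAt ℝ (fun x => L.compContinuousAlternatingMap (Φ x)) x ∧
      extDeriv (fun x => L.compContinuousAlternatingMap (Φ x)) x = 0 := by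
    intro L Φ h
    refine ⟨(realPart Base L).differentiableAt.comp x h.1, ?_⟩
    rw [extDeriv_realPart L h.1, h.2]
    ext v
    simp
  fin_cases α
  · exact key Complex.reCLM (extDeriv_ghHol h)
  · exact key Complex.imCLM (extDeriv_ghHol h)
  · exact key Complex.reCLM (extDeriv_ghThree h)

theorem extDeriv_ghCoord_zero {τ : ℂ → ℂ} {τ' : ℂ} {x : Coord} (hτ : HasDerivAt τ τ' x.1)
    (α : Fin 3) : DifferentiableAt ℝ (fun x : Coord => ghCoord α x 0 (τ x.1).im (τ x.1).re) x ∧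
      extDeriv (fun x : Coord => ghCoord α x 0 (τ x.1).im (τ x.1).re) x = 0 := by
  have key : ∀ (L : ℂ →L[ℝ] ℝ) {Φ : Coord → Coord [⋀^Fin 2]→L[ℝ] ℂ},
      DifferentiableAt ℝ Φ x ∧ extDeriv Φ x = 0 →
      DifferentiableAt ℝ (fun x => L.compContinuousAlternatingMap (Φ x)) x ∧
      extDeriv (fun x => L.compContinuousAlternatingMap (Φ x)) x = 0 := by
    intro L Φ h
    refine ⟨(realPart Coord L).differentiableAt.comp x h.1, ?_⟩
    rw [extDeriv_realPart L h.1, h.2]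
    ext v
    simp
  fin_cases α
  · exact key Complex.reCLM (extDeriv_ghCoordHol_zero hτ)
  · exact key Complex.imCLM (extDeriv_ghCoordHol_zero hτ)
  · exact key Complex.reCLM (extDeriv_ghCoordThree_zero hτ)

theorem contDiff_toBase : ContDiff ℝ ∞ toBase := contDiff_fst.cexp.prodMk (by fun_prop)

/-- The form splits into the part with τ, closed by holomorphy, and the pull-back of the instanton
part from the base, closed by the monopole equation for the sum over all n. -/
theorem extDeriv_omega_conifold (ε : ℕ) (α : Fin 3) {x : Coord} (hx : x ∈ cover) :
    extDeriv ((conifold ε).omega α) x = 0 := by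
  set τ : ℂ → ℂ := fun s => tauOV s + tauDiff (Complex.exp s) with hτdef
  have hτ : HasDerivAt τ (deriv τ x.1) x.1 := by
    refine DifferentiableAt.hasDerivAt (DifferentiableAt.add ?_ ?_)
    · unfold tauOV; fun_prop
    · exact ((differentiableOn_tauDiff _ (exp_mem_strip hx)).differentiableAt
        (isOpen_strip.mem_nhds (exp_mem_strip hx))).comp _ Complex.differentiableAt_exp
  have hev : (conifold ε).omega α =ᶠ[𝓝 x] fun x => ghCoord α x 0 (τ x.1).im (τ x.1).re +
      (gh α (latticeConn univ (toBase x)) (latticePot univ (toBase x)) 0).compContinuousLinearMap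
        (fderiv ℝ toBase x) := by
    filter_upwards [isOpen_cover.mem_nhds hx] with y hy
    rw [(isElectric_conifold ε (exp_mem_strip hy)).omega_eq, ← ghCoord_add, zero_add, add_zero,
      add_comm (latticePot univ (toBase y))]
  have hm := isMonopoleAt_lattice (x := toBase x)
    (awayFrom_univ (exp_mem_strip hx) (Complex.exp_ne_zero _))
  obtain ⟨d1, e1⟩ := extDeriv_ghCoord_zero hτ α
  obtain ⟨d2, e2⟩ := extDeriv_gh hm α
  have hc := contDiff_toBase.contDiffAt (x := x)
  have d3 : DifferentiableAt ℝ (fun x => (gh α (latticeConn univ (toBase x))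
      (latticePot univ (toBase x)) 0).compContinuousLinearMap (fderiv ℝ toBase x)) x :=
    ((d2.comp x (hc.differentiableAt (by simp))).hasFDerivAt
      |>.continuousAlternatingMapCompContinuousLinearMap
        ((contDiff_toBase.fderiv_right (m := ∞) (by simp)).differentiable (by simp)
          x).hasFDerivAt).differentiableAt
  rw [hev.extDeriv_eq, extDeriv_fun_add d1 d3, e1, zero_add]
  have h := extDeriv_pullback d2 hc minSmoothness_two_le
  refine h.trans ?_
  rw [e2]
  ext v
  simp

theorem surjective_fderiv_taubNUT (x : Coord) : Function.Surjective (fderiv ℝ taubNUT x) :=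
  LinearMap.injective_iff_surjective (f := (fderiv ℝ taubNUT x : Coord →ₗ[ℝ] Coord)).1
    (injective_fderiv_taubNUT x)

/-- Off the axes the pull-back along `taubNUT` is the closed conifold form, and surjectivity of the
derivative transfers the vanishing; the exterior derivative is continuous, so density gives the
rest. -/
theorem extDeriv_conForm (α : Fin 3) {y : Coord} (hy : y ∈ tnDomain) :
    extDeriv (conForm α) y = 0 := by
  refine eqOn_of_dense isOpen_tnDomain dense_offAxes
    (contDiffOn_extDeriv isOpen_tnDomain (contDiffOn_conForm α)) continuousOn_const ?_ hy
  intro y hy h0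
  obtain ⟨x, hx, rfl⟩ := exists_taubNUT_eq hy h0
  have hd : DifferentiableAt ℝ (conForm α) (taubNUT x) :=
    ((contDiffOn_conForm α).differentiableOn (by simp) _ hy).differentiableAt
      (isOpen_tnDomain.mem_nhds hy)
  have h := extDeriv_pullback hd (contDiff_taubNUT.contDiffAt (x := x)) minSmoothness_two_le
  have hev : (fun x => (conForm α (taubNUT x)).compContinuousLinearMap (fderiv ℝ taubNUT x))
      =ᶠ[𝓝 x] (conifold 0).omega α := by
    filter_upwards [isOpen_coverSlab.mem_nhds hx] with z hz
    exact conForm_taubNUT_eq 0 α hz.1 hz.2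
  rw [hev.extDeriv_eq, extDeriv_omega_conifold 0 α hx.1] at h
  ext v
  choose u hu using fun i => surjective_fderiv_taubNUT x (v i)
  have h1 := congrArg (fun φ : Coord [⋀^Fin 3]→L[ℝ] ℝ => φ u) h
  simp only [ContinuousAlternatingMap.compContinuousLinearMap_apply] at h1
  rw [show v = fderiv ℝ taubNUT x ∘ u from funext fun i => (hu i).symm, ← h1]
  rfl

end ConifoldHK
end

noncomputable section
namespace ConifoldHK
open MeasureTheory Filter Topology

/-! ### Hyperkähler structures determined by their Kähler forms -/

section HK

variable {E F : Type} [NormedAddCommGroup E] [NormedSpace ℝ E] [FiniteDimensional ℝ E]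
  [NormedAddCommGroup F] [NormedSpace ℝ F] [FiniteDimensional ℝ F]

/-- The Kähler forms `Ψ`, the metric `G` and the complex structures `I` form a hyperkähler structure
on a vector space. -/
structure IsHKTriple (Ψ : Fin 3 → F [⋀^Fin 2]→L[ℝ] ℝ) (G : F →L[ℝ] F →L[ℝ] ℝ)
    (I : Fin 3 → F →L[ℝ] F) : Prop where
  symm : ∀ u v, G u v = G v u
  nondegenerate : ∀ u, (∀ v, G u v = 0) → u = 0
  square : ∀ α u, I α (I α u) = -u
  quaternion : ∀ u, I 0 (I 1 u) = I 2 u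
  kahler : ∀ α u v, Ψ α ![u, v] = G (I α u) v

/-- The complex structures determined by the Kähler forms. -/
def hkI (Ψ : Fin 3 → F [⋀^Fin 2]→L[ℝ] ℝ) (α : Fin 3) : F →L[ℝ] F :=
  -((flatMap (Ψ (α + 1))).inverse ∘L flatMap (Ψ (α + 2)))

/-- The metric determined by the Kähler forms. -/
def hkG (Ψ : Fin 3 → F [⋀^Fin 2]→L[ℝ] ℝ) : F →L[ℝ] F →L[ℝ] ℝ := -(flatMap (Ψ 0) ∘L hkI Ψ 0)

theorem exists_equiv_flatMap {Ψ : F [⋀^Fin 2]→L[ℝ] ℝ} (h : Nondegenerate Ψ) :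
    ∃ e : F ≃L[ℝ] (F →L[ℝ] ℝ), (e : F →L[ℝ] F →L[ℝ] ℝ) = flatMap Ψ := by
  have hinj : Function.Injective (flatMap Ψ : F →ₗ[ℝ] F →L[ℝ] ℝ) := by
    rw [injective_iff_map_eq_zero]
    intro u hu
    refine h u fun v => ?_
    rw [← flatMap_apply]
    exact congrArg (fun L : F →L[ℝ] ℝ => L v) hu
  have hrank : Module.finrank ℝ F = Module.finrank ℝ (F →L[ℝ] ℝ) := by
    rw [← (LinearMap.toContinuousLinearMap (𝕜 := ℝ) (E := F) (F' := ℝ)).finrank_eq]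
    exact Subspace.dual_finrank_eq.symm
  refine ⟨(LinearEquiv.ofInjectiveOfFinrankEq _ hinj hrank).toContinuousLinearEquiv, ?_⟩
  ext u v
  rfl

theorem nondegenerate_of_flatMap_eq {Ψ : F [⋀^Fin 2]→L[ℝ] ℝ} {e : F ≃L[ℝ] (F →L[ℝ] ℝ)}
    (h : (e : F →L[ℝ] F →L[ℝ] ℝ) = flatMap Ψ) : Nondegenerate Ψ := by
  intro u hu
  have : e u = 0 := by
    ext v
    have h1 := congrArg (fun L : F →L[ℝ] F →L[ℝ] ℝ => L u v) h
    simp only [ContinuousLinearEquiv.coe_coe, flatMap_apply, hu] at h1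
    exact h1
  simpa using this

namespace IsHKTriple

variable {Ψ : Fin 3 → F [⋀^Fin 2]→L[ℝ] ℝ} {G : F →L[ℝ] F →L[ℝ] ℝ} {I : Fin 3 → F →L[ℝ] F}

theorem form_nondegenerate (h : IsHKTriple Ψ G I) (α : Fin 3) : Nondegenerate (Ψ α) := by
  intro u hu
  have h1 : I α u = 0 := h.nondegenerate _ fun v => by rw [← h.kahler, hu]
  have h2 := h.square α u
  rw [h1, map_zero] at h2
  exact neg_eq_zero.1 h2.symm

/-- The full quaternion table follows from I₀I₁ = I₂ and the three squares being -1; indices are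
cyclic in `Fin 3`. -/
theorem anticomm (h : IsHKTriple Ψ G I) (α : Fin 3) (u : F) : I (α + 1) (I α u) = -I (α + 2) u := by
  have q := h.quaternion
  have s := h.square
  fin_cases α
  · change I 1 (I 0 u) = -I 2 u
    have h1 : I 0 (I 1 (I 0 u)) = I 1 u := by
      have h2 : I 1 (I 1 u) = -u := s 1 u
      have h3 : I 2 (I 2 (I 1 u)) = -I 1 u := s 2 (I 1 u)
      rw [← q (I 1 u), h2, map_neg, map_neg, ← q (I 0 u)] at h3
      exact neg_injective h3
    have h4 := s 0 (I 1 (I 0 u))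
    rw [h1, q] at h4
    rw [h4, neg_neg]
  · change I 2 (I 1 u) = -I 0 u
    rw [← q, s, map_neg]
  · change I 0 (I 2 u) = -I 1 u
    rw [← q, s]

/-- As ω_{α+2}(u, ·) = G(I_{α+2}u, ·) = -G(I_{α+1}I_α u, ·) = -ω_{α+1}(I_α u, ·), the structure I_α
is recovered from two of the forms. This uniqueness makes structures defined in different charts
agree automatically. -/
theorem eq_hkI (h : IsHKTriple Ψ G I) (α : Fin 3) : hkI Ψ α = I α := by
  obtain ⟨e, he⟩ := exists_equiv_flatMap (h.form_nondegenerate (α + 1))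
  ext u
  have h1 : flatMap (Ψ (α + 2)) u = e (-I α u) := by
    ext v
    rw [← ContinuousLinearEquiv.coe_coe e, he, flatMap_apply, flatMap_apply, h.kahler, h.kahler,
      map_neg, h.anticomm, neg_neg]
  simp only [hkI, ← he, ContinuousLinearMap.inverse_equiv]
  simp [h1]

theorem eq_hkG (h : IsHKTriple Ψ G I) : hkG Ψ = G := by
  ext u v
  simp only [hkG, h.eq_hkI, neg_apply, ContinuousLinearMap.comp_apply, flatMap_apply, h.kahler,
    h.square]
  simp

theorem pullback (h : IsHKTriple Ψ G I) (L : E ≃L[ℝ] F) :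
    IsHKTriple (fun α => (Ψ α).compContinuousLinearMap (L : E →L[ℝ] F))
      (ContinuousLinearMap.bilinearComp G (L : E →L[ℝ] F) (L : E →L[ℝ] F))
      (fun α => (L.symm : F →L[ℝ] E) ∘L I α ∘L (L : E →L[ℝ] F)) where
  symm u v := h.symm _ _
  nondegenerate u hu := by
    have := h.nondegenerate (L u) fun v => by simpa using hu (L.symm v)
    simpa using this
  square α u := by simp [h.square]
  quaternion u := by simp [h.quaternion]
  kahler α u v := by rw [form_comp_vec]; simp [h.kahler]

end IsHKTriple

theorem contDiffOn_hkI {Ψ : Fin 3 → E → F [⋀^Fin 2]→L[ℝ] ℝ} {U : Set E}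
    (h : ∀ α, ContDiffOn ℝ ∞ (Ψ α) U) (hn : ∀ y ∈ U, ∀ α, Nondegenerate (Ψ α y)) (α : Fin 3) :
    ContDiffOn ℝ ∞ (fun y => hkI (fun α => Ψ α y) α) U := by
  have h1 : ContDiffOn ℝ ∞ (fun y => (flatMap (Ψ (α + 1) y)).inverse) U := by
    intro y hy
    obtain ⟨e, he⟩ := exists_equiv_flatMap (hn y hy (α + 1))
    have h2 : ContDiffAt ℝ ∞ ContinuousLinearMap.inverse (flatMap (Ψ (α + 1) y)) :=
      he ▸ contDiffAt_map_inverse e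
    exact h2.comp_contDiffWithinAt y (contDiffOn_flatMap (h (α + 1)) y hy)
  exact (h1.clm_comp (contDiffOn_flatMap (h (α + 2)))).neg

theorem contDiffOn_hkG {Ψ : Fin 3 → E → F [⋀^Fin 2]→L[ℝ] ℝ} {U : Set E}
    (h : ∀ α, ContDiffOn ℝ ∞ (Ψ α) U) (hn : ∀ y ∈ U, ∀ α, Nondegenerate (Ψ α y)) :
    ContDiffOn ℝ ∞ (fun y => hkG (fun α => Ψ α y)) U :=
  ((contDiffOn_flatMap (h 0)).clm_comp (contDiffOn_hkI h hn 0)).neg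

theorem isOpen_nondegenerate {Ψ : Fin 3 → E → F [⋀^Fin 2]→L[ℝ] ℝ} {U : Set E} (hU : IsOpen U)
    (h : ∀ α, ContDiffOn ℝ ∞ (Ψ α) U) : IsOpen {y ∈ U | ∀ α, Nondegenerate (Ψ α y)} := by
  have h1 : {y ∈ U | ∀ α, Nondegenerate (Ψ α y)} = ⋂ α, U ∩ (fun y => flatMap (Ψ α y)) ⁻¹'
      range ((↑) : (F ≃L[ℝ] (F →L[ℝ] ℝ)) → F →L[ℝ] F →L[ℝ] ℝ) := by
    ext y
    simp only [mem_iInter, mem_inter_iff, mem_preimage]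
    constructor
    · exact fun h α => ⟨h.1, exists_equiv_flatMap (h.2 α)⟩
    · exact fun h => ⟨(h 0).1, fun α => by
        obtain ⟨e, he⟩ := (h α).2
        exact nondegenerate_of_flatMap_eq he⟩
  rw [h1]
  exact isOpen_iInter_of_finite fun α => (contDiffOn_flatMap (h α)).continuousOn.isOpen_inter_preimage
    hU (ContinuousLinearEquiv.isOpen)

/-- Where the forms are non-degenerate, `hkI` and `hkG` are continuous, so the algebraic identities
are closed conditions. Non-degeneracy of the metric is not one, and is deduced from that of the
first form together with I₀² = -1. -/
theorem isHKTriple_of_dense {Ψ : Fin 3 → E → F [⋀^Fin 2]→L[ℝ] ℝ} {U D : Set E} (hU : IsOpen U)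
    (h : ∀ α, ContDiffOn ℝ ∞ (Ψ α) U) (hn : ∀ y ∈ U, ∀ α, Nondegenerate (Ψ α y)) (hD : Dense D)
    (hk : ∀ y ∈ U, y ∈ D → ∃ G I, IsHKTriple (fun α => Ψ α y) G I) {y : E} (hy : y ∈ U) :
    IsHKTriple (fun α => Ψ α y) (hkG fun α => Ψ α y) (hkI fun α => Ψ α y) := by
  have hk' : ∀ y ∈ U, y ∈ D →
      IsHKTriple (fun α => Ψ α y) (hkG fun α => Ψ α y) (hkI fun α => Ψ α y) := by
    intro y hy hyD
    obtain ⟨G, I, hGI⟩ := hk y hy hyD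
    have h1 : hkI (fun α => Ψ α y) = I := funext hGI.eq_hkI
    rwa [h1, hGI.eq_hkG]
  have cI : ∀ α, ContinuousOn (fun y => hkI (fun α => Ψ α y) α) U :=
    fun α => (contDiffOn_hkI h hn α).continuousOn
  have cG := (contDiffOn_hkG h hn).continuousOn
  have ev : ∀ {H : Type} [NormedAddCommGroup H] [NormedSpace ℝ H] {L : E → F →L[ℝ] H} {u : E → F},
      ContinuousOn L U → ContinuousOn u U → ContinuousOn (fun y => L y (u y)) U :=
    fun hL hu => hL.clm_apply hu
  have hsq : ∀ y ∈ U, ∀ α u, hkI (fun α => Ψ α y) α (hkI (fun α => Ψ α y) α u) = -u :=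
    fun y hy α u => eqOn_of_dense hU hD (ev (cI α) (ev (cI α) continuousOn_const))
      continuousOn_const (fun y hy hyD => (hk' y hy hyD).square α u) hy
  refine ⟨fun u v => ?_, fun u hu => ?_, hsq y hy, fun u => ?_, fun α u v => ?_⟩
  · exact eqOn_of_dense hU hD (ev (ev cG continuousOn_const) continuousOn_const)
      (ev (ev cG continuousOn_const) continuousOn_const)
      (fun y hy hyD => (hk' y hy hyD).symm u v) hy
  · have h1 : hkI (fun α => Ψ α y) 0 u = 0 := hn y hy 0 _ fun v => by
      have := hu v
      rwa [hkG, neg_apply, neg_apply, neg_eq_zero, ContinuousLinearMap.comp_apply,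
        flatMap_apply] at this
    have h2 := hsq y hy 0 u
    rw [h1, map_zero] at h2
    exact neg_eq_zero.1 h2.symm
  · exact eqOn_of_dense hU hD (ev (cI 0) (ev (cI 1) continuousOn_const))
      (ev (cI 2) continuousOn_const) (fun y hy hyD => (hk' y hy hyD).quaternion u) hy
  · exact eqOn_of_dense hU hD (contDiffOn_form_apply (h α) ![u, v]).continuousOn
      (ev (ev cG (ev (cI α) continuousOn_const)) continuousOn_const)
      (fun y hy hyD => (hk' y hy hyD).kahler α u v) hy

/-! ### Closed triples have integrable complex structures -/

theorem fderiv_flatMap {Ψ : F → F [⋀^Fin 2]→L[ℝ] ℝ} {y : F} (h : DifferentiableAt ℝ Ψ y)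
    (h' : DifferentiableAt ℝ (fun z => flatMap (Ψ z)) y) (x u v : F) :
    fderiv ℝ (fun z => flatMap (Ψ z)) y x u v = fderiv ℝ Ψ y x ![u, v] := by
  have h1 : HasFDerivAt (fun z => flatMap (Ψ z) u v) _ y :=
    (h'.hasFDerivAt.clm_apply (hasFDerivAt_const u y)).clm_apply (hasFDerivAt_const v y)
  have h2 : HasFDerivAt (fun z => Ψ z ![u, v]) _ y :=
    (ContinuousAlternatingMap.apply ℝ F ℝ ![u, v]).hasFDerivAt.comp y h.hasFDerivAt
  simp only [flatMap_apply] at h1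
  have h3 := congrArg (fun L : F →L[ℝ] ℝ => L x) (h1.unique h2)
  simpa using h3

theorem extDeriv_eq_zero_cyclic {Ψ : F → F [⋀^Fin 2]→L[ℝ] ℝ} {y : F} (h : extDeriv Ψ y = 0)
    (u v w : F) : fderiv ℝ Ψ y u ![v, w] + fderiv ℝ Ψ y v ![w, u] + fderiv ℝ Ψ y w ![u, v] = 0 := by
  have h1 := congrArg (fun φ : F [⋀^Fin 3]→L[ℝ] ℝ => φ ![u, v, w]) h
  rw [extDeriv, ContinuousAlternatingMap.alternatizeUncurryFin_apply, Fin.sum_univ_three,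
    show (0 : F [⋀^Fin 3]→L[ℝ] ℝ) ![u, v, w] = 0 from rfl] at h1
  rw [form_eq_vec (fderiv ℝ Ψ y _), form_eq_vec (fderiv ℝ Ψ y (![u, v, w] 1)),
    form_eq_vec (fderiv ℝ Ψ y (![u, v, w] 2))] at h1
  have h2 := form_swap (fderiv ℝ Ψ y v) u w
  simp [Fin.removeNth, Fin.succAbove] at h1
  linarith

/-- Hitchin's lemma on the integrability of the complex structures of a hyperkähler triple. -/
theorem nijenhuis_eq_zero {Ψ Ψ' : F → F [⋀^Fin 2]→L[ℝ] ℝ} {J : F → F →L[ℝ] F} {y : F}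
    (hΨ : DifferentiableAt ℝ Ψ y) (hΨ' : DifferentiableAt ℝ Ψ' y)
    (hB : DifferentiableAt ℝ (fun z => flatMap (Ψ z)) y) (hJ : DifferentiableAt ℝ J y)
    (hc : extDeriv Ψ y = 0) (hc' : extDeriv Ψ' y = 0) (hn : Nondegenerate (Ψ y))
    (hsq : ∀ᶠ z in 𝓝 y, ∀ u, J z (J z u) = -u)
    (hrel : ∀ᶠ z in 𝓝 y, ∀ u v, Ψ' z ![u, v] = -Ψ z ![J z u, v]) (u v : F) :
    fderiv ℝ J y (J y u) v - fderiv ℝ J y (J y v) u + J y (fderiv ℝ J y v u)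
      - J y (fderiv ℝ J y u v) = 0 := by
  -- Both Ψ and Ψ' are skew, so J is self-adjoint with respect to Ψ.
  have hsymm : ∀ᶠ z in 𝓝 y, ∀ u v, Ψ z ![J z u, v] = Ψ z ![u, J z v] := by
    filter_upwards [hrel] with z hz u v
    have h1 := hz u v
    have h2 := hz v u
    rw [form_swap] at h2
    rw [form_swap (Ψ z) (J z v) u]
    linarith
  have eJ : ∀ a : F, HasFDerivAt (fun z => J z a) _ y := fun a =>
    hJ.hasFDerivAt.clm_apply (hasFDerivAt_const a y)
  have d1 : ∀ x a : F, fderiv ℝ J y x (J y a) + J y (fderiv ℝ J y x a) = 0 := by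
    intro x a
    have h1 : HasFDerivAt (fun z => J z (J z a)) _ y := hJ.hasFDerivAt.clm_apply (eJ a)
    have h2 : HasFDerivAt (fun z => J z (J z a)) (0 : F →L[ℝ] F) y :=
      (hasFDerivAt_const (-a) y).congr_of_eventuallyEq (hsq.mono fun z hz => hz a)
    have h3 := congrArg (fun L : F →L[ℝ] F => L x) (h1.unique h2)
    simp at h3
    rw [add_comm]
    exact h3
  have d2 : ∀ x a b : F, fderiv ℝ Ψ y x ![J y a, b] + Ψ y ![fderiv ℝ J y x a, b] =
      -fderiv ℝ Ψ' y x ![a, b] := by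
    intro x a b
    have h1 : HasFDerivAt (fun z => flatMap (Ψ z) (J z a) b) _ y :=
      (hB.hasFDerivAt.clm_apply (eJ a)).clm_apply (hasFDerivAt_const b y)
    have h2 : HasFDerivAt (fun z => -Ψ' z ![a, b]) _ y :=
      ((ContinuousAlternatingMap.apply ℝ F ℝ ![a, b]).hasFDerivAt.comp y hΨ'.hasFDerivAt).neg
    have h3 := congrArg (fun L : F →L[ℝ] ℝ => L x) (h1.unique (h2.congr_of_eventuallyEq
      (hrel.mono fun z hz => by simp only [flatMap_apply, hz, neg_neg])))
    simp [fderiv_flatMap hΨ hB, flatMap_apply] at h3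
    linarith
  have d3 : ∀ x a b : F, fderiv ℝ Ψ y x ![J y a, b] + Ψ y ![fderiv ℝ J y x a, b] =
      fderiv ℝ Ψ y x ![a, J y b] - Ψ y ![fderiv ℝ J y x b, a] := by
    intro x a b
    have h1 : HasFDerivAt (fun z => flatMap (Ψ z) (J z a) b) _ y :=
      (hB.hasFDerivAt.clm_apply (eJ a)).clm_apply (hasFDerivAt_const b y)
    have h2 : HasFDerivAt (fun z => flatMap (Ψ z) a (J z b)) _ y :=
      (hB.hasFDerivAt.clm_apply (hasFDerivAt_const a y)).clm_apply (eJ b)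
    have h3 := congrArg (fun L : F →L[ℝ] ℝ => L x) (h1.unique (h2.congr_of_eventuallyEq
      (hsymm.mono fun z hz => by simp only [flatMap_apply, hz])))
    simp [fderiv_flatMap hΨ hB, flatMap_apply] at h3
    have h4 := form_swap (Ψ y) (fderiv ℝ J y x b) a
    linarith
  have hs := hsymm.self_of_nhds
  have hq := hsq.self_of_nhds
  have d4 : ∀ x a b : F, Ψ y ![fderiv ℝ J y x (J y a), b] + Ψ y ![fderiv ℝ J y x a, J y b] = 0 := by
    intro x a b
    have h1 := congrArg (fun c => flatMap (Ψ y) c b) (d1 x a)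
    simp only [map_add, add_apply, flatMap_apply, map_zero, zero_apply] at h1
    rwa [← hs]
  refine hn _ fun w => ?_
  have c1 := extDeriv_eq_zero_cyclic hc
  have c2 := extDeriv_eq_zero_cyclic hc'
  rw [← flatMap_apply]
  simp only [map_add, map_sub, add_apply, sub_apply, flatMap_apply, hs]
  -- The Nijenhuis tensor contracted with Ψ is a combination of dΨ on (u, v, w) and (Ju, Jv, w) and
  -- of dΨ' on (u, Jv, w) and (Ju, v, w), once the derivatives of J² = -1, of Ψ' = -Ψ(J·, ·) and of
  -- the self-adjointness of J are used to eliminate the derivatives of Ψ' and J.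
  have e1 := c2 u (J y v) w
  have e2 := c2 (J y u) v w
  have e3 := c1 u v w
  have e4 := c1 (J y u) (J y v) w
  have t1 := d2 u (J y v) w
  have t2 := d2 (J y v) w u
  have t3 := d2 w u (J y v)
  have t4 := d2 (J y u) v w
  have t5 := d2 v w (J y u)
  have t6 := d2 w (J y u) v
  have r1 := d3 v u (J y w)
  have r2 := d3 (J y v) u w
  have q1 := d4 u v w
  have q2 := d4 v w u
  have q3 := d4 w u v
  have neg1 : ∀ (φ : F [⋀^Fin 2]→L[ℝ] ℝ) (a b : F), φ ![-a, b] = -φ ![a, b] := fun φ a b => by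
    rw [← flatMap_apply, map_neg, neg_apply, flatMap_apply]
  have neg2 : ∀ (φ : F [⋀^Fin 2]→L[ℝ] ℝ) (a b : F), φ ![a, -b] = -φ ![a, b] := fun φ a b => by
    rw [← flatMap_apply, map_neg, flatMap_apply]
  simp only [hq, neg1, neg2] at t1 t6 r1
  have s1 := form_swap (fderiv ℝ Ψ y v) u w
  have s2 := form_swap (fderiv ℝ Ψ y w) (J y u) (J y v)
  have s3 := form_swap (fderiv ℝ Ψ y (J y v)) u (J y w)
  have s4 := form_swap (fderiv ℝ Ψ y v) (J y u) (J y w)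
  have s5 := form_swap (fderiv ℝ Ψ y (J y v)) (J y u) w
  linarith

/-- Closed two-forms that are pointwise hyperkähler triples define a hyperkähler structure. -/
theorem isHyperkahlerOn_of_isHKTriple {Ψ : Fin 3 → F → F [⋀^Fin 2]→L[ℝ] ℝ} {U : Set F}
    (hU : IsOpen U) (h : ∀ α, ContDiffOn ℝ ∞ (Ψ α) U) (hc : ∀ y ∈ U, ∀ α, extDeriv (Ψ α) y = 0)
    (hk : ∀ y ∈ U, IsHKTriple (fun α => Ψ α y) (hkG fun α => Ψ α y) (hkI fun α => Ψ α y)) :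
    IsHyperkahlerOn U (fun y => hkG fun α => Ψ α y) (fun α y => hkI (fun α => Ψ α y) α) Ψ := by
  have hn : ∀ y ∈ U, ∀ α, Nondegenerate (Ψ α y) := fun y hy α => (hk y hy).form_nondegenerate α
  refine ⟨contDiffOn_hkG h hn, contDiffOn_hkI h hn, h, fun y hy => (hk y hy).symm,
    fun y hy => (hk y hy).nondegenerate, fun y hy => (hk y hy).square,
    fun y hy => (hk y hy).quaternion, fun y hy => (hk y hy).kahler, hc, fun y hy α u v => ?_⟩
  have hm := hU.mem_nhds hy
  have hd : ∀ β, DifferentiableAt ℝ (Ψ β) y := fun β =>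
    ((h β).differentiableOn (by simp) y hy).differentiableAt hm
  refine nijenhuis_eq_zero (Ψ := Ψ (α + 1)) (Ψ' := Ψ (α + 2)) (hd _) (hd _)
    (((contDiffOn_flatMap (h _)).differentiableOn (by simp) y hy).differentiableAt hm)
    (((contDiffOn_hkI h hn α).differentiableOn (by simp) y hy).differentiableAt hm)
    (hc y hy _) (hc y hy _) (hn y hy _) ?_ ?_ u v
  · filter_upwards [hm] with z hz using (hk z hz).square α
  · filter_upwards [hm] with z hz a b
    rw [(hk z hz).kahler, (hk z hz).kahler, (hk z hz).anticomm, map_neg, neg_apply, neg_neg]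

end HK

end ConifoldHK
end

noncomputable section
namespace ConifoldHK
open MeasureTheory Filter Topology

/-! ### The hyperkähler triple of the Gibbons-Hawking ansatz at a point -/

/-- The Kähler forms of `ℂ²` with the metric `w |dx|² + |dy|² / (4 π² w)`. -/
def scaledForm (w : ℝ) (α : Fin 3) : (ℂ × ℂ) [⋀^Fin 2]→L[ℝ] ℝ :=
  ![Complex.reCLM.compContinuousAlternatingMap ((1 / (2 * Real.pi) : ℂ) •
      wedge (ContinuousLinearMap.fst ℝ ℂ ℂ) (ContinuousLinearMap.snd ℝ ℂ ℂ)),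
    Complex.imCLM.compContinuousAlternatingMap ((1 / (2 * Real.pi) : ℂ) •
      wedge (ContinuousLinearMap.fst ℝ ℂ ℂ) (ContinuousLinearMap.snd ℝ ℂ ℂ)),
    Complex.reCLM.compContinuousAlternatingMap ((Complex.I / 2) • ((w : ℂ) •
      wedge (ContinuousLinearMap.fst ℝ ℂ ℂ) (conjForm (ContinuousLinearMap.fst ℝ ℂ ℂ)) +
      (1 / (4 * Real.pi ^ 2 * w) : ℂ) • wedge (ContinuousLinearMap.snd ℝ ℂ ℂ)
        (conjForm (ContinuousLinearMap.snd ℝ ℂ ℂ))))] α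

/-- The metric `Re (z z̄')` on `ℂ`. -/
def reInner : ℂ →L[ℝ] ℂ →L[ℝ] ℝ :=
  ContinuousLinearMap.bilinearComp
    ((ContinuousLinearMap.compL ℝ ℂ ℂ ℝ Complex.reCLM) ∘L ContinuousLinearMap.mul ℝ ℂ)
    (ContinuousLinearMap.id ℝ ℂ) (Complex.conjCLE : ℂ →L[ℝ] ℂ)

theorem reInner_apply (z z' : ℂ) : reInner z z' = (z * (starRingEnd ℂ) z').re := by
  simp [reInner]

/-- The metric `w |dx|² + |dy|² / (4 π² w)` on `ℂ²`. -/
def scaledMetric (w : ℝ) : ℂ × ℂ →L[ℝ] ℂ × ℂ →L[ℝ] ℝ :=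
  w • reInner.bilinearComp (ContinuousLinearMap.fst ℝ ℂ ℂ) (ContinuousLinearMap.fst ℝ ℂ ℂ) +
    (1 / (4 * Real.pi ^ 2) * w⁻¹) •
      reInner.bilinearComp (ContinuousLinearMap.snd ℝ ℂ ℂ) (ContinuousLinearMap.snd ℝ ℂ ℂ)

theorem scaledMetric_apply (w : ℝ) (u v : ℂ × ℂ) : scaledMetric w u v =
    w * (u.1 * (starRingEnd ℂ) v.1).re +
      1 / (4 * Real.pi ^ 2) * w⁻¹ * (u.2 * (starRingEnd ℂ) v.2).re := by
  simp [scaledMetric, reInner_apply]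

/-- The antilinear map `(x, y) ↦ (- k ȳ / (2 π w), 2 π w k x̄)`. -/
def antiRot (w : ℝ) (k : ℂ) : ℂ × ℂ →L[ℝ] ℂ × ℂ :=
  ((-(k / (2 * Real.pi * w))) • conjForm (ContinuousLinearMap.snd ℝ ℂ ℂ)).prod
    ((2 * Real.pi * w * k) • conjForm (ContinuousLinearMap.fst ℝ ℂ ℂ))

/-- The complex structures of `ℂ²` for `scaledForm` and `scaledMetric`. -/
def scaledComplex (w : ℝ) (α : Fin 3) : ℂ × ℂ →L[ℝ] ℂ × ℂ :=
  ![antiRot w 1, antiRot w Complex.I, Complex.I • ContinuousLinearMap.id ℝ (ℂ × ℂ)] α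

theorem antiRot_apply (w : ℝ) (k : ℂ) (u : ℂ × ℂ) : antiRot w k u =
    (-(k / (2 * Real.pi * w)) * (starRingEnd ℂ) u.2, 2 * Real.pi * w * k * (starRingEnd ℂ) u.1) := by
  simp [antiRot]

theorem isHKTriple_scaled {w : ℝ} (hw : w ≠ 0) :
    IsHKTriple (scaledForm w) (scaledMetric w) (scaledComplex w) := by
  have hpi := Real.pi_ne_zero
  have hpi' : (Real.pi : ℂ) ≠ 0 := by exact_mod_cast hpi
  have hw' : (w : ℂ) ≠ 0 := by exact_mod_cast hw
  have hc : (starRingEnd ℂ) 2 = 2 := map_ofNat _ 2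
  refine ⟨fun u v => ?_, fun u hu => ?_, fun α u => ?_, fun u => ?_, fun α u v => ?_⟩
  · rw [scaledMetric_apply, scaledMetric_apply]
    simp only [Complex.mul_re, Complex.conj_re, Complex.conj_im]
    ring
  · have h1 := hu (u.1, 0)
    have h2 := hu (0, u.2)
    rw [scaledMetric_apply] at h1 h2
    simp only [map_zero, mul_zero, Complex.zero_re, add_zero, zero_add, Complex.mul_conj,
      Complex.ofReal_re, mul_eq_zero, hw, inv_eq_zero, div_eq_zero_iff, hpi,
      Complex.normSq_eq_zero, false_or, or_false, one_ne_zero, pow_eq_zero_iff, ne_eq,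
      OfNat.ofNat_ne_zero, not_false_eq_true] at h1 h2
    exact Prod.ext h1 h2
  · fin_cases α
    · change antiRot w 1 (antiRot w 1 u) = -u
      simp only [antiRot_apply]
      refine Prod.ext ?_ ?_ <;> simp <;> field_simp <;> simp [hc]
    · change antiRot w Complex.I (antiRot w Complex.I u) = -u
      simp only [antiRot_apply]
      refine Prod.ext ?_ ?_ <;> simp <;> field_simp <;> simp [hc]
    · change Complex.I • Complex.I • u = -u
      rw [smul_smul, Complex.I_mul_I, neg_one_smul]
  · change antiRot w 1 (antiRot w Complex.I u) = Complex.I • u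
    simp only [antiRot_apply]
    refine Prod.ext ?_ ?_ <;> simp <;> field_simp <;> simp [hc]
  · rw [scaledMetric_apply]
    fin_cases α
    · change Complex.re ((1 / (2 * Real.pi) : ℂ) •
        wedge (ContinuousLinearMap.fst ℝ ℂ ℂ) (ContinuousLinearMap.snd ℝ ℂ ℂ) ![u, v]) = _
      change _ = w * ((antiRot w 1 u).1 * _).re + _ * ((antiRot w 1 u).2 * _).re
      rw [antiRot_apply, wedge_apply, show (1 / (2 * Real.pi) : ℂ) = ((1 / (2 * Real.pi) : ℝ) : ℂ) by push_cast; ring,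
        show -(1 / (2 * Real.pi * w) : ℂ) = ((-(1 / (2 * Real.pi * w)) : ℝ) : ℂ) by push_cast; ring,
        show (2 * Real.pi * w * 1 : ℂ) = ((2 * Real.pi * w : ℝ) : ℂ) by push_cast; ring]
      simp
      field_simp
      ring
    · change Complex.im ((1 / (2 * Real.pi) : ℂ) •
        wedge (ContinuousLinearMap.fst ℝ ℂ ℂ) (ContinuousLinearMap.snd ℝ ℂ ℂ) ![u, v]) = _
      change _ = w * ((antiRot w Complex.I u).1 * _).re + _ * ((antiRot w Complex.I u).2 * _).re
      rw [antiRot_apply, wedge_apply, show (1 / (2 * Real.pi) : ℂ) = ((1 / (2 * Real.pi) : ℝ) : ℂ) by push_cast; ring,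
        show -(Complex.I / (2 * Real.pi * w) : ℂ) = ((-(1 / (2 * Real.pi * w)) : ℝ) : ℂ) * Complex.I by push_cast; ring,
        show (2 * Real.pi * w * Complex.I : ℂ) = ((2 * Real.pi * w : ℝ) : ℂ) * Complex.I by push_cast; ring]
      simp
      field_simp
      ring
    · change Complex.re ((Complex.I / 2) * ((w : ℂ) * wedge _ _ ![u, v] +
        (1 / (4 * Real.pi ^ 2 * w) : ℂ) * wedge _ _ ![u, v])) = _
      change _ = w * ((Complex.I * u.1) * _).re + _ * ((Complex.I * u.2) * _).re
      rw [wedge_apply, wedge_apply, show (1 / (4 * Real.pi ^ 2 * w) : ℂ) =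
        ((1 / (4 * Real.pi ^ 2) * w⁻¹ : ℝ) : ℂ) by push_cast; field_simp,
        show Complex.I / 2 = ((1 / 2 : ℝ) : ℂ) * Complex.I by push_cast; ring]
      generalize 1 / (4 * Real.pi ^ 2) * w⁻¹ = k
      simp
      ring

/-- The one-form `Θ = dθ_{β^∨} - τ dθ_β + Im (c̄ dt)` of the Gibbons-Hawking ansatz. -/
def ghTheta (x : Coord) (c z : ℂ) : Coord →L[ℝ] ℂ :=
  dθmag - z • dθelec - (Complex.I / 2 * (starRingEnd ℂ) c) • dtCoord x +
    (Complex.I / 2 * c) • conjForm (dtCoord x)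

/-- On vectors with dt = 0 the imaginary part of Θ is -w dθ_β, so w ≠ 0 is what makes (dt, Θ) a
complex coframe. -/
theorem exists_coframe (x : Coord) (c : ℂ) {w : ℝ} (hw : w ≠ 0) (κ : ℝ) :
    ∃ L : Coord ≃L[ℝ] ℂ × ℂ, (L : Coord →L[ℝ] ℂ × ℂ) =
      (dtCoord x).prod (ghTheta x c (κ + Complex.I * w)) := by
  have hinj : Function.Injective
      ((dtCoord x).prod (ghTheta x c (κ + Complex.I * w)) : Coord →ₗ[ℝ] ℂ × ℂ) := by
    rw [injective_iff_map_eq_zero]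
    intro u hu
    have h1 : Complex.exp x.1 * u.1 = 0 := congrArg Prod.fst hu
    have h1 : u.1 = 0 := by simpa using h1
    have h2 : ghTheta x c (κ + Complex.I * w) u = 0 := congrArg Prod.snd hu
    simp [ghTheta, h1] at h2
    have h3 := congrArg Complex.im h2
    simp [hw] at h3
    refine Prod.ext h1 (Prod.ext h3 ?_)
    simpa [h3] using h2
  exact ⟨(LinearEquiv.ofInjectiveOfFinrankEq _ hinj
    coordC.toLinearEquiv.finrank_eq).toContinuousLinearEquiv, rfl⟩

/-- The Gibbons-Hawking identity: ω₁ + iω₂ = dt ∧ Θ / 2π and ω₃ = (i/2)(w dt ∧ dt̄ + Θ ∧ Θ̄ / 4π²w),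
which reduces the pointwise geometry to a linear model on ℂ². -/
theorem scaledForm_comp_coframe (x : Coord) (c : ℂ) {w : ℝ} (hw : w ≠ 0) (κ : ℝ) (α : Fin 3) :
    (scaledForm w α).compContinuousLinearMap
      ((dtCoord x).prod (ghTheta x c (κ + Complex.I * w))) = ghCoord α x c w κ := by
  have hpi : (Real.pi : ℂ) ≠ 0 := by exact_mod_cast Real.pi_ne_zero
  have hw' : (w : ℂ) ≠ 0 := by exact_mod_cast hw
  have h1 : ∀ v : Fin 2 → Coord, (1 / (2 * Real.pi) : ℂ) *
      wedge (dtCoord x) (ghTheta x c (κ + Complex.I * w)) v = ghCoordHol x c w κ v := by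
    intro v
    rw [ghCoordHol_apply, wedge_apply]
    simp only [ghTheta, dtCoord_apply, dθmag_apply, dθelec_apply, conjForm_apply, add_apply,
      sub_apply, smul_apply, smul_eq_mul]
    field_simp
    ring
  have h2 : ∀ v : Fin 2 → Coord, Complex.I / 2 * (w * wedge (dtCoord x) (conjForm (dtCoord x)) v +
      (1 / (4 * Real.pi ^ 2 * w) : ℂ) * wedge (ghTheta x c (κ + Complex.I * w))
        (conjForm (ghTheta x c (κ + Complex.I * w))) v) = ghCoordThree x c w v := by
    intro v
    rw [ghCoordThree_apply, wedge_apply, wedge_apply]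
    simp only [ghTheta, dtCoord_apply, dθmag_apply, dθelec_apply, conjForm_apply, add_apply,
      sub_apply, smul_apply, smul_eq_mul, map_add, map_sub, map_mul, Complex.conj_ofReal,
      Complex.conj_I, Complex.conj_conj, map_div₀, map_ofNat]
    field_simp
    ring_nf
    simp only [Complex.I_sq, Complex.I_pow_three]
    ring
  ext v
  fin_cases α
  · exact congrArg Complex.re (h1 v)
  · exact congrArg Complex.im (h1 v)
  · exact congrArg Complex.re (h2 v)

theorem exists_isHKTriple_ghCoord (x : Coord) (c : ℂ) {w : ℝ} (hw : w ≠ 0) (κ : ℝ) :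
    ∃ G I, IsHKTriple (fun α => ghCoord α x c w κ) G I ∧ ∀ u v, G u v =
      w * absSq (dtCoord x) u v +
        1 / (4 * Real.pi ^ 2) * w⁻¹ * absSq (ghTheta x c (κ + Complex.I * w)) u v := by
  obtain ⟨L, hL⟩ := exists_coframe x c hw κ
  have h := (isHKTriple_scaled hw).pullback L
  simp_rw [hL, scaledForm_comp_coframe x c hw κ] at h
  exact ⟨_, _, h, fun u v => scaledMetric_apply _ _ _⟩

/-- For w = 0 the vector ∂/∂θ_β + κ ∂/∂θ_{β^∨} annihilates dt and Θ, hence the first form; so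
degeneracy of T is already seen by ω₁. -/
theorem not_nondegenerate_ghCoord (x : Coord) (c : ℂ) (κ : ℝ) :
    ¬ Nondegenerate (ghCoord 0 x c 0 κ) := by
  intro h
  have h1 := h (0, 1, κ) fun v => by
    change Complex.re (ghCoordHol x c 0 κ _) = 0
    rw [ghCoordHol_apply, ← Complex.zero_re]
    congr 1
    simp
    ring
  simpa using congrArg (fun u : Coord => u.2.1) h1

theorem BPSData.IsElectric.nondegenerate_iff {G : Type} {D : BPSData G} {N : Set ℤ} {pos neg : N → G}
    {x : Coord} {τ : ℂ} (h : D.IsElectric N pos neg x τ) :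
    (∀ α, Nondegenerate (D.omega α x)) ↔ D.HorizontallyNondegenerate x := by
  rw [h.horizontallyNondegenerate_iff]
  simp_rw [h.omega_eq]
  constructor
  · intro h1 h2
    have h3 := h1 0
    rw [h2] at h3
    exact not_nondegenerate_ghCoord _ _ _ h3
  · intro hw
    obtain ⟨G, I, hG, -⟩ := exists_isHKTriple_ghCoord x (latticeConn N (toBase x)) hw τ.re
    exact hG.form_nondegenerate

theorem BPSData.IsElectric.exists_isHKTriple {G : Type} {D : BPSData G} {N : Set ℤ}
    {pos neg : N → G} {x : Coord} {τ : ℂ} (h : D.IsElectric N pos neg x τ)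
    (hx : D.HorizontallyNondegenerate x) :
    ∃ g I, IsHKTriple (fun α => D.omega α x) g I ∧ ∀ u v, g u v = D.metric x u v := by
  rw [h.horizontallyNondegenerate_iff] at hx
  obtain ⟨g, I, hg, hm⟩ := exists_isHKTriple_ghCoord x (latticeConn N (toBase x)) hx τ.re
  simp_rw [h.omega_eq]
  refine ⟨g, I, hg, fun u v => ?_⟩
  rw [hm, metric, h.potential_eq, h.dZ_electric, h.conn_eq]
  have h1 : τ + Complex.I * latticePot N (toBase x) =
      (τ.re : ℂ) + Complex.I * ((latticePot N (toBase x) + τ.im : ℝ) : ℂ) := by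
    conv_lhs => rw [← Complex.re_add_im τ]
    push_cast
    ring
  rw [h1]
  rfl

theorem Nondegenerate.comp_equiv {E F : Type} [NormedAddCommGroup E] [NormedSpace ℝ E]
    [NormedAddCommGroup F] [NormedSpace ℝ F] {φ : F [⋀^Fin 2]→L[ℝ] ℝ} (h : Nondegenerate φ)
    (L : E ≃L[ℝ] F) : Nondegenerate (φ.compContinuousLinearMap (L : E →L[ℝ] F)) := by
  intro u hu
  have h1 : L u = 0 := h _ fun v => by
    have := hu (L.symm v)
    rw [form_comp_vec] at this
    simpa using this
  simpa using h1

theorem comp_equiv_symm {E F : Type} [NormedAddCommGroup E] [NormedSpace ℝ E]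
    [NormedAddCommGroup F] [NormedSpace ℝ F] (φ : F [⋀^Fin 2]→L[ℝ] ℝ) (L : E ≃L[ℝ] F) :
    (φ.compContinuousLinearMap (L : E →L[ℝ] F)).compContinuousLinearMap
      (L.symm : F →L[ℝ] E) = φ := by
  ext v
  simp [ContinuousAlternatingMap.compContinuousLinearMap_apply, Function.comp_def]

/-- An injective endomorphism of `Coord` is an equivalence. -/
theorem exists_equiv_of_injective {L : Coord →L[ℝ] Coord} (h : Function.Injective L) :
    ∃ e : Coord ≃L[ℝ] Coord, (e : Coord →L[ℝ] Coord) = L :=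
  ⟨(LinearEquiv.ofInjectiveOfFinrankEq (L : Coord →ₗ[ℝ] Coord) h rfl).toContinuousLinearEquiv, rfl⟩

/-! ### The hyperkähler structure in the Taub-NUT coordinates -/

/-- The part of `tnDomain` where the three forms are non-degenerate. -/
def tnRegular : Set Coord := {y ∈ tnDomain | ∀ α, Nondegenerate (conForm α y)}

theorem isOpen_tnRegular : IsOpen tnRegular :=
  isOpen_nondegenerate isOpen_tnDomain contDiffOn_conForm

/-- Off the axes the triple is transported from the covering, where non-degeneracy of the forms
means w ≠ 0; the axes are reached by `isHKTriple_of_dense`. The point t = 0 therefore needs no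
formula for the metric. -/
theorem isHKTriple_conForm {y : Coord} (hy : y ∈ tnRegular) :
    IsHKTriple (fun α => conForm α y) (hkG fun α => conForm α y) (hkI fun α => conForm α y) := by
  refine isHKTriple_of_dense isOpen_tnRegular (fun α => (contDiffOn_conForm α).mono
    fun _ hy => hy.1) (fun _ hy => hy.2) dense_offAxes ?_ hy
  intro y hy h0
  obtain ⟨x, hx, rfl⟩ := exists_taubNUT_eq hy.1 h0
  obtain ⟨L, hL⟩ := exists_equiv_of_injective (injective_fderiv_taubNUT x)
  have h1 : ∀ α, (conForm α (taubNUT x)).compContinuousLinearMap (L : Coord →L[ℝ] Coord) =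
      (conifold 1).omega α x := fun α => by rw [hL, conForm_taubNUT_eq 1 α hx.1 hx.2]
  have he := isElectric_conifold 1 (exp_mem_strip hx.1)
  obtain ⟨g, I, hg, -⟩ := he.exists_isHKTriple (he.nondegenerate_iff.1 fun α =>
    h1 α ▸ (hy.2 α).comp_equiv L)
  have h2 := hg.pullback L.symm
  simp_rw [← h1, comp_equiv_symm] at h2
  exact ⟨_, _, h2⟩

theorem isHyperkahlerOn_conForm : IsHyperkahlerOn tnRegular (fun y => hkG fun α => conForm α y)
    (fun α y => hkI (fun α => conForm α y) α) conForm :=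
  isHyperkahlerOn_of_isHKTriple isOpen_tnRegular
    (fun α => (contDiffOn_conForm α).mono fun y hy => hy.1)
    (fun y hy α => extDeriv_conForm α hy.1) fun y hy => isHKTriple_conForm hy

end ConifoldHK
end

noncomputable section
namespace ConifoldHK
open MeasureTheory Filter Topology

/-! ### The gluing map -/

/-- The squared modulus of the second coordinate of `glue y`. -/
def glueNormSq (y : Coord) : ℝ :=
  (momNorm (zfst y * zsnd y, moment y - 2 * Real.pi) - (moment y - 2 * Real.pi)) / (2 * Real.pi)

/-- The second coordinate of `glue y`. -/
def glueSnd (y : Coord) : ℂ :=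
  (starRingEnd ℂ) (zfst y) * (Real.sqrt (glueNormSq y / Complex.normSq (zfst y)) : ℂ)

/-- The map that expresses `θ_β ↦ θ_β - 2 π` in the Taub-NUT coordinates. -/
def glue (y : Coord) : Coord := mkZ (zfst y * zsnd y / glueSnd y) (glueSnd y)

/-- The exchange of the coordinates of `ℂ²`. -/
def swapZ (y : Coord) : Coord := mkZ (zsnd y) (zfst y)

/-- The inverse of `glue`. -/
def unglue (y : Coord) : Coord := swapZ (glue (swapZ y))

/-- The part `0 < θ_β` of `tnDomain`. -/
def tnPos : Set Coord := {y ∈ tnDomain | 0 < moment y}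

/-- The part `θ_β < 0` of `tnDomain`. -/
def tnNeg : Set Coord := {y ∈ tnDomain | moment y < 0}

@[simp] theorem swapZ_swapZ (y : Coord) : swapZ (swapZ y) = y := by simp [swapZ]

@[simp] theorem moment_swapZ (y : Coord) : moment (swapZ y) = -moment y := by
  simp [swapZ, moment]; ring

theorem contDiff_swapZ : ContDiff ℝ ∞ swapZ := by
  rw [← contDiffOn_univ]
  exact contDiff_mkZ zsnd.contDiff.contDiffOn zfst.contDiff.contDiffOn

theorem swapZ_mem_tnPos {y : Coord} : swapZ y ∈ tnPos ↔ y ∈ tnNeg := by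
  simp only [tnPos, tnNeg, tnDomain, mem_ofPred_eq, moment_swapZ, abs_neg, neg_pos]
  simp [swapZ, mul_comm]

theorem isOpen_tnPos : IsOpen tnPos :=
  isOpen_tnDomain.inter (isOpen_lt continuous_const contDiff_moment.continuous)

theorem isOpen_tnNeg : IsOpen tnNeg :=
  isOpen_tnDomain.inter (isOpen_lt contDiff_moment.continuous continuous_const)

theorem moment_lt {y : Coord} (hy : y ∈ tnDomain) : moment y < 2 * Real.pi := (abs_lt.1 hy.2).2

theorem normSq_zfst_pos {y : Coord} (hy : 0 < moment y) : 0 < Complex.normSq (zfst y) := by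
  have h2 := Complex.normSq_nonneg (zsnd y)
  have hpi := Real.pi_pos
  by_contra h
  rw [moment] at hy
  nlinarith

theorem glueNormSq_pos {y : Coord} (hy : moment y < 2 * Real.pi) : 0 < glueNormSq y := by
  have h := abs_le_momNorm (zfst y * zsnd y, moment y - 2 * Real.pi)
  have h1 := abs_nonneg (moment y - 2 * Real.pi)
  simp only at h
  refine div_pos ?_ (mul_pos two_pos Real.pi_pos)
  linarith

theorem normSq_glueSnd {y : Coord} (h0 : 0 < moment y) (h1 : moment y < 2 * Real.pi) :
    Complex.normSq (glueSnd y) = glueNormSq y := by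
  have h2 := normSq_zfst_pos h0
  rw [glueSnd, Complex.normSq_mul, Complex.normSq_conj, Complex.normSq_ofReal,
    Real.mul_self_sqrt (div_pos (glueNormSq_pos h1) h2).le, mul_div_cancel₀ _ h2.ne']

theorem glueSnd_ne_zero {y : Coord} (h0 : 0 < moment y) (h1 : moment y < 2 * Real.pi) :
    glueSnd y ≠ 0 := by
  rw [← Complex.normSq_pos, normSq_glueSnd h0 h1]
  exact glueNormSq_pos h1

theorem zfst_mul_zsnd_glue {y : Coord} (h0 : 0 < moment y) (h1 : moment y < 2 * Real.pi) :
    zfst (glue y) * zsnd (glue y) = zfst y * zsnd y := by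
  rw [glue, zfst_mkZ, zsnd_mkZ, div_mul_cancel₀ _ (glueSnd_ne_zero h0 h1)]

/-- With b = θ - 2π and M² = 4π²|t|² + b², the choice |w'|² = (M - b)/2π forces |t|²/|w'|² = (M +
b)/2π, and the difference of the two, times π, is b. -/
theorem moment_glue {y : Coord} (h0 : 0 < moment y) (h1 : moment y < 2 * Real.pi) :
    moment (glue y) = moment y - 2 * Real.pi := by
  have hp := glueNormSq_pos h1
  have hM := momNorm_sq (zfst y * zsnd y, moment y - 2 * Real.pi)
  have hpi := Real.pi_pos
  simp only at hM
  rw [moment, glue, zfst_mkZ, zsnd_mkZ, Complex.normSq_div, normSq_glueSnd h0 h1]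
  have hr : 2 * Real.pi * glueNormSq y = momNorm (zfst y * zsnd y, moment y - 2 * Real.pi) -
      (moment y - 2 * Real.pi) := by
    rw [glueNormSq]; field_simp
  generalize momNorm (zfst y * zsnd y, moment y - 2 * Real.pi) = M at *
  generalize glueNormSq y = r at *
  generalize Complex.normSq (zfst y * zsnd y) = n at *
  generalize moment y - 2 * Real.pi = b at *
  have h3 : M = 2 * Real.pi * r + b := by linarith
  have h4 : Real.pi * n = r * (Real.pi * r + b) := by
    have h5 : 4 * Real.pi * (Real.pi * n) = 4 * Real.pi * (r * (Real.pi * r + b)) := by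
      rw [h3] at hM; linarith
    exact mul_left_cancel₀ (by positivity) h5
  rw [mul_sub, mul_div_assoc', h4, mul_div_cancel_left₀ _ hp.ne']
  ring

theorem glue_mem {y : Coord} (hy : y ∈ tnPos) : glue y ∈ tnNeg := by
  have h1 := moment_lt hy.1
  have h2 := moment_glue hy.2 h1
  refine ⟨⟨by rw [zfst_mul_zsnd_glue hy.2 h1]; exact hy.1.1, ?_⟩, ?_⟩
  · rw [h2, abs_lt]
    constructor <;> linarith [hy.2]
  · rw [h2]; linarith

theorem unglue_mem {y : Coord} (hy : y ∈ tnNeg) : unglue y ∈ tnPos := by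
  rw [unglue, swapZ_mem_tnPos]
  exact glue_mem (swapZ_mem_tnPos.2 hy)

/-- Exchanging z and w reverses the sign of θ, so conjugating `glue` by the exchange shifts θ by
+2π. The phase of w' is that of z̄, and applying the rule twice restores the phase of z. -/
theorem unglue_glue {y : Coord} (hy : y ∈ tnPos) : unglue (glue y) = y := by
  have h1 := moment_lt hy.1
  have hz := normSq_zfst_pos hy.2
  have hz' : zfst y ≠ 0 := Complex.normSq_pos.1 hz
  have hw := glueSnd_ne_zero hy.2 h1
  have hm := moment_glue hy.2 h1
  have key : glueSnd (swapZ (glue y)) = zfst y := by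
    have h2 : glueNormSq (swapZ (glue y)) = Complex.normSq (zfst y) := by
      rw [normSq_zfst, glueNormSq, moment_swapZ, hm, swapZ, zfst_mkZ, zsnd_mkZ,
        mul_comm (zsnd (glue y)), zfst_mul_zsnd_glue hy.2 h1,
        show -(moment y - 2 * Real.pi) - 2 * Real.pi = -moment y by ring]
      have h3 : momNorm (zfst y * zsnd y, -moment y) = momNorm (zBase y) := by
        simp [momNorm, gapD₀, sqBase, zBase]
      rw [h3]
      ring
    have h4 : zfst (swapZ (glue y)) = glueSnd y := by simp [swapZ, glue]
    rw [glueSnd, h2, h4, normSq_glueSnd hy.2 h1, glueSnd, map_mul, Complex.conj_conj,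
      Complex.conj_ofReal, mul_assoc, ← Complex.ofReal_mul, ← Real.sqrt_mul
      (div_pos (glueNormSq_pos h1) hz).le, div_mul_div_cancel₀ hz.ne',
      div_self (glueNormSq_pos h1).ne']
    simp
  refine coord_ext_z ?_ ?_
  · rw [unglue, swapZ, zfst_mkZ, glue, zsnd_mkZ, key]
  · rw [unglue, swapZ, zsnd_mkZ, glue, zfst_mkZ, key, swapZ, zfst_mkZ, zsnd_mkZ,
      mul_comm (zsnd (glue y)), zfst_mul_zsnd_glue hy.2 h1, mul_div_cancel_left₀ _ hz']

theorem glue_unglue {y : Coord} (hy : y ∈ tnNeg) : glue (unglue y) = y := by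
  have h := unglue_glue (swapZ_mem_tnPos.2 hy)
  rw [unglue] at h
  rw [unglue, ← swapZ_swapZ (glue (swapZ (glue (swapZ y)))), h, swapZ_swapZ]

theorem zfst_mul_zsnd_unglue {y : Coord} (hy : y ∈ tnNeg) :
    zfst (unglue y) * zsnd (unglue y) = zfst y * zsnd y := by
  have h := unglue_mem hy
  rw [← zfst_mul_zsnd_glue h.2 (moment_lt h.1), glue_unglue hy]

theorem moment_unglue {y : Coord} (hy : y ∈ tnNeg) : moment (unglue y) = moment y + 2 * Real.pi := by
  have h := unglue_mem hy
  have h1 := moment_glue h.2 (moment_lt h.1)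
  rw [glue_unglue hy] at h1
  linarith

/-- For 0 < θ < 2π the point θ - 2π is negative, so the shifted norm and w' do not vanish, and θ > 0
keeps z away from 0; all roots and quotients are then smooth, including at w = 0. -/
theorem contDiffOn_glue : ContDiffOn ℝ ∞ glue tnPos := by
  have hm := contDiff_moment.contDiffOn (s := tnPos)
  have ht : ContDiff ℝ ∞ fun y : Coord => zfst y * zsnd y := zfst.contDiff.mul zsnd.contDiff
  have h1 : ContDiffOn ℝ ∞ (fun y : Coord =>
      momNorm (zfst y * zsnd y, moment y - 2 * Real.pi)) tnPos := by
    refine ContDiffOn.sqrt (f := fun y : Coord => 4 * Real.pi ^ 2 *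
      Complex.normSq (zfst y * zsnd y) + (moment y - 2 * Real.pi) ^ 2) ?_ fun y hy => ?_
    · exact (contDiffOn_const.mul (contDiff_normSq.comp ht).contDiffOn).add
        ((hm.sub contDiffOn_const).pow 2)
    · have := moment_lt hy.1
      have h2 := Complex.normSq_nonneg (zfst y * zsnd y)
      have h3 : 0 < (moment y - 2 * Real.pi) ^ 2 := sq_pos_of_neg (by linarith)
      positivity
  have h2 : ContDiffOn ℝ ∞ glueSnd tnPos := by
    refine ((Complex.conjCLE : ℂ →L[ℝ] ℂ).contDiff.comp zfst.contDiff).contDiffOn.mul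
      (Complex.ofRealCLM.contDiff.comp_contDiffOn (ContDiffOn.sqrt ?_ fun y hy => ?_))
    · exact ((h1.sub (hm.sub contDiffOn_const)).div_const _).div
        (contDiff_normSq.comp zfst.contDiff).contDiffOn fun y hy => (normSq_zfst_pos hy.2).ne'
    · exact (div_pos (glueNormSq_pos (moment_lt hy.1)) (normSq_zfst_pos hy.2)).ne'
  refine contDiff_mkZ ?_ h2
  simp_rw [div_eq_mul_inv]
  exact ht.contDiffOn.mul (h2.inv fun y hy => glueSnd_ne_zero hy.2 (moment_lt hy.1))

theorem contDiffOn_unglue : ContDiffOn ℝ ∞ unglue tnNeg :=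
  contDiff_swapZ.comp_contDiffOn (contDiffOn_glue.comp contDiff_swapZ.contDiffOn
    fun _ hy => swapZ_mem_tnPos.2 hy)

/-- `glue` as a homeomorphism between open subsets of `Coord`. -/
def gluePartial : OpenPartialHomeomorph Coord Coord where
  toFun := glue
  invFun := unglue
  source := tnPos
  target := tnNeg
  map_source' _ := glue_mem
  map_target' _ := unglue_mem
  left_inv' _ := unglue_glue
  right_inv' _ := glue_unglue
  open_source := isOpen_tnPos
  open_target := isOpen_tnNeg
  continuousOn_toFun := contDiffOn_glue.continuousOn
  continuousOn_invFun := contDiffOn_unglue.continuousOn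

/-- The phases match: lowering θ_β by 2π adds Im s to the imaginary part of `logZ`, so the new w =
exp(s - logZ) has the argument of the old z̄. The moduli agree by the formula for |w|². -/
theorem glue_taubNUT {x : Coord} (hx : x.2.1 ∈ Ioo 0 (2 * Real.pi)) :
    glue (taubNUT x) = taubNUT (deck 1 0 (-1) 0 x) := by
  have hpi := Real.pi_pos
  have hm : moment (taubNUT x) = x.2.1 := congrArg Prod.snd (zBase_taubNUT x)
  have hs : (deck 1 0 (-1) 0 x).1 = x.1 := by simp [deck]
  have ha : (deck 1 0 (-1) 0 x).2.1 = x.2.1 - 2 * Real.pi := by simp [deck]; ring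
  have hb : (deck 1 0 (-1) 0 x).2.2 = x.2.2 := by simp [deck]
  have ht : toBase (deck 1 0 (-1) 0 x) = (Complex.exp x.1, x.2.1 - 2 * Real.pi) := by
    rw [toBase, hs, ha]
  have h0 : 0 < moment (taubNUT x) := hm ▸ hx.1
  have h1 : moment (taubNUT x) < 2 * Real.pi := hm ▸ hx.2
  have hz := normSq_zfst_pos h0
  obtain ⟨r, hr⟩ : ∃ r : ℝ, zsnd (taubNUT (deck 1 0 (-1) 0 x)) =
      (starRingEnd ℂ) (zfst (taubNUT x)) * (Real.exp r : ℂ) := by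
    refine ⟨(x.1 - logZ (deck 1 0 (-1) 0 x) - logZ x).re, ?_⟩
    rw [taubNUT, taubNUT, zsnd_mkZ, zfst_mkZ, hs, ← Complex.exp_conj, Complex.ofReal_exp,
      ← Complex.exp_add]
    congr 1
    refine Complex.ext ?_ ?_
    · simp
    · simp only [logZ, hs, ha, hb, Complex.add_im, Complex.sub_im, Complex.ofReal_im,
        Complex.mul_im, Complex.ofReal_re, Complex.I_im, Complex.I_re, Complex.conj_im]
      field_simp
      ring
  have hn := normSq_zsnd_taubNUT (deck 1 0 (-1) 0 x)
  rw [hr, ha, ht, Complex.normSq_mul, Complex.normSq_conj, Complex.normSq_ofReal] at hn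
  have h2 : glueNormSq (taubNUT x) = Complex.normSq (zfst (taubNUT x)) *
      (Real.exp r * Real.exp r) := by
    rw [hn, glueNormSq, hm, zfst_mul_zsnd_taubNUT]
  have h3 : glueSnd (taubNUT x) = zsnd (taubNUT (deck 1 0 (-1) 0 x)) := by
    rw [hr, glueSnd, h2, mul_div_cancel_left₀ _ hz.ne', Real.sqrt_mul_self (Real.exp_pos r).le]
  refine coord_ext_z ?_ ?_
  · rw [glue, zfst_mkZ, h3, zfst_mul_zsnd_taubNUT, ← hs, ← zfst_mul_zsnd_taubNUT,
      mul_div_cancel_right₀]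
    rw [← h3]
    exact glueSnd_ne_zero h0 h1
  · rw [glue, zsnd_mkZ, h3]

/-- This is where the twist matters: going k times around t = 0 adds kθ_β + kπ to θ_{β^∨} and,
through the factor θ_β - π in `logZ`, subtracts k(θ_β - π). The total 2πk is invisible in exp; with
ε = 0 the sign (-1)^k would remain. -/
theorem taubNUT_deck (k m : ℤ) (x : Coord) : taubNUT (deck 1 k 0 m x) = taubNUT x := by
  have hpi := Real.pi_pos
  have hpi' : (Real.pi : ℂ) ≠ 0 := by exact_mod_cast hpi.ne'
  have hb : toBase (deck 1 k 0 m x) = toBase x := by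
    rw [toBase_deck]; simp [toBase]
  have hl : logZ (deck 1 k 0 m x) = logZ x + (k + m : ℤ) * (2 * Real.pi * Complex.I) := by
    rw [logZ, hb, logZ]
    simp only [deck, Complex.add_im, Complex.mul_im, Complex.mul_re]
    simp
    field_simp
    ring
  have hs : (deck 1 k 0 m x).1 - logZ (deck 1 k 0 m x) =
      x.1 - logZ x + (-m : ℤ) * (2 * Real.pi * Complex.I) := by
    rw [hl]; simp only [deck]; push_cast; ring
  rw [taubNUT, hs, hl, Complex.exp_periodic.int_mul, Complex.exp_periodic.int_mul, taubNUT]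

theorem taubNUT_eq_iff {x y : Coord} (h : taubNUT x = taubNUT y) :
    ∃ k m : ℤ, y = deck 1 k 0 m x := by
  have hpi := Real.pi_pos
  have h1 : toBase x = toBase y := by rw [← zBase_taubNUT, h, zBase_taubNUT]
  obtain ⟨k, hk⟩ := Complex.exp_eq_exp_iff_exists_int.1 (congrArg Prod.fst h1).symm
  have ha : x.2.1 = y.2.1 := congrArg Prod.snd h1
  have h2 : zfst (taubNUT y) = zfst (taubNUT x) := by rw [h]
  rw [taubNUT, taubNUT, zfst_mkZ, zfst_mkZ] at h2
  obtain ⟨n, hn⟩ := Complex.exp_eq_exp_iff_exists_int.1 h2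
  have him (x : Coord) : (logZ x).im = x.2.2 - x.1.im / (2 * Real.pi) * (x.2.1 - Real.pi) := by
    simp only [logZ, Complex.add_im, Complex.ofReal_im, Complex.mul_im, Complex.ofReal_re,
      Complex.I_im, Complex.I_re]
    ring
  have hint (n : ℤ) : ((n : ℂ) * (2 * Real.pi * Complex.I)).im = n * (2 * Real.pi) := by simp
  have h3 := congrArg Complex.im hn
  have hk' := congrArg Complex.im hk
  rw [Complex.add_im, him, him, hint] at h3
  rw [Complex.add_im, hint] at hk'
  refine ⟨k, n - k, Prod.ext ?_ (Prod.ext ?_ ?_)⟩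
  · rw [hk]; simp [deck]; ring
  · simp [deck, ha]
  · rw [hk', ha] at h3
    simp only [deck, ha]
    push_cast
    field_simp at h3
    have h4 : 2 * Real.pi * (y.2.2 - (x.2.2 + k * y.2.1 + 1 * k * Real.pi +
      2 * Real.pi * (n - k))) = 0 := by linarith
    have := (mul_eq_zero.1 h4).resolve_left (by positivity)
    linarith

end ConifoldHK
end

noncomputable section
namespace ConifoldHK
open MeasureTheory Filter Topology

/-! ### The filled-in torus bundle -/

/-- Two points of `tnDomain` that are identified by `glue`. -/
def Glued (y y' : Coord) : Prop :=
  y' = y ∨ (y ∈ tnPos ∧ y' = glue y) ∨ (y ∈ tnNeg ∧ y' = unglue y)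

theorem disjoint_tnPos_tnNeg {y : Coord} (h : y ∈ tnPos) : y ∉ tnNeg := fun h' =>
  (lt_asymm h.2 h'.2)

theorem Glued.symm {y y' : Coord} (h : Glued y y') : Glued y' y := by
  rcases h with rfl | ⟨h, rfl⟩ | ⟨h, rfl⟩
  · exact Or.inl rfl
  · exact Or.inr (Or.inr ⟨glue_mem h, (unglue_glue h).symm⟩)
  · exact Or.inr (Or.inl ⟨unglue_mem h, (glue_unglue h).symm⟩)

/-- Since `glue` maps `tnPos` into the disjoint set `tnNeg`, two successive identifications in the
same direction are impossible, and each class has at most two points. -/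
theorem Glued.trans {y y' z : Coord} (h : Glued y y') (h' : Glued y' z) : Glued y z := by
  rcases h with rfl | ⟨h, rfl⟩ | ⟨h, rfl⟩
  · exact h'
  · rcases h' with rfl | ⟨h', rfl⟩ | ⟨h', rfl⟩
    · exact Or.inr (Or.inl ⟨h, rfl⟩)
    · exact absurd (glue_mem h) (disjoint_tnPos_tnNeg h')
    · exact Or.inl (unglue_glue h)
  · rcases h' with rfl | ⟨h', rfl⟩ | ⟨h', rfl⟩
    · exact Or.inr (Or.inr ⟨h, rfl⟩)
    · exact Or.inl (glue_unglue h)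
    · exact absurd h' (disjoint_tnPos_tnNeg (unglue_mem h))

/-- The identification of the points of `tnDomain` by `glue`. -/
def tnSetoid : Setoid tnDomain where
  r y y' := Glued y y'
  iseqv := ⟨fun _ => Or.inl rfl, Glued.symm, Glued.trans⟩

/-- The torus bundle of twisted characters with a pinched torus over `t = 0`. -/
def Filled : Type := Quotient tnSetoid

/-- The quotient map. -/
def filledMk (y : tnDomain) : Filled := Quotient.mk tnSetoid y

instance : TopologicalSpace Filled := inferInstanceAs (TopologicalSpace (Quotient tnSetoid))

theorem mkZ_zero_mem : mkZ 0 0 ∈ tnDomain := by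
  refine ⟨?_, ?_⟩
  · simp [fullM]
  · simp [moment, Real.pi_pos]

open Classical in
/-- The projection of `tnDomain` to the quotient. -/
def proj (y : Coord) : Filled :=
  if h : y ∈ tnDomain then filledMk ⟨y, h⟩ else filledMk ⟨_, mkZ_zero_mem⟩

theorem proj_of_mem {y : Coord} (h : y ∈ tnDomain) : proj y = filledMk ⟨y, h⟩ :=
  dif_pos h

theorem proj_eq_iff {y y' : Coord} (h : y ∈ tnDomain) (h' : y' ∈ tnDomain) :
    proj y = proj y' ↔ Glued y y' := by
  rw [proj_of_mem h, proj_of_mem h']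
  exact Quotient.eq (r := tnSetoid)

theorem exists_proj (x : Filled) : ∃ y ∈ tnDomain, proj y = x := by
  obtain ⟨y, rfl⟩ := Quotient.exists_rep x
  exact ⟨y, y.2, proj_of_mem y.2⟩

theorem continuousOn_proj : ContinuousOn proj tnDomain := by
  rw [continuousOn_iff_continuous_domRestrict]
  have h : tnDomain.domRestrict proj = filledMk := funext fun y => proj_of_mem y.2
  rw [h]
  exact continuous_quotient_mk'

/-- The saturation of O is O together with its images under the two partial homeomorphisms, all
open. -/
theorem isOpen_image_proj {O : Set Coord} (hO : IsOpen O) (hW : O ⊆ tnDomain) :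
    IsOpen (proj '' O) := by
  change IsOpen (filledMk ⁻¹' (proj '' O))
  have h : filledMk ⁻¹' (proj '' O) = Subtype.val ⁻¹'
      (O ∪ (gluePartial '' (tnPos ∩ O) ∪ gluePartial.symm '' (tnNeg ∩ O))) := by
    ext z
    simp only [mem_preimage, mem_image, mem_union]
    rw [← proj_of_mem z.2]
    constructor
    · rintro ⟨y, hy, h⟩
      rcases (proj_eq_iff (hW hy) z.2).1 h with h | ⟨h1, h⟩ | ⟨h1, h⟩
      · exact Or.inl (h ▸ hy)
      · exact Or.inr (Or.inl ⟨y, ⟨h1, hy⟩, h.symm⟩)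
      · exact Or.inr (Or.inr ⟨y, ⟨h1, hy⟩, h.symm⟩)
    · rintro (h | ⟨y, ⟨h1, hy⟩, h⟩ | ⟨y, ⟨h1, hy⟩, h⟩)
      · exact ⟨z, h, rfl⟩
      · exact ⟨y, hy, (proj_eq_iff (hW hy) z.2).2 (Or.inr (Or.inl ⟨h1, h.symm⟩))⟩
      · exact ⟨y, hy, (proj_eq_iff (hW hy) z.2).2 (Or.inr (Or.inr ⟨h1, h.symm⟩))⟩
  rw [h]
  refine (hO.union (IsOpen.union ?_ ?_)).preimage continuous_subtype_val
  · exact gluePartial.isOpen_image_of_subset_source (isOpen_tnPos.inter hO) inter_subset_left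
  · exact gluePartial.symm.isOpen_image_of_subset_source (isOpen_tnNeg.inter hO) inter_subset_left

theorem exists_chart {O : Set Coord} (hO : IsOpen O) (hW : O ⊆ tnDomain) (hi : InjOn proj O) :
    ∃ e : OpenPartialHomeomorph Filled Coord, e.target = O ∧ ∀ y, e.symm y = proj y := by
  refine ⟨OpenPartialHomeomorph.symm
    { InjOn.toPartialEquiv proj O hi with
      open_source := hO
      open_target := isOpen_image_proj hO hW
      continuousOn_toFun := continuousOn_proj.mono hW
      continuousOn_invFun := ?_ }, rfl, fun y => rfl⟩
  rw [continuousOn_iff']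
  intro U hU
  refine ⟨proj '' (O ∩ U), isOpen_image_proj (hO.inter hU) (inter_subset_left.trans hW), ?_⟩
  have hl : ∀ {y}, y ∈ O → (InjOn.toPartialEquiv proj O hi).invFun (proj y) = y :=
    (InjOn.toPartialEquiv proj O hi).left_inv
  ext x
  constructor
  · rintro ⟨h1, ⟨y, hy, rfl⟩⟩
    refine ⟨⟨y, ⟨hy, ?_⟩, rfl⟩, ⟨y, hy, rfl⟩⟩
    have := hl hy
    rw [mem_preimage] at h1
    exact this ▸ h1
  · rintro ⟨⟨y, ⟨hy, hyU⟩, rfl⟩, h2⟩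
    refine ⟨?_, h2⟩
    have := hl hy
    rw [mem_preimage, this]
    exact hyU

/-- Distinct identified points have values of θ_β that differ by exactly 2π. -/
theorem injOn_proj {O : Set Coord} (hW : O ⊆ tnDomain)
    (h : ∀ y ∈ O, ∀ y' ∈ O, moment y < moment y' + 2 * Real.pi) : InjOn proj O := by
  intro y hy y' hy' hp
  rcases (proj_eq_iff (hW hy) (hW hy')).1 hp with h1 | ⟨h1, rfl⟩ | ⟨h1, rfl⟩
  · exact h1.symm
  · have h2 := h _ hy _ hy'
    rw [moment_glue h1.2 (moment_lt h1.1)] at h2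
    linarith
  · have h2 := h _ hy' _ hy
    rw [moment_unglue h1] at h2
    linarith

/-- Open sets on which `proj` is injective. -/
theorem exists_injOn_proj (m : ℝ) : ∃ O ⊆ tnDomain, IsOpen O ∧ InjOn proj O ∧
    ∀ y ∈ tnDomain, moment y = m → y ∈ O := by
  have hpi := Real.pi_pos

  -- The sets θ < 0, |θ| < π and θ > 0 cover the domain, and on each of them θ varies by less than
  -- 2π.
  rcases lt_trichotomy m 0 with h | h | h
  · refine ⟨tnNeg, fun y hy => hy.1, isOpen_tnNeg, injOn_proj (fun y hy => hy.1) ?_,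
      fun y hy hmy => ⟨hy, hmy ▸ h⟩⟩
    intro y hy y' hy'
    have h1 := (abs_lt.1 hy'.1.2).1
    linarith [hy.2]
  · refine ⟨tnDomain ∩ {y | |moment y| < Real.pi}, inter_subset_left, isOpen_tnDomain.inter
      (isOpen_lt contDiff_moment.continuous.abs continuous_const),
      injOn_proj inter_subset_left ?_, fun y hy hmy => ⟨hy, by simp [hmy, h, hpi]⟩⟩
    intro y hy y' hy'
    have h1 := (abs_lt.1 (show |moment y'| < Real.pi from hy'.2)).1
    have h2 := (abs_lt.1 (show |moment y| < Real.pi from hy.2)).2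
    linarith
  · refine ⟨tnPos, fun y hy => hy.1, isOpen_tnPos, injOn_proj (fun y hy => hy.1) ?_,
      fun y hy hmy => ⟨hy, hmy ▸ h⟩⟩
    intro y hy y' hy'
    have h1 := moment_lt hy.1
    linarith [hy'.2]

/-! ### The smooth structure of the quotient -/

/-- The charts of `Filled` are the local inverses of `proj`. -/
def filledAtlas : Set (OpenPartialHomeomorph Filled Coord) :=
  {e | e.target ⊆ tnDomain ∧ ∀ y, e.symm y = proj y}

theorem exists_chart_at {y : Coord} (hy : y ∈ tnDomain) : ∃ e ∈ filledAtlas, y ∈ e.target := by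
  obtain ⟨O, hW, hO, hi, hy'⟩ := exists_injOn_proj (moment y)
  obtain ⟨e, rfl, he⟩ := exists_chart hO hW hi
  exact ⟨e, ⟨hW, he⟩, hy' y hy rfl⟩

theorem exists_chart_source (x : Filled) : ∃ e ∈ filledAtlas, x ∈ e.source := by
  obtain ⟨y, hy, rfl⟩ := exists_proj x
  obtain ⟨e, he, hye⟩ := exists_chart_at hy
  exact ⟨e, he, by rw [← he.2]; exact e.map_target hye⟩

instance : ChartedSpace Coord Filled where
  atlas := filledAtlas
  chartAt x := (exists_chart_source x).choose
  mem_chart_source x := (exists_chart_source x).choose_spec.2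
  chart_mem_atlas x := (exists_chart_source x).choose_spec.1

/-- The local expressions of `proj` in the charts. -/
def IsGluing (φ : Coord → Coord) (y : Coord) : Prop :=
  φ = id ∨ (φ = glue ∧ y ∈ tnPos) ∨ (φ = unglue ∧ y ∈ tnNeg)

namespace IsGluing

variable {φ : Coord → Coord} {y : Coord}

theorem contDiffAt (h : IsGluing φ y) : ContDiffAt ℝ ∞ φ y := by
  rcases h with rfl | ⟨rfl, h⟩ | ⟨rfl, h⟩
  · exact contDiffAt_id
  · exact contDiffOn_glue.contDiffAt (isOpen_tnPos.mem_nhds h)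
  · exact contDiffOn_unglue.contDiffAt (isOpen_tnNeg.mem_nhds h)

theorem eventually (h : IsGluing φ y) : ∀ᶠ z in 𝓝 y, IsGluing φ z := by
  rcases h with rfl | ⟨rfl, h⟩ | ⟨rfl, h⟩
  · exact Eventually.of_forall fun z => Or.inl rfl
  · filter_upwards [isOpen_tnPos.mem_nhds h] with z hz using Or.inr (Or.inl ⟨rfl, hz⟩)
  · filter_upwards [isOpen_tnNeg.mem_nhds h] with z hz using Or.inr (Or.inr ⟨rfl, hz⟩)

theorem mem (h : IsGluing φ y) (hy : y ∈ tnDomain) : φ y ∈ tnDomain := by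
  rcases h with rfl | ⟨rfl, h⟩ | ⟨rfl, h⟩
  · exact hy
  · exact (glue_mem h).1
  · exact (unglue_mem h).1

theorem glued (h : IsGluing φ y) : Glued y (φ y) := by
  rcases h with rfl | ⟨rfl, h⟩ | ⟨rfl, h⟩
  · exact Or.inl rfl
  · exact Or.inr (Or.inl ⟨h, rfl⟩)
  · exact Or.inr (Or.inr ⟨h, rfl⟩)

theorem proj_eq (h : IsGluing φ y) (hy : y ∈ tnDomain) : proj (φ y) = proj y :=
  ((proj_eq_iff hy (h.mem hy)).2 h.glued).symm

end IsGluing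

theorem Glued.exists_isGluing {y y' : Coord} (h : Glued y y') : ∃ φ, IsGluing φ y ∧ φ y = y' := by
  rcases h with rfl | ⟨h, rfl⟩ | ⟨h, rfl⟩
  · exact ⟨id, Or.inl rfl, rfl⟩
  · exact ⟨glue, Or.inr (Or.inl ⟨rfl, h⟩), rfl⟩
  · exact ⟨unglue, Or.inr (Or.inr ⟨rfl, h⟩), rfl⟩

/-- Near each point the coordinate changes are the identity, `glue` or `unglue`, all smooth. -/
theorem exists_isGluing {e : OpenPartialHomeomorph Filled Coord} (he : e ∈ filledAtlas) {y : Coord}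
    (hy : y ∈ tnDomain) (hs : proj y ∈ e.source) : ∃ φ, IsGluing φ y ∧ e ∘ proj =ᶠ[𝓝 y] φ := by
  have h1 : e (proj y) ∈ e.target := e.map_source hs
  have h2 : proj (e (proj y)) = proj y := by rw [← he.2, e.left_inv hs]
  obtain ⟨φ, hφ, h3⟩ := ((proj_eq_iff hy (he.1 h1)).1 h2.symm).exists_isGluing
  refine ⟨φ, hφ, ?_⟩
  filter_upwards [hφ.eventually, isOpen_tnDomain.mem_nhds hy,
    hφ.contDiffAt.continuousAt.preimage_mem_nhds (e.open_target.mem_nhds (h3 ▸ h1))] with z hz hzW ht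
  rw [Function.comp_apply, ← hz.proj_eq hzW, ← he.2, e.right_inv ht]

instance : IsManifold 𝓘(ℝ, Coord) ∞ Filled := by
  refine isManifold_of_contDiffOn _ _ _ fun e e' he he' => ?_
  intro y hy
  have h1 : y ∈ e.target ∧ e.symm y ∈ e'.source := by simpa using hy
  have h2 : proj y ∈ e'.source := by rw [← he.2]; exact h1.2
  obtain ⟨φ, hφ, h3⟩ := exists_isGluing he' (he.1 h1.1) h2
  refine (hφ.contDiffAt.congr_of_eventuallyEq ?_).contDiffWithinAt
  filter_upwards [h3] with z hz
  rw [← hz]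
  simp [he.2]

instance : SecondCountableTopology Filled := by
  have hq : IsOpenQuotientMap filledMk := by
    refine ⟨Quotient.mk_surjective, continuous_quotient_mk', fun U hU => ?_⟩
    have h1 := isOpen_image_proj (isOpen_tnDomain.isOpenMap_subtype_val U hU)
      (by rintro _ ⟨y, -, rfl⟩; exact y.2)
    rw [image_image] at h1
    refine Eq.mpr (congrArg IsOpen (image_congr fun y _ => (proj_of_mem y.2).symm)) h1
  exact hq.isQuotientMap.secondCountableTopology hq.isOpenMap

end ConifoldHK
end

noncomputable section
namespace ConifoldHK
open MeasureTheory Filter Topology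

/-! ### Functions and tensor fields on the filled-in torus bundle -/

theorem Glued.zfst_mul_zsnd {y y' : Coord} (h : Glued y y') :
    zfst y' * zsnd y' = zfst y * zsnd y := by
  rcases h with rfl | ⟨h, rfl⟩ | ⟨h, rfl⟩
  · rfl
  · exact zfst_mul_zsnd_glue h.2 (moment_lt h.1)
  · exact zfst_mul_zsnd_unglue h

theorem Glued.exp_moment {y y' : Coord} (h : Glued y y') :
    Circle.exp (moment y') = Circle.exp (moment y) := by
  rcases h with rfl | ⟨h, rfl⟩ | ⟨h, rfl⟩
  · rfl
  · rw [moment_glue h.2 (moment_lt h.1), Circle.exp_sub_two_pi]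
  · rw [moment_unglue h, Circle.exp_add_two_pi]

/-- The function `t` on `Filled`. -/
def fillT : Filled → ℂ := Quotient.lift (fun y : tnDomain => zfst (y : Coord) * zsnd (y : Coord))
  fun _ _ h => (Glued.zfst_mul_zsnd h).symm

/-- The function `exp (i θ_β)` on `Filled`. -/
def fillU : Filled → Circle := Quotient.lift (fun y : tnDomain => Circle.exp (moment (y : Coord)))
  fun _ _ h => (Glued.exp_moment h).symm

theorem fillT_proj {y : Coord} (hy : y ∈ tnDomain) : fillT (proj y) = zfst y * zsnd y := by
  rw [proj_of_mem hy]; rfl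

theorem fillU_proj {y : Coord} (hy : y ∈ tnDomain) : fillU (proj y) = Circle.exp (moment y) := by
  rw [proj_of_mem hy]; rfl

theorem chart_symm_eq (x₀ : Filled) : ((chartAt Coord x₀).symm : Coord → Filled) = proj :=
  funext (chart_mem_atlas Coord x₀ : chartAt Coord x₀ ∈ filledAtlas).2

theorem chart_target_subset (x₀ : Filled) : (chartAt Coord x₀).target ⊆ tnDomain :=
  (chart_mem_atlas Coord x₀ : chartAt Coord x₀ ∈ filledAtlas).1

theorem chart_mem_tnDomain {x₀ x : Filled} (hx : x ∈ (chartAt Coord x₀).source) :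
    chartAt Coord x₀ x ∈ tnDomain :=
  chart_target_subset x₀ ((chartAt Coord x₀).map_source hx)

theorem proj_chart {x₀ x : Filled} (hx : x ∈ (chartAt Coord x₀).source) :
    proj (chartAt Coord x₀ x) = x := by
  rw [← chart_symm_eq x₀, (chartAt Coord x₀).left_inv hx]

theorem contMDiff_of_proj {f : Filled → ℂ} {F : Coord → ℂ} (hF : ContDiff ℝ ∞ F)
    (h : ∀ y ∈ tnDomain, f (proj y) = F y) : ContMDiff 𝓘(ℝ, Coord) 𝓘(ℝ, ℂ) ∞ f := by
  intro x
  have h1 : ContMDiffAt 𝓘(ℝ, Coord) 𝓘(ℝ, Coord) ∞ (chartAt Coord x) x :=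
    contMDiffAt_of_mem_maximalAtlas (IsManifold.chart_mem_maximalAtlas x) (mem_chart_source _ x)
  refine (hF.contMDiff.contMDiffAt.comp x h1).congr_of_eventuallyEq ?_
  filter_upwards [(chartAt Coord x).open_source.mem_nhds (mem_chart_source _ x)] with z hz
  rw [Function.comp_apply, ← h _ (chart_mem_tnDomain hz), proj_chart hz]

theorem mfderiv_of_proj {f : Filled → ℂ} {F : Coord → ℂ} (hF : ContDiff ℝ ∞ F)
    (h : ∀ y ∈ tnDomain, f (proj y) = F y) (x : Filled) :
    (show Coord →L[ℝ] ℂ from mfderiv 𝓘(ℝ, Coord) 𝓘(ℝ, ℂ) f x) =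
      fderiv ℝ F (chartAt Coord x x) := by
  have h1 := ((contMDiff_of_proj hF h x).mdifferentiableAt (by simp)).mfderiv
  refine Eq.trans h1 ?_
  have h2 : writtenInExtChartAt 𝓘(ℝ, Coord) 𝓘(ℝ, ℂ) x f =ᶠ[𝓝 (chartAt Coord x x)] F := by
    filter_upwards [(chartAt Coord x).open_target.mem_nhds (mem_chart_target _ x)] with z hz
    rw [← h z (chart_target_subset x hz), ← chart_symm_eq x]
    simp [writtenInExtChartAt]
    rfl
  rw [modelWithCornersSelf_coe, range_id, fderivWithin_univ]
  exact h2.fderiv_eq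

theorem continuous_of_proj {Y : Type} [TopologicalSpace Y] {f : Filled → Y} {F : Coord → Y}
    (hF : Continuous F) (h : ∀ y ∈ tnDomain, f (proj y) = F y) : Continuous f := by
  rw [continuous_def]
  intro U hU
  have h1 : f ⁻¹' U = proj '' (tnDomain ∩ F ⁻¹' U) := by
    ext x
    obtain ⟨y, hy, rfl⟩ := exists_proj x
    constructor
    · exact fun hx => ⟨y, ⟨hy, by rw [mem_preimage, ← h y hy]; exact hx⟩, rfl⟩
    · rintro ⟨z, ⟨hz, hzU⟩, hzy⟩
      rw [mem_preimage, ← hzy, h z hz]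
      exact hzU
  rw [h1]
  exact isOpen_image_proj (isOpen_tnDomain.inter (hU.preimage hF)) inter_subset_left

theorem continuous_fillT : Continuous fillT :=
  continuous_of_proj (zfst.continuous.mul zsnd.continuous) fun _ hy => fillT_proj hy

theorem continuous_fillU : Continuous fillU :=
  continuous_of_proj (Circle.exp.continuous.comp contDiff_moment.continuous)
    fun _ hy => fillU_proj hy

/-- Both values of θ_β lie in (-2π, 2π), so they differ by 0 or ±2π, which a single gluing corrects.
-/
theorem exists_proj_moment_eq {y y' : Coord} (hy : y ∈ tnDomain) (hy' : y' ∈ tnDomain)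
    (h : Circle.exp (moment y) = Circle.exp (moment y')) :
    ∃ z ∈ tnDomain, proj z = proj y ∧ moment z = moment y' := by
  have hpi := Real.pi_pos
  obtain ⟨k, hk⟩ := Circle.exp_eq_exp.1 h
  have h1 := abs_lt.1 hy.2
  have h2 := abs_lt.1 hy'.2
  have hk1 : k < 2 := by
    have : (k : ℝ) * (2 * Real.pi) < 2 * (2 * Real.pi) := by linarith
    exact_mod_cast lt_of_mul_lt_mul_right this (by positivity)
  have hk2 : -2 < k := by
    have : (-2 : ℝ) * (2 * Real.pi) < k * (2 * Real.pi) := by linarith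
    exact_mod_cast lt_of_mul_lt_mul_right this (by positivity)
  obtain rfl | rfl | rfl : k = -1 ∨ k = 0 ∨ k = 1 := by omega
  · have hn : y ∈ tnNeg := ⟨hy, by push_cast at hk; linarith⟩
    refine ⟨unglue y, (unglue_mem hn).1, ?_, ?_⟩
    · exact (proj_eq_iff (unglue_mem hn).1 hy).2 (Glued.symm (Or.inr (Or.inr ⟨hn, rfl⟩)))
    · rw [moment_unglue hn]; push_cast at hk; linarith
  · exact ⟨y, hy, rfl, by push_cast at hk; linarith⟩
  · have hn : y ∈ tnPos := ⟨hy, by push_cast at hk; linarith⟩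
    refine ⟨glue y, (glue_mem hn).1, ?_, ?_⟩
    · exact (proj_eq_iff (glue_mem hn).1 hy).2 (Glued.symm (Or.inr (Or.inl ⟨hn, rfl⟩)))
    · rw [moment_glue hn.2 (moment_lt hn.1)]; push_cast at hk; linarith

/-- Points are separated by the continuous functions t and exp(iθ_β) if these differ. Otherwise
representatives with equal θ_β exist, and both lie in one open set on which `proj` is injective. -/
instance : T2Space Filled := by
  refine ⟨fun x x' hx => ?_⟩
  by_cases hT : fillT x = fillT x'
  swap
  · exact separated_by_continuous continuous_fillT hT
  by_cases hU : fillU x = fillU x'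
  swap
  · exact separated_by_continuous continuous_fillU hU
  obtain ⟨y₀, hy₀, rfl⟩ := exists_proj x
  obtain ⟨y', hy', rfl⟩ := exists_proj x'
  rw [fillU_proj hy₀, fillU_proj hy'] at hU
  obtain ⟨y, hy, hyx, hm⟩ := exists_proj_moment_eq hy₀ hy' hU
  rw [← hyx] at hx ⊢
  obtain ⟨O, hW, hO, hi, hmem⟩ := exists_injOn_proj (moment y')
  have hne : y ≠ y' := fun h => hx (h ▸ rfl)
  obtain ⟨U, V, hU, hV, hyU, hyV, hd⟩ := t2_separation hne
  refine ⟨proj '' (O ∩ U), proj '' (O ∩ V),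
    isOpen_image_proj (hO.inter hU) (inter_subset_left.trans hW),
    isOpen_image_proj (hO.inter hV) (inter_subset_left.trans hW),
    ⟨y, ⟨hmem y hy hm, hyU⟩, rfl⟩, ⟨y', ⟨hmem y' hy' rfl, hyV⟩, rfl⟩, ?_⟩
  rw [disjoint_iff_forall_ne]
  rintro _ ⟨a, ⟨ha, haU⟩, rfl⟩ _ ⟨b, ⟨hb, hbV⟩, rfl⟩ h
  exact disjoint_left.1 hd haU (hi ha hb h ▸ hbV)

theorem exists_proj_abs_le (x : Filled) : ∃ y ∈ tnDomain, proj y = x ∧ |moment y| ≤ Real.pi := by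
  have hpi := Real.pi_pos
  obtain ⟨y, hy, rfl⟩ := exists_proj x
  have h1 := abs_lt.1 hy.2
  by_cases h : Real.pi < moment y
  · have hn : y ∈ tnPos := ⟨hy, by linarith⟩
    refine ⟨glue y, (glue_mem hn).1, ?_, ?_⟩
    · exact (proj_eq_iff (glue_mem hn).1 hy).2 (Glued.symm (Or.inr (Or.inl ⟨hn, rfl⟩)))
    · rw [moment_glue hn.2 (moment_lt hn.1), abs_le]
      constructor <;> linarith
  by_cases h' : moment y < -Real.pi
  · have hn : y ∈ tnNeg := ⟨hy, by linarith⟩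
    refine ⟨unglue y, (unglue_mem hn).1, ?_, ?_⟩
    · exact (proj_eq_iff (unglue_mem hn).1 hy).2 (Glued.symm (Or.inr (Or.inr ⟨hn, rfl⟩)))
    · rw [moment_unglue hn, abs_le]
      constructor <;> linarith
  · exact ⟨y, hy, rfl, abs_le.2 ⟨not_lt.1 h', not_lt.1 h⟩⟩

/-- The preimage is covered by the closed set |θ_β| ≤ π, on which |z|² + |w|² = D/π is bounded in
terms of |t| and |θ_β|. -/
theorem isCompact_fillT_preimage {K : Set ℂ} (hK : K ⊆ fullM) (hc : IsCompact K) :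
    IsCompact (fillT ⁻¹' K) := by
  have hpi := Real.pi_pos
  set S : Set Coord := {y | zfst y * zsnd y ∈ K ∧ |moment y| ≤ Real.pi}
  have hS : S ⊆ tnDomain := fun y hy => ⟨hK hy.1, hy.2.trans_lt (by linarith)⟩
  have h1 : fillT ⁻¹' K = proj '' S := by
    ext x
    constructor
    · intro hx
      obtain ⟨y, hy, rfl, hm⟩ := exists_proj_abs_le x
      rw [mem_preimage, fillT_proj hy] at hx
      exact ⟨y, ⟨hx, hm⟩, rfl⟩
    · rintro ⟨y, hy, rfl⟩
      rw [mem_preimage, fillT_proj (hS hy)]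
      exact hy.1
  rw [h1]
  refine IsCompact.image_of_continuousOn ?_ (continuousOn_proj.mono hS)
  have hcl : IsClosed S := (hc.isClosed.preimage (zfst.continuous.mul zsnd.continuous)).inter
    (isClosed_le contDiff_moment.continuous.abs continuous_const)
  obtain ⟨R, hR⟩ := hc.isBounded.exists_norm_le
  -- A bound r for |z|² gives |z| ≤ 1 + |z|² ≤ 1 + r.
  set B : ℝ := 1 + (2 * Real.pi * R + Real.pi)
  have key : ∀ y ∈ S, ‖zfst y‖ ≤ B ∧ ‖zsnd y‖ ≤ B := by
    intro y hy
    have h2 := hR _ hy.1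
    have hR0 : 0 ≤ R := (norm_nonneg _).trans h2
    have h3 : momNorm (zBase y) ≤ 2 * Real.pi * R + Real.pi := by
      refine abs_le_of_sq_le_sq' ?_ (by positivity) |>.2
      rw [momNorm_sq, Complex.normSq_eq_norm_sq]
      have h4 : ‖(zBase y).1‖ ^ 2 ≤ R ^ 2 := pow_le_pow_left₀ (norm_nonneg _) h2 2
      have h5 : (zBase y).2 ^ 2 ≤ Real.pi ^ 2 := sq_le_sq' (abs_le.1 hy.2).1 (abs_le.1 hy.2).2
      have h6 : 0 ≤ 4 * Real.pi ^ 2 * R := by positivity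
      nlinarith [mul_le_mul_of_nonneg_left h4 (by positivity : 0 ≤ 4 * Real.pi ^ 2)]
    rw [momNorm_zBase, Complex.normSq_eq_norm_sq, Complex.normSq_eq_norm_sq] at h3
    have h7 : 1 ≤ Real.pi := by linarith [Real.pi_gt_three]
    have h8 : ‖zfst y‖ ^ 2 + ‖zsnd y‖ ^ 2 ≤ 2 * Real.pi * R + Real.pi := by nlinarith [sq_nonneg ‖zfst y‖, sq_nonneg ‖zsnd y‖]
    constructor
    · nlinarith [sq_nonneg (‖zfst y‖ - 1), sq_nonneg ‖zsnd y‖]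
    · nlinarith [sq_nonneg (‖zsnd y‖ - 1), sq_nonneg ‖zfst y‖]
  refine IsCompact.of_isClosed_subset (((isCompact_closedBall (0 : ℂ) B).prod
    (isCompact_closedBall (0 : ℂ) B)).image coordC.symm.continuous) hcl ?_
  intro y hy
  refine ⟨(zfst y, zsnd y), ⟨?_, ?_⟩, mkZ_zfst_zsnd y⟩
  · simpa using (key y hy).1
  · simpa using (key y hy).2

theorem isLocalDiffeomorphAt_proj {y : Coord} (hy : y ∈ tnDomain) :
    IsLocalDiffeomorphAt 𝓘(ℝ, Coord) 𝓘(ℝ, Coord) ∞ proj y := by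
  obtain ⟨e, he, hye⟩ := exists_chart_at hy
  have hm := IsManifold.subset_maximalAtlas (I := 𝓘(ℝ, Coord)) (n := ∞)
    (show e ∈ atlas Coord Filled from he)
  exact ⟨{ e.symm.toPartialEquiv with
    open_source := e.open_target
    open_target := e.open_source
    contMDiffOn_toFun := contMDiffOn_symm_of_mem_maximalAtlas hm
    contMDiffOn_invFun := contMDiffOn_of_mem_maximalAtlas hm }, hye, fun z _ => (he.2 z).symm⟩

theorem mfderiv_to_filled {f : Coord → Filled} {y : Coord}
    (hf : MDifferentiableAt 𝓘(ℝ, Coord) 𝓘(ℝ, Coord) f y) :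
    (show Coord →L[ℝ] Coord from mfderiv 𝓘(ℝ, Coord) 𝓘(ℝ, Coord) f y) =
      fderiv ℝ (chartAt Coord (f y) ∘ f) y := by
  refine Eq.trans hf.mfderiv ?_
  rw [modelWithCornersSelf_coe, range_id, fderivWithin_univ]
  rfl

/-- Tangent vectors at `proj y` are read in the preferred chart there, whose value may be the other
representative of the class; the derivative of `proj` is then that of the gluing map φ. -/
theorem exists_mfderiv_proj {y : Coord} (hy : y ∈ tnDomain) : ∃ φ, IsGluing φ y ∧
    (show Coord →L[ℝ] Coord from mfderiv 𝓘(ℝ, Coord) 𝓘(ℝ, Coord) proj y) = fderiv ℝ φ y ∧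
    chartAt Coord (proj y) (proj y) = φ y := by
  obtain ⟨φ, hφ, h⟩ := exists_isGluing (chart_mem_atlas Coord (proj y)) hy (mem_chart_source _ _)
  have h1 := (isLocalDiffeomorphAt_proj hy).mdifferentiableAt (by simp)
  exact ⟨φ, hφ, (mfderiv_to_filled h1).trans h.fderiv_eq, h.self_of_nhds⟩

theorem IsGluing.exists_equiv {φ : Coord → Coord} {y : Coord} (h : IsGluing φ y) :
    ∃ L : Coord ≃L[ℝ] Coord, (L : Coord →L[ℝ] Coord) = fderiv ℝ φ y := by
  have hd := h.contDiffAt.differentiableAt (by simp)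
  have key : ∀ ψ : Coord → Coord, DifferentiableAt ℝ ψ (φ y) → ψ ∘ φ =ᶠ[𝓝 y] id →
      Function.Injective (fderiv ℝ φ y) := by
    intro ψ hψ he
    have h1 := fderiv_comp y hψ hd
    rw [he.fderiv_eq, fderiv_id] at h1
    refine Function.LeftInverse.injective (g := fderiv ℝ ψ (φ y)) fun v => ?_
    exact (congrArg (fun L : Coord →L[ℝ] Coord => L v) h1).symm
  refine exists_equiv_of_injective ?_
  rcases h with rfl | ⟨rfl, h⟩ | ⟨rfl, h⟩
  · exact key id differentiableAt_id EventuallyEq.rfl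
  · refine key unglue ((contDiffOn_unglue.contDiffAt
      (isOpen_tnNeg.mem_nhds (glue_mem h))).differentiableAt (by simp)) ?_
    filter_upwards [isOpen_tnPos.mem_nhds h] with z hz using unglue_glue hz
  · refine key glue ((contDiffOn_glue.contDiffAt
      (isOpen_tnPos.mem_nhds (unglue_mem h))).differentiableAt (by simp)) ?_
    filter_upwards [isOpen_tnNeg.mem_nhds h] with z hz using glue_unglue hz

/-! ### Descent of forms to the quotient -/

/-- A form on `tnDomain` that is compatible with the gluing. -/
def GlueInvariant (Ψ : Coord → Coord [⋀^Fin 2]→L[ℝ] ℝ) : Prop :=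
  ∀ y ∈ tnDomain, ∀ φ, IsGluing φ y → (Ψ (φ y)).compContinuousLinearMap (fderiv ℝ φ y) = Ψ y

/-- The field of two-forms on `Filled` given by a form on `tnDomain`. -/
def formField (Ψ : Coord → Coord [⋀^Fin 2]→L[ℝ] ℝ) : FormField Filled := fun x =>
  Ψ (chartAt Coord x x)

theorem pullForm_proj {Ψ : Coord → Coord [⋀^Fin 2]→L[ℝ] ℝ} (h : GlueInvariant Ψ) {y : Coord}
    (hy : y ∈ tnDomain) : pullForm proj (formField Ψ) y = Ψ y := by
  obtain ⟨φ, hφ, h1, h2⟩ := exists_mfderiv_proj hy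
  rw [← h y hy φ hφ, ← h1, ← h2]
  rfl

theorem isSmoothForm_formField {Ψ : Coord → Coord [⋀^Fin 2]→L[ℝ] ℝ} (h : GlueInvariant Ψ)
    (hs : ContDiffOn ℝ ∞ Ψ tnDomain) : IsSmoothForm (formField Ψ) := by
  intro x₀
  rw [chart_symm_eq]
  have hsub : chartDomain x₀ univ ⊆ tnDomain := fun y hy => chart_target_subset x₀ hy.1
  exact (hs.mono hsub).congr fun y hy => pullForm_proj h (hsub hy)

end ConifoldHK
end

noncomputable section
namespace ConifoldHK
open MeasureTheory Filter Topology

/-! ### The hyperkähler structure on the filled-in torus bundle -/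

theorem comp_comp_form {E F G : Type} [NormedAddCommGroup E] [NormedSpace ℝ E]
    [NormedAddCommGroup F] [NormedSpace ℝ F] [NormedAddCommGroup G] [NormedSpace ℝ G]
    (φ : G [⋀^Fin 2]→L[ℝ] ℝ) (L : F →L[ℝ] G) (M : E →L[ℝ] F) :
    (φ.compContinuousLinearMap L).compContinuousLinearMap M =
      φ.compContinuousLinearMap (L ∘L M) := rfl

theorem form_comp_surjective {φ ψ : Coord [⋀^Fin 2]→L[ℝ] ℝ} {L : Coord →L[ℝ] Coord}
    (hL : Function.Surjective L)
    (h : φ.compContinuousLinearMap L = ψ.compContinuousLinearMap L) : φ = ψ := by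
  ext v
  obtain ⟨w, rfl⟩ : ∃ w : Fin 2 → Coord, v = L ∘ w :=
    ⟨fun i => (hL (v i)).choose, funext fun i => (hL (v i)).choose_spec.symm⟩
  exact congrArg (fun φ : Coord [⋀^Fin 2]→L[ℝ] ℝ => φ w) h

theorem differentiable_deck (ε : ℕ) (k l m : ℤ) : Differentiable ℝ (deck ε k l m) := by
  unfold deck
  fun_prop

theorem deck_mem_cover (ε : ℕ) (k l m : ℤ) {x : Coord} (hx : x ∈ cover) : deck ε k l m x ∈ cover := by
  change Complex.exp (deck ε k l m x).1 ∈ baseM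
  rw [deck, exp_add_two_pi_I_mul]
  exact hx

/-- In the coordinates of the covering, `glue` is the deck transformation θ_β ↦ θ_β - 2π, so
invariance off the axes is the hypothesis on F; density extends it, and the case of `unglue` is the
inverse statement. -/
theorem glueInvariant_of_taubNUT {Ψ F : Coord → Coord [⋀^Fin 2]→L[ℝ] ℝ}
    (hs : ContDiffOn ℝ ∞ Ψ tnDomain)
    (h : ∀ x ∈ coverSlab, (Ψ (taubNUT x)).compContinuousLinearMap (fderiv ℝ taubNUT x) = F x)
    (hF : ∀ x ∈ cover, (F (deck 1 0 (-1) 0 x)).compContinuousLinearMap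
      (fderiv ℝ (deck 1 0 (-1) 0) x) = F x) : GlueInvariant Ψ := by
  have hglue : ∀ y ∈ tnPos, (Ψ (glue y)).compContinuousLinearMap (fderiv ℝ glue y) = Ψ y := by
    refine eqOn_of_dense isOpen_tnPos dense_offAxes (contDiffOn_form_comp
      (hs.comp contDiffOn_glue fun y hy => (glue_mem hy).1)
      (contDiffOn_glue.fderiv_of_isOpen isOpen_tnPos (m := ∞) (by simp))).continuousOn
      (hs.mono fun y hy => hy.1).continuousOn ?_
    intro y hy h0
    obtain ⟨x, hx, rfl⟩ := exists_taubNUT_eq hy.1 h0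
    have hm : moment (taubNUT x) = x.2.1 := congrArg Prod.snd (zBase_taubNUT x)
    have hx0 : x.2.1 ∈ Ioo 0 (2 * Real.pi) := ⟨hm ▸ hy.2, hx.2.2⟩
    have he : glue ∘ taubNUT =ᶠ[𝓝 x] taubNUT ∘ deck 1 0 (-1) 0 := by
      filter_upwards [(isOpen_Ioo.preimage (by fun_prop :
        Continuous fun x : Coord => x.2.1)).mem_nhds hx0] with z hz using glue_taubNUT hz
    have hx' : deck 1 0 (-1) 0 x ∈ coverSlab := by
      refine ⟨deck_mem_cover _ _ _ _ hx.1, ?_⟩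
      have h1 := hx0.1
      have h2 := hx0.2
      change (deck 1 0 (-1) 0 x).2.1 ∈ Ioo (-(2 * Real.pi)) (2 * Real.pi)
      simp only [deck]
      push_cast
      constructor <;> linarith
    have hd := he.fderiv_eq (𝕜 := ℝ)
    rw [fderiv_comp x ((contDiffOn_glue.contDiffAt (isOpen_tnPos.mem_nhds hy)).differentiableAt
      (by simp)) (hasFDerivAt_taubNUT x).differentiableAt, fderiv_comp x
      (hasFDerivAt_taubNUT _).differentiableAt (differentiable_deck _ _ _ _ x)] at hd
    refine form_comp_surjective (surjective_fderiv_taubNUT x) ?_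
    rw [comp_comp_form, hd, h x hx, ← hF x hx.1, ← h _ hx', comp_comp_form, glue_taubNUT hx0]
  intro y hy φ hφ
  rcases hφ with rfl | ⟨rfl, hφ⟩ | ⟨rfl, hφ⟩
  · rw [fderiv_id]
    rfl
  · exact hglue y hφ
  · have hu := unglue_mem hφ
    have he : glue ∘ unglue =ᶠ[𝓝 y] id := by
      filter_upwards [isOpen_tnNeg.mem_nhds hφ] with z hz using glue_unglue hz
    have hd := he.fderiv_eq (𝕜 := ℝ)
    rw [fderiv_comp y ((contDiffOn_glue.contDiffAt (isOpen_tnPos.mem_nhds hu)).differentiableAt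
      (by simp)) ((contDiffOn_unglue.contDiffAt (isOpen_tnNeg.mem_nhds hφ)).differentiableAt
      (by simp)), fderiv_id] at hd
    rw [← hglue _ hu, comp_comp_form, hd, glue_unglue hφ]
    rfl

theorem glueInvariant_conForm (α : Fin 3) : GlueInvariant (conForm α) :=
  glueInvariant_of_taubNUT (contDiffOn_conForm α)
    (fun _ hx => conForm_taubNUT_eq 1 α hx.1 hx.2) fun _ hx => omega_conifold_deck 1 hx α _ _ _

theorem glueInvariant_ovForm (α : Fin 3) : GlueInvariant (ovForm α) :=
  glueInvariant_of_taubNUT (contDiffOn_ovForm α)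
    (fun _ hx => ovForm_taubNUT_eq 1 α hx.1 hx.2) fun _ hx => omega_ooguriVafa_deck 1 hx α _ _ _

/-- The metric on `Filled`. -/
def filledMetric : BilinField Filled := fun x => hkG fun α => conForm α (chartAt Coord x x)

/-- The complex structures on `Filled`. -/
def filledComplex (α : Fin 3) : EndField Filled := fun x =>
  hkI (fun α => conForm α (chartAt Coord x x)) α

theorem proj_mem_nondegenerateLocus {y : Coord} (hy : y ∈ tnDomain) :
    proj y ∈ nondegenerateLocus (fun α => formField (conForm α)) ↔ y ∈ tnRegular := by
  obtain ⟨φ, hφ, -, h2⟩ := exists_mfderiv_proj hy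
  obtain ⟨L, hL⟩ := hφ.exists_equiv
  have h1 : ∀ α, Nondegenerate (conForm α (φ y)) ↔ Nondegenerate (conForm α y) := by
    intro α
    have h3 := glueInvariant_conForm α y hy φ hφ
    rw [← hL] at h3
    constructor
    · exact fun h => h3 ▸ h.comp_equiv L
    · intro h
      rw [← h3] at h
      exact comp_equiv_symm (conForm α (φ y)) L ▸ h.comp_equiv L.symm
  change (∀ α, Nondegenerate (conForm α (chartAt Coord (proj y) (proj y)))) ↔ _
  simp_rw [h2, h1]
  exact ⟨fun h => ⟨hy, h⟩, fun h => h.2⟩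

theorem nondegenerateLocus_eq :
    nondegenerateLocus (fun α => formField (conForm α)) = proj '' tnRegular := by
  ext x
  obtain ⟨y, hy, rfl⟩ := exists_proj x
  constructor
  · exact fun h => ⟨y, (proj_mem_nondegenerateLocus hy).1 h, rfl⟩
  · rintro ⟨z, hz, h⟩
    rw [← h]
    exact (proj_mem_nondegenerateLocus hz.1).2 hz

/-- The metric and the complex structures are determined by the forms, hence compatible with
`proj`. -/
theorem pullback_hk {y : Coord} (hy : y ∈ tnRegular) :
    pullBilin proj filledMetric y = hkG (fun α => conForm α y) ∧
    ∀ α v, filledComplex α (proj y) (mfderiv 𝓘(ℝ, Coord) 𝓘(ℝ, Coord) proj y v) =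
      mfderiv 𝓘(ℝ, Coord) 𝓘(ℝ, Coord) proj y (hkI (fun α => conForm α y) α v) := by
  obtain ⟨φ, hφ, h1, h2⟩ := exists_mfderiv_proj hy.1
  obtain ⟨L, hL⟩ := hφ.exists_equiv
  have h3 : ∀ α, (conForm α (φ y)).compContinuousLinearMap (L : Coord →L[ℝ] Coord) = conForm α y :=
    fun α => hL ▸ glueInvariant_conForm α y hy.1 φ hφ
  have hy' : φ y ∈ tnRegular := by
    refine ⟨hφ.mem hy.1, fun α => ?_⟩
    have h4 := hy.2 α
    rw [← h3] at h4
    exact comp_equiv_symm (conForm α (φ y)) L ▸ h4.comp_equiv L.symm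
  have hk := (isHKTriple_conForm hy').pullback L
  simp_rw [h3] at hk
  have h1' : (show Coord →L[ℝ] Coord from mfderiv 𝓘(ℝ, Coord) 𝓘(ℝ, Coord) proj y) = L :=
    h1.trans hL.symm
  constructor
  · rw [hk.eq_hkG]
    refine ContinuousLinearMap.ext fun u => ContinuousLinearMap.ext fun v => ?_
    change hkG (fun α => conForm α (chartAt Coord (proj y) (proj y)))
      ((show Coord →L[ℝ] Coord from mfderiv 𝓘(ℝ, Coord) 𝓘(ℝ, Coord) proj y) u)
      ((show Coord →L[ℝ] Coord from mfderiv 𝓘(ℝ, Coord) 𝓘(ℝ, Coord) proj y) v) = _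
    rw [h1', h2]
    rfl
  · intro α v
    change hkI (fun α => conForm α (chartAt Coord (proj y) (proj y))) α
      ((show Coord →L[ℝ] Coord from mfderiv 𝓘(ℝ, Coord) 𝓘(ℝ, Coord) proj y) v) =
      (show Coord →L[ℝ] Coord from mfderiv 𝓘(ℝ, Coord) 𝓘(ℝ, Coord) proj y) _
    rw [h1', h2, hk.eq_hkI]
    exact (L.apply_symm_apply _).symm

/-- The inverse chart is `proj`, and `pullback_hk` says that the endomorphism field commutes with
its derivative. -/
theorem chartEnd_filledComplex (x₀ : Filled) (α : Fin 3) {y : Coord}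
    (hy : y ∈ (chartAt Coord x₀).target) (hr : y ∈ tnRegular) :
    chartEnd x₀ (filledComplex α) y = hkI (fun α => conForm α y) α := by
  refine ContinuousLinearMap.ext fun v => ?_
  have h1 := (mdifferentiable_chart (I := 𝓘(ℝ, Coord)) x₀).comp_symm_deriv hy
  have h2 := (pullback_hk hr).2 α v
  rw [chart_symm_eq] at h1
  rw [chartEnd, chart_symm_eq]
  change mfderiv 𝓘(ℝ, Coord) 𝓘(ℝ, Coord) (chartAt Coord x₀) (proj y)
    (filledComplex α (proj y) (mfderiv 𝓘(ℝ, Coord) 𝓘(ℝ, Coord) proj y v)) = _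
  rw [h2]
  exact congrArg (fun L : Coord →L[ℝ] Coord => L (hkI (fun α => conForm α y) α v)) h1

theorem IsHyperkahlerOn.congr {F : Type} [NormedAddCommGroup F] [NormedSpace ℝ F] {U V : Set F}
    {g g' : F → F →L[ℝ] F →L[ℝ] ℝ} {I I' : Fin 3 → F → F →L[ℝ] F}
    {Φ Φ' : Fin 3 → F → F [⋀^Fin 2]→L[ℝ] ℝ} (h : IsHyperkahlerOn U g I Φ) (hV : IsOpen V)
    (hVU : V ⊆ U) (hg : EqOn g' g V) (hI : ∀ α, EqOn (I' α) (I α) V)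
    (hΦ : ∀ α, EqOn (Φ' α) (Φ α) V) : IsHyperkahlerOn V g' I' Φ' where
  smooth_metric := (h.smooth_metric.mono hVU).congr hg
  smooth_complex α := ((h.smooth_complex α).mono hVU).congr (hI α)
  smooth_form α := ((h.smooth_form α).mono hVU).congr (hΦ α)
  symm y hy := by rw [hg hy]; exact h.symm y (hVU hy)
  nondegenerate y hy := by rw [hg hy]; exact h.nondegenerate y (hVU hy)
  square y hy α := by rw [hI α hy]; exact h.square y (hVU hy) α
  quaternion y hy := by rw [hI 0 hy, hI 1 hy, hI 2 hy]; exact h.quaternion y (hVU hy)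
  kahler y hy α := by rw [hg hy, hI α hy, hΦ α hy]; exact h.kahler y (hVU hy) α
  closed y hy α := by
    rw [((hΦ α).eventuallyEq_of_mem (hV.mem_nhds hy)).extDeriv_eq]
    exact h.closed y (hVU hy) α
  integrable y hy α := by
    rw [((hI α).eventuallyEq_of_mem (hV.mem_nhds hy)).fderiv_eq, hI α hy]
    exact h.integrable y (hVU hy) α

theorem isHyperkahlerOnManifold_filled :
    IsHyperkahlerOnManifold (nondegenerateLocus fun α => formField (conForm α)) filledMetric
      filledComplex (fun α => formField (conForm α)) := by
  have ho : IsOpen (nondegenerateLocus fun α => formField (conForm α)) := by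
    rw [nondegenerateLocus_eq]
    exact isOpen_image_proj isOpen_tnRegular fun y hy => hy.1
  refine ⟨ho, fun x₀ => ?_⟩
  have hsub : chartDomain x₀ (nondegenerateLocus fun α => formField (conForm α)) ⊆ tnRegular := by
    intro y hy
    have h1 := hy.2
    rw [chart_symm_eq] at h1
    exact (proj_mem_nondegenerateLocus (chart_target_subset x₀ hy.1)).1 h1
  refine isHyperkahlerOn_conForm.congr ((chartAt Coord x₀).isOpen_inter_preimage_symm ho) hsub
    ?_ ?_ ?_
  · intro y hy
    rw [chart_symm_eq]
    exact (pullback_hk (hsub hy)).1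
  · exact fun α y hy => chartEnd_filledComplex x₀ α hy.1 (hsub hy)
  · intro α y hy
    rw [chart_symm_eq]
    exact pullForm_proj (glueInvariant_conForm α) (hsub hy).1

end ConifoldHK
end

noncomputable section
namespace ConifoldHK
open MeasureTheory Filter Topology

/-! ### The torus bundle inside the filled-in torus bundle -/

/-- An integer `l` with `|θ - 2 π l| ≤ π`. -/
def turns (θ : ℝ) : ℤ := toIocDiv Real.two_pi_pos (-Real.pi) θ

theorem turns_spec (θ : ℝ) : θ - 2 * Real.pi * turns θ ∈ Ioc (-Real.pi) Real.pi := by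
  have h := sub_toIocDiv_zsmul_mem_Ioc Real.two_pi_pos (-Real.pi) θ
  rw [zsmul_eq_mul] at h
  rw [turns]
  constructor <;> linarith [h.1, h.2]

/-- The presentation of the torus bundle by its covering. -/
def fillQ (x : Coord) : Filled := proj (taubNUT (deck 1 0 (-turns x.2.1) 0 x))

theorem deck_snd_fst (ε : ℕ) (k l m : ℤ) (x : Coord) :
    (deck ε k l m x).2.1 = x.2.1 + 2 * Real.pi * l := rfl

theorem deck_deck_one (k l m l' : ℤ) (x : Coord) :
    deck 1 0 l' 0 (deck 1 k l m x) = deck 1 k 0 (m - k * (l + l')) (deck 1 0 (l + l') 0 x) := by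
  refine Prod.ext ?_ (Prod.ext ?_ ?_)
  · simp [deck]
  · simp [deck]; ring
  · simp [deck]; ring

/-- The deck group is of Heisenberg type: turning θ_β by 2πl before winding k' times moves θ_{β^∨}
by a further 2πk'l. -/
theorem exists_deck_deck (k l m k' l' m' : ℤ) (x : Coord) :
    ∃ n : ℤ, deck 1 k' l' m' (deck 1 k l m x) = deck 1 (k + k') (l + l') n x := by
  refine ⟨m + m' + k' * l, Prod.ext ?_ (Prod.ext ?_ ?_)⟩
  · simp [deck]; ring
  · simp [deck]; ring
  · simp [deck]; ring

theorem taubNUT_deck_mem {x : Coord} (hx : x ∈ cover) {l : ℤ}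
    (hl : |x.2.1 + 2 * Real.pi * l| < 2 * Real.pi) : deck 1 0 l 0 x ∈ coverSlab :=
  ⟨deck_mem_cover _ _ _ _ hx, abs_lt.1 hl⟩

theorem proj_taubNUT_deck_aux {x : Coord} (hx : x ∈ cover) {l : ℤ}
    (h0 : |x.2.1 + 2 * Real.pi * l| < 2 * Real.pi)
    (h1 : |x.2.1 + 2 * Real.pi * (l - 1 : ℤ)| < 2 * Real.pi) :
    proj (taubNUT (deck 1 0 (l - 1) 0 x)) = proj (taubNUT (deck 1 0 l 0 x)) := by
  have hpi := Real.pi_pos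
  have hm0 := taubNUT_mem (taubNUT_deck_mem hx h0)
  have hm1 := taubNUT_mem (taubNUT_deck_mem hx h1)
  push_cast at h1
  rw [abs_lt] at h0 h1
  have ha : (deck 1 0 l 0 x).2.1 ∈ Ioo 0 (2 * Real.pi) := by
    rw [deck_snd_fst]; constructor <;> linarith
  have hg := glue_taubNUT ha
  rw [deck_deck_one] at hg
  have h2 : deck 1 0 0 (0 - 0 * (l + -1)) (deck 1 0 (l + -1) 0 x) = deck 1 0 (l - 1) 0 x := by
    simp [deck, sub_eq_add_neg]
  rw [h2] at hg
  refine (proj_eq_iff hm1 hm0).2 (Glued.symm (Or.inr (Or.inl ⟨⟨hm0, ?_⟩, hg.symm⟩)))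
  rw [show moment (taubNUT (deck 1 0 l 0 x)) = _ from congrArg Prod.snd (zBase_taubNUT _)]
  exact ha.1

/-- Admissible translates differ by at most one turn, and one turn is a gluing. Hence the
normalisation by `turns` is immaterial and causes no discontinuity. -/
theorem proj_taubNUT_deck {x : Coord} (hx : x ∈ cover) {l l' : ℤ}
    (hl : |x.2.1 + 2 * Real.pi * l| < 2 * Real.pi)
    (hl' : |x.2.1 + 2 * Real.pi * l'| < 2 * Real.pi) :
    proj (taubNUT (deck 1 0 l 0 x)) = proj (taubNUT (deck 1 0 l' 0 x)) := by
  have hpi := Real.pi_pos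
  have h1 := abs_lt.1 hl
  have h2 := abs_lt.1 hl'
  have h3 : l < l' + 2 := by
    have : 2 * Real.pi * l < 2 * Real.pi * (l' + 2) := by linarith
    exact_mod_cast lt_of_mul_lt_mul_left this (by positivity)
  have h4 : l' < l + 2 := by
    have : 2 * Real.pi * l' < 2 * Real.pi * (l + 2) := by linarith
    exact_mod_cast lt_of_mul_lt_mul_left this (by positivity)
  obtain rfl | rfl | rfl : l = l' ∨ l = l' - 1 ∨ l' = l - 1 := by omega
  · rfl
  · exact proj_taubNUT_deck_aux hx hl' hl
  · exact (proj_taubNUT_deck_aux hx hl hl').symm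

theorem abs_turns_lt (θ : ℝ) : |θ + 2 * Real.pi * (-turns θ : ℤ)| < 2 * Real.pi := by
  have hpi := Real.pi_pos
  have h := turns_spec θ
  push_cast
  rw [abs_lt]
  constructor <;> linarith [h.1, h.2]

theorem fillQ_eq {x : Coord} (hx : x ∈ cover) {l : ℤ}
    (hl : |x.2.1 + 2 * Real.pi * l| < 2 * Real.pi) : fillQ x = proj (taubNUT (deck 1 0 l 0 x)) :=
  proj_taubNUT_deck hx (abs_turns_lt _) hl

theorem fillQ_mem {x : Coord} (hx : x ∈ cover) :
    deck 1 0 (-turns x.2.1) 0 x ∈ coverSlab := taubNUT_deck_mem hx (abs_turns_lt _)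

theorem fillQ_deck {x : Coord} (hx : x ∈ cover) (k l m : ℤ) : fillQ (deck 1 k l m x) = fillQ x := by
  set l' := -turns (deck 1 k l m x).2.1
  have h1 : |x.2.1 + 2 * Real.pi * (l + l' : ℤ)| < 2 * Real.pi := by
    have := abs_turns_lt (deck 1 k l m x).2.1
    rw [deck_snd_fst] at this
    push_cast at this ⊢
    rw [show (l' : ℝ) = -(turns (deck 1 k l m x).2.1 : ℝ) by simp [l']]
    rw [mul_add, ← add_assoc]
    exact this
  rw [fillQ_eq hx h1, fillQ, deck_deck_one, taubNUT_deck]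

theorem moment_taubNUT (x : Coord) : moment (taubNUT x) = x.2.1 :=
  congrArg Prod.snd (zBase_taubNUT x)

theorem fillT_fillQ {x : Coord} (hx : x ∈ cover) : fillT (fillQ x) = Complex.exp x.1 := by
  rw [fillQ, fillT_proj (taubNUT_mem (fillQ_mem hx)), zfst_mul_zsnd_taubNUT]
  simp [deck]

theorem fillU_fillQ {x : Coord} (hx : x ∈ cover) : fillU (fillQ x) = Circle.exp x.2.1 := by
  rw [fillQ, fillU_proj (taubNUT_mem (fillQ_mem hx)), moment_taubNUT, deck_snd_fst,
    Circle.exp_eq_exp]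
  exact ⟨-turns x.2.1, by ring⟩

theorem image_fillQ : fillQ '' cover = {x | fillT x ≠ 0} := by
  ext x
  constructor
  · rintro ⟨y, hy, rfl⟩
    rw [mem_ofPred_eq, fillT_fillQ hy]
    exact Complex.exp_ne_zero _
  · intro hx
    obtain ⟨y, hy, rfl⟩ := exists_proj x
    rw [mem_ofPred_eq, fillT_proj hy] at hx
    obtain ⟨z, hz, rfl⟩ := exists_taubNUT_eq hy hx
    refine ⟨z, hz.1, ?_⟩
    rw [fillQ_eq hz.1 (l := 0) (by simpa using abs_lt.2 hz.2)]
    congr 2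
    simp [deck]

theorem exists_deck_of_proj_eq {x y : Coord} (hx : x ∈ coverSlab) (hy : y ∈ coverSlab)
    (h : proj (taubNUT x) = proj (taubNUT y)) : ∃ k l m : ℤ, y = deck 1 k l m x := by
  have aux : ∀ {x y : Coord}, taubNUT x ∈ tnPos → taubNUT y = glue (taubNUT x) → x ∈ coverSlab →
      ∃ k l m : ℤ, y = deck 1 k l m x := by
    intro x y hp hg hx
    rw [glue_taubNUT ⟨moment_taubNUT x ▸ hp.2, hx.2.2⟩] at hg
    obtain ⟨k, m, rfl⟩ := taubNUT_eq_iff hg.symm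
    obtain ⟨n, hn⟩ := exists_deck_deck 0 (-1) 0 k 0 m x
    exact ⟨_, _, n, hn⟩
  rcases (proj_eq_iff (taubNUT_mem hx) (taubNUT_mem hy)).1 h with h | ⟨h1, h⟩ | ⟨h1, h⟩
  · obtain ⟨k, m, hkm⟩ := taubNUT_eq_iff h.symm
    exact ⟨k, 0, m, hkm⟩
  · exact aux h1 h hx
  · have h2 := unglue_mem h1
    rw [← h] at h2
    obtain ⟨k, l, m, rfl⟩ := aux (y := x) h2 (by rw [h, glue_unglue h1]) hy
    obtain ⟨n, hn⟩ := exists_deck_deck k l m (-k) (-l) 0 y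
    obtain ⟨n', hn'⟩ := exists_deck_deck k l m (-k) (-l) (-n) y
    refine ⟨-k, -l, -n, ?_⟩
    refine Prod.ext ?_ (Prod.ext ?_ ?_)
    · simp [deck]
    · simp [deck]
    · have h3 := congrArg (fun z : Coord => z.2.2) hn
      simp [deck] at h3 ⊢
      linarith

theorem fillQ_eq_iff {x y : Coord} (hx : x ∈ cover) (hy : y ∈ cover) :
    fillQ x = fillQ y ↔ SamePoint 1 x y := by
  rw [samePoint_iff]
  constructor
  · intro h
    obtain ⟨k, l, m, h1⟩ := exists_deck_of_proj_eq (fillQ_mem hx) (fillQ_mem hy) h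
    obtain ⟨n, hn⟩ := exists_deck_deck 0 (-turns x.2.1) 0 k l m x
    rw [hn] at h1
    have h2 : y = deck 1 0 (turns y.2.1) 0 (deck 1 0 (-turns y.2.1) 0 y) := by
      refine Prod.ext ?_ (Prod.ext ?_ ?_) <;> simp [deck]
    rw [h1] at h2
    obtain ⟨n', hn'⟩ := exists_deck_deck (0 + k) (-turns x.2.1 + l) n 0 (turns y.2.1) 0 x
    exact ⟨_, _, n', h2.trans hn'⟩
  · rintro ⟨k, l, m, rfl⟩
    exact (fillQ_deck hx k l m).symm

/-! ### The covering map as a local diffeomorphism, and pull-backs along it -/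

theorem isLocalDiffeomorphAt_of_injective {f : Coord → Coord} (hf : ContDiff ℝ ∞ f)
    (hi : ∀ x, Function.Injective (fderiv ℝ f x)) (x : Coord) :
    IsLocalDiffeomorphAt 𝓘(ℝ, Coord) 𝓘(ℝ, Coord) ∞ f x := by
  have hL : ∀ x, ∃ L : Coord ≃L[ℝ] Coord, HasFDerivAt f (L : Coord →L[ℝ] Coord) x := fun x => by
    obtain ⟨L, hL⟩ := exists_equiv_of_injective (hi x)
    exact ⟨L, hL ▸ (hf.differentiable (by simp) x).hasFDerivAt⟩
  obtain ⟨L, hLx⟩ := hL x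
  set e := hf.contDiffAt.toOpenPartialHomeomorph f hLx (by simp)
  have he : (e : Coord → Coord) = f := hf.contDiffAt.toOpenPartialHomeomorph_coe hLx (by simp)
  refine ⟨{ e.toPartialEquiv with
    open_source := e.open_source
    open_target := e.open_target
    contMDiffOn_toFun := ?_
    contMDiffOn_invFun := ?_ },
    hf.contDiffAt.mem_toOpenPartialHomeomorph_source hLx (by simp), fun z _ => ?_⟩
  · exact (he ▸ hf : ContDiff ℝ ∞ e).contMDiff.contMDiffOn
  · intro z hz
    obtain ⟨L', hL'⟩ := hL (e.symm z)
    exact (e.contDiffAt_symm hz (he ▸ hL') (he ▸ hf.contDiffAt)).contMDiffAt.contMDiffWithinAt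
  · exact congrFun he.symm z

theorem contDiff_deck (ε : ℕ) (k l m : ℤ) : ContDiff ℝ ∞ (deck ε k l m) := by
  unfold deck
  fun_prop

theorem injective_fderiv_taubNUT_deck (l : ℤ) (x : Coord) :
    Function.Injective (fderiv ℝ (taubNUT ∘ deck 1 0 l 0) x) := by
  rw [fderiv_comp x (hasFDerivAt_taubNUT _).differentiableAt (differentiable_deck _ _ _ _ x)]
  refine (injective_fderiv_taubNUT _).comp fun u v h => ?_
  change fderiv ℝ (deck 1 0 l 0) x u = fderiv ℝ (deck 1 0 l 0) x v at h
  rw [fderiv_deck_apply, fderiv_deck_apply] at h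
  simpa [Prod.ext_iff] using h

/-- Although `turns` jumps, the translate used at x remains admissible nearby because |θ_β| < 2π is
an open condition, so `fillQ` is locally a composition of smooth maps. -/
theorem fillQ_eventuallyEq {x : Coord} (hx : x ∈ cover) :
    fillQ =ᶠ[𝓝 x] proj ∘ (taubNUT ∘ deck 1 0 (-turns x.2.1) 0) := by
  have ho : IsOpen {z : Coord | |z.2.1 + 2 * Real.pi * (-turns x.2.1 : ℤ)| < 2 * Real.pi} :=
    isOpen_lt (by fun_prop) continuous_const
  filter_upwards [isOpen_cover.mem_nhds hx, ho.mem_nhds (abs_turns_lt x.2.1)] with z hz hl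
  exact fillQ_eq hz hl

theorem isLocalDiffeomorphAt_congr {f g : Coord → Filled} {x : Coord}
    (h : IsLocalDiffeomorphAt 𝓘(ℝ, Coord) 𝓘(ℝ, Coord) ∞ g x) (hfg : f =ᶠ[𝓝 x] g) :
    IsLocalDiffeomorphAt 𝓘(ℝ, Coord) 𝓘(ℝ, Coord) ∞ f x := by
  obtain ⟨Φ, hx, he⟩ := h
  obtain ⟨V, hV, hVo, hxV⟩ := mem_nhds_iff.1 hfg
  have hU : IsOpen (Φ.source ∩ V) := Φ.open_source.inter hVo
  refine ⟨{ Φ.toPartialEquiv.restr V with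
    open_source := hU
    open_target := ?_
    contMDiffOn_toFun := Φ.contMDiffOn_toFun.mono inter_subset_left
    contMDiffOn_invFun := Φ.contMDiffOn_invFun.mono inter_subset_left }, ⟨hx, hxV⟩, ?_⟩
  · exact Φ.contMDiffOn_invFun.continuousOn.isOpen_inter_preimage Φ.open_target hVo
  · intro z hz
    exact (hV hz.2).trans (he hz.1)

theorem isLocalDiffeomorphOn_fillQ :
    IsLocalDiffeomorphOn 𝓘(ℝ, Coord) 𝓘(ℝ, Coord) ∞ fillQ cover := by
  rintro ⟨x, hx⟩
  refine isLocalDiffeomorphAt_congr ?_ (fillQ_eventuallyEq hx)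
  exact (isLocalDiffeomorphAt_of_injective (contDiff_taubNUT.comp (contDiff_deck _ _ _ _))
    (injective_fderiv_taubNUT_deck _) x).comp 𝓘(ℝ, Coord) Filled
    (isLocalDiffeomorphAt_proj (taubNUT_mem (fillQ_mem hx)))

theorem mfderiv_fillQ {x : Coord} (hx : x ∈ cover) :
    (show Coord →L[ℝ] Coord from mfderiv 𝓘(ℝ, Coord) 𝓘(ℝ, Coord) fillQ x) =
      (show Coord →L[ℝ] Coord from mfderiv 𝓘(ℝ, Coord) 𝓘(ℝ, Coord) proj
        (taubNUT (deck 1 0 (-turns x.2.1) 0 x))) ∘L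
        fderiv ℝ (taubNUT ∘ deck 1 0 (-turns x.2.1) 0) x := by
  have h1 := (isLocalDiffeomorphAt_proj (taubNUT_mem (fillQ_mem hx))).mdifferentiableAt (by simp)
  have h2 : DifferentiableAt ℝ (taubNUT ∘ deck 1 0 (-turns x.2.1) 0) x :=
    (hasFDerivAt_taubNUT _).differentiableAt.comp x (differentiable_deck _ _ _ _ x)
  have h3 := (fillQ_eventuallyEq hx).mfderiv_eq (I := 𝓘(ℝ, Coord)) (I' := 𝓘(ℝ, Coord))
  refine Eq.trans h3 ?_
  have h4 := mfderiv_comp x h1 h2.mdifferentiableAt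
  rw [mfderiv_eq_fderiv] at h4
  exact h4

theorem pullForm_fillQ {Ψ F : Coord → Coord [⋀^Fin 2]→L[ℝ] ℝ} (hi : GlueInvariant Ψ)
    (h : ∀ x ∈ coverSlab, (Ψ (taubNUT x)).compContinuousLinearMap (fderiv ℝ taubNUT x) = F x)
    (hF : ∀ x ∈ cover, ∀ l, (F (deck 1 0 l 0 x)).compContinuousLinearMap
      (fderiv ℝ (deck 1 0 l 0) x) = F x) {x : Coord} (hx : x ∈ cover) :
    pullForm fillQ (formField Ψ) x = F x := by
  have h1 := pullForm_proj hi (taubNUT_mem (fillQ_mem hx))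
  have h2 : pullForm fillQ (formField Ψ) x =
      (pullForm proj (formField Ψ) (taubNUT (deck 1 0 (-turns x.2.1) 0 x))).compContinuousLinearMap
        (fderiv ℝ (taubNUT ∘ deck 1 0 (-turns x.2.1) 0) x) := by
    refine congrArg (fun L : Coord →L[ℝ] Coord => ContinuousAlternatingMap.compContinuousLinearMap
      (M := Coord) (formField Ψ (fillQ x)) L) (mfderiv_fillQ hx)
  rw [h2, h1, fderiv_comp x (hasFDerivAt_taubNUT _).differentiableAt
    (differentiable_deck _ _ _ _ x), ← comp_comp_form, h _ (fillQ_mem hx), hF x hx]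

theorem fillQ_mem_nondegenerateLocus {x : Coord} (hx : x ∈ cover) :
    fillQ x ∈ nondegenerateLocus (fun α => formField (conForm α)) ↔
      (conifold 1).HorizontallyNondegenerate x := by
  have he := isElectric_conifold 1 (exp_mem_strip hx)
  rw [← he.nondegenerate_iff, fillQ, proj_mem_nondegenerateLocus (taubNUT_mem (fillQ_mem hx))]
  obtain ⟨L, hL⟩ := exists_equiv_of_injective (injective_fderiv_taubNUT_deck (-turns x.2.1) x)
  have h1 : ∀ α, (conForm α (taubNUT (deck 1 0 (-turns x.2.1) 0 x))).compContinuousLinearMap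
      (L : Coord →L[ℝ] Coord) = (conifold 1).omega α x := fun α => by
    rw [hL, fderiv_comp x (hasFDerivAt_taubNUT _).differentiableAt
      (differentiable_deck _ _ _ _ x), ← comp_comp_form,
      conForm_taubNUT_eq 1 α (fillQ_mem hx).1 (fillQ_mem hx).2, omega_conifold_deck 1 hx]
  constructor
  · exact fun h α => h1 α ▸ (h.2 α).comp_equiv L
  · refine fun h => ⟨taubNUT_mem (fillQ_mem hx), fun α => ?_⟩
    have h2 := h α
    rw [← h1] at h2
    exact comp_equiv_symm (conForm α (taubNUT (deck 1 0 (-turns x.2.1) 0 x))) L ▸ h2.comp_equiv L.symm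

/-- The pulled-back metric and the instanton corrected metric both complete the same three forms to
a hyperkähler triple, so they agree by uniqueness. -/
theorem pullBilin_fillQ {x : Coord} (hx : x ∈ cover) (h : (conifold 1).HorizontallyNondegenerate x)
    (u v : Coord) : pullBilin fillQ filledMetric x u v = (conifold 1).metric x u v := by
  have hr := (proj_mem_nondegenerateLocus (taubNUT_mem (fillQ_mem hx))).1
    ((fillQ_mem_nondegenerateLocus hx).2 h)
  obtain ⟨L, hL⟩ := exists_equiv_of_injective (injective_fderiv_taubNUT_deck (-turns x.2.1) x)
  have h1 : ∀ α, (conForm α (taubNUT (deck 1 0 (-turns x.2.1) 0 x))).compContinuousLinearMap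
      (L : Coord →L[ℝ] Coord) = (conifold 1).omega α x := fun α => by
    rw [hL, fderiv_comp x (hasFDerivAt_taubNUT _).differentiableAt
      (differentiable_deck _ _ _ _ x), ← comp_comp_form,
      conForm_taubNUT_eq 1 α (fillQ_mem hx).1 (fillQ_mem hx).2, omega_conifold_deck 1 hx]
  have hk := (isHKTriple_conForm hr).pullback L
  simp_rw [h1] at hk
  obtain ⟨g, I, hg, hm⟩ := (isElectric_conifold 1 (exp_mem_strip hx)).exists_isHKTriple h
  have h3 := hk.eq_hkG.symm.trans hg.eq_hkG
  rw [← hm, ← h3, hL, ← (pullback_hk hr).1]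
  change filledMetric (fillQ x)
    ((show Coord →L[ℝ] Coord from mfderiv 𝓘(ℝ, Coord) 𝓘(ℝ, Coord) fillQ x) u)
    ((show Coord →L[ℝ] Coord from mfderiv 𝓘(ℝ, Coord) 𝓘(ℝ, Coord) fillQ x) v) = _
  rw [mfderiv_fillQ hx]
  rfl

end ConifoldHK
end

noncomputable section
namespace ConifoldHK
open MeasureTheory Filter Topology

/-! ### The pinched torus -/

/-- The points of `ℂ²` over `t = 0`. -/
def pinchPt (a : ℝ) (w : Circle) : Coord :=
  mkZ (Real.sqrt (max a 0 / Real.pi) * w) (Real.sqrt (max (-a) 0 / Real.pi) * (starRingEnd ℂ) w)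

theorem zfst_mul_zsnd_pinchPt (a : ℝ) (w : Circle) :
    zfst (pinchPt a w) * zsnd (pinchPt a w) = 0 := by
  rw [pinchPt, zfst_mkZ, zsnd_mkZ]
  rcases le_total a 0 with h | h <;> simp [h]

theorem moment_pinchPt (a : ℝ) (w : Circle) : moment (pinchPt a w) = a := by
  have hpi := Real.pi_pos
  rw [moment, pinchPt, zfst_mkZ, zsnd_mkZ, Complex.normSq_mul, Complex.normSq_mul,
    Complex.normSq_conj, Complex.normSq_ofReal, Complex.normSq_ofReal,
    Real.mul_self_sqrt (by positivity), Real.mul_self_sqrt (by positivity), Circle.normSq_coe]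
  rcases le_total a 0 with h | h <;> simp [h] <;> field_simp

theorem pinchPt_mem {a : ℝ} (ha : |a| < 2 * Real.pi) (w : Circle) : pinchPt a w ∈ tnDomain := by
  refine ⟨?_, ?_⟩
  · rw [zfst_mul_zsnd_pinchPt]
    exact mem_insert _ _
  · rwa [moment_pinchPt]

theorem continuous_pinchPt : Continuous fun p : ℝ × Circle => pinchPt p.1 p.2 := by
  refine coordC.symm.continuous.comp (Continuous.prodMk ?_ ?_)
  · fun_prop
  · have h : Continuous fun p : ℝ × Circle => (starRingEnd ℂ) (p.2 : ℂ) :=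
      Complex.continuous_conj.comp (by fun_prop)
    have h2 : Continuous fun p : ℝ × Circle => (Real.sqrt (max (-p.1) 0 / Real.pi) : ℂ) := by
      fun_prop
    exact h2.mul h

/-- Gluing carries the disc w = 0 to the disc z = 0 with conjugate phase; the conjugation built into
`pinchPt` therefore keeps the circle parameter fixed. -/
theorem glue_pinchPt {a : ℝ} (h0 : 0 < a) (h1 : a < 2 * Real.pi) (w : Circle) :
    glue (pinchPt a w) = pinchPt (a - 2 * Real.pi) w := by
  have hpi := Real.pi_pos
  have hn : glueNormSq (pinchPt a w) = (2 * Real.pi - a) / Real.pi := by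
    have h2 : momNorm (0, a - 2 * Real.pi) = 2 * Real.pi - a := by
      refine (sq_eq_sq₀ ((abs_nonneg _).trans (abs_le_momNorm _)) (by linarith)).1 ?_
      rw [momNorm_sq]
      simp
      ring
    rw [glueNormSq, zfst_mul_zsnd_pinchPt, moment_pinchPt, h2]
    field_simp
    ring
  have hz : zfst (pinchPt a w) = Real.sqrt (a / Real.pi) * w := by
    rw [pinchPt, zfst_mkZ, max_eq_left h0.le]
  have hz2 : Complex.normSq (zfst (pinchPt a w)) = a / Real.pi := by
    rw [hz, Complex.normSq_mul, Complex.normSq_ofReal, Real.mul_self_sqrt (by positivity),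
      Circle.normSq_coe, mul_one]
  refine coord_ext_z ?_ ?_
  · rw [glue, zfst_mkZ, zfst_mul_zsnd_pinchPt, zero_div, pinchPt, zfst_mkZ,
      max_eq_right (by linarith)]
    simp
  · rw [glue, zsnd_mkZ, glueSnd, hn, hz2, hz, map_mul, Complex.conj_ofReal, pinchPt, zsnd_mkZ,
      max_eq_left (by linarith), mul_right_comm, ← Complex.ofReal_mul,
      ← Real.sqrt_mul (by positivity), mul_div_cancel₀ _ (by positivity)]
    congr 4
    ring

theorem proj_pinchPt_eq {a a' : ℝ} (ha : |a| < 2 * Real.pi) (ha' : |a'| < 2 * Real.pi)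
    (h : Circle.exp a = Circle.exp a') (w : Circle) :
    proj (pinchPt a w) = proj (pinchPt a' w) := by
  have hpi := Real.pi_pos
  have aux : ∀ {b : ℝ}, |b| < 2 * Real.pi → |b - 2 * Real.pi| < 2 * Real.pi →
      proj (pinchPt b w) = proj (pinchPt (b - 2 * Real.pi) w) := by
    intro b hb hb'
    have h1 := abs_lt.1 hb
    have h2 := abs_lt.1 hb'
    have h3 : 0 < b := by linarith
    refine (proj_eq_iff (pinchPt_mem hb w) (pinchPt_mem hb' w)).2 (Or.inr (Or.inl
      ⟨⟨pinchPt_mem hb w, by rwa [moment_pinchPt]⟩, (glue_pinchPt h3 h1.2 w).symm⟩))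
  obtain ⟨k, hk⟩ := Circle.exp_eq_exp.1 h
  have h1 := abs_lt.1 ha
  have h2 := abs_lt.1 ha'
  have hk1 : k < 2 := by
    have : (k : ℝ) * (2 * Real.pi) < 2 * (2 * Real.pi) := by linarith
    exact_mod_cast lt_of_mul_lt_mul_right this (by positivity)
  have hk2 : -2 < k := by
    have : (-2 : ℝ) * (2 * Real.pi) < k * (2 * Real.pi) := by linarith
    exact_mod_cast lt_of_mul_lt_mul_right this (by positivity)
  obtain rfl | rfl | rfl : k = -1 ∨ k = 0 ∨ k = 1 := by omega
  · have h3 : a = a' - 2 * Real.pi := by push_cast at hk; linarith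
    subst h3
    exact (aux ha' ha).symm
  · have h3 : a = a' := by push_cast at hk; linarith
    rw [h3]
  · have h3 : a' = a - 2 * Real.pi := by push_cast at hk; linarith
    subst h3
    exact aux ha ha'

/-- The parametrisation of the fibre over `t = 0`. -/
def pinch (p : Circle × Circle) : Filled := proj (pinchPt (Complex.arg p.1) p.2)

theorem abs_arg_lt (z : ℂ) : |Complex.arg z| < 2 * Real.pi :=
  (Complex.abs_arg_le_pi z).trans_lt (by linarith [Real.pi_pos])

theorem pinch_exp {a : ℝ} (ha : |a| < 2 * Real.pi) (w : Circle) :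
    pinch (Circle.exp a, w) = proj (pinchPt a w) :=
  proj_pinchPt_eq (abs_arg_lt _) ha (Circle.exp_arg _) w

/-- The argument jumps at -1, so continuity is tested after composing with the open quotient map
from (-2π, 2π), where `pinch_exp` allows any lift of the angle. -/
theorem continuous_pinch : Continuous pinch := by
  have hpi := Real.pi_pos
  have ho : IsOpenQuotientMap fun a : Ioo (-(2 * Real.pi)) (2 * Real.pi) => Circle.exp a := by
    refine ⟨fun v => ?_, Circle.exp.continuous.comp continuous_subtype_val,
      isLocalHomeomorph_circleExp.isOpenMap.comp isOpen_Ioo.isOpenMap_subtype_val⟩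
    exact ⟨⟨Complex.arg v, abs_lt.1 (abs_arg_lt v)⟩, Circle.exp_arg v⟩
  have hq := ho.prodMap (IsOpenQuotientMap.id (X := Circle))
  rw [hq.isQuotientMap.continuous_iff]
  have h : pinch ∘ Prod.map (fun a : Ioo (-(2 * Real.pi)) (2 * Real.pi) => Circle.exp a) id =
      fun p => proj (pinchPt p.1 p.2) := by
    funext p
    exact pinch_exp (abs_lt.2 p.1.2) p.2
  rw [h]
  exact continuousOn_proj.comp_continuous (continuous_pinchPt.comp
    ((continuous_subtype_val.comp continuous_fst).prodMk continuous_snd))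
    fun p => pinchPt_mem (abs_lt.2 p.1.2) p.2

theorem fillU_pinch (v w : Circle) : fillU (pinch (v, w)) = v := by
  rw [pinch, fillU_proj (pinchPt_mem (abs_arg_lt _) _), moment_pinchPt, Circle.exp_arg]

theorem exists_circle_eq (z : ℂ) : ∃ w : Circle, z = Real.sqrt (Complex.normSq z) * w := by
  refine ⟨Circle.exp (Complex.arg z), ?_⟩
  rw [Complex.normSq_eq_norm_sq, Real.sqrt_sq (norm_nonneg _), Circle.coe_exp,
    Complex.norm_mul_exp_arg_mul_I]

theorem range_pinch : range pinch = fillT ⁻¹' {0} := by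
  have hpi := Real.pi_pos
  ext x
  constructor
  · rintro ⟨⟨v, w⟩, rfl⟩
    rw [mem_preimage, pinch, fillT_proj (pinchPt_mem (abs_arg_lt _) _), zfst_mul_zsnd_pinchPt]
    rfl
  · intro hx
    obtain ⟨y, hy, rfl⟩ := exists_proj x
    rw [mem_preimage, fillT_proj hy, mem_singleton_iff, mul_eq_zero] at hx
    suffices h : ∃ w, pinchPt (moment y) w = y by
      obtain ⟨w, hw⟩ := h
      exact ⟨(Circle.exp (moment y), w), by rw [pinch_exp hy.2, hw]⟩
    rcases hx with h | h
    · obtain ⟨w, hw⟩ := exists_circle_eq ((starRingEnd ℂ) (zsnd y))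
      have hm : moment y = -(Real.pi * Complex.normSq (zsnd y)) := by simp [moment, h]
      have h0 := mul_nonneg hpi.le (Complex.normSq_nonneg (zsnd y))
      refine ⟨w, coord_ext_z ?_ ?_⟩
      · rw [pinchPt, zfst_mkZ, hm, max_eq_right (by linarith), h]
        simp
      · have hw' := congrArg (starRingEnd ℂ) hw
        rw [Complex.conj_conj, map_mul, Complex.conj_ofReal, Complex.normSq_conj] at hw'
        rw [pinchPt, zsnd_mkZ, hm, neg_neg, max_eq_left h0, mul_div_cancel_left₀ _ hpi.ne', ← hw']
    · obtain ⟨w, hw⟩ := exists_circle_eq (zfst y)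
      have hm : moment y = Real.pi * Complex.normSq (zfst y) := by simp [moment, h]
      have h0 := mul_nonneg hpi.le (Complex.normSq_nonneg (zfst y))
      refine ⟨w, coord_ext_z ?_ ?_⟩
      · rw [pinchPt, zfst_mkZ, hm, max_eq_left h0, mul_div_cancel_left₀ _ hpi.ne', ← hw]
      · rw [pinchPt, zsnd_mkZ, hm, max_eq_right (by linarith), h]
        simp

/-- For v = 1 the angle is 0 and both coordinates vanish, whatever w is; for any other v one
coordinate is non-zero and carries the phase w. -/
theorem pinch_eq_iff (v w v' w' : Circle) :
    pinch (v, w) = pinch (v', w') ↔ v = v' ∧ (v = 1 ∨ w = w') := by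
  have hpi := Real.pi_pos
  constructor
  · intro h
    have hv : v = v' := by rw [← fillU_pinch v w, h, fillU_pinch]
    subst hv
    refine ⟨rfl, ?_⟩
    have hy := pinchPt_mem (abs_arg_lt v) w
    have hy' := pinchPt_mem (abs_arg_lt v) w'
    have h1 : pinchPt (Complex.arg v) w' = pinchPt (Complex.arg v) w := by
      have hm : moment (pinchPt (Complex.arg v) w') = moment (pinchPt (Complex.arg v) w) := by
        rw [moment_pinchPt, moment_pinchPt]
      rcases (proj_eq_iff hy hy').1 h with h1 | ⟨h1, h2⟩ | ⟨h1, h2⟩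
      · exact h1
      · rw [h2, moment_glue h1.2 (moment_lt h1.1)] at hm
        linarith
      · rw [h2, moment_unglue h1] at hm
        linarith
    rcases lt_trichotomy (Complex.arg v) 0 with h2 | h2 | h2
    · have h3 := congrArg zsnd h1
      rw [pinchPt, pinchPt, zsnd_mkZ, zsnd_mkZ, max_eq_left (by linarith)] at h3
      have h4 : (Real.sqrt (-Complex.arg v / Real.pi) : ℂ) ≠ 0 := by
        exact_mod_cast (Real.sqrt_pos.2 (div_pos (by linarith) hpi)).ne'
      have h5 := mul_left_cancel₀ h4 h3
      exact Or.inr (Circle.ext ((starRingEnd ℂ).injective h5).symm)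
    · left
      rw [← Circle.exp_arg v, h2, Circle.exp_zero]
    · have h3 := congrArg zfst h1
      rw [pinchPt, pinchPt, zfst_mkZ, zfst_mkZ, max_eq_left h2.le] at h3
      have h4 : (Real.sqrt (Complex.arg v / Real.pi) : ℂ) ≠ 0 := by
        exact_mod_cast (Real.sqrt_pos.2 (div_pos h2 hpi)).ne'
      exact Or.inr (Circle.ext (mul_left_cancel₀ h4 h3).symm)
  · rintro ⟨rfl, rfl | rfl⟩
    · simp [pinch, pinchPt]
    · rfl

/-! ### The completion -/

theorem contDiff_exp_moment : ContDiff ℝ ∞ fun y : Coord => Complex.exp (moment y * Complex.I) :=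
  ((Complex.ofRealCLM.contDiff.comp contDiff_moment).mul contDiff_const).cexp

theorem coe_fillU_proj {y : Coord} (hy : y ∈ tnDomain) :
    (fillU (proj y) : ℂ) = Complex.exp (moment y * Complex.I) := by
  rw [fillU_proj hy, Circle.coe_exp]

theorem contDiff_zfst_mul_zsnd : ContDiff ℝ ∞ fun y : Coord => zfst y * zsnd y :=
  zfst.contDiff.mul zsnd.contDiff

/-- The filled-in torus bundle completes the bundle of twisted characters. -/
def filledCompletion : Completion Filled where
  q := fillQ
  t := fillT
  u := fillU
  smooth_t := contMDiff_of_proj contDiff_zfst_mul_zsnd fun _ hy => fillT_proj hy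
  smooth_u := contMDiff_of_proj contDiff_exp_moment fun _ hy => coe_fillU_proj hy
  mem_fullM x := by
    obtain ⟨y, hy, rfl⟩ := exists_proj x
    rw [fillT_proj hy]
    exact hy.1
  proper _ hK hc := isCompact_fillT_preimage hK hc
  local_q := isLocalDiffeomorphOn_fillQ
  image_q := image_fillQ
  q_eq_iff _ hx _ hy := fillQ_eq_iff hx hy
  t_q _ hx := fillT_fillQ hx
  u_q _ hx := fillU_fillQ hx
  pinched := ⟨pinch, continuous_pinch, range_pinch, fillU_pinch, pinch_eq_iff⟩

/-- The definition evaluates η at the principal argument, the chart at the moment map; they differ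
by a multiple of 2π, which periodicity absorbs. The one-form u⁻¹du has imaginary part the
differential of the moment map. -/
theorem pullBase_filledCompletion {η : Base → Base [⋀^Fin 2]→L[ℝ] ℝ} {x : Filled}
    (hη : ∀ θ : ℝ, η (fillT x, θ + 2 * Real.pi) = η (fillT x, θ)) :
    filledCompletion.pullBase η x = (η (zBase (chartAt Coord x x))).compContinuousLinearMap
      (fderiv ℝ zBase (chartAt Coord x x)) := by
  set y := chartAt Coord x x with hy
  have hyW : y ∈ tnDomain := chart_mem_tnDomain (mem_chart_source _ x)
  have hx : proj y = x := proj_chart (mem_chart_source _ x)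
  have h1 := mfderiv_of_proj contDiff_zfst_mul_zsnd (fun _ hy => fillT_proj hy) x
  have h2 := mfderiv_of_proj (f := fun x => (fillU x : ℂ)) contDiff_exp_moment (fun _ hy => coe_fillU_proj hy) x
  have ht : fillT x = zfst y * zsnd y := by rw [← hx, fillT_proj hyW]
  have hu : fillU x = Circle.exp (moment y) := by rw [← hx, fillU_proj hyW]
  have hm : HasFDerivAt moment (fderiv ℝ moment y) y :=
    (contDiff_moment.differentiable (by simp) y).hasFDerivAt
  have h3 : filledCompletion.dθ x = fderiv ℝ moment y := by
    have h4 : HasFDerivAt (fun y : Coord => Complex.exp (moment y * Complex.I))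
        (Complex.exp (moment y * Complex.I) • Complex.I • realForm (fderiv ℝ moment y)) y := by
      have h5 : HasFDerivAt (fun y : Coord => (moment y : ℂ)) (realForm (fderiv ℝ moment y)) y :=
        Complex.ofRealCLM.hasFDerivAt.comp y hm
      exact (h5.mul_const Complex.I).cexp
    rw [h4.fderiv] at h2
    have h6 : filledCompletion.dθ x = Complex.imCLM ∘L ((starRingEnd ℂ) (fillU x : ℂ) •
      (Complex.exp (moment y * Complex.I) • Complex.I • realForm (fderiv ℝ moment y))) :=
      congrArg (fun L : Coord →L[ℝ] ℂ => Complex.imCLM ∘L ((starRingEnd ℂ) (fillU x : ℂ) • L)) h2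
    rw [h6, ← Circle.coe_exp, ← hu]
    refine ContinuousLinearMap.ext fun v => ?_
    have h7 : (starRingEnd ℂ) (fillU x : ℂ) * (fillU x : ℂ) = 1 := by
      rw [mul_comm, Complex.mul_conj, Circle.normSq_coe, Complex.ofReal_one]
    simp only [ContinuousLinearMap.comp_apply, smul_apply, smul_eq_mul, ← mul_assoc, h7, one_mul,
      realForm, Complex.ofRealCLM_apply, Complex.imCLM_apply]
    simp
  have h4 : fderiv ℝ zBase y = (fderiv ℝ (fun y : Coord => zfst y * zsnd y) y).prod
      (fderiv ℝ moment y) :=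
    ((contDiff_zfst_mul_zsnd.differentiable (by simp) y).hasFDerivAt.prodMk hm).fderiv
  have h5 : η (fillT x, Complex.arg (fillU x)) = η (zBase y) := by
    obtain ⟨k, hk⟩ := Circle.exp_eq_exp.1 ((Circle.exp_arg (fillU x)).trans hu)
    rw [hk]
    have h6 : Function.Periodic (fun θ : ℝ => η (fillT x, θ)) (2 * Real.pi) := hη
    have h7 := h6.int_mul k (moment y)
    rw [show zBase y = (fillT x, moment y) by rw [ht]; rfl]
    exact h7
  have h6 : filledCompletion.pullBase η x =
      (η (fillT x, Complex.arg (fillU x))).compContinuousLinearMap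
        ((fderiv ℝ (fun y : Coord => zfst y * zsnd y) y).prod (fderiv ℝ moment y)) := by
    rw [← h3]
    exact congrArg (fun L : Coord →L[ℝ] ℂ => (η (fillT x, Complex.arg
      (fillU x))).compContinuousLinearMap (L.prod (filledCompletion.dθ x))) h1
  rw [h6, h5, h4]

theorem formField_conForm (α : Fin 3) (x : Filled) : formField (conForm α) x =
    formField (ovForm α) x + filledCompletion.pullBase (etaForm α) x := by
  rw [pullBase_filledCompletion fun θ => etaForm_periodic α _ θ]
  rfl

end ConifoldHK
end

theorem mainTheorem1 :
    -- the series converge, and the forms descend to the torus bundles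
    (∀ ε : ℕ, ∀ x ∈ cover,
      (conifold ε).WellDefinedAt x ∧ (ooguriVafa ε cutoff).WellDefinedAt x ∧
      ∀ (α : Fin 3) (k l m : ℤ),
        ((conifold ε).omega α (deck ε k l m x)).compContinuousLinearMap
            (fderiv ℝ (deck ε k l m) x) = (conifold ε).omega α x ∧
        ((ooguriVafa ε cutoff).omega α (deck ε k l m x)).compContinuousLinearMap
            (fderiv ℝ (deck ε k l m) x) = (ooguriVafa ε cutoff).omega α x) ∧
    -- the splitting, with forms that are smooth over `t = 0`
    ∃ η : Fin 3 → Base → Base [⋀^Fin 2]→L[ℝ] ℝ,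
      (∀ α, ContDiffOn ℝ ∞ (η α) (fullM ×ˢ Set.univ)) ∧
      (∀ α, ∀ t ∈ fullM, ∀ θ : ℝ, η α (t, θ + 2 * Real.pi) = η α (t, θ)) ∧
      (∀ ε : ℕ, ∀ α, ∀ x ∈ cover,
        (conifold ε).omega α x = (ooguriVafa ε cutoff).omega α x +
          (η α (toBase x)).compContinuousLinearMap (fderiv ℝ toBase x)) ∧
      -- the values of these forms at `t = 0`
      (∀ θ : ℝ, ∃ S : ℝ,
        HasSum (fun n : {n : ℤ // n ≠ 0} => pairV n 0 θ) (S : ℂ) ∧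
        (∀ v, (η 0 (0, θ) v : ℂ) = ((1 / (2 * Real.pi) * S : ℝ) : ℂ) * wedge dtIm dθβ v) ∧
        (∀ v, (η 1 (0, θ) v : ℂ) = ((-(1 / (2 * Real.pi)) * S : ℝ) : ℂ) * wedge dtRe dθβ v) ∧
        (∀ v, (η 2 (0, θ) v : ℂ) = Complex.I / 2 * (S : ℂ) * wedge dt (conjForm dt) v)) ∧
      -- the extension of the hyperkähler structure
      ∃ (X : Type) (_ : TopologicalSpace X) (_ : ChartedSpace Coord X) (C : Completion X)
        (Φ Φov : Fin 3 → FormField X),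
        T2Space X ∧ SecondCountableTopology X ∧ IsManifold 𝓘(ℝ, Coord) ∞ X ∧
        (∀ α, IsSmoothForm (Φ α)) ∧ (∀ α, IsSmoothForm (Φov α)) ∧
        (∀ α, ∀ x ∈ cover, pullForm C.q (Φ α) x = (conifold 1).omega α x) ∧
        (∀ α, ∀ x ∈ cover, pullForm C.q (Φov α) x = (ooguriVafa 1 cutoff).omega α x) ∧
        (∀ α, ∀ x, Φ α x = Φov α x + C.pullBase (η α) x) ∧
        (∀ x ∈ cover, C.q x ∈ nondegenerateLocus Φ ↔
          (conifold 1).HorizontallyNondegenerate x) ∧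
        ∃ (g : BilinField X) (I : Fin 3 → EndField X),
          IsHyperkahlerOnManifold (nondegenerateLocus Φ) g I Φ ∧
          ∀ x ∈ cover, (conifold 1).HorizontallyNondegenerate x →
            ∀ u v : Coord, pullBilin C.q g x u v = (conifold 1).metric x u v := by
  refine ⟨fun ε x hx => ⟨(isElectric_conifold ε (exp_mem_strip hx)).wellDefinedAt,
    (isElectric_ooguriVafa ε (exp_mem_strip hx)).wellDefinedAt, fun α k l m =>
    ⟨omega_conifold_deck ε hx α k l m, omega_ooguriVafa_deck ε hx α k l m⟩⟩, etaForm,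
    fun α => (contDiffOn_etaForm α).mono (Set.prod_mono fullM_subset_strip subset_rfl),
    fun α t _ θ => etaForm_periodic α t θ, fun ε α x hx => omega_conifold_eq ε α hx,
    fun θ => ⟨_, hasSum_pairV θ, etaForm_zero_apply θ⟩,
    Filled, inferInstance, inferInstance, filledCompletion, fun α => formField (conForm α),
    fun α => formField (ovForm α), inferInstance, inferInstance, inferInstance,
    fun α => isSmoothForm_formField (glueInvariant_conForm α) (contDiffOn_conForm α),
    fun α => isSmoothForm_formField (glueInvariant_ovForm α) (contDiffOn_ovForm α),
    fun α x hx => pullForm_fillQ (glueInvariant_conForm α)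
      (fun x hx => conForm_taubNUT_eq 1 α hx.1 hx.2)
      (fun x hx l => omega_conifold_deck 1 hx α 0 l 0) hx,
    fun α x hx => pullForm_fillQ (glueInvariant_ovForm α)
      (fun x hx => ovForm_taubNUT_eq 1 α hx.1 hx.2)
      (fun x hx l => omega_ooguriVafa_deck 1 hx α 0 l 0) hx,
    formField_conForm, fun x hx => fillQ_mem_nondegenerateLocus hx, filledMetric, filledComplex,
    isHyperkahlerOnManifold_filled, fun x hx h u v => pullBilin_fillQ hx h u v⟩
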